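/- Fix constants $0<k\le l$, $L_0>0$, $M_c>0$, $M>0$. For $z=(x,v)\in\mathbb R^3\times\mathbb R^3$ put $L=|x\times v|^2=|x|^2|v|^2-(x\cdot v)^2$. For spherically symmetric $f=f(x,v)$ (that is, $f(Ax,Av)=f(x,v)$ for all $A\in O(3)$) let $\rho_f(x)=\int f(x,v)\,dv$, $m_f(r)=\int_{|x|\le r}\rho_f\,dx$, $\nabla U_f(x)=\frac{m_f(|x|)}{|x|^2}\frac{x}{|x|}$, $U_f(x)=-\int_{|x|}^\infty \frac{m_f(s)}{s^2}\,ds$, and $$E_{\rm kin}(f)=\tfrac12\iint|v|^2f\,dv\,dx,\qquad E_{\rm pot}(f)=-\tfrac1{8\pi}\int\Big(|\nabla U_f|^2+\tfrac{8\pi M_c}{|x|}\rho_f\Big)dx,$$ $$\mathcal C(f)=\iint f^{1+1/k}(L-L_0)_+^{-l/k}\,dv\,dx,\qquad \mathcal H_C=E_{\rm kin}+E_{\rm pot}+\mathcal C .$$ Let $$\mathcal F_M=\Big\{f\in L^1(\mathbb R^6): f\ge0,\ f\text{ spherically symmetric},\ \iint f=M,\ E_{\rm kin}(f)+\mathcal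 C(f)<\infty,\ f=0\text{ a.e. on }\{0\le L<L_0\}\Big\}.$$ Let $f_0\in\mathcal F_M$ be a minimizer of $\mathcal H_C$ over $\mathcal F_M$. Put $E(x,v)=\frac12|v|^2+U_{f_0}(x)-\frac{M_c}{|x|}$ and, for $f\in\mathcal F_M$, $$d(f,f_0)=\iint\Big[\big(f^{1+1/k}-f_0^{1+1/k}\big)(L-L_0)_+^{-l/k}+(E-E_0)(f-f_0)\Big]dv\,dx,$$ where $E_0\in\mathbb R$ is any constant, for instance the cut-off energy of $f_0$ (since $\iint f=\iint f_0$, the value of $d$ does not depend on $E_0$). A (global classical) solution of the Vlasov--Poisson system with a point mass $M_c$ at the origin is a pair $(f,U)$ with $f\in C^1([0,\infty)\times\mathbb R^6)$, $f\ge0$, such that $\rho(t,x)=\int f(t,x,v)\,dv$ exists, $U(t,\cdot)\in C^2(\mathbb R^3)$ with $\nabla_xU$ and $\partial_x^2U$ continuous on $[0,\infty)\times\mathbb R^3$, $\nabla_xU$ bounded on $[0,T]\times\mathbb R^3$ for every $T$, and $$\partial_tf+v\cdot\nabla_xf-\nabla_x\Big(U-\frac{M_c}{|x|}\Big)\cdot\nabla_vf=0\quad(x\ne0),\qquad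 \Delta U=4\pi\rho,\qquad \lim_{|x|\to\infty}U(t,x)=0 .$$ **Theorem 6.1.** Assume that the minimizer $f_0$ is unique in $\mathcal F_M$ (up to equality a.e.). Then for every $\epsilon>0$ there is $\delta>0$ such that for every solution $(f,U)$ of the Vlasov--Poisson system with $f(0)\in C^1_c(\mathbb R^6)\cap\mathcal F_M$, $$d(f(0),f_0)+\frac1{8\pi}\int|\nabla U_{f(0)}-\nabla U_{f_0}|^2dx<\delta$$ implies that for all $t\ge0$ one has $f(t)\in\mathcal F_M$, both integrals below converge absolutely, and $$d(f(t),f_0)+\frac1{8\pi}\int|\nabla U_{f(t)}-\nabla U_{f_0}|^2dx<\epsilon .$$ -/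

import Mathlib

open MeasureTheory Set Filter Topology

noncomputable section

namespace VlasovPoisson

/-- Position space (and velocity space) `ℝ³` with its Euclidean structure. -/
abbrev Space := EuclideanSpace ℝ (Fin 3)

/-- Phase space `ℝ³ × ℝ³`, with points `z = (x, v)`. -/
abbrev Phase := Space × Space

/-- `L = |x × v|² = |x|² |v|² - (x ⬝ v)²`, the squared modulus of angular momentum. -/
def angMom (z : Phase) : ℝ :=
  ‖z.1‖ ^ 2 * ‖z.2‖ ^ 2 - (inner ℝ z.1 z.2) ^ 2

/-- Spherical symmetry of (the a.e.-class of) a phase-space function: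
`f (A x, A v) = f (x, v)` for every orthogonal transformation `A` of `ℝ³`. -/
def IsSphericallySymmetric (f : Phase → ℝ) : Prop :=
  ∀ A : Space ≃ₗᵢ[ℝ] Space, ∀ᵐ z : Phase, f (A z.1, A z.2) = f z

/-- The spatial density `ρ_f (x) = ∫ f (x, v) dv`. -/
def density (f : Phase → ℝ) (x : Space) : ℝ :=
  ∫ v : Space, f (x, v)

/-- The mass `m_f (r)` contained in the ball `|x| ≤ r`. -/
def massInBall (f : Phase → ℝ) (r : ℝ) : ℝ :=
  ∫ x in Metric.closedBall (0 : Space) r, density f x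

/-- The gradient `∇U_f (x) = (m_f (r) / r²) (x / r)`, `r = |x|`, of the potential induced by a
spherically symmetric `f`. -/
def gradPotential (f : Phase → ℝ) (x : Space) : Space :=
  (massInBall f ‖x‖ / ‖x‖ ^ 2) • (‖x‖⁻¹ • x)

/-- The potential `U_f (x) = - ∫_r^∞ m_f (s) / s² ds`, `r = |x|`, induced by a spherically
symmetric `f`. -/
def potential (f : Phase → ℝ) (x : Space) : ℝ :=
  - ∫ s in Ioi ‖x‖, massInBall f s / s ^ 2

/-- The kinetic energy `½ ∬ |v|² f`. -/
def kineticEnergy (f : Phase → ℝ) : ℝ :=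
  (1 / 2) * ∫ z : Phase, ‖z.2‖ ^ 2 * f z

/-- The potential energy `- (1 / 8π) ∫ (|∇U_f|² + (8π M_c / |x|) ρ_f) dx`; the second term is the
interaction with the point mass `M_c` at the origin. -/
def potentialEnergy (Mc : ℝ) (f : Phase → ℝ) : ℝ :=
  - (1 / (8 * Real.pi)) *
    ∫ x : Space, (‖gradPotential f x‖ ^ 2 + 8 * Real.pi * Mc / ‖x‖ * density f x)

/-- The density `f ^ (1 + 1/k) (L - L₀)₊ ^ (-l/k)` of the Casimir functional.  (For
`L ≤ L₀` this real power is `0`; it is only used for `f` that vanish there.) -/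
def casimirDensity (k l L₀ : ℝ) (f : Phase → ℝ) (z : Phase) : ℝ :=
  f z ^ (1 + 1 / k) * (max (angMom z - L₀) 0) ^ (-(l / k))

/-- The Casimir functional. -/
def casimir (k l L₀ : ℝ) (f : Phase → ℝ) : ℝ :=
  ∫ z : Phase, casimirDensity k l L₀ f z

/-- The energy-Casimir functional `H_C = E_kin + E_pot + C`. -/
def energyCasimir (k l L₀ Mc : ℝ) (f : Phase → ℝ) : ℝ :=
  kineticEnergy f + potentialEnergy Mc f + casimir k l L₀ f

/-- The class `F_M` of admissible perturbations (a property of a.e.-classes). -/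
structure IsAdmissible (k l L₀ M : ℝ) (f : Phase → ℝ) : Prop where
  integrable : Integrable f
  nonneg : ∀ᵐ z : Phase, 0 ≤ f z
  symmetric : IsSphericallySymmetric f
  mass : ∫ z : Phase, f z = M
  kinetic_finite : Integrable (fun z : Phase => ‖z.2‖ ^ 2 * f z)
  casimir_finite : Integrable (casimirDensity k l L₀ f)
  vanish : ∀ᵐ z : Phase, angMom z < L₀ → f z = 0

/-- `f` minimizes the energy-Casimir functional over `F_M`. -/
def IsMinimizer (k l L₀ Mc M : ℝ) (f : Phase → ℝ) : Prop :=
  IsAdmissible k l L₀ M f ∧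
    ∀ g : Phase → ℝ, IsAdmissible k l L₀ M g →
      energyCasimir k l L₀ Mc f ≤ energyCasimir k l L₀ Mc g

/-- The particle energy `E = ½ |v|² + U_{f₀} (x) - M_c / |x|` in the field of the state `f₀` and
of the point mass. -/
def particleEnergy (Mc : ℝ) (f₀ : Phase → ℝ) (z : Phase) : ℝ :=
  (1 / 2) * ‖z.2‖ ^ 2 + potential f₀ z.1 - Mc / ‖z.1‖

/-- The integrand of `d (f, f₀)`. -/
def distDensity (k l L₀ Mc E₀ : ℝ) (f f₀ : Phase → ℝ) (z : Phase) : ℝ :=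
  (f z ^ (1 + 1 / k) - f₀ z ^ (1 + 1 / k)) * (max (angMom z - L₀) 0) ^ (-(l / k))
    + (particleEnergy Mc f₀ z - E₀) * (f z - f₀ z)

/-- `d (f, f₀) = ∬ [(f ^ (1+1/k) - f₀ ^ (1+1/k)) (L - L₀)₊ ^ (-l/k) + (E - E₀) (f - f₀)]`. -/
def dist₀ (k l L₀ Mc E₀ : ℝ) (f f₀ : Phase → ℝ) : ℝ :=
  ∫ z : Phase, distDensity k l L₀ Mc E₀ f f₀ z

/-- `|∇U_f - ∇U_{f₀}|²`. -/
def fieldDiffSq (f f₀ : Phase → ℝ) (x : Space) : ℝ :=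
  ‖gradPotential f x - gradPotential f₀ x‖ ^ 2

/-- The stability distance `d (f, f₀) + (1 / 8π) ∫ |∇U_f - ∇U_{f₀}|² dx`. -/
def stabilityDist (k l L₀ Mc E₀ : ℝ) (f f₀ : Phase → ℝ) : ℝ :=
  dist₀ k l L₀ Mc E₀ f f₀ + 1 / (8 * Real.pi) * ∫ x : Space, fieldDiffSq f f₀ x

/-- The effective potential `U - M_c / |x|`. -/
def effPotential (Mc : ℝ) (U : Space → ℝ) (x : Space) : ℝ :=
  U x - Mc / ‖x‖

/-- `(f, U)` is a (global, classical) solution of the Vlasov-Poisson system with a point mass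
`M_c` fixed at the origin, for times `t ≥ 0`.  The Vlasov equation is required
away from the origin, where the external force is singular.  No symmetry and no decay of `f` is
imposed. -/
structure IsSolution (Mc : ℝ) (f : ℝ → Phase → ℝ) (U : ℝ → Space → ℝ) : Prop where
  /-- `f ∈ C¹ ([0, ∞) × ℝ⁶)`. -/
  contDiff : ContDiffOn ℝ 1 (fun p : ℝ × Phase => f p.1 p.2) (Ici 0 ×ˢ univ)
  nonneg : ∀ t, 0 ≤ t → ∀ z, 0 ≤ f t z
  /-- The spatial density exists. -/
  density_exists : ∀ t, 0 ≤ t → ∀ x : Space, Integrable (fun v : Space => f t (x, v))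
  /-- `U`, `∇U` and `D²U` exist; the latter two are continuous on `[0, ∞) × ℝ³`. -/
  potential_contDiff : ∀ t, 0 ≤ t → ContDiff ℝ 2 (U t)
  grad_continuous :
    ContinuousOn (fun p : ℝ × Space => gradient (U p.1) p.2) (Ici 0 ×ˢ univ)
  hessian_continuous :
    ContinuousOn (fun p : ℝ × Space => fderiv ℝ (gradient (U p.1)) p.2) (Ici 0 ×ˢ univ)
  /-- `∇U` is bounded on `[0, T] × ℝ³` for every `T`. -/
  grad_bounded : ∀ T : ℝ, ∃ B : ℝ, ∀ t ∈ Icc 0 T, ∀ x, ‖gradient (U t) x‖ ≤ B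
  /-- The Poisson equation `ΔU = 4π ρ`, with `U (t, x) → 0` as `|x| → ∞`. -/
  poisson : ∀ t, 0 ≤ t → ∀ x,
    Laplacian.laplacian (U t) x = 4 * Real.pi * density (f t) x
  potential_vanishes : ∀ t, 0 ≤ t → Tendsto (U t) (cocompact Space) (𝓝 0)
  /-- The Vlasov equation `∂ₜ f + v ⬝ ∇ₓ f - ∇ₓ (U - M_c / |x|) ⬝ ∇ᵥ f = 0`. -/
  vlasov : ∀ t, 0 ≤ t → ∀ x v : Space, x ≠ 0 →
    derivWithin (fun s => f s (x, v)) (Ici 0) t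
      + inner ℝ v (gradient (fun y => f t (y, v)) x)
      - inner ℝ (gradient (effPotential Mc (U t)) x) (gradient (fun w => f t (x, w)) v) = 0

end VlasovPoisson

end

/-!
The distance functional and the energy-Casimir functional are tied together by the identity
`H_C(f) - H_C(f₀) = d(f, f₀) - (1/8π) ∫ |∇U_f - ∇U_{f₀}|²` (`IsAdmissible.expansion`): the energy is
a quadratic functional of `f` whose second order part is minus the field energy.  Stability then
follows from two facts.

*Near-minimizers have almost the field of `f₀`* (`exists_fieldDiff_lt`).  Since `f` vanishes where
`L < L₀`, one has `1/|x|² ≤ |v|²/L₀` on its support.  This angular momentum barrier bounds fields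
and inverse moments by the kinetic energy, which makes `H_C` coercive (`exists_coercive`).  Along a
minimizing sequence the monotone functions `m_f` converge by Helly's theorem, hence the fields
converge in `L²`.  The energy at the midpoint of two members of the sequence is not below the
minimum, so the midpoint convexity defect of the Casimir functional is controlled by the excess of
energy and the distance of the fields (`IsAdmissible.integral_convexGap_le`), and strict convexity of
powers turns this into `L¹` convergence with a weight that discounts large `|x|`
(`exists_weighted_dist_le`).  The limit `g` has mass at most `M` and energy at most the minimum.  If
mass were lost at infinity, it could be replaced by a dilute, slow cloud, which lowers the energy
because the attraction of the point mass beats the other terms at large distances; this needs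
`k ≤ l` (`exists_energyCasimir_lt`).  So `g` is a minimizer (`exists_minimizer_limit`), and by
uniqueness it is `f₀`.

*Solutions stay in the admissible class and conserve `H_C`*
(`IsSolution.admissible_conserved`).  A solution is not assumed to be spherically symmetric at later
times, and the force is singular at the origin, so that there is no flow to work with.  Instead,
integrals over phase space are differentiated in time (`transport_identity`), with the region of
small angular momentum cut off.  This region is harmless: `L` changes only through the bounded force
`∇U`, at rate `O(√L)`, and the region `L ≤ η` has volume `O(η)`.  The result is a barrier principle
(`IsSolution.barrier`).  Applied to the virial energies `½|v|² ± x ⬝ v + |x|² - M_c/|x|` it confines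
the support (`IsSolution.exists_boundedRegion`); applied to `L` it keeps the support away from
`L = 0` for a short time.  There the squared `L²` norm of the failure of symmetry of `f` obeys a
Gronwall inequality, because the failure of symmetry of the field is bounded in `L²` by that of the
density (`elliptic_estimate`); so symmetry persists (`IsSolution.rotInvariant_propagates`).  In a
symmetric field `L` is conserved, the bound `L ≥ L₀` is restored, and the argument can be repeated
(`IsSolution.symmetric_confined`).  Symmetric solutions have the field given by `m_f`
(`IsSolution.gradient_eq`).  Mass and Casimir functional are conserved since `f` and `L` are constant
along characteristics (`IsSolution.casimir_conserved`).  For the energy, the expansion about the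
state at time `s` shows that it changes by `O((t - s)²)` from `s` to `t`, so it is constant
(`IsSolution.energy_conserved`).

If the initial distance is small, so is the conserved excess `H_C(f(t)) - H_C(f₀)`; hence the field
of `f(t)` is close to that of `f₀`, and by the identity above `d(f(t), f₀)` is small as well.
-/


noncomputable section

namespace VlasovPoisson

/-! ### Angular momentum -/

instance : (volume : Measure Phase).IsAddHaarMeasure :=
  inferInstanceAs ((volume : Measure Space).prod (volume : Measure Space)).IsAddHaarMeasure

lemma volume_phase : (volume : Measure Phase) = (volume : Measure Space).prod volume := rfl

/-- `|x|² v - (x ⬝ v) x`, which is `|x|²` times the component of `v` orthogonal to `x`. -/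
def perp (x v : Space) : Space := ‖x‖ ^ 2 • v - (inner ℝ x v : ℝ) • x

lemma norm_perp_sq (x v : Space) : ‖perp x v‖ ^ 2 = ‖x‖ ^ 2 * angMom (x, v) := by
  unfold perp angMom
  rw [norm_sub_sq_real, norm_smul, norm_smul, inner_smul_left, inner_smul_right,
    real_inner_comm x v, mul_pow, mul_pow]
  simp only [Real.norm_eq_abs, sq_abs, RCLike.conj_to_real]
  rw [real_inner_comm v x]
  ring

lemma angMom_nonneg (z : Phase) : 0 ≤ angMom z := by
  have h := abs_real_inner_le_norm z.1 z.2
  have h2 : (inner ℝ z.1 z.2 : ℝ) ^ 2 ≤ (‖z.1‖ * ‖z.2‖) ^ 2 := by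
    rw [← sq_abs]; gcongr
  unfold angMom; nlinarith

lemma angMom_le (z : Phase) : angMom z ≤ ‖z.1‖ ^ 2 * ‖z.2‖ ^ 2 := by
  unfold angMom; nlinarith [sq_nonneg (inner ℝ z.1 z.2 : ℝ)]

lemma angMom_map (A : Space ≃ₗᵢ[ℝ] Space) (z : Phase) : angMom (A z.1, A z.2) = angMom z := by
  simp [angMom]

lemma angMom_smul (a b : ℝ) (z : Phase) :
    angMom (a • z.1, b • z.2) = (a * b) ^ 2 * angMom z := by
  simp only [angMom, norm_smul, inner_smul_left, inner_smul_right, Real.norm_eq_abs, mul_pow,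
    sq_abs, RCLike.conj_to_real]
  ring

lemma contDiff_angMom {n : WithTop ℕ∞} : ContDiff ℝ n angMom := by
  unfold angMom
  have h1 : ContDiff ℝ n (fun z : Phase => ‖z.1‖ ^ 2) := contDiff_fst.norm_sq ℝ
  have h2 : ContDiff ℝ n (fun z : Phase => ‖z.2‖ ^ 2) := contDiff_snd.norm_sq ℝ
  have h3 : ContDiff ℝ n (fun z : Phase => (inner ℝ z.1 z.2 : ℝ)) :=
    contDiff_fst.inner ℝ contDiff_snd
  exact (h1.mul h2).sub (h3.pow 2)

lemma continuous_angMom : Continuous angMom := (contDiff_angMom (n := 0)).continuous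

lemma fst_ne_zero_of_angMom_pos {z : Phase} (h : 0 < angMom z) : z.1 ≠ 0 := by
  intro h0
  simp [angMom, h0] at h

/-- For `x ≠ 0` the level sets of `v ↦ L (x, v)` are null: for `c > 0` they bound the convex set
`L ≤ c` (a solid cylinder), for `c = 0` they are lines. -/
lemma volume_fiber_angMom_eq {x : Space} (hx : x ≠ 0) {c : ℝ} (hc : 0 ≤ c) :
    volume {v : Space | angMom (x, v) = c} = 0 := by
  have hx' : 0 < ‖x‖ ^ 2 := by positivity
  rcases hc.eq_or_lt with rfl | hc
  · have hsub : {v : Space | angMom (x, v) = 0} ⊆ (Submodule.span ℝ {x} : Submodule ℝ Space) := by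
      intro v hv
      have h1 : ‖perp x v‖ ^ 2 = 0 := by rw [norm_perp_sq, (hv : angMom (x, v) = 0), mul_zero]
      have h2 : perp x v = 0 := by simpa using h1
      have h3 : v = ((‖x‖ ^ 2)⁻¹ * (inner ℝ x v : ℝ)) • x := by
        rw [perp, sub_eq_zero] at h2
        rw [mul_smul, ← h2, smul_smul, inv_mul_cancel₀ hx'.ne', one_smul]
      rw [h3]
      exact Submodule.smul_mem _ _ (Submodule.mem_span_singleton_self x)
    refine measure_mono_null hsub (Measure.addHaar_submodule _ _ ?_)
    intro htop
    have := finrank_span_singleton (K := ℝ) hx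
    rw [htop, finrank_top, finrank_euclideanSpace_fin] at this
    omega
  · have hconv : Convex ℝ {v : Space | ‖perp x v‖ ≤ √(‖x‖ ^ 2 * c)} := by
      have hT : IsLinearMap ℝ (perp x) :=
        { map_add := fun v w => by
            simp only [perp, inner_add_right, smul_add, add_smul]; abel
          map_smul := fun a v => by
            simp only [perp, inner_smul_right, smul_sub, smul_smul]
            rw [mul_comm] }
      have : {v : Space | ‖perp x v‖ ≤ √(‖x‖ ^ 2 * c)}
          = (perp x) ⁻¹' Metric.closedBall 0 (√(‖x‖ ^ 2 * c)) := by
        ext v; simp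
      rw [this]
      exact (convex_closedBall _ _).is_linear_preimage hT
    refine measure_mono_null ?_ (hconv.addHaar_frontier volume)
    intro v hv
    have hv' : angMom (x, v) = c := hv
    have hmem : ∀ w : Space, ‖perp x w‖ ≤ √(‖x‖ ^ 2 * c) ↔ angMom (x, w) ≤ c := by
      intro w
      rw [Real.le_sqrt (norm_nonneg _) (by positivity), norm_perp_sq]
      exact mul_le_mul_iff_of_pos_left hx'
    refine ⟨subset_closure ((hmem v).2 hv'.le), fun hint => ?_⟩
    have hcont : Tendsto (fun s : ℝ => s • v) (𝓝[>] 1) (𝓝 v) := by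
      have : Tendsto (fun s : ℝ => s • v) (𝓝 1) (𝓝 ((1 : ℝ) • v)) :=
        (continuous_id.smul continuous_const).tendsto 1
      rw [one_smul] at this
      exact this.mono_left nhdsWithin_le_nhds
    have hev := hcont.eventually (mem_interior_iff_mem_nhds.1 hint)
    obtain ⟨s, hs, hs1⟩ := (hev.and self_mem_nhdsWithin).exists
    have h1 := (hmem _).1 hs
    have h2 := angMom_smul 1 s (x, v)
    simp only [one_smul, one_mul] at h2
    rw [h2, hv'] at h1
    have h3 : (1 : ℝ) < s := hs1
    have h4 : 1 < s ^ 2 := by nlinarith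
    nlinarith [mul_pos (sub_pos.2 h4) hc]

lemma volume_angMom_eq {c : ℝ} (hc : 0 ≤ c) : volume {z : Phase | angMom z = c} = 0 := by
  have hm : MeasurableSet {z : Phase | angMom z = c} :=
    continuous_angMom.measurable (measurableSet_singleton c)
  rw [volume_phase, Measure.measure_prod_null hm]
  have : ∀ᵐ x : Space, x ≠ 0 := by
    simp [ae_iff]
  filter_upwards [this] with x hx
  exact volume_fiber_angMom_eq hx hc

/-! ### Integrable phase-space functions of finite kinetic energy -/

/-- The linear space containing the differences of admissible functions: integrable, of finite
kinetic energy, vanishing at angular momentum below `L₀`. -/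
structure IsTame (L₀ : ℝ) (f : Phase → ℝ) : Prop where
  integrable : Integrable f
  kinetic : Integrable (fun z : Phase => ‖z.2‖ ^ 2 * f z)
  vanish : ∀ᵐ z : Phase, angMom z < L₀ → f z = 0

lemma IsAdmissible.tame {k l L₀ M : ℝ} {f : Phase → ℝ} (h : IsAdmissible k l L₀ M f) :
    IsTame L₀ f := ⟨h.integrable, h.kinetic_finite, h.vanish⟩

section tame
variable {L₀ : ℝ} {f g : Phase → ℝ}

lemma IsTame.add (hf : IsTame L₀ f) (hg : IsTame L₀ g) : IsTame L₀ (fun z => f z + g z) where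
  integrable := hf.integrable.add hg.integrable
  kinetic := (hf.kinetic.add hg.kinetic).congr (ae_of_all _ fun z => by simp [mul_add])
  vanish := by
    filter_upwards [hf.vanish, hg.vanish] with z h1 h2 hz
    simp [h1 hz, h2 hz]

lemma IsTame.const_mul (c : ℝ) (hf : IsTame L₀ f) : IsTame L₀ (fun z => c * f z) where
  integrable := hf.integrable.const_mul c
  kinetic := (hf.kinetic.const_mul c).congr (ae_of_all _ fun z => by simp; ring)
  vanish := by
    filter_upwards [hf.vanish] with z h1 hz
    simp [h1 hz]

lemma IsTame.sub (hf : IsTame L₀ f) (hg : IsTame L₀ g) : IsTame L₀ (fun z => f z - g z) := by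
  have := hf.add (hg.const_mul (-1))
  simpa [sub_eq_add_neg] using this

/-- On the support of a tame function, `1/|x|²` is controlled by `|v|²/L₀`. -/
lemma IsTame.inv_sq_le (hL₀ : 0 < L₀) (hf : IsTame L₀ f) :
    ∀ᵐ z : Phase, f z ≠ 0 → (‖z.1‖⁻¹) ^ 2 ≤ L₀⁻¹ * ‖z.2‖ ^ 2 := by
  filter_upwards [hf.vanish] with z hz hne
  have hL : L₀ ≤ angMom z := by
    by_contra h
    exact hne (hz (not_le.1 h))
  have h1 := angMom_le z
  have hx : 0 < ‖z.1‖ := norm_pos_iff.2 (fst_ne_zero_of_angMom_pos (hL₀.trans_le hL))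
  rw [inv_pow, inv_mul_eq_div, le_div_iff₀ hL₀, inv_mul_le_iff₀ (by positivity)]
  linarith

/-- Consequence of the angular momentum barrier: a tame function has a second inverse moment. -/
lemma IsTame.integrable_inv_sq (hL₀ : 0 < L₀) (hf : IsTame L₀ f) :
    Integrable (fun z : Phase => (‖z.1‖⁻¹) ^ 2 * f z) := by
  refine (hf.kinetic.const_mul L₀⁻¹).mono ?_ ?_
  · exact (Measurable.aestronglyMeasurable (by fun_prop)).mul hf.integrable.1
  · filter_upwards [hf.inv_sq_le hL₀] with z hz
    by_cases h : f z = 0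
    · simp [h]
    · have := mul_le_mul_of_nonneg_right (hz h) (abs_nonneg (f z))
      simp only [norm_mul, Real.norm_eq_abs, abs_pow, abs_inv, abs_norm, abs_of_pos hL₀]
      linarith

lemma IsTame.integrable_inv (hL₀ : 0 < L₀) (hf : IsTame L₀ f) :
    Integrable (fun z : Phase => ‖z.1‖⁻¹ * f z) := by
  refine (hf.integrable.norm.add (hf.integrable_inv_sq hL₀).norm).mono' ?_ ?_
  · exact (Measurable.aestronglyMeasurable (by fun_prop)).mul hf.integrable.1
  · refine ae_of_all _ fun z => ?_
    simp only [norm_mul, Real.norm_eq_abs, abs_pow, abs_inv, abs_norm, Pi.add_apply]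
    have h : ‖z.1‖⁻¹ ≤ 1 + ‖z.1‖⁻¹ ^ 2 := by nlinarith [sq_nonneg (‖z.1‖⁻¹ - 1)]
    nlinarith [mul_le_mul_of_nonneg_right h (abs_nonneg (f z))]

lemma measurableSet_norm_fst_le (r : ℝ) : MeasurableSet {z : Phase | ‖z.1‖ ≤ r} :=
  measurableSet_le (by fun_prop) measurable_const

lemma massInBall_eq (hf : Integrable f) (r : ℝ) :
    massInBall f r = ∫ z in {z : Phase | ‖z.1‖ ≤ r}, f z := by
  have h : {z : Phase | ‖z.1‖ ≤ r} = Metric.closedBall (0 : Space) r ×ˢ univ := by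
    ext z; simp
  rw [h, volume_phase, setIntegral_prod _ (by exact hf.integrableOn)]
  simp [massInBall, density]

lemma massInBall_congr (h : f =ᵐ[volume] g) (hf : Integrable f) (r : ℝ) :
    massInBall f r = massInBall g r := by
  rw [massInBall_eq hf, massInBall_eq (hf.congr h)]
  exact integral_congr_ae (ae_restrict_of_ae h)

lemma massInBall_add (hf : Integrable f) (hg : Integrable g) (r : ℝ) :
    massInBall (fun z => f z + g z) r = massInBall f r + massInBall g r := by
  rw [massInBall_eq (f := fun z => f z + g z) (hf.add hg), massInBall_eq hf, massInBall_eq hg]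
  exact integral_add hf.integrableOn hg.integrableOn

lemma massInBall_sub (hf : Integrable f) (hg : Integrable g) (r : ℝ) :
    massInBall (fun z => f z - g z) r = massInBall f r - massInBall g r := by
  rw [massInBall_eq (f := fun z => f z - g z) (hf.sub hg), massInBall_eq hf, massInBall_eq hg]
  exact integral_sub hf.integrableOn hg.integrableOn

lemma massInBall_const_mul (hf : Integrable f) (c r : ℝ) :
    massInBall (fun z => c * f z) r = c * massInBall f r := by
  rw [massInBall_eq (hf.const_mul c), massInBall_eq hf]
  exact integral_const_mul c f

lemma gradPotential_sub (hf : Integrable f) (hg : Integrable g) (x : Space) :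
    gradPotential (fun z => f z - g z) x = gradPotential f x - gradPotential g x := by
  simp only [gradPotential, massInBall_sub hf hg, sub_div, sub_smul]

lemma abs_massInBall_le (hf : Integrable f) (r : ℝ) : |massInBall f r| ≤ ∫ z, ‖f z‖ := by
  rw [massInBall_eq hf]
  exact (norm_integral_le_integral_norm _).trans
    (setIntegral_le_integral hf.norm (ae_of_all _ fun _ => norm_nonneg _))

lemma massInBall_nonneg (hf : Integrable f) (h0 : ∀ᵐ z : Phase, 0 ≤ f z) (r : ℝ) :
    0 ≤ massInBall f r := by
  rw [massInBall_eq hf]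
  exact integral_nonneg_of_ae (ae_restrict_of_ae h0)

lemma massInBall_mono (hf : Integrable f) (h0 : ∀ᵐ z : Phase, 0 ≤ f z) :
    Monotone (massInBall f) := by
  intro r s hrs
  rw [massInBall_eq hf, massInBall_eq hf]
  exact setIntegral_mono_set hf.integrableOn (ae_restrict_of_ae h0)
    (ae_of_all _ fun z (hz : ‖z.1‖ ≤ r) => hz.trans hrs)

/-- The mass in a ball vanishes quadratically with the radius, because of the angular momentum
barrier. -/
lemma IsTame.abs_massInBall_le_sq (hL₀ : 0 < L₀) (hf : IsTame L₀ f) {r : ℝ} (hr : 0 < r) :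
    |massInBall f r| ≤ r ^ 2 * ∫ z : Phase, ‖(‖z.1‖⁻¹) ^ 2 * f z‖ := by
  rw [massInBall_eq hf.integrable, ← integral_const_mul]
  have hi := (hf.integrable_inv_sq hL₀).norm.const_mul (r ^ 2)
  refine (norm_integral_le_integral_norm (μ := volume.restrict {z : Phase | ‖z.1‖ ≤ r}) f).trans ?_
  refine le_trans ?_ (setIntegral_le_integral (s := {z : Phase | ‖z.1‖ ≤ r}) hi
    (ae_of_all _ fun _ => by positivity))
  refine setIntegral_mono_on_ae hf.integrable.norm.integrableOn hi.integrableOn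
    (measurableSet_norm_fst_le r) ?_
  filter_upwards [hf.vanish] with z hz hzr
  by_cases h : f z = 0
  · simp [h]
  · have hL : L₀ ≤ angMom z := by
      by_contra h'
      exact h (hz (not_le.1 h'))
    have hx : 0 < ‖z.1‖ := norm_pos_iff.2 (fst_ne_zero_of_angMom_pos (hL₀.trans_le hL))
    have h1 : 1 ≤ r ^ 2 * (‖z.1‖⁻¹) ^ 2 := by
      rw [← mul_pow]
      refine one_le_pow₀ ?_
      rw [← div_eq_mul_inv, le_div_iff₀ hx, one_mul]
      exact hzr
    have := mul_le_mul_of_nonneg_right h1 (norm_nonneg (f z))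
    simp only [norm_mul, norm_pow, norm_inv, norm_norm]
    linarith

/-- The constant in the bound for the field strength `m_f (r) / r²`. -/
def fieldBound (f : Phase → ℝ) : ℝ :=
  4 * ((∫ z : Phase, ‖(‖z.1‖⁻¹) ^ 2 * f z‖) + ∫ z : Phase, ‖f z‖)

/-- The field of a tame function is bounded near the origin and decays like `|x|⁻²`. -/
lemma IsTame.massInBall_bound (hL₀ : 0 < L₀) (hf : IsTame L₀ f) {r : ℝ} (hr : 0 < r) :
    |massInBall f r| / r ^ 2 ≤ fieldBound f * (1 + r) ^ (-2 : ℝ) := by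
  unfold fieldBound
  set A := ∫ z : Phase, ‖(‖z.1‖⁻¹) ^ 2 * f z‖ with hA
  set N := ∫ z : Phase, ‖f z‖ with hN
  have hA0 : 0 ≤ A := integral_nonneg fun _ => norm_nonneg _
  have hN0 : 0 ≤ N := integral_nonneg fun _ => norm_nonneg _
  have h1 := hf.abs_massInBall_le_sq hL₀ hr
  have h2 := abs_massInBall_le hf.integrable r
  rw [Real.rpow_neg (by positivity), Real.rpow_ofNat, div_le_iff₀ (by positivity)]
  rw [← hA] at h1
  rw [← hN] at h2
  rcases le_total r 1 with h | h
  · have : 1 ≤ 4 * ((1 + r) ^ 2)⁻¹ := by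
      rw [← div_eq_mul_inv, le_div_iff₀ (by positivity)]; nlinarith
    calc |massInBall f r| ≤ (A + N) * r ^ 2 * 1 := by nlinarith [sq_nonneg r]
      _ ≤ (A + N) * r ^ 2 * (4 * ((1 + r) ^ 2)⁻¹) := by gcongr
      _ = _ := by ring
  · have : 1 ≤ 4 * ((1 + r) ^ 2)⁻¹ * r ^ 2 := by
      rw [mul_right_comm, ← div_eq_mul_inv, le_div_iff₀ (by positivity)]; nlinarith
    calc |massInBall f r| ≤ (A + N) * 1 := by linarith
      _ ≤ (A + N) * (4 * ((1 + r) ^ 2)⁻¹ * r ^ 2) := by gcongr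
      _ = _ := by ring

lemma IsTame.exists_massInBall_bound (hL₀ : 0 < L₀) (hf : IsTame L₀ f) :
    ∃ B, 0 ≤ B ∧ ∀ r, 0 < r → |massInBall f r| / r ^ 2 ≤ B * (1 + r) ^ (-2 : ℝ) :=
  ⟨fieldBound f, mul_nonneg (by norm_num) (add_nonneg (integral_nonneg fun _ => norm_nonneg _)
    (integral_nonneg fun _ => norm_nonneg _)), fun _ hr => hf.massInBall_bound hL₀ hr⟩

lemma measurable_massInBall (hf : Integrable f) : Measurable (massInBall f) := by
  obtain ⟨f', hf', hff'⟩ := hf.1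
  have h : massInBall f = fun r => ∫ z : Phase, ({z : Phase | ‖z.1‖ ≤ r}).indicator f' z := by
    ext r
    rw [massInBall_congr hff' hf, massInBall_eq (hf.congr hff'),
      integral_indicator (measurableSet_norm_fst_le r)]
  rw [h]
  refine (StronglyMeasurable.integral_prod_right (f := fun (r : ℝ) (z : Phase) =>
    ({z : Phase | ‖z.1‖ ≤ r}).indicator f' z) ?_).measurable
  have : Function.uncurry (fun (r : ℝ) (z : Phase) => ({z : Phase | ‖z.1‖ ≤ r}).indicator f' z)
      = ({p : ℝ × Phase | ‖p.2.1‖ ≤ p.1}).indicator (fun p => f' p.2) := by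
    ext p; simp [Function.uncurry, indicator]
  rw [this]
  exact (hf'.comp_measurable measurable_snd).indicator
    (measurableSet_le (by fun_prop) (by fun_prop))

lemma inner_gradPotential (x : Space) :
    inner ℝ (gradPotential f x) (gradPotential g x)
      = (massInBall f ‖x‖ / ‖x‖ ^ 2) * (massInBall g ‖x‖ / ‖x‖ ^ 2) := by
  by_cases hx : x = 0
  · simp [hx, gradPotential]
  · have : ‖x‖ ≠ 0 := norm_ne_zero_iff.2 hx
    simp only [gradPotential, inner_smul_left, inner_smul_right, RCLike.conj_to_real,
      real_inner_self_eq_norm_sq]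
    field_simp

lemma norm_gradPotential_sq (x : Space) :
    ‖gradPotential f x‖ ^ 2 = (massInBall f ‖x‖ / ‖x‖ ^ 2) ^ 2 := by
  rw [← real_inner_self_eq_norm_sq, inner_gradPotential, ← sq]

/-- The squared field of a tame function is dominated by a multiple of this integrable function. -/
lemma integrable_japanese : Integrable (fun x : Space => (1 + ‖x‖) ^ (-4 : ℝ)) := by
  refine integrable_one_add_norm (E := Space) ?_
  rw [finrank_euclideanSpace_fin]; norm_num

lemma IsTame.integrable_inner_grad (hL₀ : 0 < L₀) (hf : IsTame L₀ f) (hg : IsTame L₀ g) :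
    Integrable (fun x : Space =>
      (massInBall f ‖x‖ / ‖x‖ ^ 2) * (massInBall g ‖x‖ / ‖x‖ ^ 2)) := by
  obtain ⟨B, hB0, hB⟩ := hf.exists_massInBall_bound hL₀
  obtain ⟨C, hC0, hC⟩ := hg.exists_massInBall_bound hL₀
  refine (integrable_japanese.const_mul (B * C)).mono' ?_ ?_
  · have h1 := measurable_massInBall hf.integrable
    have h2 := measurable_massInBall hg.integrable
    exact Measurable.aestronglyMeasurable (by fun_prop)
  · have : ∀ᵐ x : Space, x ≠ 0 := by simp [ae_iff]
    filter_upwards [this] with x hx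
    have hx' : 0 < ‖x‖ := norm_pos_iff.2 hx
    have h3 : ((1 + ‖x‖) ^ (-4 : ℝ)) = (1 + ‖x‖) ^ (-2 : ℝ) * (1 + ‖x‖) ^ (-2 : ℝ) := by
      rw [← Real.rpow_add (by positivity)]; norm_num
    rw [norm_mul, Real.norm_eq_abs, Real.norm_eq_abs, abs_div, abs_div, abs_of_pos
      (show (0 : ℝ) < ‖x‖ ^ 2 by positivity), h3]
    calc _ ≤ (B * (1 + ‖x‖) ^ (-2 : ℝ)) * (C * (1 + ‖x‖) ^ (-2 : ℝ)) := by
          gcongr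
          · exact hB _ hx'
          · exact hC _ hx'
      _ = _ := by ring

lemma IsTame.integrable_grad_sq (hL₀ : 0 < L₀) (hf : IsTame L₀ f) :
    Integrable (fun x => ‖gradPotential f x‖ ^ 2) := by
  refine (hf.integrable_inner_grad hL₀ hf).congr (ae_of_all _ fun x => ?_)
  simp only [norm_gradPotential_sq]
  ring

/-- Integration of radial functions over `ℝ³`. -/
lemma integral_radial (F : ℝ → ℝ) :
    ∫ x : Space, F ‖x‖ = 4 * Real.pi * ∫ r in Ioi 0, r ^ 2 * F r := by
  rw [integral_fun_norm_addHaar volume F, finrank_euclideanSpace_fin]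
  have : (volume : Measure Space).real (Metric.ball 0 1) = 4 / 3 * Real.pi := by
    rw [Measure.real, EuclideanSpace.volume_ball]
    have h1 : Real.Gamma ((Fintype.card (Fin 3) : ℝ) / 2 + 1) = 3 / 4 * √Real.pi := by
      rw [Fintype.card_fin, Real.Gamma_add_one (by norm_num),
        show ((3 : ℕ) : ℝ) / 2 = 1 / 2 + 1 by norm_num, Real.Gamma_add_one (by norm_num),
        Real.Gamma_one_half_eq]
      ring
    have hpi : √Real.pi ^ 2 = Real.pi := Real.sq_sqrt Real.pi_pos.le
    have hs : 0 < √Real.pi := Real.sqrt_pos.2 Real.pi_pos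
    rw [h1, Fintype.card_fin]
    simp only [ENNReal.ofReal_one, one_pow, one_mul]
    rw [ENNReal.toReal_ofReal (by positivity)]
    field_simp
    rw [hpi]
  rw [this]
  simp only [smul_eq_mul, nsmul_eq_mul]
  push_cast
  ring

lemma integrable_radial {F : ℝ → ℝ} :
    Integrable (fun x : Space => F ‖x‖) ↔ IntegrableOn (fun r => r ^ 2 * F r) (Ioi 0) := by
  rw [integrable_fun_norm_addHaar volume, finrank_euclideanSpace_fin]
  simp

end tame

/-! ### The energy as a quadratic functional -/

/-- The squared `L²` norm of the induced field. -/
def fieldSq (f : Phase → ℝ) : ℝ := ∫ x : Space, ‖gradPotential f x‖ ^ 2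

/-- The first inverse moment `∬ f / |x|`. -/
def invMoment (f : Phase → ℝ) : ℝ := ∫ z : Phase, ‖z.1‖⁻¹ * f z

section energy
variable {L₀ : ℝ} {f g : Phase → ℝ}

lemma IsTame.integrableOn_massInBall_div (hL₀ : 0 < L₀) (hg : IsTame L₀ g) :
    IntegrableOn (fun r => massInBall g r / r ^ 2) (Ioi 0) := by
  obtain ⟨B, hB0, hB⟩ := hg.exists_massInBall_bound hL₀
  have hj : Integrable (fun r : ℝ => (1 + ‖r‖) ^ (-2 : ℝ)) := by
    refine integrable_one_add_norm (E := ℝ) ?_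
    rw [Module.finrank_self]; norm_num
  refine ((hj.const_mul B).integrableOn (s := Ioi 0)).mono' ?_ ?_
  · have := measurable_massInBall hg.integrable
    exact Measurable.aestronglyMeasurable (by fun_prop)
  · refine (ae_restrict_iff' measurableSet_Ioi).2 (ae_of_all _ fun r hr => ?_)
    have hr' : (0 : ℝ) < r := hr
    rw [Real.norm_eq_abs, abs_div, abs_of_pos (show 0 < r ^ 2 by positivity), Real.norm_eq_abs,
      abs_of_pos hr']
    exact hB r hr'

lemma setIntegral_indicator_Ici (k : ℝ → ℝ) {a : ℝ} (ha : 0 ≤ a) :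
    ∫ r in Ioi 0, (Ici a).indicator k r = ∫ r in Ioi a, k r := by
  rw [setIntegral_indicator measurableSet_Ici]
  refine setIntegral_congr_set ?_
  have h : (Ioi 0 ∩ Ici a : Set ℝ) =ᵐ[volume] (Ioi 0 ∩ Ioi a : Set ℝ) :=
    (ae_eq_refl _).inter Ioi_ae_eq_Ici.symm
  rwa [Ioi_inter_Ioi, max_eq_right ha] at h

/-- Green's identity for radial potentials: `∫ ∇U_f ⬝ ∇U_g = - 4π ∬ U_g f`. -/
lemma IsTame.pairing (hL₀ : 0 < L₀) (hf : IsTame L₀ f) (hg : IsTame L₀ g) :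
    Integrable (fun z : Phase => potential g z.1 * f z) ∧
    ∫ x : Space, inner ℝ (gradPotential f x) (gradPotential g x)
      = - (4 * Real.pi) * ∫ z : Phase, potential g z.1 * f z := by
  set k : ℝ → ℝ := fun r => massInBall g r / r ^ 2 with hk
  have hki : Integrable k (volume.restrict (Ioi 0)) := hg.integrableOn_massInBall_div hL₀
  set S : Set (Phase × ℝ) := {p | ‖p.1.1‖ ≤ p.2} with hS
  have hSm : MeasurableSet S := measurableSet_le (by fun_prop) (by fun_prop)
  have hint : Integrable (S.indicator fun p => f p.1 * k p.2)
      (volume.prod (volume.restrict (Ioi 0))) := (hf.integrable.mul_prod hki).indicator hSm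
  have hz : ∀ z : Phase, ∫ r in Ioi 0, S.indicator (fun p => f p.1 * k p.2) (z, r)
      = - (potential g z.1 * f z) := by
    intro z
    have : ∀ r, S.indicator (fun p => f p.1 * k p.2) (z, r)
        = f z * (Ici ‖z.1‖).indicator k r := by
      intro r
      simp only [hS, indicator, mem_ofPred_eq, mem_Ici]
      split_ifs <;> simp
    simp only [this]
    rw [integral_const_mul, setIntegral_indicator_Ici k (norm_nonneg _)]
    simp only [potential, hk]
    ring
  have hr : ∀ r, ∫ z : Phase, S.indicator (fun p => f p.1 * k p.2) (z, r)
      = massInBall f r * k r := by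
    intro r
    have : ∀ z, S.indicator (fun p => f p.1 * k p.2) (z, r)
        = ({z : Phase | ‖z.1‖ ≤ r}).indicator f z * k r := by
      intro z
      simp only [hS, indicator, mem_ofPred_eq]
      split_ifs <;> simp
    simp only [this]
    rw [integral_mul_const, integral_indicator (measurableSet_norm_fst_le r),
      massInBall_eq hf.integrable]
  have h1 := integral_prod _ hint
  have h2 := integral_prod_symm _ hint
  simp only [hz] at h1
  simp only [hr] at h2
  have hi := hint.integral_prod_left
  simp only [hz] at hi
  refine ⟨by simpa using hi.neg, ?_⟩
  have hF : ∀ x : Space, (inner ℝ (gradPotential f x) (gradPotential g x) : ℝ)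
      = (fun r => (massInBall f r / r ^ 2) * (massInBall g r / r ^ 2)) ‖x‖ :=
    fun x => inner_gradPotential x
  refine (integral_congr_ae (ae_of_all _ hF)).trans ((integral_radial (fun r =>
    (massInBall f r / r ^ 2) * (massInBall g r / r ^ 2))).trans ?_)
  have h3 : ∫ r in Ioi 0, r ^ 2 * (massInBall f r / r ^ 2 * (massInBall g r / r ^ 2))
      = ∫ r in Ioi 0, massInBall f r * k r := by
    refine setIntegral_congr_fun measurableSet_Ioi fun r hr => ?_
    have : (0 : ℝ) < r := hr
    simp only [hk]
    field_simp
  rw [h3, ← h2, h1, integral_neg]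
  ring

lemma IsTame.fieldSq_eq (hL₀ : 0 < L₀) (hf : IsTame L₀ f) :
    fieldSq f = - (4 * Real.pi) * ∫ z : Phase, potential f z.1 * f z := by
  rw [← (hf.pairing hL₀ hf).2]
  simp [fieldSq]

/-- The two terms of the potential energy, which the definition integrates together, are separately
finite. -/
lemma IsTame.potentialEnergy_eq (hL₀ : 0 < L₀) (hf : IsTame L₀ f) (Mc : ℝ) :
    potentialEnergy Mc f = - (1 / (8 * Real.pi)) * fieldSq f - Mc * invMoment f := by
  have hi : Integrable (fun z : Phase => ‖z.1‖⁻¹ * f z) (volume.prod volume) :=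
    hf.integrable_inv hL₀
  have hv : ∀ x : Space, ∫ v : Space, ‖x‖⁻¹ * f (x, v) = ‖x‖⁻¹ * density f x := by
    intro x; rw [integral_const_mul, density]
  have h1 : invMoment f = ∫ x : Space, ‖x‖⁻¹ * density f x := by
    rw [invMoment, volume_phase, integral_prod _ hi]
    simp only [hv]
  have h2 : Integrable (fun x : Space => ‖x‖⁻¹ * density f x) := by
    have := hi.integral_prod_left
    simpa only [hv] using this
  have h3 : (fun x : Space => 8 * Real.pi * Mc / ‖x‖ * density f x)
      = fun x => 8 * Real.pi * Mc * (‖x‖⁻¹ * density f x) := by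
    ext x; ring
  have hpi := Real.pi_pos
  rw [potentialEnergy, integral_add (hf.integrable_grad_sq hL₀)
    (by rw [h3]; exact h2.const_mul _), h3, integral_const_mul, ← h1, fieldSq]
  field_simp
  ring

lemma IsTame.integrable_particleEnergy (hL₀ : 0 < L₀) (hf : IsTame L₀ f) (hg : IsTame L₀ g)
    (Mc : ℝ) : Integrable (fun z => particleEnergy Mc f z * g z) ∧
      ∫ z, particleEnergy Mc f z * g z
        = kineticEnergy g + ∫ z : Phase, potential f z.1 * g z - Mc * ‖z.1‖⁻¹ * g z := by
  have h1 := hg.kinetic.const_mul (1 / 2)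
  have h2 := (hg.pairing hL₀ hf).1
  have h3 := (hg.integrable_inv hL₀).const_mul Mc
  have he : (fun z => particleEnergy Mc f z * g z) = fun z => (1 / 2 * (‖z.2‖ ^ 2 * g z))
      + (potential f z.1 * g z - Mc * ‖z.1‖⁻¹ * g z) := by
    ext z; simp only [particleEnergy]; ring
  have h4 : Integrable (fun z : Phase => potential f z.1 * g z - Mc * ‖z.1‖⁻¹ * g z) := by
    refine h2.sub (h3.congr (ae_of_all _ fun z => ?_))
    simp only; ring
  rw [he]
  refine ⟨h1.add h4, ?_⟩
  rw [integral_add h1 h4, integral_const_mul, kineticEnergy]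

lemma IsTame.integrable_fieldDiffSq (hL₀ : 0 < L₀) (hf : IsTame L₀ f) (hg : IsTame L₀ g) :
    Integrable (fieldDiffSq f g) := by
  have h := (hf.sub hg).integrable_grad_sq hL₀
  refine h.congr (ae_of_all _ fun x => ?_)
  simp only [fieldDiffSq, gradPotential_sub hf.integrable hg.integrable]

lemma IsTame.integral_fieldDiffSq (hf : IsTame L₀ f) (hg : IsTame L₀ g) :
    ∫ x, fieldDiffSq f g x = fieldSq (fun z => f z - g z) := by
  simp only [fieldSq, fieldDiffSq, gradPotential_sub hf.integrable hg.integrable]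

lemma kineticEnergy_sub (hf : IsTame L₀ f) (hg : IsTame L₀ g) :
    kineticEnergy (fun z => f z - g z) = kineticEnergy f - kineticEnergy g := by
  simp only [kineticEnergy, mul_sub]
  rw [integral_sub hf.kinetic hg.kinetic]; ring

lemma invMoment_sub (hL₀ : 0 < L₀) (hf : IsTame L₀ f) (hg : IsTame L₀ g) :
    invMoment (fun z => f z - g z) = invMoment f - invMoment g := by
  simp only [invMoment, mul_sub]
  rw [integral_sub (hf.integrable_inv hL₀) (hg.integrable_inv hL₀)]

/-- The energy of a phase-space function in the joint field of its own and of the point mass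
is a quadratic functional; this is its Taylor expansion. -/
lemma IsTame.energy_expansion (hL₀ : 0 < L₀) (hf : IsTame L₀ f) (hg : IsTame L₀ g) (Mc : ℝ) :
    (kineticEnergy f + potentialEnergy Mc f) - (kineticEnergy g + potentialEnergy Mc g)
      = (∫ z, particleEnergy Mc g z * (f z - g z))
        - 1 / (8 * Real.pi) * ∫ x, fieldDiffSq f g x := by
  have hd := hf.sub hg
  have hpi := Real.pi_pos
  have hexp : fieldSq f = fieldSq g
      + 2 * (∫ x : Space, inner ℝ (gradPotential (fun z => f z - g z) x) (gradPotential g x))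
      + fieldSq (fun z => f z - g z) := by
    have hi : Integrable (fun x : Space => (inner ℝ (gradPotential (fun z => f z - g z) x)
        (gradPotential g x) : ℝ)) := by
      refine (hd.integrable_inner_grad hL₀ hg).congr (ae_of_all _ fun x => ?_)
      simp only [inner_gradPotential]
    have hi2 : Integrable (fun x : Space => ‖gradPotential g x‖ ^ 2
        + 2 * (inner ℝ (gradPotential (fun z => f z - g z) x) (gradPotential g x) : ℝ)) :=
      (hg.integrable_grad_sq hL₀).add (hi.const_mul 2)
    rw [fieldSq, fieldSq, fieldSq, ← integral_const_mul, ← integral_add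
      (hg.integrable_grad_sq hL₀) (hi.const_mul 2), ← integral_add hi2
      (hd.integrable_grad_sq hL₀)]
    refine integral_congr_ae (ae_of_all _ fun x => ?_)
    have : gradPotential f x = gradPotential (fun z => f z - g z) x + gradPotential g x := by
      rw [gradPotential_sub hf.integrable hg.integrable]; abel
    simp only [this, norm_add_sq_real]
    ring
  rw [(hd.pairing hL₀ hg).2] at hexp
  have hE := (hg.integrable_particleEnergy hL₀ hd Mc).2
  have h2 := (hd.pairing hL₀ hg).1
  have h3 := (hd.integrable_inv hL₀).const_mul Mc
  have h4 : ∫ z : Phase, potential g z.1 * (f z - g z) - Mc * ‖z.1‖⁻¹ * (f z - g z)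
      = (∫ z : Phase, potential g z.1 * (f z - g z)) - Mc * invMoment (fun z => f z - g z) := by
    rw [invMoment, ← integral_const_mul, ← integral_sub h2 h3]
    simp only [mul_assoc]
  rw [hE, h4, hf.integral_fieldDiffSq hg, hf.potentialEnergy_eq hL₀, hg.potentialEnergy_eq hL₀,
    kineticEnergy_sub hf hg, invMoment_sub hL₀ hf hg, hexp]
  field_simp
  ring

/-- The potential of a nonnegative `f` lies above that of the same mass concentrated at the origin. -/
lemma potential_ge (hf : Integrable f) (h0 : ∀ᵐ z : Phase, 0 ≤ f z) {x : Space} (hx : x ≠ 0) :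
    - ((∫ z, f z) * ‖x‖⁻¹) ≤ potential f x := by
  have hx' : 0 < ‖x‖ := norm_pos_iff.2 hx
  have hN : ∫ z, ‖f z‖ = ∫ z, f z :=
    integral_congr_ae (h0.mono fun z hz => by simp only [Real.norm_eq_abs, abs_of_nonneg hz])
  have hi : IntegrableOn (fun s : ℝ => s ^ (-2 : ℝ)) (Ioi ‖x‖) :=
    integrableOn_Ioi_rpow_of_lt (by norm_num) hx'
  have hint : ∫ s in Ioi ‖x‖, (∫ z, f z) * s ^ (-2 : ℝ) = (∫ z, f z) * ‖x‖⁻¹ := by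
    rw [integral_const_mul, integral_Ioi_rpow_of_lt (by norm_num) hx']
    norm_num [Real.rpow_neg_one]
  rw [potential, neg_le_neg_iff, ← hint]
  refine integral_mono_of_nonneg ?_ (hi.const_mul _) ?_
  · exact ae_of_all _ fun s => div_nonneg (massInBall_nonneg hf h0 s) (sq_nonneg s)
  · refine (ae_restrict_iff' measurableSet_Ioi).2 (ae_of_all _ fun s hs => ?_)
    have hs' : 0 < s := hx'.trans hs
    have := (abs_le.1 (abs_massInBall_le hf s)).2
    rw [hN] at this
    simp only
    rw [Real.rpow_neg hs'.le, Real.rpow_ofNat, div_eq_mul_inv]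
    gcongr

lemma IsTame.fieldSq_le (hL₀ : 0 < L₀) (hf : IsTame L₀ f) (h0 : ∀ᵐ z : Phase, 0 ≤ f z) :
    fieldSq f ≤ 4 * Real.pi * (∫ z, f z) * invMoment f := by
  have hpi := Real.pi_pos
  rw [hf.fieldSq_eq hL₀, invMoment, mul_assoc, neg_mul, ← mul_neg]
  refine mul_le_mul_of_nonneg_left ?_ (by positivity)
  rw [← integral_const_mul, ← integral_neg]
  refine integral_mono_ae (hf.pairing hL₀ hf).1.neg ((hf.integrable_inv hL₀).const_mul _) ?_
  filter_upwards [h0, hf.vanish] with z hz hv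
  by_cases h : f z = 0
  · simp [h]
  · have hL : L₀ ≤ angMom z := by
      by_contra h'
      exact h (hv (not_le.1 h'))
    have := potential_ge hf.integrable h0 (fst_ne_zero_of_angMom_pos (hL₀.trans_le hL))
    nlinarith

/-- Interpolation of `1/|x|` between `1` and `1/|x|² ≤ |v|²/L₀`: an arbitrarily small part of the
kinetic energy controls the first inverse moment. -/
lemma IsTame.invMoment_le (hL₀ : 0 < L₀) (hf : IsTame L₀ f) (h0 : ∀ᵐ z : Phase, 0 ≤ f z)
    {s : ℝ} (hs : 0 < s) :
    invMoment f ≤ s * (L₀⁻¹ * (2 * kineticEnergy f)) + (4 * s)⁻¹ * ∫ z, f z := by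
  have : s * (L₀⁻¹ * (2 * kineticEnergy f)) + (4 * s)⁻¹ * ∫ z, f z
      = ∫ z, (s * L₀⁻¹ * (‖z.2‖ ^ 2 * f z) + (4 * s)⁻¹ * f z) := by
    rw [integral_add (hf.kinetic.const_mul _) (hf.integrable.const_mul _), integral_const_mul,
      integral_const_mul, kineticEnergy]
    ring
  rw [this, invMoment]
  refine integral_mono_ae (hf.integrable_inv hL₀)
    ((hf.kinetic.const_mul _).add (hf.integrable.const_mul _)) ?_
  filter_upwards [h0, hf.inv_sq_le hL₀] with z hz hv
  by_cases h : f z = 0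
  · simp [h]
  · have h1 := hv h
    have h2 : ‖z.1‖⁻¹ ≤ s * ‖z.1‖⁻¹ ^ 2 + (4 * s)⁻¹ := by
      have := sq_nonneg (2 * s * ‖z.1‖⁻¹ - 1)
      have h4 : 0 < (4 * s)⁻¹ := by positivity
      have h5 : (4 * s)⁻¹ * (4 * s) = 1 := inv_mul_cancel₀ (by positivity)
      nlinarith [mul_nonneg h4.le this]
    have h3 : ‖z.1‖⁻¹ ≤ s * (L₀⁻¹ * ‖z.2‖ ^ 2) + (4 * s)⁻¹ := by nlinarith
    have := mul_le_mul_of_nonneg_right h3 hz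
    linarith

lemma invMoment_nonneg (h0 : ∀ᵐ z : Phase, 0 ≤ f z) : 0 ≤ invMoment f :=
  integral_nonneg_of_ae (h0.mono fun z hz => mul_nonneg (by positivity) hz)

lemma kineticEnergy_nonneg (h0 : ∀ᵐ z : Phase, 0 ≤ f z) : 0 ≤ kineticEnergy f :=
  mul_nonneg (by norm_num)
    (integral_nonneg_of_ae (h0.mono fun z hz => mul_nonneg (by positivity) hz))

end energy

section admissible
variable {k l L₀ Mc M : ℝ} {f g : Phase → ℝ}

lemma casimirDensity_nonneg {z : Phase} (hz : 0 ≤ f z) : 0 ≤ casimirDensity k l L₀ f z :=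
  mul_nonneg (Real.rpow_nonneg hz _) (Real.rpow_nonneg (le_max_right _ _) _)

lemma casimir_nonneg (h0 : ∀ᵐ z : Phase, 0 ≤ f z) : 0 ≤ casimir k l L₀ f :=
  integral_nonneg_of_ae (h0.mono fun _ hz => casimirDensity_nonneg hz)

/-- The energy-Casimir functional controls the kinetic energy and the Casimir functional. -/
lemma exists_coercive (k l : ℝ) (hL₀ : 0 < L₀) (hMc : 0 < Mc) (hM : 0 < M) :
    ∃ C, ∀ f, IsAdmissible k l L₀ M f →
      kineticEnergy f / 2 + casimir k l L₀ f ≤ energyCasimir k l L₀ Mc f + C := by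
  set s := L₀ / (4 * (Mc + M / 2)) with hs
  have hs0 : 0 < s := by positivity
  refine ⟨(Mc + M / 2) * ((4 * s)⁻¹ * M), fun f hf => ?_⟩
  have h1 := hf.tame.invMoment_le hL₀ hf.nonneg hs0
  have h2 := hf.tame.fieldSq_le hL₀ hf.nonneg
  rw [hf.mass] at h1 h2
  have hpi := Real.pi_pos
  rw [energyCasimir, hf.tame.potentialEnergy_eq hL₀]
  have h3 : 1 / (8 * Real.pi) * fieldSq f ≤ M / 2 * invMoment f := by
    rw [one_div, inv_mul_le_iff₀ (by positivity)]
    linarith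
  have h4 : (Mc + M / 2) * (s * (L₀⁻¹ * (2 * kineticEnergy f))) = kineticEnergy f / 2 := by
    rw [hs]; field_simp; ring
  have h5 := mul_le_mul_of_nonneg_left h1 (show 0 ≤ Mc + M / 2 by positivity)
  rw [mul_add, h4] at h5
  linarith

/-- The expansion of the energy-Casimir functional about `g`. -/
lemma IsAdmissible.expansion (hL₀ : 0 < L₀) (hf : IsAdmissible k l L₀ M f)
    (hg : IsAdmissible k l L₀ M g) (E₀ : ℝ) :
    Integrable (distDensity k l L₀ Mc E₀ f g) ∧
    energyCasimir k l L₀ Mc f - energyCasimir k l L₀ Mc g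
      = dist₀ k l L₀ Mc E₀ f g - 1 / (8 * Real.pi) * ∫ x, fieldDiffSq f g x := by
  have hd := hf.tame.sub hg.tame
  have hE := (hg.tame.integrable_particleEnergy hL₀ hd Mc).1
  have hc := hf.casimir_finite.sub hg.casimir_finite
  have he : distDensity k l L₀ Mc E₀ f g = fun z =>
      (casimirDensity k l L₀ f z - casimirDensity k l L₀ g z)
        + (particleEnergy Mc g z * (f z - g z) - E₀ * (f z - g z)) := by
    ext z; simp only [distDensity, casimirDensity]; ring
  have hm : ∫ z, (f z - g z) = 0 := by
    rw [integral_sub hf.integrable hg.integrable, hf.mass, hg.mass, sub_self]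
  rw [dist₀, he]
  have hE2 : Integrable (fun z => particleEnergy Mc g z * (f z - g z) - E₀ * (f z - g z)) :=
    hE.sub (hd.integrable.const_mul E₀)
  refine ⟨hc.add hE2, ?_⟩
  rw [integral_add (f := fun z => casimirDensity k l L₀ f z - casimirDensity k l L₀ g z) hc
    hE2, integral_sub hE (hd.integrable.const_mul E₀),
    integral_const_mul, hm, integral_sub hf.casimir_finite hg.casimir_finite]
  have := hf.tame.energy_expansion hL₀ hg.tame Mc
  simp only [energyCasimir, casimir]
  linarith

end admissible

/-! ### Uniform convexity of powers -/

/-- The midpoint convexity defect of the power `s ↦ s ^ p`. -/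
def convexGap (p a b : ℝ) : ℝ := (a ^ p + b ^ p) / 2 - ((a + b) / 2) ^ p

lemma convexGap_nonneg {p a b : ℝ} (hp : 1 < p) (ha : 0 ≤ a) (hb : 0 ≤ b) :
    0 ≤ convexGap p a b := by
  have h := (convexOn_rpow hp.le).2 (mem_Ici.2 ha) (mem_Ici.2 hb) (show (0 : ℝ) ≤ 1 / 2 by norm_num)
    (show (0 : ℝ) ≤ 1 / 2 by norm_num) (by norm_num)
  simp only [smul_eq_mul] at h
  have e : 1 / 2 * a + 1 / 2 * b = (a + b) / 2 := by ring
  rw [e] at h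
  unfold convexGap; linarith

lemma convexGap_pos {p a b : ℝ} (hp : 1 < p) (ha : 0 ≤ a) (hb : 0 ≤ b) (hab : a ≠ b) :
    0 < convexGap p a b := by
  have h := (strictConvexOn_rpow hp).2 (mem_Ici.2 ha) (mem_Ici.2 hb) hab
    (show (0 : ℝ) < 1 / 2 by norm_num) (show (0 : ℝ) < 1 / 2 by norm_num) (by norm_num)
  simp only [smul_eq_mul] at h
  have e : 1 / 2 * a + 1 / 2 * b = (a + b) / 2 := by ring
  rw [e] at h
  unfold convexGap; linarith

/-- Qualitative uniform convexity: the distance of two numbers is controlled by their convexity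
defect, up to an arbitrarily small multiple of their powers. -/
lemma exists_abs_sub_le_convexGap {p : ℝ} (hp : 1 < p) {δ : ℝ} (hδ : 0 < δ) :
    ∃ C, 0 ≤ C ∧ ∀ a b : ℝ, 0 ≤ a → 0 ≤ b →
      |a - b| ≤ δ * (1 + a ^ p + b ^ p) + C * convexGap p a b := by
  have hev : ∀ᶠ t : ℝ in atTop, δ⁻¹ ≤ t ^ (p - 1) :=
    (tendsto_rpow_atTop (sub_pos.2 hp)).eventually_ge_atTop _
  obtain ⟨R₀, hR₀⟩ := eventually_atTop.1 hev
  -- beyond `R` the superlinear power dominates; on the compact set of pairs below `R` that differ by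
  -- at least `δ` the convexity defect has a positive minimum `m`
  set R := max R₀ 1 with hRdef
  have hR1 : 1 ≤ R := le_max_right _ _
  have hlarge : ∀ t, R ≤ t → t ≤ δ * t ^ p := by
    intro t ht
    have ht0 : 0 < t := by linarith
    have h1 := hR₀ t ((le_max_left _ _).trans ht)
    have h2 : t ^ p = t ^ (p - 1) * t := by
      rw [← Real.rpow_add_one ht0.ne']; ring_nf
    rw [h2]
    calc t = δ * (δ⁻¹ * t) := by field_simp
      _ ≤ δ * (t ^ (p - 1) * t) := by gcongr
  set K : Set (ℝ × ℝ) := (Icc 0 R ×ˢ Icc 0 R) ∩ {q | δ ≤ |q.1 - q.2|} with hK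
  have hKc : IsCompact K := (isCompact_Icc.prod isCompact_Icc).inter_right
    (isClosed_le continuous_const (by fun_prop))
  have hcont : Continuous (fun q : ℝ × ℝ => convexGap p q.1 q.2) := by
    have hp0 : 0 ≤ p := by linarith
    unfold convexGap
    have h1 := Real.continuous_rpow_const hp0
    exact ((h1.comp continuous_fst).add (h1.comp continuous_snd)).div_const 2 |>.sub
      (h1.comp ((continuous_fst.add continuous_snd).div_const 2))
  obtain ⟨m, hm, hmK⟩ : ∃ m, 0 < m ∧ ∀ q ∈ K, m ≤ convexGap p q.1 q.2 := by
    rcases K.eq_empty_or_nonempty with he | hne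
    · exact ⟨1, one_pos, by simp [he]⟩
    · obtain ⟨q, hq, hmin⟩ := hKc.exists_isMinOn hne hcont.continuousOn
      refine ⟨convexGap p q.1 q.2, convexGap_pos hp hq.1.1.1 hq.1.2.1 ?_, fun r hr => hmin hr⟩
      intro h
      have : δ ≤ |q.1 - q.2| := hq.2
      rw [h, sub_self, abs_zero] at this
      linarith
  refine ⟨R / m, by positivity, fun a b ha hb => ?_⟩
  have hg := convexGap_nonneg hp ha hb
  have ha' : 0 ≤ a ^ p := Real.rpow_nonneg ha p
  have hb' : 0 ≤ b ^ p := Real.rpow_nonneg hb p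
  have hg' : 0 ≤ R / m * convexGap p a b := by positivity
  by_cases haR : R ≤ a
  · by_cases hba : b ≤ a
    · rw [abs_of_nonneg (by linarith)]
      nlinarith [hlarge a haR]
    · rw [abs_of_nonpos (by linarith)]
      nlinarith [hlarge b (by linarith)]
  · by_cases hbR : R ≤ b
    · rw [abs_of_nonpos (by linarith)]
      nlinarith [hlarge b hbR]
    · push Not at haR hbR
      by_cases hd : δ ≤ |a - b|
      · have h1 : m ≤ convexGap p a b := hmK (a, b) ⟨⟨⟨ha, haR.le⟩, ⟨hb, hbR.le⟩⟩, hd⟩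
        have h2 : |a - b| ≤ R := by rw [abs_le]; constructor <;> linarith
        have h3 : R ≤ R / m * convexGap p a b := by
          rw [div_mul_eq_mul_div, le_div_iff₀ hm]
          gcongr
        have : 0 ≤ δ * (1 + a ^ p + b ^ p) := by positivity
        linarith
      · push Not at hd
        nlinarith

/-! ### Operations on admissible functions -/

section ops
variable {k l L₀ Mc M M₁ M₂ : ℝ} {f g : Phase → ℝ}

lemma one_lt_exponent (hk : 0 < k) : 1 < 1 + 1 / k := by
  have : 0 < 1 / k := by positivity
  linarith

lemma aestronglyMeasurable_casimirDensity (hf : AEStronglyMeasurable f) :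
    AEStronglyMeasurable (casimirDensity k l L₀ f) := by
  have h1 := hf.aemeasurable.pow_const (1 + 1 / k)
  have h2 : Measurable (fun z : Phase => (max (angMom z - L₀) 0) ^ (-(l / k))) := by
    have := continuous_angMom.measurable
    fun_prop
  exact (h1.mul h2.aemeasurable).aestronglyMeasurable

lemma IsSphericallySymmetric.add (hf : IsSphericallySymmetric f) (hg : IsSphericallySymmetric g) :
    IsSphericallySymmetric (fun z => f z + g z) := by
  intro A
  filter_upwards [hf A, hg A] with z h1 h2
  simp [h1, h2]

lemma IsSphericallySymmetric.const_mul (c : ℝ) (hf : IsSphericallySymmetric f) :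
    IsSphericallySymmetric (fun z => c * f z) := by
  intro A
  filter_upwards [hf A] with z h1
  simp [h1]

/-- The Casimir functional is homogeneous of degree `1 + 1/k`. -/
lemma IsAdmissible.const_mul (hf : IsAdmissible k l L₀ M f) {c : ℝ} (hc : 0 ≤ c) :
    IsAdmissible k l L₀ (c * M) (fun z => c * f z) ∧
      casimir k l L₀ (fun z => c * f z) = c ^ (1 + 1 / k) * casimir k l L₀ f := by
  have he : casimirDensity k l L₀ (fun z => c * f z) =ᵐ[volume]
      fun z => c ^ (1 + 1 / k) * casimirDensity k l L₀ f z := by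
    filter_upwards [hf.nonneg] with z hz
    simp only [casimirDensity]
    rw [Real.mul_rpow hc hz, mul_assoc]
  have ht := hf.tame.const_mul c
  refine ⟨⟨ht.integrable, ?_, hf.symmetric.const_mul c, ?_, ht.kinetic, ?_, ht.vanish⟩, ?_⟩
  · filter_upwards [hf.nonneg] with z hz
    positivity
  · rw [integral_const_mul, hf.mass]
  · exact (hf.casimir_finite.const_mul _).congr he.symm
  · rw [casimir, integral_congr_ae he, integral_const_mul, casimir]

/-- The admissible class is convex, and the Casimir functional is convex on it. -/
lemma IsAdmissible.convexComb (hk : 0 < k) (hf : IsAdmissible k l L₀ M₁ f)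
    (hg : IsAdmissible k l L₀ M₂ g) {s : ℝ} (hs0 : 0 ≤ s) (hs1 : s ≤ 1) :
    IsAdmissible k l L₀ ((1 - s) * M₁ + s * M₂) (fun z => (1 - s) * f z + s * g z) ∧
      casimir k l L₀ (fun z => (1 - s) * f z + s * g z)
        ≤ (1 - s) * casimir k l L₀ f + s * casimir k l L₀ g := by
  have ht := (hf.tame.const_mul (1 - s)).add (hg.tame.const_mul s)
  have hle : ∀ᵐ z, casimirDensity k l L₀ (fun z => (1 - s) * f z + s * g z) z
      ≤ (1 - s) * casimirDensity k l L₀ f z + s * casimirDensity k l L₀ g z := by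
    filter_upwards [hf.nonneg, hg.nonneg] with z h1 h2
    have h := (convexOn_rpow (one_lt_exponent hk).le).2 (mem_Ici.2 h1) (mem_Ici.2 h2)
      (sub_nonneg.2 hs1) hs0 (by ring)
    simp only [smul_eq_mul] at h
    have hw : 0 ≤ (max (angMom z - L₀) 0) ^ (-(l / k)) := Real.rpow_nonneg (le_max_right _ _) _
    simp only [casimirDensity]
    nlinarith [mul_le_mul_of_nonneg_right h hw]
  have h0 : ∀ᵐ z : Phase, 0 ≤ (1 - s) * f z + s * g z := by
    filter_upwards [hf.nonneg, hg.nonneg] with z h1 h2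
    have := sub_nonneg.2 hs1
    positivity
  have hi := (hf.casimir_finite.const_mul (1 - s)).add (hg.casimir_finite.const_mul s)
  have hci : Integrable (casimirDensity k l L₀ (fun z => (1 - s) * f z + s * g z)) := by
    refine hi.mono' (aestronglyMeasurable_casimirDensity ht.integrable.1) ?_
    filter_upwards [hle, h0] with z h1 h2
    rw [Real.norm_eq_abs, abs_of_nonneg (casimirDensity_nonneg h2)]
    exact h1
  refine ⟨⟨ht.integrable, h0, (hf.symmetric.const_mul _).add (hg.symmetric.const_mul _), ?_,
    ht.kinetic, hci, ht.vanish⟩, ?_⟩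
  · rw [integral_add (hf.integrable.const_mul _) (hg.integrable.const_mul _), integral_const_mul,
      integral_const_mul, hf.mass, hg.mass]
  · rw [casimir, casimir, casimir, ← integral_const_mul, ← integral_const_mul,
      ← integral_add (hf.casimir_finite.const_mul (1 - s)) (hg.casimir_finite.const_mul s)]
    exact integral_mono_ae hci hi hle

/-! ### Rescaling and dispersing mass -/

/-- The map `(x, v) ↦ (a x, b v)`. -/
def scalePhase {a b : ℝ} (ha : a ≠ 0) (hb : b ≠ 0) : Phase ≃ₜ Phase :=
  (Homeomorph.smulOfNeZero a ha).prodCongr (Homeomorph.smulOfNeZero b hb)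

lemma map_scalePhase {a b : ℝ} (ha : 0 < a) (hb : 0 < b) :
    (volume : Measure Phase).map (scalePhase ha.ne' hb.ne')
      = ENNReal.ofReal ((a * b) ^ 3)⁻¹ • (volume : Measure Phase) := by
  set D : Phase →ₗ[ℝ] Phase := LinearMap.prodMap (a • LinearMap.id) (b • LinearMap.id) with hD
  have hdet : LinearMap.det D = (a * b) ^ 3 := by
    rw [hD, LinearMap.det_prodMap, LinearMap.det_smul, LinearMap.det_smul, LinearMap.det_id,
      finrank_euclideanSpace_fin]
    ring
  have hne : LinearMap.det D ≠ 0 := by rw [hdet]; positivity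
  have h := Measure.map_linearMap_addHaar_eq_smul_addHaar (volume : Measure Phase) hne
  have hfun : (⇑D : Phase → Phase) = scalePhase ha.ne' hb.ne' := rfl
  rw [hfun, hdet, abs_of_pos (by positivity)] at h
  exact h

lemma integrable_comp_scale {a b : ℝ} (ha : 0 < a) (hb : 0 < b) {F : Phase → ℝ}
    (hF : Integrable F) : Integrable (fun z : Phase => F (a • z.1, b • z.2)) := by
  have he := (scalePhase ha.ne' hb.ne').toMeasurableEquiv.measurableEmbedding
  have h : Integrable F ((volume : Measure Phase).map (scalePhase ha.ne' hb.ne')) := by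
    rw [map_scalePhase ha hb]
    exact hF.smul_measure ENNReal.ofReal_ne_top
  exact (he.integrable_map_iff).1 h

lemma integral_comp_scale {a b : ℝ} (ha : 0 < a) (hb : 0 < b) (F : Phase → ℝ) :
    ∫ z : Phase, F (a • z.1, b • z.2) = ((a * b) ^ 3)⁻¹ * ∫ z, F z := by
  have he := (scalePhase ha.ne' hb.ne').toMeasurableEquiv.measurableEmbedding
  have h := he.integral_map (μ := volume) F
  have h2 : (volume : Measure Phase).map (scalePhase ha.ne' hb.ne').toMeasurableEquiv
    = ENNReal.ofReal ((a * b) ^ 3)⁻¹ • (volume : Measure Phase) := map_scalePhase ha hb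
  rw [h2, integral_smul_measure, ENNReal.toReal_ofReal (by positivity), smul_eq_mul] at h
  exact h.symm

lemma ae_comp_scale {a b : ℝ} (ha : 0 < a) (hb : 0 < b) {P : Phase → Prop}
    (hP : ∀ᵐ z, P z) : ∀ᵐ z : Phase, P (a • z.1, b • z.2) := by
  have h : ∀ᵐ z ∂((volume : Measure Phase).map (scalePhase ha.ne' hb.ne')), P z := by
    rw [map_scalePhase ha hb]
    exact Measure.ae_smul_measure hP _
  exact ae_of_ae_map (scalePhase ha.ne' hb.ne').continuous.aemeasurable h

/-- Spreading out `f` in space by a factor `1/a` while rescaling velocities by `1/b`. -/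
lemma IsAdmissible.scale (hk : 0 < k) (hl : 0 < l) (hL₀ : 0 < L₀) (hf : IsAdmissible k l L₀ M f)
    {a b c : ℝ} (ha : 0 < a) (hb : 0 < b) (hab : a * b ≤ 1) (hc : 0 ≤ c) :
    ∃ g, IsAdmissible k l L₀ (c * M) g ∧ kineticEnergy g = c * (b⁻¹) ^ 2 * kineticEnergy f ∧
      invMoment g = c * a * invMoment f ∧
      casimir k l L₀ g ≤ c ^ (1 + 1 / k) * (a * b) ^ ((3 + 2 * l) / k) * casimir k l L₀ f := by
  have hab0 : 0 < a * b := by positivity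
  set D : Phase → Phase := fun z => (a • z.1, b • z.2) with hD
  set g : Phase → ℝ := fun z => f (D z) with hg
  have hle : ∀ᵐ z, casimirDensity k l L₀ g z
      ≤ (a * b) ^ (2 * l / k) * casimirDensity k l L₀ f (D z) := by
    have hnull : ∀ᵐ z : Phase, angMom z ≠ L₀ := by
      rw [ae_iff]; simpa using volume_angMom_eq hL₀.le
    filter_upwards [ae_comp_scale ha hb hf.vanish, ae_comp_scale ha hb hf.nonneg,
      ae_comp_scale ha hb hnull] with z h1 h2 h3
    simp only [casimirDensity, hg]
    rcases lt_or_gt_of_ne h3 with h | h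
    · have h4 : f (D z) = 0 := h1 h
      have h5 : (0 : ℝ) ^ (1 + 1 / k) = 0 := Real.zero_rpow (by have := one_lt_exponent hk; linarith)
      rw [h4, h5]; simp
    · have hL : angMom (D z) = (a * b) ^ 2 * angMom z := angMom_smul a b z
      have h' : L₀ < angMom (D z) := h
      have hpos : 0 < angMom (D z) - L₀ := by linarith
      have hcmp : (angMom (D z) - L₀) * ((a * b)⁻¹) ^ 2 ≤ angMom z - L₀ := by
        rw [inv_pow, ← div_eq_mul_inv, div_le_iff₀ (by positivity), hL]
        have : (a * b) ^ 2 ≤ 1 := pow_le_one₀ hab0.le hab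
        nlinarith
      have hpos2 : 0 < (angMom (D z) - L₀) * ((a * b)⁻¹) ^ 2 := by positivity
      rw [max_eq_left (by linarith : 0 ≤ angMom z - L₀), max_eq_left hpos.le]
      have h5 : (angMom z - L₀) ^ (-(l / k))
          ≤ ((angMom (D z) - L₀) * ((a * b)⁻¹) ^ 2) ^ (-(l / k)) :=
        Real.rpow_le_rpow_of_nonpos hpos2 hcmp (by have : 0 < l / k := by positivity
                                                   linarith)
      have h6 : (((a * b)⁻¹) ^ 2) ^ (-(l / k)) = (a * b) ^ (2 * l / k) := by
        rw [← Real.rpow_natCast, ← Real.rpow_neg_one, ← Real.rpow_mul hab0.le,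
          ← Real.rpow_mul hab0.le]
        congr 1; push_cast; ring
      rw [Real.mul_rpow hpos.le (by positivity), h6] at h5
      have h7 : 0 ≤ f (D z) ^ (1 + 1 / k) := Real.rpow_nonneg h2 _
      calc _ ≤ f (D z) ^ (1 + 1 / k) * ((angMom (D z) - L₀) ^ (-(l / k)) * (a * b) ^ (2 * l / k)) :=
            mul_le_mul_of_nonneg_left h5 h7
        _ = _ := by ring
  have h0 : ∀ᵐ z, 0 ≤ g z := ae_comp_scale ha hb hf.nonneg
  have hgi : Integrable g := integrable_comp_scale ha hb hf.integrable
  have hkin : ∀ z : Phase, ‖z.2‖ ^ 2 * g z = (b⁻¹) ^ 2 * (‖(D z).2‖ ^ 2 * f (D z)) := by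
    intro z
    simp only [hg, hD, norm_smul, Real.norm_eq_abs, abs_of_pos hb]
    field_simp
  have hkin2 : ∀ z : Phase, ‖z.1‖⁻¹ * g z = a * (‖(D z).1‖⁻¹ * f (D z)) := by
    intro z
    simp only [hg, hD, norm_smul, Real.norm_eq_abs, abs_of_pos ha, mul_inv]
    field_simp
  have hci : Integrable (casimirDensity k l L₀ g) := by
    refine ((integrable_comp_scale ha hb hf.casimir_finite).const_mul
      ((a * b) ^ (2 * l / k))).mono' (aestronglyMeasurable_casimirDensity hgi.1) ?_
    filter_upwards [hle, h0] with z h1 h2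
    rw [Real.norm_eq_abs, abs_of_nonneg (casimirDensity_nonneg h2)]
    exact h1
  have hadm : IsAdmissible k l L₀ (((a * b) ^ 3)⁻¹ * M) g := by
    refine ⟨hgi, h0, ?_, ?_, ?_, hci, ?_⟩
    · intro A
      filter_upwards [ae_comp_scale ha hb (hf.symmetric A)] with z hz
      simpa [hg, hD] using hz
    · rw [← hf.mass]
      exact integral_comp_scale ha hb f
    · simp only [hkin]
      exact (integrable_comp_scale ha hb hf.kinetic_finite).const_mul _
    · filter_upwards [ae_comp_scale ha hb hf.vanish] with z hz hlt
      refine hz ?_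
      rw [angMom_smul]
      have : (a * b) ^ 2 ≤ 1 := pow_le_one₀ hab0.le hab
      nlinarith [angMom_nonneg z]
  have hc' : 0 ≤ c * (a * b) ^ 3 := by positivity
  obtain ⟨hadm2, hcas⟩ := hadm.const_mul hc'
  have hmass : c * (a * b) ^ 3 * (((a * b) ^ 3)⁻¹ * M) = c * M := by field_simp
  rw [hmass] at hadm2
  refine ⟨_, hadm2, ?_, ?_, ?_⟩
  · have : ∀ z : Phase, ‖z.2‖ ^ 2 * (c * (a * b) ^ 3 * g z)
        = c * (a * b) ^ 3 * (b⁻¹) ^ 2 * (‖(D z).2‖ ^ 2 * f (D z)) := by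
      intro z; rw [mul_left_comm, hkin]; ring
    simp only [kineticEnergy, this]
    rw [integral_const_mul, integral_comp_scale ha hb (fun z => ‖z.2‖ ^ 2 * f z)]
    field_simp
  · have : ∀ z : Phase, ‖z.1‖⁻¹ * (c * (a * b) ^ 3 * g z)
        = c * (a * b) ^ 3 * a * (‖(D z).1‖⁻¹ * f (D z)) := by
      intro z; rw [mul_left_comm, hkin2]; ring
    simp only [invMoment, this]
    rw [integral_const_mul, integral_comp_scale ha hb (fun z => ‖z.1‖⁻¹ * f z)]
    field_simp
  · have h1 : casimir k l L₀ g ≤ (a * b) ^ (2 * l / k) * (((a * b) ^ 3)⁻¹ * casimir k l L₀ f) := by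
      have h2 : ∫ z, (a * b) ^ (2 * l / k) * casimirDensity k l L₀ f (D z)
          = (a * b) ^ (2 * l / k) * (((a * b) ^ 3)⁻¹ * casimir k l L₀ f) := by
        rw [integral_const_mul, integral_comp_scale ha hb (casimirDensity k l L₀ f), casimir]
      rw [← h2]
      exact integral_mono_ae hci ((integrable_comp_scale ha hb hf.casimir_finite).const_mul _) hle
    rw [hcas]
    have hcabs : 0 ≤ (c * (a * b) ^ 3) ^ (1 + 1 / k) := Real.rpow_nonneg hc' _
    refine (mul_le_mul_of_nonneg_left h1 hcabs).trans (le_of_eq ?_)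
    rw [Real.mul_rpow hc (by positivity)]
    have e1 : ((a * b) ^ 3) ^ (1 + 1 / k) = (a * b) ^ 3 * (a * b) ^ (3 / k) := by
      rw [← Real.rpow_natCast, ← Real.rpow_mul hab0.le, ← Real.rpow_add hab0]
      congr 1; push_cast; ring
    have e2 : (a * b) ^ ((3 + 2 * l) / k) = (a * b) ^ (3 / k) * (a * b) ^ (2 * l / k) := by
      rw [← Real.rpow_add hab0]; congr 1; ring
    rw [e1, e2]
    have : (a * b) ^ 3 * ((a * b) ^ 3)⁻¹ = 1 := mul_inv_cancel₀ (by positivity)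
    linear_combination (c ^ (1 + 1 / k) * (a * b) ^ (3 / k) * (a * b) ^ (2 * l / k)
      * casimir k l L₀ f) * this

end ops

section blob
variable {k l L₀ Mc M M₁ M₂ : ℝ} {f g : Phase → ℝ}

/-- Superposition of two states.  The bound is convexity of the Casimir functional, applied to
`f + g = (1 - s) (f / (1 - s)) + s (g / s)` and combined with homogeneity. -/
lemma IsAdmissible.add (hk : 0 < k) (hf : IsAdmissible k l L₀ M₁ f)
    (hg : IsAdmissible k l L₀ M₂ g) {s : ℝ} (hs0 : 0 < s) (hs1 : s < 1) :
    IsAdmissible k l L₀ (M₁ + M₂) (fun z => f z + g z) ∧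
      casimir k l L₀ (fun z => f z + g z)
        ≤ (1 - s) ^ (-(1 / k)) * casimir k l L₀ f + s ^ (-(1 / k)) * casimir k l L₀ g := by
  have hs2 : 0 < 1 - s := by linarith
  obtain ⟨h1, h2⟩ := hf.const_mul (inv_nonneg.2 hs2.le)
  obtain ⟨h3, h4⟩ := hg.const_mul (inv_nonneg.2 hs0.le)
  obtain ⟨h5, h6⟩ := h1.convexComb hk h3 hs0.le hs1.le
  have e1 : (fun z => (1 - s) * ((1 - s)⁻¹ * f z) + s * (s⁻¹ * g z)) = fun z => f z + g z := by
    ext z; field_simp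
  have e2 : (1 - s) * ((1 - s)⁻¹ * M₁) + s * (s⁻¹ * M₂) = M₁ + M₂ := by field_simp
  rw [e1, e2] at h5
  rw [e1, h2, h4, ← mul_assoc, ← mul_assoc] at h6
  have e3 : ∀ t : ℝ, 0 < t → t * t⁻¹ ^ (1 + 1 / k) = t ^ (-(1 / k)) := by
    intro t ht
    rw [← Real.rpow_neg_one t, ← Real.rpow_mul ht.le]
    nth_rewrite 1 [← Real.rpow_one t]
    rw [← Real.rpow_add ht]
    congr 1; ring
  rw [e3 _ hs2, e3 _ hs0] at h6
  exact ⟨h5, h6⟩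

/-- Gravity is attractive: superposing two nonnegative states does not raise the energy above the
sum of the energies, even without the self-energy of one of them. -/
lemma energy_add_le (hL₀ : 0 < L₀) (hf : IsTame L₀ f) (hg : IsTame L₀ g)
    (hf0 : ∀ᵐ z : Phase, 0 ≤ f z) (hg0 : ∀ᵐ z : Phase, 0 ≤ g z) :
    kineticEnergy (fun z => f z + g z) + potentialEnergy Mc (fun z => f z + g z)
      ≤ (kineticEnergy f + potentialEnergy Mc f) + (kineticEnergy g - Mc * invMoment g) := by
  have hfg := hf.add hg
  have hpi := Real.pi_pos
  have hk : kineticEnergy (fun z => f z + g z) = kineticEnergy f + kineticEnergy g := by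
    simp only [kineticEnergy, mul_add]
    rw [integral_add hf.kinetic hg.kinetic]; ring
  have hi : invMoment (fun z => f z + g z) = invMoment f + invMoment g := by
    simp only [invMoment, mul_add]
    rw [integral_add (hf.integrable_inv hL₀) (hg.integrable_inv hL₀)]
  have hfs : fieldSq f ≤ fieldSq (fun z => f z + g z) := by
    refine integral_mono (hf.integrable_grad_sq hL₀) (hfg.integrable_grad_sq hL₀) fun x => ?_
    simp only [norm_gradPotential_sq, massInBall_add hf.integrable hg.integrable]
    have h1 := massInBall_nonneg hf.integrable hf0 ‖x‖
    have h2 := massInBall_nonneg hg.integrable hg0 ‖x‖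
    gcongr
    linarith
  rw [hfg.potentialEnergy_eq hL₀, hf.potentialEnergy_eq hL₀, hk, hi]
  have := mul_le_mul_of_nonneg_left hfs (show 0 ≤ 1 / (8 * Real.pi) by positivity)
  linarith

/-- A state of positive mass gains energy in the field of the point mass. -/
lemma IsAdmissible.invMoment_pos (hL₀ : 0 < L₀) (hM : 0 < M) (hf : IsAdmissible k l L₀ M f) :
    0 < invMoment f := by
  have h0 : 0 ≤ᵐ[volume] fun z : Phase => ‖z.1‖⁻¹ * f z :=
    hf.nonneg.mono fun z hz => mul_nonneg (by positivity) hz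
  refine lt_of_le_of_ne (invMoment_nonneg hf.nonneg) fun h => ?_
  have h1 := (integral_eq_zero_iff_of_nonneg_ae h0 (hf.tame.integrable_inv hL₀)).1 h.symm
  have h2 : f =ᵐ[volume] 0 := by
    filter_upwards [h1, hf.vanish] with z hz hv
    by_contra hne
    have hL : L₀ ≤ angMom z := by
      by_contra h'
      exact hne (hv (not_le.1 h'))
    have := norm_pos_iff.2 (fst_ne_zero_of_angMom_pos (hL₀.trans_le hL))
    rcases mul_eq_zero.1 hz with h3 | h3
    · rw [inv_eq_zero] at h3; linarith
    · exact hne h3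
  have h3 := hf.mass
  rw [integral_congr_ae h2] at h3
  simp at h3
  linarith

/-- Mass can be added at negative cost: a thin cloud, far out and slowly moving, has negative
energy in the field of the point mass, and for `k ≤ l` this beats its Casimir functional. -/
lemma exists_energyCasimir_lt (hk : 0 < k) (hkl : k ≤ l) (hL₀ : 0 < L₀) (hMc : 0 < Mc)
    (hM : 0 < M) (hf : IsAdmissible k l L₀ M₁ f) (hM₁ : M₁ < M) (hg : IsAdmissible k l L₀ M g) :
    ∃ h, IsAdmissible k l L₀ M h ∧ energyCasimir k l L₀ Mc h < energyCasimir k l L₀ Mc f := by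
  have hl : 0 < l := hk.trans_le hkl
  set c := (M - M₁) / M with hc
  have hc0 : 0 < c := div_pos (by linarith) hM
  have hcM : c * M = M - M₁ := by rw [hc]; field_simp
  have hI := hg.invMoment_pos hL₀ hM
  -- the exponent `ν` keeps both the kinetic energy and the Casimir functional below order `σ ^ 2`
  set ν := 1 / (5 + 2 * l) with hν
  have hν0 : 0 < ν := by positivity
  have hν1 : ν * (5 + 2 * l) = 1 := by rw [hν]; field_simp
  have hν2 : ν < 1 := by nlinarith
  set e := ((1 - ν / 2) * (3 + 2 * l) - (2 + ν)) / k with he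
  -- `e` is the order in `σ` of the contribution of the added cloud to the Casimir functional;
  -- here `k ≤ l` enters
  have he2 : 0 < e - 2 := by
    rw [he, sub_pos, lt_div_iff₀ hk]; nlinarith
  set q := 1 / k with hq
  -- the state `g` is dilated by `σ⁻²` in space and contracted by `σ ^ (1 + ν / 2)` in velocity, and
  -- added to `f` with convexity parameter `s = σ ^ (2 + ν)`; after division by `σ ^ 2` the change of
  -- the functional tends to `- Mc * c * invMoment g < 0` as `σ → 0`
  have hT1 : Tendsto (fun σ : ℝ => σ ^ ν) (𝓝[>] 0) (𝓝 0) := by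
    have := (Real.continuousAt_rpow_const 0 ν (Or.inr hν0.le)).tendsto
    rw [Real.zero_rpow hν0.ne'] at this
    exact this.mono_left nhdsWithin_le_nhds
  have hT2 : Tendsto (fun σ : ℝ => σ ^ (e - 2)) (𝓝[>] 0) (𝓝 0) := by
    have := (Real.continuousAt_rpow_const 0 (e - 2) (Or.inr he2.le)).tendsto
    rw [Real.zero_rpow he2.ne'] at this
    exact this.mono_left nhdsWithin_le_nhds
  have hT4 : Tendsto (fun σ : ℝ => σ ^ (2 + ν)) (𝓝[>] 0) (𝓝 0) := by
    have := (Real.continuousAt_rpow_const 0 (2 + ν) (Or.inr (by linarith))).tendsto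
    rw [Real.zero_rpow (by linarith)] at this
    exact this.mono_left nhdsWithin_le_nhds
  have hpos : ∀ᶠ σ : ℝ in 𝓝[>] 0, 0 < σ := self_mem_nhdsWithin
  have hlt1 : ∀ᶠ σ : ℝ in 𝓝[>] 0, σ < 1 :=
    nhdsWithin_le_nhds (eventually_lt_nhds one_pos)
  have hT3 : Tendsto (fun σ : ℝ => ((1 - σ ^ (2 + ν)) ^ (-q) - 1) / σ ^ (2 + ν)) (𝓝[>] 0)
      (𝓝 q) := by
    have hd : HasDerivAt (fun t : ℝ => (1 - t) ^ (-q)) q 0 := by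
      have h1 : HasDerivAt (fun t : ℝ => 1 - t) (-1) 0 := by
        simpa using (hasDerivAt_id (0 : ℝ)).const_sub 1
      have h2 := h1.rpow_const (p := -q) (Or.inl (by norm_num))
      simpa using h2
    have h3 := (hasDerivAt_iff_tendsto_slope.1 hd)
    have h4 : Tendsto (fun σ : ℝ => σ ^ (2 + ν)) (𝓝[>] 0) (𝓝[≠] 0) := by
      refine tendsto_nhdsWithin_iff.2 ⟨hT4, ?_⟩
      filter_upwards [hpos] with σ hσ
      exact (Real.rpow_pos_of_pos hσ _).ne'
    refine (h3.comp h4).congr fun σ => ?_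
    simp [slope_def_field]
  have hlim : Tendsto (fun σ : ℝ => -(Mc * (c * invMoment g)) + c * kineticEnergy g * σ ^ ν
      + casimir k l L₀ f * (((1 - σ ^ (2 + ν)) ^ (-q) - 1) / σ ^ (2 + ν) * σ ^ ν)
      + c ^ (1 + 1 / k) * casimir k l L₀ g * σ ^ (e - 2)) (𝓝[>] 0)
      (𝓝 (-(Mc * (c * invMoment g)) + c * kineticEnergy g * 0 + casimir k l L₀ f * (q * 0)
        + c ^ (1 + 1 / k) * casimir k l L₀ g * 0)) :=
    (((hT1.const_mul _).const_add _).add ((hT3.mul hT1).const_mul _)).add (hT2.const_mul _)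
  have hneg : -(Mc * (c * invMoment g)) + c * kineticEnergy g * 0 + casimir k l L₀ f * (q * 0)
        + c ^ (1 + 1 / k) * casimir k l L₀ g * 0 < 0 := by
    have : 0 < Mc * (c * invMoment g) := by positivity
    linarith
  obtain ⟨σ, hσ, hσ0, hσ1⟩ := ((hlim.eventually_lt_const hneg).and (hpos.and hlt1)).exists
  have hs0 : 0 < σ ^ (2 + ν) := Real.rpow_pos_of_pos hσ0 _
  have hs1 : σ ^ (2 + ν) < 1 := Real.rpow_lt_one hσ0.le hσ1 (by linarith)
  have ha0 : 0 < σ ^ (2 : ℝ) := Real.rpow_pos_of_pos hσ0 _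
  have hb0 : 0 < σ ^ (-(1 + ν / 2)) := Real.rpow_pos_of_pos hσ0 _
  have hab : σ ^ (2 : ℝ) * σ ^ (-(1 + ν / 2)) = σ ^ (1 - ν / 2) := by
    rw [← Real.rpow_add hσ0]; congr 1; ring
  have hab1 : σ ^ (2 : ℝ) * σ ^ (-(1 + ν / 2)) ≤ 1 := by
    rw [hab]; exact Real.rpow_le_one hσ0.le hσ1.le (by linarith)
  obtain ⟨φ, hφ, hφT, hφI, hφC⟩ := hg.scale hk hl hL₀ ha0 hb0 hab1 hc0.le
  rw [hcM] at hφ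
  obtain ⟨hsum, hcas⟩ := hf.add hk hφ hs0 hs1
  have hMM : M₁ + (M - M₁) = M := by ring
  rw [hMM] at hsum
  refine ⟨_, hsum, ?_⟩
  have hen := energy_add_le (Mc := Mc) hL₀ hf.tame hφ.tame hf.nonneg hφ.nonneg
  have hbinv : (σ ^ (-(1 + ν / 2)))⁻¹ ^ 2 = σ ^ (2 : ℝ) * σ ^ ν := by
    rw [← Real.rpow_neg hσ0.le, ← Real.rpow_natCast, ← Real.rpow_mul hσ0.le, ← Real.rpow_add hσ0]
    congr 1; push_cast; ring
  have h2ν : σ ^ (2 + ν) = σ ^ (2 : ℝ) * σ ^ ν := Real.rpow_add hσ0 _ _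
  have hC2 : (σ ^ (2 + ν)) ^ (-q) * casimir k l L₀ φ
      ≤ σ ^ (2 : ℝ) * (c ^ (1 + 1 / k) * casimir k l L₀ g * σ ^ (e - 2)) := by
    have h1 : 0 ≤ (σ ^ (2 + ν)) ^ (-q) := Real.rpow_nonneg hs0.le _
    refine (mul_le_mul_of_nonneg_left hφC h1).trans (le_of_eq ?_)
    have h2 : (σ ^ (2 + ν)) ^ (-q) * (σ ^ (1 - ν / 2)) ^ ((3 + 2 * l) / k)
        = σ ^ (2 : ℝ) * σ ^ (e - 2) := by
      rw [← Real.rpow_mul hσ0.le, ← Real.rpow_mul hσ0.le, ← Real.rpow_add hσ0,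
        ← Real.rpow_add hσ0]
      congr 1
      rw [he, hq]; field_simp; ring
    rw [hab]
    linear_combination (c ^ (1 + 1 / k) * casimir k l L₀ g) * h2
  have hC1 : (1 - σ ^ (2 + ν)) ^ (-q) * casimir k l L₀ f = casimir k l L₀ f
      + σ ^ (2 : ℝ) * (casimir k l L₀ f * (((1 - σ ^ (2 + ν)) ^ (-q) - 1) / σ ^ (2 + ν) * σ ^ ν)) := by
    have : σ ^ (2 : ℝ) * (((1 - σ ^ (2 + ν)) ^ (-q) - 1) / σ ^ (2 + ν) * σ ^ ν)
        = (1 - σ ^ (2 + ν)) ^ (-q) - 1 := by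
      have hν' : 0 < σ ^ ν := Real.rpow_pos_of_pos hσ0 _
      rw [h2ν]; field_simp
    linear_combination (-casimir k l L₀ f) * this
  have hfin := mul_neg_of_pos_of_neg ha0 hσ
  simp only [energyCasimir]
  rw [hφT, hφI, hbinv] at hen
  rw [hC1] at hcas
  nlinarith

end blob

/-! ### Limit theorems -/

/-- Helly's selection theorem: a uniformly bounded sequence of monotone functions has a
subsequence converging outside a countable set. -/
lemma exists_subseq_tendsto_of_monotone {m : ℕ → ℝ → ℝ} {M : ℝ} (hm : ∀ n, Monotone (m n))
    (hb : ∀ n r, m n r ∈ Icc 0 M) :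
    ∃ φ : ℕ → ℕ, StrictMono φ ∧ ∃ G : ℝ → ℝ, ∃ S : Set ℝ, S.Countable ∧
      ∀ r ∉ S, Tendsto (fun n => m (φ n) r) atTop (𝓝 (G r)) := by
  have hK : IsCompact (univ.pi fun _ : ℚ => Icc (0 : ℝ) M) := isCompact_univ_pi fun _ => isCompact_Icc
  obtain ⟨a, ha, φ, hφ, hlim⟩ := hK.tendsto_subseq (x := fun n (q : ℚ) => m n q)
    (fun n q _ => hb n q)
  have hlim' : ∀ q : ℚ, Tendsto (fun n => m (φ n) q) atTop (𝓝 (a q)) :=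
    fun q => (tendsto_pi_nhds.1 hlim) q
  have haM : ∀ q, a q ∈ Icc 0 M := fun q => ha q (mem_univ q)
  set G : ℝ → ℝ := fun r => sSup (a '' {q : ℚ | (q : ℝ) < r}) with hG
  have hbdd : ∀ r, BddAbove (a '' {q : ℚ | (q : ℝ) < r}) := by
    rintro r
    refine ⟨M, ?_⟩
    rintro _ ⟨q, -, rfl⟩
    exact (haM q).2
  have hne : ∀ r, (a '' {q : ℚ | (q : ℝ) < r}).Nonempty := by
    intro r
    obtain ⟨q, hq⟩ := exists_rat_lt r
    exact ⟨a q, q, hq, rfl⟩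
  have hGm : Monotone G := fun r s hrs =>
    csSup_le_csSup (hbdd s) (hne r) (image_mono fun q (hq : (q : ℝ) < r) => hq.trans_le hrs)
  refine ⟨φ, hφ, G, {r | ¬ContinuousAt G r}, hGm.countable_not_continuousAt, fun r hr => ?_⟩
  have hcont : ContinuousAt G r := by simpa using hr
  refine tendsto_order.2 ⟨fun y hy => ?_, fun y hy => ?_⟩
  · obtain ⟨_, ⟨q, hq, rfl⟩, hyq⟩ := exists_lt_of_lt_csSup (hne r) hy
    filter_upwards [(hlim' q).eventually_const_lt hyq] with n hn
    exact hn.trans_le (hm _ (le_of_lt hq))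
  · have hev := hcont.tendsto.eventually_lt_const hy
    obtain ⟨s, hs, hrs⟩ : ∃ s, G s < y ∧ r < s := by
      have h1 : ∀ᶠ s in 𝓝[>] r, G s < y := nhdsWithin_le_nhds hev
      obtain ⟨s, h2, h3⟩ := (h1.and self_mem_nhdsWithin).exists
      exact ⟨s, h2, h3⟩
    obtain ⟨q, hrq, hqs⟩ := exists_rat_btwn hrs
    have haq : a q < y := (le_csSup (hbdd s) ⟨q, hqs, rfl⟩).trans_lt hs
    filter_upwards [(hlim' q).eventually_lt_const haq] with n hn
    exact (hm _ hrq.le).trans_lt hn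

section limits
variable {α : Type*} [MeasurableSpace α] {μ : Measure α}

/-- Fatou's lemma for Bochner integrals. -/
lemma integrable_and_integral_le_of_tendsto {u : ℕ → α → ℝ} {v : α → ℝ} {c : ℕ → ℝ} {c' : ℝ}
    (hi : ∀ n, Integrable (u n) μ) (h0 : ∀ n, ∀ᵐ x ∂μ, 0 ≤ u n x)
    (hlim : ∀ᵐ x ∂μ, Tendsto (fun n => u n x) atTop (𝓝 (v x)))
    (hc : ∀ n, ∫ x, u n x ∂μ ≤ c n) (hc' : Tendsto c atTop (𝓝 c')) :
    Integrable v μ ∧ ∫ x, v x ∂μ ≤ c' := by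
  have hvm : AEStronglyMeasurable v μ := aestronglyMeasurable_of_tendsto_ae _ (fun n => (hi n).1) hlim
  have hv0 : 0 ≤ᵐ[μ] v := by
    filter_upwards [hlim, ae_all_iff.2 h0] with x hx h
    exact ge_of_tendsto' hx h
  have hle : ∫⁻ x, ENNReal.ofReal (v x) ∂μ ≤ ENNReal.ofReal c' := by
    calc ∫⁻ x, ENNReal.ofReal (v x) ∂μ
        = ∫⁻ x, liminf (fun n => ENNReal.ofReal (u n x)) atTop ∂μ := by
          refine lintegral_congr_ae ?_
          filter_upwards [hlim] with x hx
          exact ((ENNReal.continuous_ofReal.tendsto _).comp hx).liminf_eq.symm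
      _ ≤ liminf (fun n => ∫⁻ x, ENNReal.ofReal (u n x) ∂μ) atTop :=
          lintegral_liminf_le' fun n => (hi n).1.aemeasurable.ennreal_ofReal
      _ ≤ liminf (fun n => ENNReal.ofReal (c n)) atTop := by
          refine liminf_le_liminf (Eventually.of_forall fun n => ?_)
          rw [← ofReal_integral_eq_lintegral_ofReal (hi n) (h0 n)]
          exact ENNReal.ofReal_le_ofReal (hc n)
      _ = ENNReal.ofReal c' := ((ENNReal.continuous_ofReal.tendsto _).comp hc').liminf_eq
  have hc0 : 0 ≤ c' := ge_of_tendsto' hc' fun n => (integral_nonneg_of_ae (h0 n)).trans (hc n)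
  have hint : Integrable v μ := by
    refine ⟨hvm, ?_⟩
    rw [hasFiniteIntegral_iff_ofReal hv0]
    exact hle.trans_lt ENNReal.ofReal_lt_top
  refine ⟨hint, ?_⟩
  rw [integral_eq_lintegral_of_nonneg_ae hv0 hvm]
  exact ENNReal.toReal_le_of_le_ofReal hc0 hle

/-- Completeness of `L¹`, together with almost everywhere convergence of a subsequence. -/
lemma exists_limit_of_cauchy {u : ℕ → α → ℝ} (hi : ∀ n, Integrable (u n) μ)
    (hC : Tendsto (fun p : ℕ × ℕ => ∫ x, |u p.1 x - u p.2 x| ∂μ) atTop (𝓝 0)) :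
    ∃ v, Integrable v μ ∧ Tendsto (fun n => ∫ x, |u n x - v x| ∂μ) atTop (𝓝 0) ∧
      ∃ φ : ℕ → ℕ, StrictMono φ ∧ ∀ᵐ x ∂μ, Tendsto (fun n => u (φ n) x) atTop (𝓝 (v x)) := by
  have hd : ∀ (w w' : α → ℝ) (hw : Integrable w μ) (hw' : Integrable w' μ),
      dist (hw.toL1 w) (hw'.toL1 w') = ∫ x, |w x - w' x| ∂μ := by
    intro w w' hw hw'
    rw [dist_eq_norm, ← Integrable.toL1_sub w w' hw hw', L1.norm_of_fun_eq_integral_norm]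
    simp [Real.norm_eq_abs]
  have hcs : CauchySeq (fun n => (hi n).toL1 (u n)) := by
    rw [cauchySeq_iff_tendsto_dist_atTop_0]
    refine hC.congr fun p => ?_
    exact (hd _ _ (hi p.1) (hi p.2)).symm
  obtain ⟨w, hw⟩ := cauchySeq_tendsto_of_complete hcs
  have hwi := L1.integrable_coeFn w
  have hw' : hwi.toL1 w = w := Integrable.toL1_coeFn w hwi
  refine ⟨w, hwi, ?_, ?_⟩
  · rw [tendsto_iff_dist_tendsto_zero] at hw
    refine hw.congr fun n => ?_
    rw [← hd _ _ (hi n) hwi, hw']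
  · obtain ⟨φ, hφ, hlim⟩ := (tendstoInMeasure_of_tendsto_Lp hw).exists_seq_tendsto_ae
    refine ⟨φ, hφ, ?_⟩
    have hall := ae_all_iff.2 fun n => (hi n).coeFn_toL1
    filter_upwards [hlim, hall] with x hx hx'
    exact hx.congr fun n => hx' (φ n)

end limits

/-! ### Compactness of minimizing sequences -/

section compactness
variable {k l L₀ Mc M : ℝ} {f g : Phase → ℝ}

lemma fieldDiffSq_eq (hf : Integrable f) (hg : Integrable g) (x : Space) :
    fieldDiffSq f g x = ((massInBall f ‖x‖ - massInBall g ‖x‖) / ‖x‖ ^ 2) ^ 2 := by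
  rw [fieldDiffSq, ← gradPotential_sub hf hg, norm_gradPotential_sq, massInBall_sub hf hg]

/-- Spheres with radii in a countable set form a null set. -/
lemma ae_norm_notMem {S : Set ℝ} (hS : S.Countable) : ∀ᵐ x : Space, ‖x‖ ∉ S := by
  rw [ae_iff]
  have : {x : Space | ¬‖x‖ ∉ S} = ⋃ r ∈ S, Metric.sphere 0 r := by
    ext x; simp
  rw [this]
  exact (measure_biUnion_null_iff hS).2 fun r _ => Measure.addHaar_sphere _ _ _

/-- Fields of uniformly bounded sources converge in `L²` as soon as the masses in almost all balls
converge. -/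
lemma tendsto_integral_fieldDiffSq {ι : Type*} {𝓕 : Filter ι} [𝓕.IsCountablyGenerated]
    (hL₀ : 0 < L₀) {f g : ι → Phase → ℝ} (hf : ∀ i, IsTame L₀ (f i)) (hg : ∀ i, IsTame L₀ (g i))
    {B : ℝ} (hfB : ∀ i, fieldBound (f i) ≤ B) (hgB : ∀ i, fieldBound (g i) ≤ B)
    (hlim : ∀ᵐ x : Space, Tendsto (fun i => massInBall (f i) ‖x‖ - massInBall (g i) ‖x‖) 𝓕 (𝓝 0)) :
    Tendsto (fun i => ∫ x, fieldDiffSq (f i) (g i) x) 𝓕 (𝓝 0) := by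
  have h0 : ∫ _ : Space, (0 : ℝ) = 0 := integral_zero _ _
  rw [← h0]
  refine tendsto_integral_filter_of_dominated_convergence
    (fun x : Space => 4 * B ^ 2 * (1 + ‖x‖) ^ (-4 : ℝ)) ?_ ?_ (integrable_japanese.const_mul _) ?_
  · exact Eventually.of_forall fun i => ((hf i).integrable_fieldDiffSq hL₀ (hg i)).1
  · refine Eventually.of_forall fun i => ?_
    have hne : ∀ᵐ x : Space, x ≠ 0 := by simp [ae_iff]
    filter_upwards [hne] with x hx
    have hx' : 0 < ‖x‖ := norm_pos_iff.2 hx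
    have h3 : ((1 + ‖x‖) ^ (-4 : ℝ)) = ((1 + ‖x‖) ^ (-2 : ℝ)) ^ 2 := by
      rw [← Real.rpow_natCast, ← Real.rpow_mul (by positivity)]; norm_num
    have hp : 0 < (1 + ‖x‖) ^ (-2 : ℝ) := Real.rpow_pos_of_pos (by positivity) _
    rw [fieldDiffSq_eq (hf i).integrable (hg i).integrable, Real.norm_eq_abs, abs_pow, h3]
    have h1 := (hf i).massInBall_bound hL₀ hx'
    have h2 := (hg i).massInBall_bound hL₀ hx'
    have h4 : |(massInBall (f i) ‖x‖ - massInBall (g i) ‖x‖) / ‖x‖ ^ 2|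
        ≤ 2 * B * (1 + ‖x‖) ^ (-2 : ℝ) := by
      rw [abs_div, abs_of_pos (show 0 < ‖x‖ ^ 2 by positivity)]
      calc _ ≤ (|massInBall (f i) ‖x‖| + |massInBall (g i) ‖x‖|) / ‖x‖ ^ 2 := by
            gcongr; exact abs_sub _ _
        _ ≤ _ := by
            rw [add_div]
            nlinarith [hfB i, hgB i]
    calc _ ≤ (2 * B * (1 + ‖x‖) ^ (-2 : ℝ)) ^ 2 := by gcongr
      _ = _ := by ring
  · filter_upwards [hlim] with x hx
    have h1 : Tendsto (fun i => ((massInBall (f i) ‖x‖ - massInBall (g i) ‖x‖) / ‖x‖ ^ 2) ^ 2) 𝓕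
        (𝓝 ((0 / ‖x‖ ^ 2) ^ 2)) := (hx.div_const _).pow 2
    simp only [zero_div, ne_eq, OfNat.ofNat_ne_zero, not_false_eq_true, zero_pow] at h1
    refine h1.congr fun i => ?_
    rw [fieldDiffSq_eq (hf i).integrable (hg i).integrable]

lemma IsTame.integral_norm_inv_sq_le (hL₀ : 0 < L₀) (hf : IsTame L₀ f) :
    ∫ z : Phase, ‖(‖z.1‖⁻¹) ^ 2 * f z‖ ≤ L₀⁻¹ * ∫ z : Phase, ‖z.2‖ ^ 2 * |f z| := by
  have hk : Integrable (fun z : Phase => ‖z.2‖ ^ 2 * |f z|) := by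
    refine hf.kinetic.norm.congr (ae_of_all _ fun z => ?_)
    simp
  rw [← integral_const_mul]
  refine integral_mono_ae (hf.integrable_inv_sq hL₀).norm (hk.const_mul _) ?_
  filter_upwards [hf.inv_sq_le hL₀] with z hz
  by_cases h : f z = 0
  · simp [h]
  · have := mul_le_mul_of_nonneg_right (hz h) (abs_nonneg (f z))
    simp only [norm_mul, norm_pow, norm_inv, Real.norm_eq_abs, abs_norm]
    linarith

lemma integral_abs_of_nonneg (h0 : ∀ᵐ z : Phase, 0 ≤ f z) : ∫ z, ‖f z‖ = ∫ z, f z :=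
  integral_congr_ae (h0.mono fun z hz => by simp only [Real.norm_eq_abs, abs_of_nonneg hz])

lemma integral_sq_mul_abs (h0 : ∀ᵐ z : Phase, 0 ≤ f z) :
    ∫ z : Phase, ‖z.2‖ ^ 2 * |f z| = 2 * kineticEnergy f := by
  rw [kineticEnergy, ← mul_assoc]
  norm_num
  exact integral_congr_ae (h0.mono fun z hz => by simp only [abs_of_nonneg hz])

/-- The field bound is uniform on sets of states of bounded mass and kinetic energy. -/
lemma IsTame.fieldBound_le (hL₀ : 0 < L₀) (hf : IsTame L₀ f) (h0 : ∀ᵐ z : Phase, 0 ≤ f z) :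
    fieldBound f ≤ 4 * (L₀⁻¹ * (2 * kineticEnergy f) + ∫ z, f z) := by
  have h1 := hf.integral_norm_inv_sq_le hL₀
  rw [integral_sq_mul_abs h0] at h1
  rw [fieldBound, integral_abs_of_nonneg h0]
  linarith

/-- The convexity defect of the Casimir functional at the midpoint of two states is controlled by
the excess of their energies and by the distance of their fields. -/
lemma IsAdmissible.integral_convexGap_le (hk : 0 < k) (hL₀ : 0 < L₀)
    (hf : IsAdmissible k l L₀ M f) (hg : IsAdmissible k l L₀ M g) {h₀ : ℝ}
    (hmin : ∀ g, IsAdmissible k l L₀ M g → h₀ ≤ energyCasimir k l L₀ Mc g) :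
    Integrable (fun z => (max (angMom z - L₀) 0) ^ (-(l / k))
        * convexGap (1 + 1 / k) (f z) (g z)) ∧
      ∫ z, (max (angMom z - L₀) 0) ^ (-(l / k)) * convexGap (1 + 1 / k) (f z) (g z)
        ≤ (energyCasimir k l L₀ Mc f + energyCasimir k l L₀ Mc g) / 2 - h₀
          + 1 / (32 * Real.pi) * ∫ x, fieldDiffSq f g x := by
  have hpi := Real.pi_pos
  obtain ⟨hmid, -⟩ := hf.convexComb hk hg (s := 1 / 2) (by norm_num) (by norm_num)
  set w : Phase → ℝ := fun z => (1 - 1 / 2) * f z + 1 / 2 * g z with hw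
  have hM : (1 - 1 / 2) * M + 1 / 2 * M = M := by ring
  rw [hM] at hmid
  have hHm := hmin w hmid
  have e1 := hf.tame.energy_expansion hL₀ hmid.tame Mc
  have e2 := hg.tame.energy_expansion hL₀ hmid.tame Mc
  have hPf := (hmid.tame.integrable_particleEnergy hL₀ (hf.tame.sub hmid.tame) Mc).1
  have hPg := (hmid.tame.integrable_particleEnergy hL₀ (hg.tame.sub hmid.tame) Mc).1
  have e3 : (∫ z, particleEnergy Mc w z * (f z - w z))
      + ∫ z, particleEnergy Mc w z * (g z - w z) = 0 := by
    rw [← integral_add hPf hPg]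
    have : ∀ z, particleEnergy Mc w z * (f z - w z) + particleEnergy Mc w z * (g z - w z) = 0 := by
      intro z; simp only [hw]; ring
    simp [this]
  have hmass : ∀ r, massInBall w r = (1 - 1 / 2) * massInBall f r + 1 / 2 * massInBall g r := by
    intro r
    rw [massInBall_add (hf.integrable.const_mul _) (hg.integrable.const_mul _),
      massInBall_const_mul hf.integrable, massInBall_const_mul hg.integrable]
  have e4 : ∫ x, fieldDiffSq f w x = 1 / 4 * ∫ x, fieldDiffSq f g x := by
    rw [← integral_const_mul]
    refine integral_congr_ae (ae_of_all _ fun x => ?_)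
    simp only [fieldDiffSq_eq hf.integrable hmid.integrable,
      fieldDiffSq_eq hf.integrable hg.integrable, hmass]
    ring
  have e5 : ∫ x, fieldDiffSq g w x = 1 / 4 * ∫ x, fieldDiffSq f g x := by
    rw [← integral_const_mul]
    refine integral_congr_ae (ae_of_all _ fun x => ?_)
    simp only [fieldDiffSq_eq hg.integrable hmid.integrable,
      fieldDiffSq_eq hf.integrable hg.integrable, hmass]
    ring
  have hgap : ∀ z, (max (angMom z - L₀) 0) ^ (-(l / k)) * convexGap (1 + 1 / k) (f z) (g z)
      = 1 / 2 * (casimirDensity k l L₀ f z + casimirDensity k l L₀ g z)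
        - casimirDensity k l L₀ w z := by
    intro z
    have : w z = (f z + g z) / 2 := by simp only [hw]; ring
    simp only [casimirDensity, convexGap, this]
    ring
  have hi1 : Integrable (fun z => 1 / 2 * (casimirDensity k l L₀ f z + casimirDensity k l L₀ g z)) :=
    (hf.casimir_finite.add hg.casimir_finite).const_mul _
  simp only [hgap]
  refine ⟨hi1.sub hmid.casimir_finite, ?_⟩
  rw [integral_sub hi1 hmid.casimir_finite, integral_const_mul, integral_add hf.casimir_finite
    hg.casimir_finite]
  rw [e4] at e1
  rw [e5] at e2
  have e6 : 1 / (32 * Real.pi) * ∫ x, fieldDiffSq f g x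
      = 1 / (8 * Real.pi) * (1 / 4 * ∫ x, fieldDiffSq f g x) := by field_simp; ring
  rw [e6]
  simp only [energyCasimir, casimir] at hHm e1 e2 e3 ⊢
  linarith

/-- The weight used to make the mass near infinity negligible. -/
def spaceWeight (z : Phase) : ℝ := (1 + ‖z.1‖)⁻¹

lemma spaceWeight_pos (z : Phase) : 0 < spaceWeight z := by unfold spaceWeight; positivity

lemma spaceWeight_le_one (z : Phase) : spaceWeight z ≤ 1 := by
  unfold spaceWeight
  exact inv_le_one_of_one_le₀ (by linarith [norm_nonneg z.1])

lemma measurable_spaceWeight : Measurable spaceWeight := by unfold spaceWeight; fun_prop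

lemma integrable_spaceWeight_mul (hf : Integrable f) :
    Integrable (fun z => spaceWeight z * f z) := by
  refine hf.mono (measurable_spaceWeight.aestronglyMeasurable.mul hf.1) (ae_of_all _ fun z => ?_)
  rw [norm_mul, Real.norm_eq_abs, abs_of_pos (spaceWeight_pos z)]
  exact mul_le_of_le_one_left (norm_nonneg _) (spaceWeight_le_one z)

set_option maxHeartbeats 800000 in
/-- The weighted `L¹` distance of states of bounded energy is controlled by the convexity defect
of the Casimir functional. -/
lemma exists_weighted_dist_le (hk : 0 < k) (hl : 0 < l) (hL₀ : 0 < L₀) (hM : 0 < M) {T : ℝ}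
    (hT : 0 ≤ T) {ε : ℝ} (hε : 0 < ε) :
    ∃ D, 0 ≤ D ∧ ∀ f g, IsAdmissible k l L₀ M f → IsAdmissible k l L₀ M g →
      kineticEnergy f ≤ T → kineticEnergy g ≤ T → casimir k l L₀ f ≤ T → casimir k l L₀ g ≤ T →
      Integrable (fun z => (max (angMom z - L₀) 0) ^ (-(l / k))
        * convexGap (1 + 1 / k) (f z) (g z)) →
      ∫ z, |spaceWeight z * f z - spaceWeight z * g z| ≤ ε + D *
        ∫ z, (max (angMom z - L₀) 0) ^ (-(l / k)) * convexGap (1 + 1 / k) (f z) (g z) := by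
  -- outside the box `|x|, |v| ≤ R` the weighted mass is at most `ε / 2`
  set R := 1 + 4 * (2 * M + 4 * T) / ε with hR
  have hR1 : 1 ≤ R := by
    have : 0 ≤ 4 * (2 * M + 4 * T) / ε := by positivity
    linarith
  have hR0 : 0 < R := by linarith
  have htail : R⁻¹ * (2 * M) + R⁻¹ * (4 * T) ≤ ε / 2 := by
    have h1 : 4 * (2 * M + 4 * T) ≤ R * ε := by
      rw [hR, add_mul, div_mul_cancel₀ _ hε.ne']; linarith
    rw [← mul_add, inv_mul_le_iff₀ hR0]
    nlinarith
  set box : Set Phase := Metric.closedBall 0 R with hbox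
  have hboxm : MeasurableSet box := Metric.isClosed_closedBall.measurableSet
  have hboxfin : volume box ≠ ⊤ := measure_closedBall_lt_top.ne
  set V := volume.real box with hV
  have hV0 : 0 ≤ V := measureReal_nonneg
  -- `1 / K` is a lower bound for the weight `(L - L₀)₊ ^ (-l/k)` in the box, where `L ≤ R ^ 4`
  set K := (R ^ 4) ^ (l / k) with hK
  have hK0 : 0 < K := Real.rpow_pos_of_pos (by positivity) _
  set δ := ε / 2 / (1 + V + K * (2 * T)) with hδ
  have hden : 0 < 1 + V + K * (2 * T) := by positivity
  have hδ0 : 0 < δ := by positivity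
  have hδ1 : δ * V + δ * K * (2 * T) ≤ ε / 2 := by
    have : δ * (1 + V + K * (2 * T)) = ε / 2 := by rw [hδ]; field_simp
    nlinarith
  obtain ⟨C, hC0, hC⟩ := exists_abs_sub_le_convexGap (one_lt_exponent hk) hδ0
  refine ⟨C * K, by positivity, fun f g hf hg hfT hgT hfC hgC hgap => ?_⟩
  set W : Phase → ℝ := fun z => (max (angMom z - L₀) 0) ^ (-(l / k)) with hW
  have hW0 : ∀ z, 0 ≤ W z := fun z => Real.rpow_nonneg (le_max_right _ _) _
  have hnull : ∀ᵐ z : Phase, angMom z ≠ L₀ := by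
    rw [ae_iff]; simpa using volume_angMom_eq hL₀.le
  have hi1 : Integrable (fun z => R⁻¹ * (f z + g z)) := (hf.integrable.add hg.integrable).const_mul _
  have hi2 : Integrable (fun z : Phase => R⁻¹ * (‖z.2‖ ^ 2 * f z + ‖z.2‖ ^ 2 * g z)) :=
    (hf.kinetic_finite.add hg.kinetic_finite).const_mul _
  have hi3 : Integrable (fun z => box.indicator (fun _ => δ) z) :=
    (integrable_indicator_iff hboxm).2 (integrableOn_const hboxfin)
  have hi4 : Integrable (fun z => δ * K * (casimirDensity k l L₀ f z + casimirDensity k l L₀ g z)) :=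
    (hf.casimir_finite.add hg.casimir_finite).const_mul _
  have hi5 := hgap.const_mul (C * K)
  have hi12 : Integrable (fun z : Phase => R⁻¹ * (f z + g z)
    + R⁻¹ * (‖z.2‖ ^ 2 * f z + ‖z.2‖ ^ 2 * g z)) := hi1.add hi2
  have hi123 : Integrable (fun z : Phase => R⁻¹ * (f z + g z)
    + R⁻¹ * (‖z.2‖ ^ 2 * f z + ‖z.2‖ ^ 2 * g z) + box.indicator (fun _ => δ) z) := hi12.add hi3
  have hi1234 : Integrable (fun z : Phase => R⁻¹ * (f z + g z)
    + R⁻¹ * (‖z.2‖ ^ 2 * f z + ‖z.2‖ ^ 2 * g z) + box.indicator (fun _ => δ) z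
    + δ * K * (casimirDensity k l L₀ f z + casimirDensity k l L₀ g z)) := hi123.add hi4
  have hbound : ∀ᵐ z : Phase, |spaceWeight z * f z - spaceWeight z * g z| ≤
      R⁻¹ * (f z + g z) + R⁻¹ * (‖z.2‖ ^ 2 * f z + ‖z.2‖ ^ 2 * g z)
        + box.indicator (fun _ => δ) z
        + δ * K * (casimirDensity k l L₀ f z + casimirDensity k l L₀ g z)
        + C * K * (W z * convexGap (1 + 1 / k) (f z) (g z)) := by
    filter_upwards [hf.nonneg, hg.nonneg, hf.vanish, hg.vanish, hnull] with z hf0 hg0 hfv hgv hne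
    have hgap0 := convexGap_nonneg (one_lt_exponent hk) hf0 hg0
    have hc1 := casimirDensity_nonneg (k := k) (l := l) (L₀ := L₀) hf0
    have hc2 := casimirDensity_nonneg (k := k) (l := l) (L₀ := L₀) hg0
    have hRi : 0 < R⁻¹ := by positivity
    have t1 : 0 ≤ R⁻¹ * (f z + g z) := by positivity
    have t2 : 0 ≤ R⁻¹ * (‖z.2‖ ^ 2 * f z + ‖z.2‖ ^ 2 * g z) := by positivity
    have t3 : 0 ≤ box.indicator (fun _ => δ) z := indicator_nonneg (fun _ _ => hδ0.le) z
    have t4 : 0 ≤ δ * K * (casimirDensity k l L₀ f z + casimirDensity k l L₀ g z) := by positivity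
    have t5 : 0 ≤ C * K * (W z * convexGap (1 + 1 / k) (f z) (g z)) :=
      mul_nonneg (by positivity) (mul_nonneg (hW0 z) hgap0)
    have hsub : |f z - g z| ≤ f z + g z := by
      rw [abs_le]; constructor <;> linarith
    have hws : |spaceWeight z * f z - spaceWeight z * g z| = spaceWeight z * |f z - g z| := by
      rw [← mul_sub, abs_mul, abs_of_pos (spaceWeight_pos z)]
    rw [hws]
    by_cases hx : ‖z.1‖ ≤ R
    · by_cases hv : ‖z.2‖ ≤ R
      · have hzb : z ∈ box := by
          rw [hbox, mem_closedBall_zero_iff]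
          exact max_le hx hv
        have hfin : |f z - g z| ≤ box.indicator (fun _ => δ) z
            + δ * K * (casimirDensity k l L₀ f z + casimirDensity k l L₀ g z)
            + C * K * (W z * convexGap (1 + 1 / k) (f z) (g z)) := by
          rcases lt_or_gt_of_ne hne with h | h
          · rw [hfv h, hgv h, sub_self, abs_zero] at *
            linarith
          · have hpos : 0 < angMom z - L₀ := by linarith
            have hWK : 1 ≤ K * W z := by
              have h1 : angMom z - L₀ ≤ R ^ 4 := by
                have h2 := angMom_le z
                have h3 : ‖z.1‖ ^ 2 * ‖z.2‖ ^ 2 ≤ R ^ 2 * R ^ 2 := by gcongr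
                nlinarith
              have h2 : (angMom z - L₀) ^ (l / k) ≤ K :=
                Real.rpow_le_rpow hpos.le h1 (by positivity)
              have h3 : W z = ((angMom z - L₀) ^ (l / k))⁻¹ := by
                simp only [hW]
                rw [max_eq_left hpos.le, Real.rpow_neg hpos.le]
              rw [h3, ← div_eq_mul_inv, le_div_iff₀ (Real.rpow_pos_of_pos hpos _), one_mul]
              exact h2
            have h1 := hC (f z) (g z) hf0 hg0
            rw [indicator_of_mem hzb]
            have hfp : 0 ≤ f z ^ (1 + 1 / k) := Real.rpow_nonneg hf0 _
            have hgp : 0 ≤ g z ^ (1 + 1 / k) := Real.rpow_nonneg hg0 _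
            have h2 : δ * (f z ^ (1 + 1 / k) + g z ^ (1 + 1 / k))
                ≤ δ * K * (casimirDensity k l L₀ f z + casimirDensity k l L₀ g z) := by
              have : δ * K * (casimirDensity k l L₀ f z + casimirDensity k l L₀ g z)
                  = δ * (f z ^ (1 + 1 / k) + g z ^ (1 + 1 / k)) * (K * W z) := by
                simp only [casimirDensity, hW]; ring
              rw [this]
              exact le_mul_of_one_le_right (by positivity) hWK
            have h3 : C * convexGap (1 + 1 / k) (f z) (g z)
                ≤ C * K * (W z * convexGap (1 + 1 / k) (f z) (g z)) := by
              have : C * K * (W z * convexGap (1 + 1 / k) (f z) (g z))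
                  = C * convexGap (1 + 1 / k) (f z) (g z) * (K * W z) := by ring
              rw [this]
              exact le_mul_of_one_le_right (mul_nonneg hC0 hgap0) hWK
            have h4 : δ * (1 + f z ^ (1 + 1 / k) + g z ^ (1 + 1 / k))
                = δ + δ * (f z ^ (1 + 1 / k) + g z ^ (1 + 1 / k)) := by ring
            rw [h4] at h1
            linarith
        have := mul_le_of_le_one_left (abs_nonneg (f z - g z)) (spaceWeight_le_one z)
        linarith
      · have hv2 : 1 ≤ R⁻¹ * ‖z.2‖ ^ 2 := by
          rw [inv_mul_eq_div, le_div_iff₀ hR0]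
          push Not at hv
          nlinarith
        have := mul_le_of_le_one_left (abs_nonneg (f z - g z)) (spaceWeight_le_one z)
        have h4 : f z + g z ≤ R⁻¹ * (‖z.2‖ ^ 2 * f z + ‖z.2‖ ^ 2 * g z) := by
          nlinarith [mul_le_mul_of_nonneg_right hv2 (add_nonneg hf0 hg0)]
        linarith
    · have hx2 : spaceWeight z ≤ R⁻¹ := by
        unfold spaceWeight
        push Not at hx
        exact inv_anti₀ hR0 (by linarith)
      have h4 : spaceWeight z * |f z - g z| ≤ R⁻¹ * (f z + g z) := by gcongr
      linarith
  have hle : ∫ z, |spaceWeight z * f z - spaceWeight z * g z| ≤ _ :=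
    integral_mono_ae ((integrable_spaceWeight_mul hf.integrable).sub
      (integrable_spaceWeight_mul hg.integrable)).abs (hi1234.add hi5) hbound
  refine hle.trans ?_
  simp only [Pi.add_apply]
  rw [integral_add hi1234 hi5, integral_add hi123 hi4, integral_add hi12 hi3, integral_add hi1 hi2,
    integral_const_mul, integral_const_mul, integral_const_mul, integral_const_mul,
    integral_add hf.integrable hg.integrable, integral_add hf.kinetic_finite hg.kinetic_finite,
    integral_add hf.casimir_finite hg.casimir_finite, integral_indicator hboxm,
    setIntegral_const, hf.mass, hg.mass, smul_eq_mul]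
  have k1 : ∫ z : Phase, ‖z.2‖ ^ 2 * f z ≤ 2 * T := by
    rw [kineticEnergy] at hfT; linarith
  have k2 : ∫ z : Phase, ‖z.2‖ ^ 2 * g z ≤ 2 * T := by
    rw [kineticEnergy] at hgT; linarith
  rw [casimir] at hfC hgC
  have hRi : 0 < R⁻¹ := by positivity
  have b1 : R⁻¹ * ((∫ z : Phase, ‖z.2‖ ^ 2 * f z) + ∫ z : Phase, ‖z.2‖ ^ 2 * g z)
      ≤ R⁻¹ * (4 * T) := by gcongr; linarith
  have b2 : δ * K * ((∫ z, casimirDensity k l L₀ f z) + ∫ z, casimirDensity k l L₀ g z)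
      ≤ δ * K * (2 * T) := by gcongr; linarith
  have b3 : volume.real box * δ = δ * V := by rw [hV]; ring
  rw [b3]
  have b4 : R⁻¹ * (M + M) = R⁻¹ * (2 * M) := by ring
  rw [b4]
  linarith

end compactness

section minimizing
variable {k l L₀ Mc M : ℝ} {f g : Phase → ℝ}

lemma ae_map_isometry (A : Space ≃ₗᵢ[ℝ] Space) {P : Phase → Prop} (hP : ∀ᵐ z, P z) :
    ∀ᵐ z : Phase, P (A z.1, A z.2) := by
  have hA : MeasurePreserving (Prod.map A A) (volume : Measure Phase) volume :=
    A.measurePreserving.prod A.measurePreserving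
  exact hA.quasiMeasurePreserving.ae hP

/-- On a fixed ball the weight is bounded below, so weighted `L¹` convergence gives convergence of
the mass in the ball. -/
lemma abs_massInBall_sub_le (hf : Integrable f) (hg : Integrable g) {r : ℝ} (hr : 0 ≤ r) :
    |massInBall f r - massInBall g r|
      ≤ (1 + r) * ∫ z, |spaceWeight z * f z - spaceWeight z * g z| := by
  have hi := ((integrable_spaceWeight_mul hf).sub (integrable_spaceWeight_mul hg)).abs
  rw [← massInBall_sub hf hg, massInBall_eq (f := fun z => f z - g z) (hf.sub hg),
    ← integral_const_mul]
  refine (norm_integral_le_integral_norm (μ := volume.restrict {z : Phase | ‖z.1‖ ≤ r})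
    (fun z => f z - g z)).trans ?_
  refine le_trans ?_ (setIntegral_le_integral (s := {z : Phase | ‖z.1‖ ≤ r}) (hi.const_mul (1 + r))
    (ae_of_all _ fun _ => by positivity))
  refine setIntegral_mono_on (hf.sub hg).norm.integrableOn (hi.const_mul _).integrableOn
    (measurableSet_norm_fst_le r) fun z hz => ?_
  have hz' : ‖z.1‖ ≤ r := hz
  have h1 : 1 ≤ (1 + r) * spaceWeight z := by
    unfold spaceWeight
    rw [← div_eq_mul_inv, le_div_iff₀ (by positivity)]
    linarith
  rw [← mul_sub, abs_mul, abs_of_pos (spaceWeight_pos z), ← mul_assoc, Real.norm_eq_abs]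
  exact le_mul_of_one_le_left (abs_nonneg _) h1

/-- The inverse moment is continuous for the weighted `L¹` distance, on sets of bounded mass and
kinetic energy: the angular momentum barrier controls it near the origin. -/
lemma abs_invMoment_sub_le (hL₀ : 0 < L₀) (hf : IsTame L₀ f) (hg : IsTame L₀ g)
    (hf0 : ∀ᵐ z : Phase, 0 ≤ f z) (hg0 : ∀ᵐ z : Phase, 0 ≤ g z) {δ : ℝ} (hδ : 0 < δ) :
    |invMoment f - invMoment g| ≤ δ * ((∫ z, f z) + ∫ z, g z)
      + δ * (L₀⁻¹ * (2 * kineticEnergy f + 2 * kineticEnergy g))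
      + (δ⁻¹ * (1 + δ⁻¹)) * ∫ z, |spaceWeight z * f z - spaceWeight z * g z| := by
  have hd := hf.sub hg
  have hi : Integrable (fun z => |spaceWeight z * f z - spaceWeight z * g z|) :=
    ((integrable_spaceWeight_mul hf.integrable).sub (integrable_spaceWeight_mul hg.integrable)).abs
  have hi1 : Integrable (fun z => δ * (f z + g z)) := (hf.integrable.add hg.integrable).const_mul _
  have hi2 : Integrable (fun z : Phase => δ * (L₀⁻¹ * (‖z.2‖ ^ 2 * f z + ‖z.2‖ ^ 2 * g z))) :=
    ((hf.kinetic.add hg.kinetic).const_mul _).const_mul _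
  have hi12 : Integrable (fun z : Phase => δ * (f z + g z)
    + δ * (L₀⁻¹ * (‖z.2‖ ^ 2 * f z + ‖z.2‖ ^ 2 * g z))) := hi1.add hi2
  have hi3 := hi.const_mul (δ⁻¹ * (1 + δ⁻¹))
  rw [← invMoment_sub hL₀ hf hg, invMoment]
  refine (norm_integral_le_integral_norm (μ := (volume : Measure Phase))
    (fun z : Phase => ‖z.1‖⁻¹ * (f z - g z))).trans ?_
  have hle := integral_mono_ae (hd.integrable_inv hL₀).norm (hi12.add hi3) ?_
  · refine hle.trans (le_of_eq ?_)
    simp only [Pi.add_apply]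
    rw [integral_add hi12 hi3, integral_add hi1 hi2, integral_const_mul, integral_const_mul,
      integral_const_mul, integral_add hf.integrable hg.integrable, integral_const_mul,
      integral_add hf.kinetic hg.kinetic, kineticEnergy, kineticEnergy]
    ring
  · filter_upwards [hf0, hg0, hd.inv_sq_le hL₀] with z h1 h2 h3
    simp only [Pi.add_apply, norm_mul, norm_inv, Real.norm_eq_abs, abs_norm]
    have hw : |spaceWeight z * f z - spaceWeight z * g z| = spaceWeight z * |f z - g z| := by
      rw [← mul_sub, abs_mul, abs_of_pos (spaceWeight_pos z)]
    have hsub : |f z - g z| ≤ f z + g z := by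
      rw [abs_le]; constructor <;> linarith
    rw [hw]
    by_cases hne : f z - g z = 0
    · rw [hne, abs_zero]; simp only [mul_zero, add_zero]; positivity
    · have h4 := h3 hne
      have hin : (‖z.1‖⁻¹ : ℝ) ≤ δ + δ * (L₀⁻¹ * ‖z.2‖ ^ 2)
          + (δ⁻¹ * (1 + δ⁻¹)) * spaceWeight z := by
        set x := ‖z.1‖ with hx
        have hx0 : 0 ≤ x := norm_nonneg _
        have hs := spaceWeight_pos z
        have hδi : 0 < δ⁻¹ := by positivity
        rcases le_total (x⁻¹) δ with h5 | h5
        · have t1 : 0 ≤ δ * (L₀⁻¹ * ‖z.2‖ ^ 2) := by positivity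
          have t2 : 0 ≤ (δ⁻¹ * (1 + δ⁻¹)) * spaceWeight z := by positivity
          linarith
        · have hxpos : 0 < x := inv_pos.1 (hδ.trans_le h5)
          rcases le_total x δ with h6 | h6
          · have h7 : x⁻¹ ≤ δ * (x⁻¹) ^ 2 := by
              rw [sq, ← mul_assoc]
              refine le_mul_of_one_le_left (by positivity) ?_
              rw [← div_eq_mul_inv, le_div_iff₀ hxpos]; linarith
            have h8 : δ * (x⁻¹) ^ 2 ≤ δ * (L₀⁻¹ * ‖z.2‖ ^ 2) := by gcongr
            have t2 : 0 ≤ (δ⁻¹ * (1 + δ⁻¹)) * spaceWeight z := by positivity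
            linarith
          · have h7 : x⁻¹ ≤ δ⁻¹ := inv_anti₀ hδ h6
            have h8 : x ≤ δ⁻¹ := by
              rw [← inv_inv x]; exact inv_anti₀ hδ h5
            have h9 : 1 ≤ (1 + δ⁻¹) * spaceWeight z := by
              unfold spaceWeight
              rw [← div_eq_mul_inv, le_div_iff₀ (by positivity)]
              linarith
            have h10 : δ⁻¹ * 1 ≤ δ⁻¹ * ((1 + δ⁻¹) * spaceWeight z) := by gcongr
            have t1 : 0 ≤ δ * (L₀⁻¹ * ‖z.2‖ ^ 2) := by positivity
            nlinarith
      have h5 := mul_le_mul_of_nonneg_right hin (abs_nonneg (f z - g z))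
      have t1 : δ * |f z - g z| ≤ δ * (f z + g z) := by gcongr
      have t2 : δ * (L₀⁻¹ * ‖z.2‖ ^ 2) * |f z - g z|
          ≤ δ * (L₀⁻¹ * ‖z.2‖ ^ 2) * (f z + g z) := by gcongr
      have t3 : δ * (L₀⁻¹ * ‖z.2‖ ^ 2) * (f z + g z)
        = δ * (L₀⁻¹ * (‖z.2‖ ^ 2 * f z + ‖z.2‖ ^ 2 * g z)) := by ring
      have t4 : (δ⁻¹ * (1 + δ⁻¹)) * spaceWeight z * |f z - g z|
        = (δ⁻¹ * (1 + δ⁻¹)) * (spaceWeight z * |f z - g z|) := by ring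
      linarith

/-- Minimizing sequences are compact: along a subsequence the fields converge in `L²` to the field
of a minimizer. -/
theorem exists_minimizer_limit (hk : 0 < k) (hkl : k ≤ l) (hL₀ : 0 < L₀) (hMc : 0 < Mc)
    (hM : 0 < M) {h₀ : ℝ} (hmin : ∀ g, IsAdmissible k l L₀ M g → h₀ ≤ energyCasimir k l L₀ Mc g)
    {F : ℕ → Phase → ℝ} (hF : ∀ n, IsAdmissible k l L₀ M (F n))
    (hlim : Tendsto (fun n => energyCasimir k l L₀ Mc (F n)) atTop (𝓝 h₀)) :
    ∃ φ : ℕ → ℕ, StrictMono φ ∧ ∃ g, IsAdmissible k l L₀ M g ∧ energyCasimir k l L₀ Mc g ≤ h₀ ∧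
      Tendsto (fun n => ∫ x, fieldDiffSq (F (φ n)) g x) atTop (𝓝 0) := by
  have hl : 0 < l := hk.trans_le hkl
  have hpi := Real.pi_pos
  obtain ⟨C, hC⟩ := exists_coercive (Mc := Mc) k l hL₀ hMc hM
  obtain ⟨H, hH⟩ := hlim.bddAbove_range
  have hHn : ∀ n, energyCasimir k l L₀ Mc (F n) ≤ H := fun n => hH ⟨n, rfl⟩
  have hk0 : ∀ n, 0 ≤ kineticEnergy (F n) := fun n => kineticEnergy_nonneg (hF n).nonneg
  have hc0 : ∀ n, 0 ≤ casimir k l L₀ (F n) := fun n => casimir_nonneg (hF n).nonneg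
  set T := 2 * (H + C) with hT
  have hkT : ∀ n, kineticEnergy (F n) ≤ T := fun n => by
    have h1 := hC _ (hF n); have h2 := hHn n; have h3 := hc0 n; linarith
  have hcT : ∀ n, casimir k l L₀ (F n) ≤ T := fun n => by
    have h1 := hC _ (hF n); have h2 := hHn n; have h3 := hc0 n; have h4 := hk0 n; linarith
  have hT0 : 0 ≤ T := (hk0 0).trans (hkT 0)
  set B := 4 * (L₀⁻¹ * (2 * T) + M) with hB
  have hFB : ∀ n, fieldBound (F n) ≤ B := fun n => by
    have h1 := (hF n).tame.fieldBound_le hL₀ (hF n).nonneg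
    rw [(hF n).mass] at h1
    have h2 : L₀⁻¹ * (2 * kineticEnergy (F n)) ≤ L₀⁻¹ * (2 * T) := by
      have := hkT n; gcongr
    linarith
  -- the masses in balls converge along a subsequence, and with them the fields
  obtain ⟨φ₁, hφ₁, G, S, hS, hG⟩ := exists_subseq_tendsto_of_monotone (M := M)
    (m := fun n => massInBall (F n)) (fun n => massInBall_mono (hF n).integrable (hF n).nonneg)
    (fun n r => ⟨massInBall_nonneg (hF n).integrable (hF n).nonneg r, by
      have h1 := (abs_le.1 (abs_massInBall_le (hF n).integrable r)).2
      rwa [integral_abs_of_nonneg (hF n).nonneg, (hF n).mass] at h1⟩)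
  have hfield : Tendsto (fun p : ℕ × ℕ => ∫ x, fieldDiffSq (F (φ₁ p.1)) (F (φ₁ p.2)) x) atTop
      (𝓝 0) := by
    refine tendsto_integral_fieldDiffSq hL₀ (f := fun p : ℕ × ℕ => F (φ₁ p.1))
      (g := fun p : ℕ × ℕ => F (φ₁ p.2)) (fun p => (hF _).tame) (fun p => (hF _).tame)
      (fun p => hFB _) (fun p => hFB _) ?_
    filter_upwards [ae_norm_notMem hS] with x hx
    have h1 := hG _ hx
    rw [← prod_atTop_atTop_eq]
    have := (h1.comp tendsto_fst).sub (h1.comp (tendsto_snd (f := (atTop : Filter ℕ))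
      (g := (atTop : Filter ℕ))))
    rw [sub_self] at this
    exact this
  -- hence the convexity defects of the Casimir functional vanish
  set gap : ℕ × ℕ → ℝ := fun p => ∫ z, (max (angMom z - L₀) 0) ^ (-(l / k))
    * convexGap (1 + 1 / k) (F (φ₁ p.1) z) (F (φ₁ p.2) z) with hgapdef
  have hgap0 : ∀ p, 0 ≤ gap p := fun p => by
    refine integral_nonneg_of_ae ?_
    filter_upwards [(hF (φ₁ p.1)).nonneg, (hF (φ₁ p.2)).nonneg] with z h1 h2
    exact mul_nonneg (Real.rpow_nonneg (le_max_right _ _) _)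
      (convexGap_nonneg (one_lt_exponent hk) h1 h2)
  have hEn : Tendsto (fun n => energyCasimir k l L₀ Mc (F (φ₁ n))) atTop (𝓝 h₀) :=
    hlim.comp hφ₁.tendsto_atTop
  have hgap : Tendsto gap atTop (𝓝 0) := by
    have h1 : Tendsto (fun p : ℕ × ℕ => (energyCasimir k l L₀ Mc (F (φ₁ p.1))
        + energyCasimir k l L₀ Mc (F (φ₁ p.2))) / 2 - h₀) atTop (𝓝 ((h₀ + h₀) / 2 - h₀)) := by
      rw [← prod_atTop_atTop_eq]
      exact (((hEn.comp tendsto_fst).add (hEn.comp tendsto_snd)).div_const 2).sub_const h₀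
    have h2 := h1.add (hfield.const_mul (1 / (32 * Real.pi)))
    have h3 : (h₀ + h₀) / 2 - h₀ + 1 / (32 * Real.pi) * 0 = 0 := by ring
    rw [h3] at h2
    exact squeeze_zero hgap0 (fun p =>
      ((hF (φ₁ p.1)).integral_convexGap_le hk hL₀ (hF (φ₁ p.2)) hmin).2) h2
  have hcauchy : Tendsto (fun p : ℕ × ℕ => ∫ z, |spaceWeight z * F (φ₁ p.1) z
      - spaceWeight z * F (φ₁ p.2) z|) atTop (𝓝 0) := by
    have hnn : ∀ p : ℕ × ℕ, 0 ≤ ∫ z, |spaceWeight z * F (φ₁ p.1) z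
      - spaceWeight z * F (φ₁ p.2) z| := fun p => integral_nonneg fun _ => abs_nonneg _
    refine tendsto_order.2 ⟨fun y hy => Eventually.of_forall fun p => hy.trans_le (hnn p),
      fun ε hε => ?_⟩
    obtain ⟨D, hD0, hD⟩ := exists_weighted_dist_le hk hl hL₀ hM hT0 (half_pos hε)
    have h1 := hgap.const_mul D
    rw [mul_zero] at h1
    filter_upwards [h1.eventually_lt_const (half_pos hε)] with p hp
    have h2 := hD _ _ (hF (φ₁ p.1)) (hF (φ₁ p.2)) (hkT _) (hkT _) (hcT _) (hcT _)
      ((hF (φ₁ p.1)).integral_convexGap_le hk hL₀ (hF (φ₁ p.2)) hmin).1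
    simp only [hgapdef] at hp
    linarith
  -- so the sequence converges strongly in weighted `L¹`
  obtain ⟨v, hvi, hv1, φ₂, hφ₂, hvae⟩ := exists_limit_of_cauchy
    (fun n => integrable_spaceWeight_mul (hF (φ₁ n)).integrable) hcauchy
  set φ := fun n => φ₁ (φ₂ n) with hφ
  set g : Phase → ℝ := fun z => (spaceWeight z)⁻¹ * v z with hg
  have hgv : ∀ z, v z = spaceWeight z * g z := fun z => by
    have := (spaceWeight_pos z).ne'
    simp only [hg]; field_simp
  have hae : ∀ᵐ z, Tendsto (fun n => F (φ n) z) atTop (𝓝 (g z)) := by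
    filter_upwards [hvae] with z hz
    refine (hz.const_mul (spaceWeight z)⁻¹).congr fun n => ?_
    have := (spaceWeight_pos z).ne'
    field_simp
    rfl
  have hg0 : ∀ᵐ z, 0 ≤ g z := by
    filter_upwards [hae, ae_all_iff.2 fun n => (hF (φ n)).nonneg] with z h1 h2
    exact ge_of_tendsto' h1 h2
  obtain ⟨hgi, hgm⟩ := integrable_and_integral_le_of_tendsto (fun n => (hF (φ n)).integrable)
    (fun n => (hF (φ n)).nonneg) hae (fun n => (hF (φ n)).mass.le) tendsto_const_nhds
  have hkin0 : ∀ n, ∀ᵐ z : Phase, 0 ≤ ‖z.2‖ ^ 2 * F (φ n) z := fun n => by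
    filter_upwards [(hF (φ n)).nonneg] with z hz
    positivity
  have hkinlim : ∀ᵐ z : Phase, Tendsto (fun n => ‖z.2‖ ^ 2 * F (φ n) z) atTop
      (𝓝 (‖z.2‖ ^ 2 * g z)) := by
    filter_upwards [hae] with z hz
    exact hz.const_mul _
  obtain ⟨hgk, hgkT⟩ := integrable_and_integral_le_of_tendsto (c := fun _ => 2 * T)
    (fun n => (hF (φ n)).kinetic_finite) hkin0 hkinlim
    (fun n => by have := hkT (φ n); rw [kineticEnergy] at this; linarith) tendsto_const_nhds
  have hcas0 : ∀ n, ∀ᵐ z : Phase, 0 ≤ casimirDensity k l L₀ (F (φ n)) z := fun n => by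
    filter_upwards [(hF (φ n)).nonneg] with z hz
    exact casimirDensity_nonneg hz
  have hcaslim : ∀ᵐ z : Phase, Tendsto (fun n => casimirDensity k l L₀ (F (φ n)) z) atTop
      (𝓝 (casimirDensity k l L₀ g z)) := by
    filter_upwards [hae] with z hz
    have hp : 0 ≤ 1 + 1 / k := by have := one_lt_exponent hk; linarith
    exact (((Real.continuous_rpow_const hp).tendsto _).comp hz).mul_const _
  obtain ⟨hgc, -⟩ := integrable_and_integral_le_of_tendsto (c := fun _ => T)
    (fun n => (hF (φ n)).casimir_finite) hcas0 hcaslim (fun n => hcT (φ n)) tendsto_const_nhds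
  have hgvan : ∀ᵐ z : Phase, angMom z < L₀ → g z = 0 := by
    filter_upwards [hae, ae_all_iff.2 fun n => (hF (φ n)).vanish] with z h1 h2 h3
    refine tendsto_nhds_unique h1 ?_
    have : (fun n => F (φ n) z) = fun _ => 0 := funext fun n => h2 n h3
    rw [this]
    exact tendsto_const_nhds
  have hgsym : IsSphericallySymmetric g := by
    intro A
    filter_upwards [hae, ae_map_isometry A hae, ae_all_iff.2 fun n => (hF (φ n)).symmetric A]
      with z h1 h2 h3
    refine tendsto_nhds_unique h2 ?_
    simp only [h3]
    exact h1
  have hga : IsAdmissible k l L₀ (∫ z, g z) g := ⟨hgi, hg0, hgsym, rfl, hgk, hgc, hgvan⟩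
  -- convergence of the fields and of the inverse moments
  have hw : Tendsto (fun n => ∫ z, |spaceWeight z * F (φ n) z - spaceWeight z * g z|) atTop
      (𝓝 0) := by
    have := hv1.comp hφ₂.tendsto_atTop
    refine this.congr fun n => ?_
    simp only [hgv, Function.comp, hφ]
  have hmass : ∀ r, 0 ≤ r →
      Tendsto (fun n => massInBall (F (φ n)) r - massInBall g r) atTop (𝓝 0) := by
    intro r hr
    have h1 := hw.const_mul (1 + r)
    rw [mul_zero] at h1
    exact squeeze_zero_norm (fun n => abs_massInBall_sub_le (hF (φ n)).integrable hgi hr) h1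
  have hgB : fieldBound g ≤ max B (fieldBound g) := le_max_right _ _
  have hfl : Tendsto (fun n => ∫ x, fieldDiffSq (F (φ n)) g x) atTop (𝓝 0) :=
    tendsto_integral_fieldDiffSq hL₀ (f := fun n => F (φ n)) (g := fun _ => g)
      (fun n => (hF _).tame) (fun _ => hga.tame) (fun n => (hFB _).trans (le_max_left _ _))
      (fun _ => hgB) (ae_of_all _ fun x => hmass _ (norm_nonneg x))
  have hinv : Tendsto (fun n => invMoment (F (φ n))) atTop (𝓝 (invMoment g)) := by
    rw [tendsto_iff_norm_sub_tendsto_zero]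
    refine tendsto_order.2 ⟨fun y hy => Eventually.of_forall fun p => hy.trans_le (norm_nonneg _),
      fun ε hε => ?_⟩
    have hQ : 0 < 1 + 2 * M + L₀⁻¹ * (4 * T) := by positivity
    set Q := 1 + 2 * M + L₀⁻¹ * (4 * T) with hQd
    set δ := ε / 2 / Q with hδ
    have hδ0 : 0 < δ := by positivity
    have hδQ : δ * Q = ε / 2 := by rw [hδ]; field_simp
    have h1 := hw.const_mul (δ⁻¹ * (1 + δ⁻¹))
    rw [mul_zero] at h1
    filter_upwards [h1.eventually_lt_const (half_pos hε)] with n hn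
    have h2 := abs_invMoment_sub_le hL₀ (hF (φ n)).tame hga.tame (hF (φ n)).nonneg hg0 hδ0
    rw [(hF (φ n)).mass] at h2
    have h3 : δ * (M + ∫ z, g z) + δ * (L₀⁻¹ * (2 * kineticEnergy (F (φ n)) + 2 * kineticEnergy g))
        ≤ δ * Q := by
      rw [← mul_add]
      refine mul_le_mul_of_nonneg_left ?_ hδ0.le
      have h4 : kineticEnergy g ≤ T := by rw [kineticEnergy]; linarith
      have h5 := hkT (φ n)
      have h6 : L₀⁻¹ * (2 * kineticEnergy (F (φ n)) + 2 * kineticEnergy g) ≤ L₀⁻¹ * (4 * T) := by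
        gcongr; linarith
      linarith
    rw [Real.norm_eq_abs]
    linarith
  have hfsq : Tendsto (fun n => fieldSq (F (φ n))) atTop (𝓝 (fieldSq g)) := by
    refine tendsto_integral_filter_of_dominated_convergence
      (fun x : Space => B ^ 2 * (1 + ‖x‖) ^ (-4 : ℝ)) ?_ ?_ (integrable_japanese.const_mul _) ?_
    · exact Eventually.of_forall fun n => ((hF (φ n)).tame.integrable_grad_sq hL₀).1
    · refine Eventually.of_forall fun n => ?_
      have hne : ∀ᵐ x : Space, x ≠ 0 := by simp [ae_iff]
      filter_upwards [hne] with x hx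
      have hx' : 0 < ‖x‖ := norm_pos_iff.2 hx
      have h3 : ((1 + ‖x‖) ^ (-4 : ℝ)) = ((1 + ‖x‖) ^ (-2 : ℝ)) ^ 2 := by
        rw [← Real.rpow_natCast, ← Real.rpow_mul (by positivity)]; norm_num
      have hp : 0 < (1 + ‖x‖) ^ (-2 : ℝ) := Real.rpow_pos_of_pos (by positivity) _
      have h1 := (hF (φ n)).tame.massInBall_bound hL₀ hx'
      rw [Real.norm_eq_abs, abs_of_nonneg (sq_nonneg _), norm_gradPotential_sq, h3, ← mul_pow,
        ← sq_abs, abs_div, abs_of_pos (show 0 < ‖x‖ ^ 2 by positivity)]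
      have h2 := hFB (φ n)
      gcongr
      exact h1.trans (by gcongr)
    · refine ae_of_all _ fun x => ?_
      simp only [norm_gradPotential_sq]
      have h1 := (hmass _ (norm_nonneg x)).add_const (massInBall g ‖x‖)
      simp only [sub_add_cancel, zero_add] at h1
      exact (h1.div_const _).pow 2
  -- lower semicontinuity of the convex part of the energy
  have hsum0 : ∀ n, ∀ᵐ z : Phase, 0 ≤ 1 / 2 * (‖z.2‖ ^ 2 * F (φ n) z)
      + casimirDensity k l L₀ (F (φ n)) z := fun n => by
    filter_upwards [hkin0 n, hcas0 n] with z h1 h2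
    positivity
  have hsumlim : ∀ᵐ z : Phase, Tendsto (fun n => 1 / 2 * (‖z.2‖ ^ 2 * F (φ n) z)
      + casimirDensity k l L₀ (F (φ n)) z) atTop
      (𝓝 (1 / 2 * (‖z.2‖ ^ 2 * g z) + casimirDensity k l L₀ g z)) := by
    filter_upwards [hkinlim, hcaslim] with z h1 h2
    exact (h1.const_mul _).add h2
  have hEn2 : Tendsto (fun n => energyCasimir k l L₀ Mc (F (φ n))
      + (1 / (8 * Real.pi) * fieldSq (F (φ n)) + Mc * invMoment (F (φ n)))) atTop
      (𝓝 (h₀ + (1 / (8 * Real.pi) * fieldSq g + Mc * invMoment g))) :=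
    (hEn.comp hφ₂.tendsto_atTop).add ((hfsq.const_mul _).add (hinv.const_mul _))
  obtain ⟨-, hle⟩ := integrable_and_integral_le_of_tendsto
    (fun n => ((hF (φ n)).kinetic_finite.const_mul (1 / 2)).add (hF (φ n)).casimir_finite)
    hsum0 hsumlim (fun n => le_of_eq (by
      simp only [Pi.add_apply]
      rw [integral_add ((hF (φ n)).kinetic_finite.const_mul (1 / 2)) (hF (φ n)).casimir_finite,
        integral_const_mul, energyCasimir, (hF (φ n)).tame.potentialEnergy_eq hL₀, kineticEnergy,
        casimir]
      ring)) hEn2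
  rw [integral_add (hgk.const_mul (1 / 2)) hgc, integral_const_mul] at hle
  have hHg : energyCasimir k l L₀ Mc g ≤ h₀ := by
    rw [energyCasimir, hga.tame.potentialEnergy_eq hL₀, kineticEnergy, casimir]
    linarith
  have hmassM : ∫ z, g z = M := by
    refine le_antisymm hgm (not_lt.1 fun hlt => ?_)
    obtain ⟨w, hwa, hwlt⟩ := exists_energyCasimir_lt hk hkl hL₀ hMc hM hga hlt (hF 0)
    have := hmin w hwa
    linarith
  rw [hmassM] at hga
  exact ⟨φ, hφ₁.comp hφ₂, g, hga, hHg, hfl⟩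

/-- If the minimizer is unique, states of almost minimal energy have almost the same field. -/
theorem exists_fieldDiff_lt (hk : 0 < k) (hkl : k ≤ l) (hL₀ : 0 < L₀) (hMc : 0 < Mc)
    (hM : 0 < M) {f₀ : Phase → ℝ} (hmin : IsMinimizer k l L₀ Mc M f₀)
    (huniq : ∀ g, IsMinimizer k l L₀ Mc M g → g =ᵐ[volume] f₀) {ε : ℝ} (hε : 0 < ε) :
    ∃ δ, 0 < δ ∧ ∀ g, IsAdmissible k l L₀ M g →
      energyCasimir k l L₀ Mc g < energyCasimir k l L₀ Mc f₀ + δ →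
      ∫ x, fieldDiffSq g f₀ x < ε := by
  -- otherwise there is a minimizing sequence whose fields stay away from that of `f₀`
  by_contra! hcon
  choose! F hF1 hF2 hF3 using fun n : ℕ => hcon (1 / ((n : ℝ) + 1)) (by positivity)
  have hlim : Tendsto (fun n => energyCasimir k l L₀ Mc (F n)) atTop
      (𝓝 (energyCasimir k l L₀ Mc f₀)) := by
    have h1 : Tendsto (fun n : ℕ => energyCasimir k l L₀ Mc f₀ + 1 / ((n : ℝ) + 1)) atTop
        (𝓝 (energyCasimir k l L₀ Mc f₀ + 0)) :=
      tendsto_const_nhds.add tendsto_one_div_add_atTop_nhds_zero_nat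
    rw [add_zero] at h1
    exact tendsto_of_tendsto_of_tendsto_of_le_of_le tendsto_const_nhds h1
      (fun n => hmin.2 _ (hF1 n)) (fun n => (hF2 n).le)
  obtain ⟨φ, -, g, hg, hgE, hgl⟩ := exists_minimizer_limit hk hkl hL₀ hMc hM hmin.2 hF1 hlim
  have hgf : g =ᵐ[volume] f₀ := huniq g ⟨hg, fun w hw => hgE.trans (hmin.2 w hw)⟩
  have hsame : ∀ n x, fieldDiffSq (F (φ n)) g x = fieldDiffSq (F (φ n)) f₀ x := by
    intro n x
    simp only [fieldDiffSq, gradPotential, massInBall_congr hgf hg.integrable]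
  simp only [hsame] at hgl
  obtain ⟨n, hn⟩ := (hgl.eventually_lt_const hε).exists
  exact absurd (hF3 (φ n)) (not_le.2 hn)

end minimizing

/-! ### The transport identity -/

lemma fderiv_eq_zero_of_notMem {E : Type*} [NormedAddCommGroup E] [NormedSpace ℝ E] {H : E → ℝ}
    {S : Set E} (hS : IsClosed S) (hH : ∀ z ∉ S, H z = 0) {z : E} (hz : z ∉ S) :
    fderiv ℝ H z = 0 := by
  have : H =ᶠ[𝓝 z] fun _ => 0 := by
    filter_upwards [hS.isOpen_compl.mem_nhds hz] with y hy using hH y hy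
  rw [this.fderiv_eq]; simp

/-- The divergence theorem for compactly supported functions, in the form of vanishing integrals of
directional derivatives. -/
lemma integral_fderiv_apply_eq_zero {H : Space → ℝ} (hH : ContDiff ℝ 1 H)
    (hc : HasCompactSupport H) (u : Space) : ∫ x, fderiv ℝ H x u = 0 := by
  have hd : Continuous (fun x => fderiv ℝ H x u) :=
    (hH.continuous_fderiv one_ne_zero).clm_apply continuous_const
  have hdc : HasCompactSupport (fun x => fderiv ℝ H x u) :=
    (hc.fderiv ℝ).comp_left (g := fun L : Space →L[ℝ] ℝ => L u) (by simp)
  have h := integral_mul_fderiv_eq_neg_fderiv_mul_of_integrable (μ := (volume : Measure Space))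
    (f := fun _ : Space => (1 : ℝ)) (g := H) (v := u) (by simp)
    (by simpa using hd.integrable_of_hasCompactSupport hdc)
    (by simpa using hH.continuous.integrable_of_hasCompactSupport hc)
    (fun x _ => differentiableAt_const _) (fun x _ => (hH.differentiable one_ne_zero) x)
  simpa using h

lemma integrable_of_continuousOn_compact {E : Type*} [TopologicalSpace E] [T2Space E]
    [MeasurableSpace E] [BorelSpace E] {μ : Measure E} [IsFiniteMeasureOnCompacts μ]
    {H : E → ℝ} {S : Set E} (hS : IsCompact S) (hH : ContinuousOn H S) (h0 : ∀ z ∉ S, H z = 0) :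
    Integrable H μ :=
  (integrableOn_iff_integrable_of_support_subset fun z hz => by
    by_contra h; exact hz (h0 z h)).1 (hH.integrableOn_compact hS)

section divergence
variable {H : Phase → ℝ} {S : Set Phase}

/-- The vector field `(v, 0)` on phase space is divergence free. -/
lemma integral_fderiv_free_streaming (hH : ContDiff ℝ 1 H) (hS : IsCompact S)
    (h0 : ∀ z ∉ S, H z = 0) :
    Integrable (fun z : Phase => fderiv ℝ H z (z.2, 0)) ∧
      ∫ z : Phase, fderiv ℝ H z (z.2, 0) = 0 := by
  have hcont : Continuous (fun z : Phase => fderiv ℝ H z (z.2, 0)) :=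
    (hH.continuous_fderiv one_ne_zero).clm_apply (continuous_snd.prodMk continuous_const)
  have hi : Integrable (fun z : Phase => fderiv ℝ H z (z.2, 0)) :=
    integrable_of_continuousOn_compact hS hcont.continuousOn fun z hz => by
      rw [fderiv_eq_zero_of_notMem hS.isClosed h0 hz]; simp
  refine ⟨hi, ?_⟩
  have hi' : Integrable (fun z : Phase => fderiv ℝ H z (z.2, 0)) (volume.prod volume) := hi
  rw [volume_phase, integral_prod_symm _ hi']
  have : ∀ v : Space, ∫ x : Space, fderiv ℝ H (x, v) (v, 0) = 0 := by
    intro v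
    have hHv : ContDiff ℝ 1 (fun x => H (x, v)) := hH.comp (contDiff_id.prodMk contDiff_const)
    have hcv : HasCompactSupport (fun x => H (x, v)) :=
      HasCompactSupport.intro (hS.image continuous_fst) fun x hx =>
        h0 _ fun h => hx ⟨(x, v), h, rfl⟩
    rw [← integral_fderiv_apply_eq_zero hHv hcv v]
    refine integral_congr_ae (ae_of_all _ fun x => ?_)
    have h1 : HasFDerivAt (fun x => H (x, v)) ((fderiv ℝ H (x, v)).comp
        ((ContinuousLinearMap.id ℝ Space).prod 0)) x :=
      HasFDerivAt.comp x ((hH.differentiable one_ne_zero) (x, v)).hasFDerivAt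
        ((hasFDerivAt_id x).prodMk (hasFDerivAt_const v x))
    simp only [h1.fderiv]
    simp
  simp [this]

/-- The vector field `(0, K (x))` on phase space is divergence free, also if `K` is singular at the
origin, as long as the support of `H` avoids `x = 0`. -/
lemma integral_fderiv_force (hH : ContDiff ℝ 1 H) (hS : IsCompact S) (hS0 : ∀ z ∈ S, z.1 ≠ 0)
    (h0 : ∀ z ∉ S, H z = 0) {K : Space → Space} (hK : ContinuousOn K {x | x ≠ 0}) :
    Integrable (fun z : Phase => fderiv ℝ H z (0, K z.1)) ∧
      ∫ z : Phase, fderiv ℝ H z (0, K z.1) = 0 := by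
  have hKS : ContinuousOn (fun z : Phase => K z.1) S :=
    hK.comp continuous_fst.continuousOn fun z hz => hS0 z hz
  have hcont : ContinuousOn (fun z : Phase => fderiv ℝ H z (0, K z.1)) S :=
    (hH.continuous_fderiv one_ne_zero).continuousOn.clm_apply
      (continuousOn_const.prodMk hKS)
  have hi : Integrable (fun z : Phase => fderiv ℝ H z (0, K z.1)) :=
    integrable_of_continuousOn_compact hS hcont fun z hz => by
      rw [fderiv_eq_zero_of_notMem hS.isClosed h0 hz]; simp
  refine ⟨hi, ?_⟩
  have hi' : Integrable (fun z : Phase => fderiv ℝ H z (0, K z.1)) (volume.prod volume) := hi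
  rw [volume_phase, integral_prod _ hi']
  have : ∀ x : Space, ∫ v : Space, fderiv ℝ H (x, v) (0, K x) = 0 := by
    intro x
    have hHx : ContDiff ℝ 1 (fun v => H (x, v)) := hH.comp (contDiff_const.prodMk contDiff_id)
    have hcx : HasCompactSupport (fun v => H (x, v)) :=
      HasCompactSupport.intro (hS.image continuous_snd) fun v hv =>
        h0 _ fun h => hv ⟨(x, v), h, rfl⟩
    rw [← integral_fderiv_apply_eq_zero hHx hcx (K x)]
    refine integral_congr_ae (ae_of_all _ fun v => ?_)
    have h1 : HasFDerivAt (fun v => H (x, v)) ((fderiv ℝ H (x, v)).comp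
        ((0 : Space →L[ℝ] Space).prod (ContinuousLinearMap.id ℝ Space))) v :=
      HasFDerivAt.comp v ((hH.differentiable one_ne_zero) (x, v)).hasFDerivAt
        ((hasFDerivAt_const x v).prodMk (hasFDerivAt_id v))
    simp only [h1.fderiv]
    simp
  simp [this]

end divergence

/-- For a function `G` of time and phase space with compact support away from the singularity
`x = 0`, the integral of `G` over phase space changes at the rate given by the derivative of `G`
along the characteristic direction `(1, v, K)`, because the field `(v, K (t, x))` is free of
divergence. -/
theorem transport_identity {G : ℝ × Phase → ℝ} {a b : ℝ} {S : Set Phase} (hS : IsCompact S)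
    (hS0 : ∀ z ∈ S, z.1 ≠ 0) (hGc : ContinuousOn G (Icc a b ×ˢ univ))
    (hG : ContDiffOn ℝ 1 G (Ioo a b ×ˢ univ)) (h0 : ∀ t ∈ Icc a b, ∀ z ∉ S, G (t, z) = 0)
    {K : ℝ → Space → Space} (hK : ∀ t ∈ Ioo a b, ContinuousOn (K t) {x | x ≠ 0}) :
    ContinuousOn (fun t => ∫ z, G (t, z)) (Icc a b) ∧
    ∀ t ∈ Ioo a b, Integrable (fun z : Phase => fderiv ℝ G (t, z) (1, z.2, K t z.1)) ∧
      HasDerivAt (fun t => ∫ z, G (t, z))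
        (∫ z : Phase, fderiv ℝ G (t, z) (1, z.2, K t z.1)) t := by
  constructor
  · exact continuousOn_integral_of_compact_support (f := fun t z => G (t, z)) hS
      (by simpa [Function.uncurry_def] using hGc) (fun t z ht hz => h0 t ht z hz)
  intro t ht
  have hopen : IsOpen (Ioo a b ×ˢ (univ : Set Phase)) := isOpen_Ioo.prod isOpen_univ
  have hGat : ∀ s ∈ Ioo a b, ∀ z, ContDiffAt ℝ 1 G (s, z) := fun s hs z =>
    hG.contDiffAt (hopen.mem_nhds ⟨hs, mem_univ _⟩)
  have hfd : ContinuousOn (fderiv ℝ G) (Ioo a b ×ˢ univ) :=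
    hG.continuousOn_fderiv_of_isOpen hopen le_rfl
  have hGd : ∀ s ∈ Ioo a b, ∀ z, HasFDerivAt G (fderiv ℝ G (s, z)) (s, z) := fun s hs z =>
    ((hGat s hs z).differentiableAt one_ne_zero).hasFDerivAt
  have htime : ∀ s ∈ Ioo a b, ∀ z, HasDerivAt (fun s => G (s, z)) (fderiv ℝ G (s, z) (1, 0)) s := by
    intro s hs z
    have h1 : HasDerivAt (fun s : ℝ => (s, z)) ((1 : ℝ), (0 : Phase)) s :=
      (hasDerivAt_id s).prodMk (hasDerivAt_const s z)
    exact (hGd s hs z).comp_hasDerivAt s h1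
  have htime0 : ∀ s ∈ Ioo a b, ∀ z ∉ S, fderiv ℝ G (s, z) (1, 0) = 0 := by
    intro s hs z hz
    rw [← (htime s hs z).deriv]
    have : (fun s => G (s, z)) =ᶠ[𝓝 s] fun _ => 0 := by
      filter_upwards [isOpen_Ioo.mem_nhds hs] with r hr using h0 r (Ioo_subset_Icc_self hr) z hz
    rw [this.deriv_eq]; simp
  have hslice : ∀ s ∈ Ioo a b, ContDiff ℝ 1 (fun z => G (s, z)) := fun s hs =>
    contDiff_iff_contDiffAt.2 fun z =>
      (hGat s hs z).comp z (contDiffAt_const.prodMk contDiffAt_id)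
  have hslice' : ∀ z w, fderiv ℝ (fun z => G (t, z)) z w = fderiv ℝ G (t, z) (0, w) := by
    intro z w
    have h1 : HasFDerivAt (fun z => G (t, z)) ((fderiv ℝ G (t, z)).comp
        ((0 : Phase →L[ℝ] ℝ).prod (ContinuousLinearMap.id ℝ Phase))) z :=
      HasFDerivAt.comp z (hGd t ht z) ((hasFDerivAt_const t z).prodMk (hasFDerivAt_id z))
    rw [h1.fderiv]; simp
  have htI := Ioo_subset_Icc_self ht
  obtain ⟨hi1, he1⟩ := integral_fderiv_free_streaming (hslice t ht) hS (h0 t htI)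
  obtain ⟨hi2, he2⟩ := integral_fderiv_force (hslice t ht) hS hS0 (h0 t htI) (hK t ht)
  simp only [hslice'] at hi1 he1 hi2 he2
  -- differentiation under the integral sign
  obtain ⟨δ, hδ, hball⟩ := Metric.isOpen_iff.1 isOpen_Ioo t ht
  have hsub : Metric.closedBall t (δ / 2) ⊆ Ioo a b :=
    (Metric.closedBall_subset_ball (by linarith)).trans hball
  have hcomp : IsCompact (Metric.closedBall t (δ / 2) ×ˢ S) := (isCompact_closedBall _ _).prod hS
  have hcont1 : ContinuousOn (fun p : ℝ × Phase => fderiv ℝ G p (1, 0))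
      (Metric.closedBall t (δ / 2) ×ˢ S) :=
    (hfd.clm_apply continuousOn_const).mono (prod_mono hsub (subset_univ _))
  obtain ⟨C, hC⟩ := hcomp.exists_bound_of_continuousOn hcont1
  have hGint : ∀ s ∈ Ioo a b, Integrable (fun z => G (s, z)) := fun s hs =>
    integrable_of_continuousOn_compact hS (hslice s hs).continuous.continuousOn
      (h0 s (Ioo_subset_Icc_self hs))
  have hslicet : ContinuousOn (fun z => fderiv ℝ G (t, z) (1, 0)) S := by
    have h1 : ContinuousOn (fun z : Phase => (t, z)) S := by fun_prop
    exact (hfd.clm_apply continuousOn_const).comp h1 fun z _ => ⟨ht, mem_univ _⟩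
  have hder := hasDerivAt_integral_of_dominated_loc_of_deriv_le (μ := (volume : Measure Phase))
    (F := fun s z => G (s, z)) (F' := fun s z => fderiv ℝ G (s, z) (1, 0)) (x₀ := t)
    (s := Metric.closedBall t (δ / 2)) (bound := S.indicator fun _ => C)
    (Metric.closedBall_mem_nhds t (by linarith))
    (by filter_upwards [isOpen_Ioo.mem_nhds ht] with s hs using (hGint s hs).1)
    (hGint t ht)
    (integrable_of_continuousOn_compact hS hslicet (htime0 t ht)).1
    (ae_of_all _ fun z s hs => by
      by_cases hz : z ∈ S
      · rw [indicator_of_mem hz]; exact hC (s, z) ⟨hs, hz⟩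
      · rw [indicator_of_notMem hz, htime0 s (hsub hs) z hz, norm_zero])
    ((integrable_indicator_iff hS.measurableSet).2 (integrableOn_const hS.measure_lt_top.ne))
    (ae_of_all _ fun z s hs => htime s (hsub hs) z)
  have hdec : ∀ z : Phase, fderiv ℝ G (t, z) (1, z.2, K t z.1) = fderiv ℝ G (t, z) (1, 0)
      + (fderiv ℝ G (t, z) (0, z.2, 0) + fderiv ℝ G (t, z) (0, 0, K t z.1)) := by
    intro z
    rw [← map_add, ← map_add]
    simp
  simp only [hdec]
  have hi12 : Integrable (fun z : Phase => fderiv ℝ G (t, z) (0, z.2, 0)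
    + fderiv ℝ G (t, z) (0, 0, K t z.1)) := hi1.add hi2
  refine ⟨hder.1.add hi12, ?_⟩
  rw [integral_add hder.1 hi12, integral_add hi1 hi2, he1, he2, add_zero, add_zero]
  exact hder.2

/-- Integrated form of the transport identity, for a one-sided bound. -/
lemma transport_le {G : ℝ × Phase → ℝ} {a b C : ℝ} (hab : a ≤ b) {S : Set Phase}
    (hS : IsCompact S) (hS0 : ∀ z ∈ S, z.1 ≠ 0) (hGc : ContinuousOn G (Icc a b ×ˢ univ))
    (hG : ContDiffOn ℝ 1 G (Ioo a b ×ˢ univ)) (h0 : ∀ t ∈ Icc a b, ∀ z ∉ S, G (t, z) = 0)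
    {K : ℝ → Space → Space} (hK : ∀ t ∈ Ioo a b, ContinuousOn (K t) {x | x ≠ 0})
    (hC : ∀ t ∈ Ioo a b, Integrable (fun z : Phase => fderiv ℝ G (t, z) (1, z.2, K t z.1)) →
      ∫ z : Phase, fderiv ℝ G (t, z) (1, z.2, K t z.1) ≤ C) :
    ∫ z, G (b, z) ≤ (∫ z, G (a, z)) + C * (b - a) := by
  obtain ⟨h1, h2⟩ := transport_identity hS hS0 hGc hG h0 hK
  have h := (convex_Icc a b).image_sub_le_mul_sub_of_deriv_le h1
    (fun t ht => by
      rw [interior_Icc] at ht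
      exact (h2 t ht).2.differentiableAt.differentiableWithinAt)
    (fun t ht => by
      rw [interior_Icc] at ht
      rw [(h2 t ht).2.deriv]
      exact hC t ht (h2 t ht).1)
    a (left_mem_Icc.2 hab) b (right_mem_Icc.2 hab) hab
  linarith

/-- Conserved quantities: if `G` is constant along characteristics, its integral is constant. -/
lemma transport_eq {G : ℝ × Phase → ℝ} {a b : ℝ} (hab : a ≤ b) {S : Set Phase}
    (hS : IsCompact S) (hS0 : ∀ z ∈ S, z.1 ≠ 0) (hGc : ContinuousOn G (Icc a b ×ˢ univ))
    (hG : ContDiffOn ℝ 1 G (Ioo a b ×ˢ univ)) (h0 : ∀ t ∈ Icc a b, ∀ z ∉ S, G (t, z) = 0)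
    {K : ℝ → Space → Space} (hK : ∀ t ∈ Ioo a b, ContinuousOn (K t) {x | x ≠ 0})
    (hC : ∀ t ∈ Ioo a b, ∀ z : Phase, fderiv ℝ G (t, z) (1, z.2, K t z.1) = 0) :
    ∫ z, G (b, z) = ∫ z, G (a, z) := by
  obtain ⟨h1, h2⟩ := transport_identity hS hS0 hGc hG h0 hK
  have hd : ∀ t ∈ Ioo a b, HasDerivAt (fun t => ∫ z, G (t, z)) 0 t := fun t ht => by
    have := (h2 t ht).2
    simp only [hC t ht, integral_zero] at this
    exact this
  have hle := (convex_Icc a b).image_sub_le_mul_sub_of_deriv_le (C := 0) h1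
    (fun t ht => by
      rw [interior_Icc] at ht
      exact (hd t ht).differentiableAt.differentiableWithinAt)
    (fun t ht => by
      rw [interior_Icc] at ht
      exact (hd t ht).deriv.le)
    a (left_mem_Icc.2 hab) b (right_mem_Icc.2 hab) hab
  have hge := (convex_Icc a b).mul_sub_le_image_sub_of_le_deriv (C := 0) h1
    (fun t ht => by
      rw [interior_Icc] at ht
      exact (hd t ht).differentiableAt.differentiableWithinAt)
    (fun t ht => by
      rw [interior_Icc] at ht
      exact (hd t ht).deriv.ge)
    a (left_mem_Icc.2 hab) b (right_mem_Icc.2 hab) hab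
  linarith

/-! ### Characteristics -/

/-- A time-dependent phase-space function as a function on `ℝ × ℝ⁶`. -/
def joint (f : ℝ → Phase → ℝ) (p : ℝ × Phase) : ℝ := f p.1 p.2

/-- The force `- ∇ (U - M_c / |x|)`. -/
def force (Mc : ℝ) (U : ℝ → Space → ℝ) (t : ℝ) (x : Space) : Space :=
  - gradient (effPotential Mc (U t)) x

lemma inner_gradient {g : Space → ℝ} (x w : Space) :
    (inner ℝ (gradient g x) w : ℝ) = fderiv ℝ g x w := by
  rw [gradient, InnerProductSpace.toDual_symm_apply]

lemma hasFDerivAt_norm {x : Space} (hx : x ≠ 0) :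
    HasFDerivAt (fun y : Space => ‖y‖) (‖x‖⁻¹ • (innerSL ℝ x)) x := by
  have h1 : HasFDerivAt (fun y : Space => ‖y‖ ^ 2) (2 • (innerSL ℝ x)) x :=
    (hasStrictFDerivAt_norm_sq x).hasFDerivAt
  have hx' : ‖x‖ ≠ 0 := norm_ne_zero_iff.2 hx
  have h2 := h1.sqrt (pow_ne_zero 2 hx')
  have h3 : (fun y : Space => √(‖y‖ ^ 2)) = fun y => ‖y‖ := by
    ext y; exact Real.sqrt_sq (norm_nonneg y)
  rw [h3, Real.sqrt_sq (norm_nonneg x)] at h2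
  refine h2.congr_fderiv ?_
  ext w
  simp
  field_simp

lemma hasFDerivAt_const_div_norm (c : ℝ) {x : Space} (hx : x ≠ 0) :
    HasFDerivAt (fun y : Space => c / ‖y‖) (-(c / ‖x‖ ^ 3) • (innerSL ℝ x)) x := by
  have hx' : ‖x‖ ≠ 0 := norm_ne_zero_iff.2 hx
  have h1 : HasDerivAt (fun r : ℝ => c / r) (c * (-(‖x‖ ^ 2)⁻¹)) ‖x‖ := by
    simpa [div_eq_mul_inv] using (hasDerivAt_inv hx').const_mul c
  have h2 := h1.comp_hasFDerivAt x (hasFDerivAt_norm hx)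
  refine h2.congr_fderiv ?_
  ext w
  simp only [smul_apply, smul_eq_mul, innerSL_apply_apply]
  field_simp

lemma contDiffAt_const_div_norm (c : ℝ) {n : WithTop ℕ∞} {x : Space} (hx : x ≠ 0) :
    ContDiffAt ℝ n (fun y : Space => c / ‖y‖) x :=
  contDiffAt_const.div (contDiffAt_norm ℝ hx) (norm_ne_zero_iff.2 hx)

lemma force_eq {Mc : ℝ} {U : ℝ → Space → ℝ} {t : ℝ} {x : Space} (hU : DifferentiableAt ℝ (U t) x)
    (hx : x ≠ 0) : force Mc U t x = - gradient (U t) x - (Mc / ‖x‖ ^ 3) • x := by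
  have h1 : HasFDerivAt (effPotential Mc (U t))
      (fderiv ℝ (U t) x - -(Mc / ‖x‖ ^ 3) • (innerSL ℝ x)) x :=
    hU.hasFDerivAt.sub (hasFDerivAt_const_div_norm Mc hx)
  refine ext_inner_right ℝ fun w => ?_
  rw [force, inner_neg_left, inner_gradient, h1.fderiv, inner_sub_left, inner_neg_left,
    inner_gradient, inner_smul_left]
  simp
  ring

section solution
variable {Mc : ℝ} {f : ℝ → Phase → ℝ} {U : ℝ → Space → ℝ}

lemma IsSolution.contDiffAt (hf : IsSolution Mc f U) {t : ℝ} (ht : 0 < t) (z : Phase) :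
    ContDiffAt ℝ 1 (joint f) (t, z) :=
  hf.contDiff.contDiffAt (by
    refine mem_nhds_iff.2 ⟨Ioi 0 ×ˢ univ, prod_mono Ioi_subset_Ici_self subset_rfl,
      isOpen_Ioi.prod isOpen_univ, ht, mem_univ _⟩)

lemma IsSolution.continuousOn (hf : IsSolution Mc f U) :
    ContinuousOn (joint f) (Ici 0 ×ˢ univ) := hf.contDiff.continuousOn

lemma IsSolution.continuous (hf : IsSolution Mc f U) {t : ℝ} (ht : 0 ≤ t) : Continuous (f t) := by
  have h1 : Continuous (fun z : Phase => ((t, z) : ℝ × Phase)) := by fun_prop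
  exact hf.continuousOn.comp_continuous h1 fun z => ⟨ht, mem_univ _⟩

lemma IsSolution.force_eq (hf : IsSolution Mc f U) {t : ℝ} (ht : 0 ≤ t) {x : Space} (hx : x ≠ 0) :
    force Mc U t x = - gradient (U t) x - (Mc / ‖x‖ ^ 3) • x :=
  VlasovPoisson.force_eq ((hf.potential_contDiff t ht).differentiable two_ne_zero x) hx

lemma IsSolution.continuous_grad (hf : IsSolution Mc f U) {t : ℝ} (ht : 0 ≤ t) :
    Continuous (gradient (U t)) := by
  have h1 : Continuous (fun x : Space => ((t, x) : ℝ × Space)) := by fun_prop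
  exact hf.grad_continuous.comp_continuous h1 fun z => ⟨ht, mem_univ _⟩

lemma IsSolution.continuousOn_force (hf : IsSolution Mc f U) {t : ℝ} (ht : 0 ≤ t) :
    ContinuousOn (force Mc U t) {x | x ≠ 0} := by
  have h1 : ContinuousOn (fun x : Space => - gradient (U t) x - (Mc / ‖x‖ ^ 3) • x)
      {x | x ≠ 0} := by
    refine (hf.continuous_grad ht).neg.continuousOn.sub
      (ContinuousOn.smul (f := fun x : Space => Mc / ‖x‖ ^ 3) (g := fun x : Space => x) ?_
        continuousOn_id)
    exact continuousOn_const.div (by fun_prop) fun x hx => pow_ne_zero 3 (norm_ne_zero_iff.2 hx)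
  exact h1.congr fun x hx => hf.force_eq ht hx

/-- The Vlasov equation: `f` is constant along characteristics. -/
lemma IsSolution.characteristic (hf : IsSolution Mc f U) {t : ℝ} (ht : 0 < t) {z : Phase}
    (hz : z.1 ≠ 0) : fderiv ℝ (joint f) (t, z) (1, z.2, force Mc U t z.1) = 0 := by
  obtain ⟨x, v⟩ := z
  have hd := ((hf.contDiffAt ht (x, v)).differentiableAt one_ne_zero).hasFDerivAt
  have h := hf.vlasov t ht.le x v hz
  set J := fderiv ℝ (joint f) (t, (x, v)) with hJ
  have h1 : derivWithin (fun s => f s (x, v)) (Ici 0) t = J (1, 0, 0) := by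
    rw [derivWithin_of_mem_nhds (Ici_mem_nhds ht)]
    have h2 : HasDerivAt (fun s : ℝ => (s, (x, v))) ((1 : ℝ), (0 : Phase)) t :=
      (hasDerivAt_id t).prodMk (hasDerivAt_const t _)
    exact (hd.comp_hasDerivAt t h2).deriv
  have h2 : (inner ℝ v (gradient (fun y => f t (y, v)) x) : ℝ) = J (0, v, 0) := by
    rw [real_inner_comm, inner_gradient]
    have h3 : HasFDerivAt (fun y : Space => (t, (y, v)))
        ((0 : Space →L[ℝ] ℝ).prod ((ContinuousLinearMap.id ℝ Space).prod 0)) x :=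
      (hasFDerivAt_const t x).prodMk ((hasFDerivAt_id x).prodMk (hasFDerivAt_const v x))
    have h4 : HasFDerivAt (fun y : Space => joint f (t, (y, v))) _ x :=
      HasFDerivAt.comp (g := joint f) x hd h3
    change fderiv ℝ (fun y : Space => joint f (t, (y, v))) x v = _
    rw [h4.fderiv]; simp
  have h3 : (inner ℝ (gradient (effPotential Mc (U t)) x) (gradient (fun w => f t (x, w)) v) : ℝ)
      = - J (0, 0, force Mc U t x) := by
    rw [real_inner_comm, inner_gradient]
    have h3 : HasFDerivAt (fun y : Space => (t, (x, y)))
        ((0 : Space →L[ℝ] ℝ).prod ((0 : Space →L[ℝ] Space).prod (ContinuousLinearMap.id ℝ Space)))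
        v :=
      (hasFDerivAt_const t v).prodMk ((hasFDerivAt_const x v).prodMk (hasFDerivAt_id v))
    have h4 : HasFDerivAt (fun y : Space => joint f (t, (x, y))) _ v :=
      HasFDerivAt.comp (g := joint f) v hd h3
    change fderiv ℝ (fun y : Space => joint f (t, (x, y))) v _ = _
    rw [h4.fderiv, force, ← map_neg]; simp [hJ]
  rw [h1, h2, h3, sub_neg_eq_add, ← map_add, ← map_add] at h
  simpa using h

end solution

/-- Derivatives along a direction can be computed on lines. -/
lemma fderiv_apply_of_line {E : Type*} [NormedAddCommGroup E] [NormedSpace ℝ E] {g : E → ℝ}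
    {p u : E} {d : ℝ} (hg : DifferentiableAt ℝ g p)
    (h : HasDerivAt (fun s : ℝ => g (p + s • u)) d 0) : fderiv ℝ g p u = d := by
  have h1 : HasDerivAt (fun s : ℝ => g (p + s • u)) (fderiv ℝ g p u) 0 :=
    hg.hasFDerivAt.hasLineDerivAt u
  exact h1.unique h

section lines
variable (x v K : Space)

lemma hasDerivAt_line : HasDerivAt (fun s : ℝ => x + s • v) v 0 := by
  simpa using ((hasDerivAt_id (0 : ℝ)).smul_const v).const_add x

lemma hasDerivAt_line_norm_sq : HasDerivAt (fun s : ℝ => ‖x + s • v‖ ^ 2) (2 * inner ℝ x v) 0 := by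
  have := (hasDerivAt_line x v).norm_sq
  simpa using this

lemma hasDerivAt_line_inner : HasDerivAt (fun s : ℝ => (inner ℝ (x + s • v) (v + s • K) : ℝ))
    (‖v‖ ^ 2 + inner ℝ x K) 0 := by
  have := (hasDerivAt_line x v).inner ℝ (hasDerivAt_line v K)
  simp only [zero_smul, add_zero, real_inner_self_eq_norm_sq] at this
  rwa [add_comm] at this

lemma hasDerivAt_line_inv_norm (c : ℝ) (hx : x ≠ 0) :
    HasDerivAt (fun s : ℝ => c / ‖x + s • v‖) (-(c / ‖x‖ ^ 3) * inner ℝ x v) 0 := by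
  have h1 := (hasFDerivAt_const_div_norm c hx)
  have h2 := h1.hasLineDerivAt v
  simpa [HasLineDerivAt] using h2

/-- The derivative of `L` along a direction `(v, K)` only sees the component of `K` orthogonal to
`x`, so a central force does not change `L`. -/
lemma hasDerivAt_line_angMom : HasDerivAt (fun s : ℝ => angMom (x + s • v, v + s • K))
    (2 * inner ℝ (perp x v) K) 0 := by
  have h := ((hasDerivAt_line_norm_sq x v).mul (hasDerivAt_line_norm_sq v K)).sub
    ((hasDerivAt_line_inner x v K).pow 2)
  simp only [zero_smul, add_zero] at h
  unfold angMom
  refine h.congr_deriv ?_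
  simp only [perp, inner_sub_left, inner_smul_left, RCLike.conj_to_real]
  ring

end lines

lemma inner_perp_self (x v : Space) : (inner ℝ (perp x v) x : ℝ) = 0 := by
  simp only [perp, inner_sub_left, inner_smul_left, RCLike.conj_to_real,
    real_inner_self_eq_norm_sq, real_inner_comm x v]
  ring

lemma abs_inner_perp_le (x v w : Space) :
    |(inner ℝ (perp x v) w : ℝ)| ≤ ‖x‖ * √(angMom (x, v)) * ‖w‖ := by
  refine (abs_real_inner_le_norm _ _).trans (le_of_eq ?_)
  congr 1
  rw [← Real.sqrt_sq (norm_nonneg (perp x v)), norm_perp_sq, Real.sqrt_mul (by positivity),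
    Real.sqrt_sq (norm_nonneg x)]

/-! ### Phase-space volume near vanishing angular momentum -/

lemma exists_isometry_map (x : Space) :
    ∃ A : Space ≃ₗᵢ[ℝ] Space, A x = ‖x‖ • EuclideanSpace.single 0 (1 : ℝ) := by
  -- the reflection that exchanges `x` with the multiple of the basis vector of the same length
  refine ⟨Submodule.reflection (ℝ ∙ (x - ‖x‖ • EuclideanSpace.single 0 (1 : ℝ)))ᗮ, ?_⟩
  refine Submodule.reflection_sub ?_
  simp [norm_smul]

/-- For fixed `x` the velocities with `L ≤ s²` form a cylinder of radius `s / |x|` around the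
axis `ℝ x`; its part in `|v| ≤ V` fits into a box. -/
lemma volume_cylinder_le {x : Space} (hx : x ≠ 0) {s V : ℝ} (hs : 0 ≤ s) (hV : 0 ≤ V) :
    volume {v : Space | angMom (x, v) ≤ s ^ 2 ∧ ‖v‖ ≤ V}
      ≤ ENNReal.ofReal (8 * V * (s / ‖x‖) ^ 2) := by
  have hx' : 0 < ‖x‖ := norm_pos_iff.2 hx
  obtain ⟨A, hA⟩ := exists_isometry_map x
  set Q : Set (Fin 3 → ℝ) := Icc ![-V, -(s / ‖x‖), -(s / ‖x‖)] ![V, s / ‖x‖, s / ‖x‖] with hQ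
  set Q' : Set Space := (MeasurableEquiv.toLp 2 (Fin 3 → ℝ)).symm ⁻¹' Q with hQ'
  have hvol : volume Q' = ENNReal.ofReal (8 * V * (s / ‖x‖) ^ 2) := by
    rw [hQ', (EuclideanSpace.volume_preserving_symm_measurableEquiv_toLp (Fin 3)).measure_preimage
      measurableSet_Icc.nullMeasurableSet, Real.volume_Icc_pi]
    simp only [Fin.prod_univ_three, Matrix.cons_val_zero, Matrix.cons_val_one, Matrix.cons_val]
    have : 0 ≤ s / ‖x‖ := by positivity
    rw [← ENNReal.ofReal_mul (by linarith), ← ENNReal.ofReal_mul (by nlinarith)]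
    congr 1; ring
  rw [← hvol]
  have hpre : {v : Space | angMom (x, v) ≤ s ^ 2 ∧ ‖v‖ ≤ V} ⊆ A ⁻¹' Q' := by
    rintro v ⟨h1, h2⟩
    set w := A v with hw
    have h3 : ‖w‖ ≤ V := by rw [hw, A.norm_map]; exact h2
    have h4 : angMom (‖x‖ • EuclideanSpace.single 0 (1 : ℝ), w) ≤ s ^ 2 := by
      rw [← hA, hw]
      exact (angMom_map A (x, v)).trans_le h1
    have h5 : ‖w‖ ^ 2 = w 0 ^ 2 + w 1 ^ 2 + w 2 ^ 2 := by
      rw [EuclideanSpace.norm_sq_eq, Fin.sum_univ_three]; simp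
    have h6 : angMom (‖x‖ • EuclideanSpace.single 0 (1 : ℝ), w) = ‖x‖ ^ 2 * (w 1 ^ 2 + w 2 ^ 2) := by
      have := angMom_smul ‖x‖ 1 (EuclideanSpace.single 0 (1 : ℝ), w)
      simp only [one_smul] at this
      rw [this]
      have h8 : (inner ℝ (EuclideanSpace.single 0 (1 : ℝ)) w : ℝ) = w 0 := by
        simp [EuclideanSpace.inner_single_left]
      simp only [angMom, h5, h8]
      simp only [PiLp.norm_single, norm_one]
      ring
    rw [h6] at h4
    have h7 : w 1 ^ 2 + w 2 ^ 2 ≤ (s / ‖x‖) ^ 2 := by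
      rw [div_pow, le_div_iff₀ (by positivity)]; linarith
    have hsx : 0 ≤ s / ‖x‖ := by positivity
    have h9 : ‖w‖ ^ 2 ≤ V ^ 2 := by gcongr
    have hs0 : (w 0 : ℝ) ^ 2 ≤ V ^ 2 := by nlinarith [sq_nonneg (w 1), sq_nonneg (w 2)]
    have hs1 : (w 1 : ℝ) ^ 2 ≤ (s / ‖x‖) ^ 2 := by nlinarith [sq_nonneg (w 2)]
    have hs2 : (w 2 : ℝ) ^ 2 ≤ (s / ‖x‖) ^ 2 := by nlinarith [sq_nonneg (w 1)]
    have hc0 : |(w 0 : ℝ)| ≤ V := abs_le_of_sq_le_sq hs0 hV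
    have hc1 : |(w 1 : ℝ)| ≤ s / ‖x‖ := abs_le_of_sq_le_sq hs1 hsx
    have hc2 : |(w 2 : ℝ)| ≤ s / ‖x‖ := abs_le_of_sq_le_sq hs2 hsx
    rw [abs_le] at hc0 hc1 hc2
    have hgoal : (fun i => w i) ∈ Q := by
      rw [hQ, mem_Icc, Pi.le_def, Pi.le_def]
      constructor
      · intro i; fin_cases i
        · exact hc0.1
        · exact hc1.1
        · exact hc2.1
      · intro i; fin_cases i
        · exact hc0.2
        · exact hc1.2
        · exact hc2.2
    exact hgoal
  refine (measure_mono hpre).trans (le_of_eq ?_)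
  have hQm : MeasurableSet Q' :=
    (MeasurableEquiv.toLp 2 (Fin 3 → ℝ)).symm.measurable measurableSet_Icc
  exact A.measurePreserving.measure_preimage hQm.nullMeasurableSet

/-- The region of phase space accessible from bounded energy: `|x| ≤ R` and
`|v|² ≤ C (1 + 1/|x|)`. -/
def boundedRegion (R C : ℝ) : Set Phase := {z | ‖z.1‖ ≤ R ∧ ‖z.2‖ ^ 2 ≤ C * (1 + 1 / ‖z.1‖)}

lemma measurableSet_boundedRegion (R C : ℝ) : MeasurableSet (boundedRegion R C) := by
  have h1 : Measurable (fun z : Phase => ‖z.1‖) := by fun_prop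
  have h2 : Measurable (fun z : Phase => ‖z.2‖ ^ 2) := by fun_prop
  exact (measurableSet_le h1 measurable_const).inter
    (measurableSet_le h2 (((h1.const_div 1).const_add 1).const_mul C))

/-- The part of `boundedRegion R C` with `L ≤ η` has volume `O(η)`: the fibre over `x` has volume at
most a multiple of `(1 + |x|^(-1/2)) η / |x|²`, which is integrable over `|x| ≤ R` in `ℝ³`. -/
lemma exists_volume_boundedRegion_le (R C : ℝ) (hC : 0 ≤ C) :
    ∃ D, 0 ≤ D ∧ ∀ η, 0 ≤ η →
      volume (boundedRegion R C ∩ {z | angMom z ≤ η}) ≤ ENNReal.ofReal (D * η) := by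
  set w : ℝ → ℝ := fun r => (Ioc 0 R).indicator (fun r => √C * (1 + r ^ (-(1 / 2) : ℝ)) / r ^ 2) r
    with hw
  have hw0 : ∀ r, 0 ≤ w r := by
    intro r
    refine indicator_nonneg (fun r hr => ?_) r
    have := hr.1
    positivity
  have hint : Integrable (fun x : Space => w ‖x‖) := by
    rw [integrable_radial]
    have h1 : IntegrableOn (fun r : ℝ => √C * (1 + r ^ (-(1 / 2) : ℝ))) (Ioc 0 R) := by
      rcases le_total 0 R with h | h
      · have h2 : IntervalIntegrable (fun r : ℝ => r ^ (-(1 / 2) : ℝ)) volume 0 R :=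
          intervalIntegral.intervalIntegrable_rpow' (by norm_num)
        have h3 := (intervalIntegrable_iff_integrableOn_Ioc_of_le h).1 h2
        exact ((integrableOn_const (by simp)).add h3).const_mul _
      · rw [Ioc_eq_empty (by linarith)]; exact integrableOn_empty
    have h2 : (fun r : ℝ => r ^ 2 * w r)
        = (Ioc 0 R).indicator (fun r => √C * (1 + r ^ (-(1 / 2) : ℝ))) := by
      ext r
      simp only [hw, indicator]
      split_ifs with h
      · have := h.1
        field_simp
      · simp
    rw [h2]
    exact ((integrable_indicator_iff measurableSet_Ioc).2 h1).integrableOn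
  refine ⟨8 * ∫ x : Space, w ‖x‖, mul_nonneg (by norm_num) (integral_nonneg fun x => hw0 _),
    fun η hη => ?_⟩
  have hm : MeasurableSet (boundedRegion R C ∩ {z | angMom z ≤ η}) :=
    (measurableSet_boundedRegion R C).inter
      (measurableSet_le continuous_angMom.measurable measurable_const)
  rw [volume_phase, Measure.prod_apply hm]
  have hle : ∀ᵐ x : Space, volume (Prod.mk x ⁻¹' (boundedRegion R C ∩ {z | angMom z ≤ η}))
      ≤ ENNReal.ofReal (8 * η * w ‖x‖) := by
    have hne : ∀ᵐ x : Space, x ≠ 0 := by simp [ae_iff]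
    filter_upwards [hne] with x hx
    have hx' : 0 < ‖x‖ := norm_pos_iff.2 hx
    by_cases hR : ‖x‖ ≤ R
    · set V := √C * (1 + ‖x‖ ^ (-(1 / 2) : ℝ)) with hV
      have hp : 0 ≤ ‖x‖ ^ (-(1 / 2) : ℝ) := Real.rpow_nonneg hx'.le _
      have hV0 : 0 ≤ V := by positivity
      have hsub : Prod.mk x ⁻¹' (boundedRegion R C ∩ {z | angMom z ≤ η})
          ⊆ {v | angMom (x, v) ≤ √η ^ 2 ∧ ‖v‖ ≤ V} := by
        rintro v ⟨⟨-, h2⟩, h3⟩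
        refine ⟨by rw [Real.sq_sqrt hη]; exact h3, ?_⟩
        have h4 : ‖v‖ ^ 2 ≤ C * (1 + 1 / ‖x‖) := h2
        refine abs_le_of_sq_le_sq' ?_ hV0 |>.2
        have h5 : (‖x‖ ^ (-(1 / 2) : ℝ)) ^ 2 = 1 / ‖x‖ := by
          rw [← Real.rpow_natCast, ← Real.rpow_mul hx'.le]
          norm_num [Real.rpow_neg_one]
        have h6 : V ^ 2 = C * (1 + 2 * ‖x‖ ^ (-(1 / 2) : ℝ) + 1 / ‖x‖) := by
          rw [hV, mul_pow, Real.sq_sqrt hC, ← h5]; ring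
        rw [h6]
        refine h4.trans (mul_le_mul_of_nonneg_left (by linarith) hC)
      refine (measure_mono hsub).trans ((volume_cylinder_le hx (Real.sqrt_nonneg _) hV0).trans
        (ENNReal.ofReal_le_ofReal (le_of_eq ?_)))
      have : w ‖x‖ = V / ‖x‖ ^ 2 := indicator_of_mem (show ‖x‖ ∈ Ioc 0 R from ⟨hx', hR⟩) _
      rw [this, div_pow, Real.sq_sqrt hη]
      ring
    · have : Prod.mk x ⁻¹' (boundedRegion R C ∩ {z | angMom z ≤ η}) = ∅ := by
        ext v
        simp only [mem_preimage, mem_inter_iff, mem_empty_iff_false, iff_false]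
        rintro ⟨⟨h1, -⟩, -⟩
        exact hR h1
      rw [this, measure_empty]
      exact zero_le
  refine (lintegral_mono_ae hle).trans (le_of_eq ?_)
  rw [← ofReal_integral_eq_lintegral_ofReal (hint.const_mul _)
    (ae_of_all _ fun x => mul_nonneg (by positivity) (hw0 _)), integral_const_mul]
  congr 1; ring

/-! ### Barriers for the support of a solution -/

lemma fderiv_angMom (t : ℝ) (x v K : Space) :
    fderiv ℝ (fun p : ℝ × Phase => angMom p.2) (t, (x, v)) (1, v, K)
      = 2 * inner ℝ (perp x v) K := by
  refine fderiv_apply_of_line ?_ ?_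
  · exact ((contDiff_angMom.comp contDiff_snd).differentiable one_ne_zero).differentiableAt
  · simpa using hasDerivAt_line_angMom x v K

lemma deriv_smoothTransition_eq_zero {s : ℝ} (hs : s < 0 ∨ 1 < s) :
    deriv Real.smoothTransition s = 0 := by
  rcases hs with hs | hs
  · have : Real.smoothTransition =ᶠ[𝓝 s] fun _ => 0 := by
      filter_upwards [Iio_mem_nhds hs] with y hy
      exact Real.smoothTransition.zero_of_nonpos (le_of_lt hy)
    rw [this.deriv_eq]; simp
  · have : Real.smoothTransition =ᶠ[𝓝 s] fun _ => 1 := by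
      filter_upwards [Ioi_mem_nhds hs] with y hy
      exact Real.smoothTransition.one_of_one_le (le_of_lt hy)
    rw [this.deriv_eq]; simp

lemma exists_abs_deriv_smoothTransition_le :
    ∃ C, 0 ≤ C ∧ ∀ s, |deriv Real.smoothTransition s| ≤ C := by
  have hc : Continuous (deriv Real.smoothTransition) :=
    (Real.smoothTransition.contDiff (n := 1)).continuous_deriv le_rfl
  obtain ⟨C, hC⟩ := isCompact_Icc.exists_bound_of_continuousOn (s := Icc (0 : ℝ) 1) hc.continuousOn
  refine ⟨max C 0, le_max_right _ _, fun s => ?_⟩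
  by_cases hs : s ∈ Icc (0 : ℝ) 1
  · exact (hC s hs).trans (le_max_left _ _)
  · rw [deriv_smoothTransition_eq_zero, abs_zero]
    · exact le_max_right _ _
    · simp only [mem_Icc, not_and_or, not_le] at hs
      exact hs

lemma smoothTransition_mono : Monotone Real.smoothTransition := Real.smoothTransition.monotone

/-- A saturated square, used to make a solution integrable on bounded regions. -/
def saturate (y : ℝ) : ℝ := y ^ 2 / (1 + y ^ 2)

lemma saturate_nonneg (y : ℝ) : 0 ≤ saturate y := by unfold saturate; positivity

lemma saturate_le_one (y : ℝ) : saturate y ≤ 1 := by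
  unfold saturate
  rw [div_le_one (by positivity)]; linarith

lemma saturate_eq_zero {y : ℝ} : saturate y = 0 ↔ y = 0 := by
  unfold saturate
  have : 1 + y ^ 2 ≠ 0 := by positivity
  simp [this]

lemma contDiff_saturate : ContDiff ℝ 1 saturate := by
  unfold saturate
  exact (contDiff_id.pow 2).div (contDiff_const.add (contDiff_id.pow 2)) fun x => by positivity

lemma isCompact_angMom_ge (η R V : ℝ) :
    IsCompact {z : Phase | η ≤ angMom z ∧ ‖z.1‖ ≤ R ∧ ‖z.2‖ ≤ V} := by
  have hsub : {z : Phase | η ≤ angMom z ∧ ‖z.1‖ ≤ R ∧ ‖z.2‖ ≤ V}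
      ⊆ Metric.closedBall (0 : Space) R ×ˢ Metric.closedBall (0 : Space) V := by
    rintro z ⟨-, h1, h2⟩
    exact ⟨by simpa using h1, by simpa using h2⟩
  refine ((isCompact_closedBall (0 : Space) R).prod (isCompact_closedBall (0 : Space) V)).of_isClosed_subset
    ?_ hsub
  exact (isClosed_le continuous_const continuous_angMom).inter
    ((isClosed_le continuous_fst.norm continuous_const).inter
      (isClosed_le continuous_snd.norm continuous_const))

/-- In `boundedRegion R C`, a lower bound on the angular momentum bounds the velocity. -/
lemma norm_snd_le_of_boundedRegion {R C η : ℝ} (hC : 0 ≤ C) (hη : 0 < η) {z : Phase}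
    (hz : z ∈ boundedRegion R C) (hL : η ≤ angMom z) : ‖z.2‖ ≤ C * (1 + 1 / √η) + 1 := by
  have hz1 : z.1 ≠ 0 := fst_ne_zero_of_angMom_pos (hη.trans_le hL)
  have hx : 0 < ‖z.1‖ := norm_pos_iff.2 hz1
  have h1 : √η ≤ ‖z.1‖ * ‖z.2‖ := by
    refine Real.sqrt_le_iff.2 ⟨by positivity, hL.trans ((angMom_le z).trans (le_of_eq ?_))⟩
    ring
  have hs : 0 < √η := Real.sqrt_pos.2 hη
  have h2 : 1 / ‖z.1‖ ≤ ‖z.2‖ / √η := by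
    rw [div_le_div_iff₀ hx hs]; linarith
  have h3 : ‖z.2‖ ^ 2 ≤ C * (1 + 1 / ‖z.1‖) := hz.2
  by_contra! h4
  have hv : 1 < ‖z.2‖ := by
    have : 0 ≤ C * (1 + 1 / √η) := by positivity
    linarith
  have h5 : C * (1 + 1 / ‖z.1‖) ≤ C * (1 + 1 / √η) * ‖z.2‖ := by
    have : 1 + 1 / ‖z.1‖ ≤ (1 + 1 / √η) * ‖z.2‖ := by
      have : (1 + 1 / √η) * ‖z.2‖ = ‖z.2‖ + ‖z.2‖ / √η := by ring
      linarith
    rw [mul_assoc]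
    exact mul_le_mul_of_nonneg_left this hC
  nlinarith

section barrier
variable {Mc : ℝ} {f : ℝ → Phase → ℝ} {U : ℝ → Space → ℝ}

/-- The angular momentum changes only through the self-consistent force. -/
lemma IsSolution.abs_fderiv_angMom_le (hf : IsSolution Mc f U) {t : ℝ} (ht : 0 ≤ t) {z : Phase}
    (hz : z.1 ≠ 0) :
    |fderiv ℝ (fun p : ℝ × Phase => angMom p.2) (t, z) (1, z.2, force Mc U t z.1)|
      ≤ 2 * (‖z.1‖ * √(angMom z) * ‖gradient (U t) z.1‖) := by
  obtain ⟨x, v⟩ := z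
  rw [fderiv_angMom, hf.force_eq ht hz, inner_sub_right, inner_smul_right, inner_perp_self,
    inner_neg_right, mul_zero, sub_zero, abs_mul, abs_neg, abs_two]
  have := abs_inner_perp_le x v (gradient (U t) x)
  simp only at this ⊢
  linarith

/-- Quantitative form of the barrier principle `IsSolution.barrier`: the integral of `θ` against
a saturated square of `f`, cut off at angular momentum of order `η`, is `O(√η)`.  The cutoff
`G η` is transported with an error supported in `η ≤ L ≤ 2 η`, of size `η⁻¹ √η` on a set of
volume `O(η)`. -/
lemma IsSolution.barrier_aux (hf : IsSolution Mc f U) {a b B R C Cθ : ℝ} (ha : 0 ≤ a)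
    (hab : a ≤ b) (hC : 0 ≤ C) (hB0 : 0 ≤ B) (hR : 0 ≤ R) (hCθ : 0 ≤ Cθ)
    (hB : ∀ t ∈ Icc a b, ∀ x, ‖gradient (U t) x‖ ≤ B) {θ : ℝ × Phase → ℝ}
    (hθ : ∀ p, p.2.1 ≠ 0 → ContDiffAt ℝ 1 θ p) (hθ0 : ∀ p, 0 ≤ θ p)
    (hθb : ∀ t ∈ Icc a b, ∀ z, 0 < angMom z → θ (t, z) ≤ Cθ)
    (hsupp : ∀ t ∈ Icc a b, ∀ z, 0 < angMom z → f t z ≠ 0 → z ∉ boundedRegion R C → θ (t, z) = 0)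
    (hD : ∀ t ∈ Ioo a b, ∀ z, 0 < angMom z → f t z ≠ 0 →
      fderiv ℝ θ (t, z) (1, z.2, force Mc U t z.1) ≤ 0)
    (hinit : ∀ z, 0 < angMom z → f a z * θ (a, z) = 0)
    {Cχ : ℝ} (hCχ : ∀ s, |deriv Real.smoothTransition s| ≤ Cχ)
    {D : ℝ} (hD0 : 0 ≤ D) (hvol : ∀ η, 0 ≤ η →
      volume (boundedRegion R C ∩ {z | angMom z ≤ η}) ≤ ENNReal.ofReal (D * η))
    {G : ℝ → ℝ × Phase → ℝ} (hG : ∀ η p, G η p = Real.smoothTransition (angMom p.2 / η - 1) *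
      (θ p * saturate (joint f p))) {η : ℝ} (hη : 0 < η) :
    (∀ z, z ∉ {z : Phase | η ≤ angMom z ∧ ‖z.1‖ ≤ R ∧ ‖z.2‖ ≤ C * (1 + 1 / √η) + 1} →
      ∀ t ∈ Icc a b, G η (t, z) = 0) ∧ ContinuousOn (G η) (Icc a b ×ˢ univ) ∧
    ∫ z, G η (b, z) ≤ Cχ * η⁻¹ * (2 * (R * √(2 * η) * B)) * Cθ * (D * (2 * η)) * (b - a) := by
  set S := {z : Phase | η ≤ angMom z ∧ ‖z.1‖ ≤ R ∧ ‖z.2‖ ≤ C * (1 + 1 / √η) + 1} with hS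
  have hCχ0 : 0 ≤ Cχ := (abs_nonneg _).trans (hCχ 0)
  have hS0 : ∀ z ∈ S, z.1 ≠ 0 := fun z hz => fst_ne_zero_of_angMom_pos (hη.trans_le hz.1)
  have hchi0 : ∀ z : Phase, angMom z ≤ η → Real.smoothTransition (angMom z / η - 1) = 0 := by
    intro z hz
    refine Real.smoothTransition.zero_of_nonpos ?_
    rw [sub_nonpos, div_le_one hη]; exact hz
  have h0 : ∀ z ∉ S, ∀ t ∈ Icc a b, G η (t, z) = 0 := by
    intro z hz t ht
    rw [hG]
    by_cases h1 : η ≤ angMom z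
    · by_cases h2 : f t z = 0
      · have : saturate (joint f (t, z)) = 0 := saturate_eq_zero.2 h2
        rw [this]; ring
      · have h3 : z ∉ boundedRegion R C := fun h =>
          hz ⟨h1, h.1, norm_snd_le_of_boundedRegion hC hη h h1⟩
        rw [hsupp t ht z (hη.trans_le h1) h2 h3]; ring
    · rw [hchi0 z (le_of_not_ge h1)]; ring
  have hGloc : ∀ p : ℝ × Phase, p.2.1 = 0 → G η =ᶠ[𝓝 p] fun _ => 0 := by
    intro p hp
    have hc : Continuous (fun p : ℝ × Phase => angMom p.2) := continuous_angMom.comp continuous_snd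
    have hlt : angMom p.2 < η := by
      have : angMom p.2 = 0 := by simp [angMom, hp]
      rw [this]; exact hη
    filter_upwards [hc.continuousAt.eventually (Iio_mem_nhds hlt)] with q hq
    rw [hG, hchi0 _ (le_of_lt hq)]; ring
  have hGe : G η = fun p : ℝ × Phase => Real.smoothTransition (angMom p.2 / η - 1) *
      (θ p * saturate (joint f p)) := funext (hG η)
  have hX : ContDiff ℝ 1 (fun p : ℝ × Phase => Real.smoothTransition (angMom p.2 / η - 1)) :=
    Real.smoothTransition.contDiff.comp
      (((contDiff_angMom.comp contDiff_snd).div_const η).sub contDiff_const)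
  have hcont : ContinuousOn (G η) (Icc a b ×ˢ univ) := by
    intro p hp
    by_cases h1 : p.2.1 = 0
    · exact ((hGloc p h1).continuousAt).continuousWithinAt
    · rw [hGe]
      refine hX.continuous.continuousWithinAt.mul
        ((hθ p h1).continuousAt.continuousWithinAt.mul ?_)
      exact contDiff_saturate.continuous.continuousAt.comp_continuousWithinAt
        ((hf.continuousOn p ⟨ha.trans hp.1.1, mem_univ _⟩).mono
          (prod_mono (fun t ht => ha.trans ht.1) subset_rfl))
  have hcd : ContDiffOn ℝ 1 (G η) (Ioo a b ×ˢ univ) := by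
    intro p hp
    refine ContDiffAt.contDiffWithinAt ?_
    by_cases h1 : p.2.1 = 0
    · exact contDiffAt_const.congr_of_eventuallyEq (hGloc p h1)
    · rw [hGe]
      exact hX.contDiffAt.mul ((hθ p h1).mul
        (contDiff_saturate.contDiffAt.comp p (hf.contDiffAt (ha.trans_lt hp.1.1) p.2)))
  refine ⟨h0, hcont, ?_⟩
  -- initially `f` or `θ` vanishes at each point of positive angular momentum
  have hinit0 : ∫ z, G η (a, z) = 0 := by
    refine integral_eq_zero_of_ae (ae_of_all _ fun z => ?_)
    change G η (a, z) = 0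
    rw [hG]
    by_cases h1 : η ≤ angMom z
    · rcases mul_eq_zero.1 (hinit z (hη.trans_le h1)) with h | h
      · have : saturate (joint f (a, z)) = 0 := saturate_eq_zero.2 h
        rw [this]; simp
      · rw [h]; simp
    · rw [hchi0 z (le_of_not_ge h1)]; simp
  set A := boundedRegion R C ∩ {z : Phase | angMom z ≤ 2 * η} with hA
  set E := Cχ * η⁻¹ * (2 * (R * √(2 * η) * B)) * Cθ with hE
  have hE0 : 0 ≤ E := by positivity
  have hmA : MeasurableSet A := (measurableSet_boundedRegion R C).inter
      (measurableSet_le continuous_angMom.measurable measurable_const)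
  have hvA : volume A ≤ ENNReal.ofReal (D * (2 * η)) := hvol _ (by positivity)
  have hpt : ∀ t ∈ Ioo a b, ∀ z, fderiv ℝ (G η) (t, z) (1, z.2, force Mc U t z.1)
      ≤ A.indicator (fun _ => E) z := by
    intro t ht z
    have hind : 0 ≤ A.indicator (fun _ => E) z := indicator_nonneg (fun _ _ => hE0) z
    have ht0 : 0 < t := ha.trans_lt ht.1
    by_cases hz0 : z.1 = 0
    · rw [(hGloc (t, z) hz0).fderiv_eq]; simpa using hind
    set u : ℝ × Phase := (1, z.2, force Mc U t z.1) with hu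
    have hdX := (hX.differentiable one_ne_zero (t, z)).hasFDerivAt
    have hdθ := ((hθ (t, z) hz0).differentiableAt one_ne_zero).hasFDerivAt
    have hdf := ((hf.contDiffAt ht0 z).differentiableAt one_ne_zero).hasFDerivAt
    have hdw := ((contDiff_saturate.differentiable one_ne_zero _).hasDerivAt).comp_hasFDerivAt
      (t, z) hdf
    have hdG := hdX.mul (hdθ.mul hdw)
    rw [show ((fun p : ℝ × Phase => Real.smoothTransition (angMom p.2 / η - 1)) *
      (θ * saturate ∘ joint f)) = G η from hGe.symm] at hdG
    rw [hdG.fderiv]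
    have hchar := hf.characteristic ht0 hz0
    rw [← hu] at hchar
    simp only [add_apply, smul_apply, smul_eq_mul, hchar, mul_zero, zero_add, Function.comp,
      Pi.mul_apply]
    have hd2 := (Real.smoothTransition.contDiff (n := 1)).differentiable one_ne_zero
      (angMom z / η - 1)
    have hdL : HasFDerivAt (fun p : ℝ × Phase => angMom p.2 / η - 1)
        (η⁻¹ • fderiv ℝ (fun p : ℝ × Phase => angMom p.2) (t, z)) (t, z) := by
      have h1 : HasFDerivAt (fun p : ℝ × Phase => angMom p.2)
          (fderiv ℝ (fun p : ℝ × Phase => angMom p.2) (t, z)) (t, z) :=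
        (((contDiff_angMom.comp contDiff_snd).differentiable one_ne_zero) (t, z)).hasFDerivAt
      simpa [div_eq_inv_mul] using (h1.const_mul η⁻¹).sub_const 1
    have hX' : fderiv ℝ (fun p : ℝ × Phase => Real.smoothTransition (angMom p.2 / η - 1)) (t, z) u
        = deriv Real.smoothTransition (angMom z / η - 1) *
          (η⁻¹ * fderiv ℝ (fun p : ℝ × Phase => angMom p.2) (t, z) u) := by
      have h1 := HasDerivAt.comp_hasFDerivAt (t, z) hd2.hasDerivAt hdL
      have h2 : fderiv ℝ (fun p : ℝ × Phase => Real.smoothTransition (angMom p.2 / η - 1)) (t, z)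
        = _ := h1.fderiv
      rw [h2]; simp
    by_cases hf0 : f t z = 0
    · have : saturate (joint f (t, z)) = 0 := saturate_eq_zero.2 hf0
      rw [this]; simpa using hind
    by_cases hLp : angMom z < η
    · have h1 : angMom z / η - 1 < 0 := by
        rw [sub_neg, div_lt_one hη]; exact hLp
      rw [hX', deriv_smoothTransition_eq_zero (Or.inl h1), hchi0 z hLp.le]
      simpa using hind
    have hLp' : 0 < angMom z := hη.trans_le (not_lt.1 hLp)
    have hDθ := hD t ht z hLp' hf0
    -- the derivative falls on the cutoff or on `θ`, as `f` is constant along characteristics; the second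
    -- term has a good sign, the first one is supported in `η ≤ L ≤ 2 η`
    have hfirst : Real.smoothTransition (angMom z / η - 1) *
        (saturate (joint f (t, z)) * fderiv ℝ θ (t, z) u) ≤ 0 :=
      mul_nonpos_of_nonneg_of_nonpos (Real.smoothTransition.nonneg _)
        (mul_nonpos_of_nonneg_of_nonpos (saturate_nonneg _) hDθ)
    refine (add_le_add_left hfirst _).trans ?_
    rw [zero_add, hX']
    have ht' : t ∈ Icc a b := Ioo_subset_Icc_self ht
    by_cases hzA : z ∈ A
    · rw [indicator_of_mem hzA]
      have h1 := hf.abs_fderiv_angMom_le ht0.le hz0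
      rw [← hu] at h1
      have h2 : |fderiv ℝ (fun p : ℝ × Phase => angMom p.2) (t, z) u|
          ≤ 2 * (R * √(2 * η) * B) := by
        refine h1.trans ?_
        have h3 : ‖z.1‖ ≤ R := hzA.1.1
        have h4 : √(angMom z) ≤ √(2 * η) := Real.sqrt_le_sqrt hzA.2
        have h5 := hB t ht' z.1
        gcongr
      have h3 : |deriv Real.smoothTransition (angMom z / η - 1) *
          (η⁻¹ * fderiv ℝ (fun p : ℝ × Phase => angMom p.2) (t, z) u)|
          ≤ Cχ * (η⁻¹ * (2 * (R * √(2 * η) * B))) := by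
        rw [abs_mul, abs_mul, abs_of_pos (inv_pos.2 hη)]
        have := hCχ (angMom z / η - 1)
        gcongr
      have h4 : θ (t, z) * saturate (joint f (t, z)) ≤ Cθ :=
        (mul_le_of_le_one_right (hθ0 _) (saturate_le_one _)).trans (hθb t ht' z hLp')
      have h5 : 0 ≤ θ (t, z) * saturate (joint f (t, z)) :=
        mul_nonneg (hθ0 _) (saturate_nonneg _)
      calc _ ≤ θ (t, z) * saturate (joint f (t, z)) *
          |deriv Real.smoothTransition (angMom z / η - 1) *
          (η⁻¹ * fderiv ℝ (fun p : ℝ × Phase => angMom p.2) (t, z) u)| :=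
            mul_le_mul_of_nonneg_left (le_abs_self _) h5
        _ ≤ Cθ * (Cχ * (η⁻¹ * (2 * (R * √(2 * η) * B)))) := by gcongr
        _ = E := by rw [hE]; ring
    · rw [indicator_of_notMem hzA]
      by_cases hL2 : angMom z ≤ 2 * η
      · have : z ∉ boundedRegion R C := fun h => hzA ⟨h, hL2⟩
        rw [hsupp t ht' z hLp' hf0 this]; simp
      · have h1 : 1 < angMom z / η - 1 := by
          rw [lt_sub_iff_add_lt, lt_div_iff₀ hη]; linarith
        rw [deriv_smoothTransition_eq_zero (Or.inr h1)]; simp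
  have hAfin : volume A ≠ ⊤ := (hvA.trans_lt ENNReal.ofReal_lt_top).ne
  have hbd : volume.real A ≤ D * (2 * η) :=
    ENNReal.toReal_le_of_le_ofReal (by positivity) hvA
  have key := transport_le (K := force Mc U) (C := E * (D * (2 * η))) hab
    (isCompact_angMom_ge η R (C * (1 + 1 / √η) + 1)) hS0 hcont hcd
    (fun t ht z hz => h0 z hz t ht)
    (fun t ht => hf.continuousOn_force (ha.trans ht.1.le)) (fun t ht hi => by
      have hiA : Integrable (A.indicator (fun _ : Phase => E)) :=
        (integrable_indicator_iff hmA).2 (integrableOn_const hAfin)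
      refine (integral_mono hi hiA (hpt t ht)).trans ?_
      rw [integral_indicator hmA, setIntegral_const, smul_eq_mul, mul_comm]
      exact mul_le_mul_of_nonneg_left hbd hE0)
  rw [hinit0, zero_add] at key
  exact key

/-- **Barrier principle.** A nonnegative function `θ` that decreases along characteristics and
vanishes on the initial support vanishes on the support of the solution at later times, as far as
the angular momentum is positive.  The singular set of small angular momentum is harmless, since it
is transported slowly (`|D L| ≤ C √L`) and has small volume. -/
lemma IsSolution.barrier (hf : IsSolution Mc f U) {a b B R C Cθ : ℝ} (ha : 0 ≤ a)
    (hC : 0 ≤ C) (hR : 0 ≤ R)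
    (hB : ∀ t ∈ Icc a b, ∀ x, ‖gradient (U t) x‖ ≤ B) {θ : ℝ × Phase → ℝ}
    (hθ : ∀ p, p.2.1 ≠ 0 → ContDiffAt ℝ 1 θ p) (hθ0 : ∀ p, 0 ≤ θ p)
    (hθb : ∀ t ∈ Icc a b, ∀ z, 0 < angMom z → θ (t, z) ≤ Cθ)
    (hsupp : ∀ t ∈ Icc a b, ∀ z, 0 < angMom z → f t z ≠ 0 → z ∉ boundedRegion R C → θ (t, z) = 0)
    (hD : ∀ t ∈ Ioo a b, ∀ z, 0 < angMom z → f t z ≠ 0 →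
      fderiv ℝ θ (t, z) (1, z.2, force Mc U t z.1) ≤ 0)
    (hinit : ∀ z, 0 < angMom z → f a z * θ (a, z) = 0) {t : ℝ} (ht : t ∈ Icc a b) {z : Phase}
    (hz : 0 < angMom z) : f t z * θ (t, z) = 0 := by
  by_contra hne
  have hB0 : 0 ≤ B := (norm_nonneg _).trans (hB t ht 0)
  have hCθ : 0 ≤ Cθ := (hθ0 _).trans (hθb t ht z hz)
  obtain ⟨Cχ, -, hCχ⟩ := exists_abs_deriv_smoothTransition_le
  obtain ⟨D, hD0, hvol⟩ := exists_volume_boundedRegion_le R C hC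
  set G : ℝ → ℝ × Phase → ℝ := fun η p => Real.smoothTransition (angMom p.2 / η - 1) *
      (θ p * saturate (joint f p)) with hG
  have hsub : ∀ s ∈ Icc a t, s ∈ Icc a b := fun s hs => ⟨hs.1, hs.2.trans ht.2⟩
  have H : ∀ η : ℝ, 0 < η → _ := fun η hη => hf.barrier_aux ha ht.1 hC hB0 hR hCθ
    (fun s hs => hB s (hsub s hs)) hθ hθ0 (fun s hs => hθb s (hsub s hs))
    (fun s hs => hsupp s (hsub s hs)) (fun s hs => hD s ⟨hs.1, hs.2.trans_le ht.2⟩) hinit hCχ hD0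
    hvol (G := G) (fun η p => rfl) (η := η) hη
  have hta : t ∈ Icc a t := ⟨ht.1, le_rfl⟩
  have hGc : ∀ η, 0 < η → Continuous (fun z => G η (t, z)) := fun η hη =>
    (H η hη).2.1.comp_continuous (by fun_prop) fun z => ⟨hta, mem_univ _⟩
  have hGs : ∀ η, 0 < η → HasCompactSupport (fun z => G η (t, z)) := fun η hη =>
    HasCompactSupport.of_support_subset_isCompact
      (isCompact_angMom_ge η R (C * (1 + 1 / √η) + 1)) fun z hz => by
        by_contra hn
        exact hz ((H η hη).1 z hn t hta)
  have hG0 : ∀ η z, 0 ≤ G η (t, z) := fun η z =>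
    mul_nonneg (Real.smoothTransition.nonneg _) (mul_nonneg (hθ0 _) (saturate_nonneg _))
  have hGi : ∀ η, 0 < η → Integrable (fun z => G η (t, z)) := fun η hη =>
    (hGc η hη).integrable_of_hasCompactSupport (hGs η hη)
  set η₁ := angMom z / 2 with hη₁
  have hη₁0 : 0 < η₁ := by positivity
  have hpos : 0 < ∫ z, G η₁ (t, z) := by
    refine (hGc η₁ hη₁0).integral_pos_of_hasCompactSupport_nonneg_nonzero (hGs η₁ hη₁0)
      (hG0 η₁) (x := z) ?_
    have h1 : angMom z / η₁ - 1 = 1 := by rw [hη₁]; field_simp; norm_num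
    simp only [hG, h1, Real.smoothTransition.one, one_mul]
    refine mul_ne_zero (fun h => hne (by rw [h, mul_zero])) fun h => hne ?_
    have : f t z = 0 := saturate_eq_zero.1 h
    rw [this, zero_mul]
  -- the cutoffs increase as `η` decreases, so the fixed `η₁` inherits the bound for all smaller `η`
  have hle : ∀ η ∈ Ioc 0 η₁, ∫ z, G η₁ (t, z)
      ≤ Cχ * η⁻¹ * (2 * (R * √(2 * η) * B)) * Cθ * (D * (2 * η)) * (t - a) := by
    intro η hη
    refine (integral_mono (hGi η₁ hη₁0) (hGi η hη.1) fun z => ?_).trans (H η hη.1).2.2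
    refine mul_le_mul_of_nonneg_right (smoothTransition_mono ?_)
      (mul_nonneg (hθ0 _) (saturate_nonneg _))
    have := angMom_nonneg z
    have := hη.1
    have := hη.2
    gcongr
  have hlim : Tendsto (fun η : ℝ => 4 * Cχ * R * B * Cθ * D * (t - a) * √(2 * η)) (𝓝[>] 0)
      (𝓝 0) := by
    have h1 : Continuous (fun η : ℝ => 4 * Cχ * R * B * Cθ * D * (t - a) * √(2 * η)) := by
      fun_prop
    have h2 := h1.tendsto 0
    simp only [mul_zero, Real.sqrt_zero] at h2
    exact h2.mono_left nhdsWithin_le_nhds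
  have hfin : ∫ z, G η₁ (t, z) ≤ 0 := by
    refine ge_of_tendsto hlim ?_
    filter_upwards [Ioc_mem_nhdsGT hη₁0] with η hη
    refine (hle η hη).trans (le_of_eq ?_)
    have := hη.1.ne'
    field_simp
    ring
  linarith

end barrier

/-! ### Propagation of the support -/

/-- To show that `smoothTransition ∘ S` decreases along `u`, only points with `0 ≤ S ≤ 1` matter. -/
lemma fderiv_smoothTransition_comp_nonpos {E : Type*} [NormedAddCommGroup E] [NormedSpace ℝ E]
    {S : E → ℝ} {p u : E} (hS : DifferentiableAt ℝ S p)
    (h : 0 ≤ S p → S p ≤ 1 → fderiv ℝ S p u ≤ 0) :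
    fderiv ℝ (fun p => Real.smoothTransition (S p)) p u ≤ 0 := by
  have hd := (Real.smoothTransition.contDiff (n := 1)).differentiable one_ne_zero (S p)
  have h1 := HasDerivAt.comp_hasFDerivAt p hd.hasDerivAt hS.hasFDerivAt
  have h2 : fderiv ℝ (fun p => Real.smoothTransition (S p)) p = _ := h1.fderiv
  rw [h2, smul_apply, smul_eq_mul]
  by_cases hs : S p < 0 ∨ 1 < S p
  · rw [deriv_smoothTransition_eq_zero hs, zero_mul]
  · push Not at hs
    exact mul_nonpos_of_nonneg_of_nonpos smoothTransition_mono.deriv_nonneg (h hs.1 hs.2)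

/-- The virial energies `½ |v|² ± x ⬝ v + |x|² - M_c / |x|`. -/
def virialEnergy (Mc σ : ℝ) (z : Phase) : ℝ :=
  1 / 2 * ‖z.2‖ ^ 2 + σ * inner ℝ z.1 z.2 + ‖z.1‖ ^ 2 - Mc / ‖z.1‖

lemma contDiffAt_virialEnergy (Mc σ : ℝ) {z : Phase} (hz : z.1 ≠ 0) :
    ContDiffAt ℝ 1 (virialEnergy Mc σ) z := by
  unfold virialEnergy
  have h1 : ContDiffAt ℝ 1 (fun z : Phase => Mc / ‖z.1‖) z :=
    ContDiffAt.comp (f := Prod.fst) (g := fun y : Space => Mc / ‖y‖) z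
      (contDiffAt_const_div_norm Mc hz) contDiffAt_fst
  refine ContDiffAt.sub (ContDiff.contDiffAt ?_) h1
  exact ((contDiff_const.mul (contDiff_snd.norm_sq ℝ)).add
    (contDiff_const.mul (contDiff_fst.inner ℝ contDiff_snd))).add (contDiff_fst.norm_sq ℝ)

/-- The derivative of a virial energy along `(v, K)`. -/
lemma fderiv_virialEnergy (Mc σ : ℝ) {x : Space} (hx : x ≠ 0) (v K : Space) :
    fderiv ℝ (virialEnergy Mc σ) (x, v) (v, K) = inner ℝ v K + σ * (‖v‖ ^ 2 + inner ℝ x K)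
      + 2 * inner ℝ x v + Mc / ‖x‖ ^ 3 * inner ℝ x v := by
  refine fderiv_apply_of_line
    ((contDiffAt_virialEnergy Mc σ (z := (x, v)) hx).differentiableAt one_ne_zero) ?_
  have h := ((((hasDerivAt_line_norm_sq v K).const_mul (1 / 2)).add
    ((hasDerivAt_line_inner x v K).const_mul σ)).add (hasDerivAt_line_norm_sq x v)).sub
    (hasDerivAt_line_inv_norm x v Mc hx)
  exact h.congr_deriv (by ring)

/-- Up to the singular potential of the point mass the virial energies are positive definite. -/
lemma norm_sq_le_virialEnergy (Mc : ℝ) {σ : ℝ} (hσ : σ ^ 2 = 1) (z : Phase) :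
    (‖z.2‖ ^ 2 + ‖z.1‖ ^ 2) / 8 ≤ virialEnergy Mc σ z + Mc / ‖z.1‖ := by
  unfold virialEnergy
  have h1 : |σ * (inner ℝ z.1 z.2 : ℝ)| ≤ ‖z.1‖ * ‖z.2‖ := by
    have : |σ| = 1 := by
      rw [← Real.sqrt_sq_eq_abs, hσ, Real.sqrt_one]
    rw [abs_mul, this, one_mul]
    exact abs_real_inner_le_norm _ _
  have h2 := (abs_le.1 h1).1
  nlinarith [sq_nonneg (3 * ‖z.2‖ - 4 * ‖z.1‖)]

/-- Bounded virial energy confines a point. -/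
lemma mem_boundedRegion_of_virialEnergy_le {Mc σ Q : ℝ} (hMc : 0 ≤ Mc) (hσ : σ ^ 2 = 1)
    (hQ : 0 ≤ Q) {z : Phase} (hz : z.1 ≠ 0) (h : virialEnergy Mc σ z ≤ Q) :
    z ∈ boundedRegion (1 + 8 * (Q + Mc)) (8 * (Q + Mc)) := by
  have h1 := norm_sq_le_virialEnergy Mc hσ z
  have hx : 0 < ‖z.1‖ := norm_pos_iff.2 hz
  constructor
  · by_contra! h2
    have h3 : 1 < ‖z.1‖ := by linarith
    have h4 : Mc / ‖z.1‖ ≤ Mc := div_le_self hMc h3.le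
    nlinarith [sq_nonneg ‖z.2‖]
  · have h2 : 8 * (Q + Mc) * (1 + 1 / ‖z.1‖) = 8 * Q + 8 * (Mc / ‖z.1‖) + 8 * Q * (1 / ‖z.1‖)
        + 8 * Mc := by ring
    have h3 : 0 ≤ 8 * Q * (1 / ‖z.1‖) := by positivity
    rw [h2]
    nlinarith [sq_nonneg ‖z.1‖]

/-- One-sided Gronwall-type bound for the virial energies along characteristics. -/
lemma virial_bound {Mc σ B : ℝ} (hMc : 0 ≤ Mc) (hσ : σ ^ 2 = 1) {x v g : Space}
    (hx : x ≠ 0) (hg : ‖g‖ ≤ B) (hq : 0 ≤ virialEnergy Mc σ (x, v)) :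
    -((17 + 16 * Mc + 8 * B ^ 2) * (1 + virialEnergy Mc σ (x, v)))
      ≤ σ * fderiv ℝ (virialEnergy Mc σ) (x, v) (v, - g - (Mc / ‖x‖ ^ 3) • x) := by
  have hx' : 0 < ‖x‖ := norm_pos_iff.2 hx
  rw [fderiv_virialEnergy Mc σ hx]
  simp only [inner_sub_right, inner_neg_right, inner_smul_right, real_inner_self_eq_norm_sq,
    real_inner_comm x v]
  set q := virialEnergy Mc σ (x, v) with hqd
  have hqe : q = 1 / 2 * ‖v‖ ^ 2 + σ * inner ℝ x v + ‖x‖ ^ 2 - Mc / ‖x‖ := rfl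
  have h1 : (‖v‖ ^ 2 + ‖x‖ ^ 2) / 8 ≤ q + Mc / ‖x‖ := norm_sq_le_virialEnergy Mc hσ (x, v)
  have hm : 0 ≤ Mc / ‖x‖ := by positivity
  have h3 : Mc / ‖x‖ ^ 3 * ‖x‖ ^ 2 = Mc / ‖x‖ := by field_simp
  have hσ1 : |σ| = 1 := by rw [← Real.sqrt_sq_eq_abs, hσ, Real.sqrt_one]
  have hv : σ * inner ℝ v g ≤ B * ‖v‖ := by
    refine (le_abs_self _).trans ?_
    rw [abs_mul, hσ1, one_mul, mul_comm B]
    exact (abs_real_inner_le_norm v g).trans (by gcongr)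
  have hxg : inner ℝ x g ≤ B * ‖x‖ := by
    rw [mul_comm B]
    exact (real_inner_le_norm x g).trans (by gcongr)
  have h4 : ‖x‖ ^ 2 ≤ 1 + 8 * q + 8 * Mc := by
    by_cases h : ‖x‖ ≤ 1
    · nlinarith
    · have h5 : Mc / ‖x‖ ≤ Mc := div_le_self hMc (le_of_not_ge h)
      nlinarith [sq_nonneg ‖v‖]
  have h6 : B * ‖v‖ + B * ‖x‖ ≤ 8 * B ^ 2 + (q + Mc / ‖x‖) / 2 := by
    nlinarith [sq_nonneg (‖v‖ - 8 * B), sq_nonneg (‖x‖ - 8 * B)]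
  have hid : σ * (-inner ℝ v g - Mc / ‖x‖ ^ 3 * inner ℝ x v
      + σ * (‖v‖ ^ 2 + (-inner ℝ x g - Mc / ‖x‖ ^ 3 * ‖x‖ ^ 2)) + 2 * inner ℝ x v
      + Mc / ‖x‖ ^ 3 * inner ℝ x v)
      = 2 * q - 2 * ‖x‖ ^ 2 + Mc / ‖x‖ - σ * inner ℝ v g - inner ℝ x g := by
    rw [h3, hqe]
    linear_combination (‖v‖ ^ 2 - inner ℝ x g - Mc / ‖x‖) * hσ
  refine le_trans ?_ (le_of_eq hid.symm)
  have h7 : 0 ≤ Mc * q := by positivity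
  have h8 : 0 ≤ B ^ 2 * q := by positivity
  nlinarith

section support
variable {Mc : ℝ} {f : ℝ → Phase → ℝ} {U : ℝ → Space → ℝ}

/-- On bounded time intervals the solution lives in a region accessible from bounded energy. -/
lemma IsSolution.exists_boundedRegion (hf : IsSolution Mc f U) (hMc : 0 ≤ Mc)
    (hcs : HasCompactSupport (f 0)) (T : ℝ) :
    ∃ R C, 0 ≤ R ∧ 0 ≤ C ∧ ∀ t ∈ Icc 0 T, ∀ z, 0 < angMom z → f t z ≠ 0 →
      z ∈ boundedRegion R C := by
  obtain ⟨B₀, hB₀⟩ := hf.grad_bounded T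
  set B := max B₀ 0 with hBdef
  have hB0 : 0 ≤ B := le_max_right _ _
  have hB : ∀ t ∈ Icc 0 T, ∀ x, ‖gradient (U t) x‖ ≤ B := fun t ht x =>
    (hB₀ t ht x).trans (le_max_left _ _)
  obtain ⟨N, hN⟩ := hcs.isCompact.isBounded.exists_norm_le
  -- `Q₀` bounds the virial energy on the initial support, which lies in `|z| ≤ N`
  set Q₀ := 3 * N ^ 2 with hQ₀
  have hQ₀0 : 0 ≤ Q₀ := by positivity
  have hq0 : ∀ z, f 0 z ≠ 0 → virialEnergy Mc (-1) z ≤ Q₀ + 1 - 1 := by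
    intro z hz
    have h1 := hN z (subset_tsupport _ hz)
    have h2 : ‖z.1‖ ≤ N := (norm_fst_le z).trans h1
    have h3 : ‖z.2‖ ≤ N := (norm_snd_le z).trans h1
    have h4 := abs_le.1 (abs_real_inner_le_norm z.1 z.2)
    have h5 : 0 ≤ Mc / ‖z.1‖ := by positivity
    unfold virialEnergy
    have h6 : ‖z.1‖ ^ 2 ≤ N ^ 2 := by gcongr
    have h7 : ‖z.2‖ ^ 2 ≤ N ^ 2 := by gcongr
    nlinarith [sq_nonneg (‖z.1‖ - ‖z.2‖)]
  set c := 17 + 16 * Mc + 8 * B ^ 2 with hc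
  have hc0 : 0 ≤ c := by positivity
  have key : ∀ t ∈ Icc 0 T, ∀ z, 0 < angMom z → f t z ≠ 0 →
      virialEnergy Mc (-1) z ≤ Real.exp (c * t) * (Q₀ + 1) := by
    intro t₀ ht₀ z₀ hz₀ hfz
    by_contra! hlt
    -- The barrier is a product of two transition functions.  The first is positive where `q₋` exceeds
    -- its expected exponential bound, the second where `exp (c t) (1 + q₊) < Q₂`.  Both decrease along
    -- characteristics, since `q₋` grows and `q₊` decays at most exponentially; the second confines the
    -- barrier to a bounded region.  The first entry of `Q₂` makes the second factor equal to `1` where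
    -- `q₊ < 0`, where no bound on its derivative is available, and the second entry makes it positive
    -- at `z₀`.
    set Q₂ := max (Real.exp (c * T) + 1) (Real.exp (c * t₀) * (1 + virialEnergy Mc 1 z₀) + 1)
      with hQ₂
    set s₁ : ℝ × Phase → ℝ := fun p =>
      (1 + virialEnergy Mc (-1) p.2) * Real.exp (-(c * p.1)) - (Q₀ + 1) with hs₁
    set s₂ : ℝ × Phase → ℝ := fun p =>
      Q₂ - Real.exp (c * p.1) * (1 + virialEnergy Mc 1 p.2) with hs₂
    have hcq : ∀ σ (p : ℝ × Phase), p.2.1 ≠ 0 →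
        ContDiffAt ℝ 1 (fun p : ℝ × Phase => virialEnergy Mc σ p.2) p := fun σ p hp =>
      ContDiffAt.comp p (contDiffAt_virialEnergy Mc σ hp) contDiffAt_snd
    have hc1 : ∀ p : ℝ × Phase, p.2.1 ≠ 0 → ContDiffAt ℝ 1 s₁ p := fun p hp =>
      ((contDiffAt_const.add (hcq _ p hp)).mul
        (Real.contDiff_exp.contDiffAt.comp p
          ((contDiffAt_const.mul contDiffAt_fst).neg))).sub contDiffAt_const
    have hc2 : ∀ p : ℝ × Phase, p.2.1 ≠ 0 → ContDiffAt ℝ 1 s₂ p := fun p hp =>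
      contDiffAt_const.sub ((Real.contDiff_exp.contDiffAt.comp p
          (contDiffAt_const.mul contDiffAt_fst)).mul (contDiffAt_const.add (hcq _ p hp)))
    have hcc : ∀ {S : ℝ × Phase → ℝ}, (∀ p : ℝ × Phase, p.2.1 ≠ 0 → ContDiffAt ℝ 1 S p) →
        ∀ p : ℝ × Phase, p.2.1 ≠ 0 → ContDiffAt ℝ 1 (fun p => Real.smoothTransition (S p)) p :=
      fun hS p hp => Real.smoothTransition.contDiff.contDiffAt.comp p (hS p hp)
    have hline : ∀ (σ t : ℝ) (z : Phase) (K : Space), z.1 ≠ 0 →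
        HasDerivAt (fun s : ℝ => virialEnergy Mc σ (z + s • (z.2, K)))
          (fderiv ℝ (virialEnergy Mc σ) z (z.2, K)) 0 := fun σ t z K hz =>
      ((contDiffAt_virialEnergy Mc σ hz).differentiableAt one_ne_zero).hasFDerivAt.hasLineDerivAt _
    have htime : ∀ (e t : ℝ), HasDerivAt (fun s : ℝ => Real.exp (e * (t + s * 1)))
        (Real.exp (e * t) * e) 0 := fun e t => by
      have h := ((((hasDerivAt_id (0 : ℝ)).mul_const 1).const_add t).const_mul e).exp
      simpa using h
    have hD : ∀ t ∈ Ioo 0 T, ∀ z : Phase, 0 < angMom z → f t z ≠ 0 →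
        fderiv ℝ (fun p => Real.smoothTransition (s₁ p) * Real.smoothTransition (s₂ p)) (t, z)
          (1, z.2, force Mc U t z.1) ≤ 0 := by
      intro t ht z hz hfz
      have hz0 : z.1 ≠ 0 := fst_ne_zero_of_angMom_pos hz
      have h1 := (hcc hc1 (t, z) hz0).differentiableAt one_ne_zero
      have h2 := (hcc hc2 (t, z) hz0).differentiableAt one_ne_zero
      have hm := h1.hasFDerivAt.mul h2.hasFDerivAt
      have hm' : fderiv ℝ (fun p => Real.smoothTransition (s₁ p) * Real.smoothTransition (s₂ p))
        (t, z) = _ := hm.fderiv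
      rw [hm']
      simp only [add_apply, smul_apply, smul_eq_mul]
      have hg := hB t (Ioo_subset_Icc_self ht) z.1
      have hforce := hf.force_eq ht.1.le hz0
      refine add_nonpos (mul_nonpos_of_nonneg_of_nonpos (Real.smoothTransition.nonneg _)
        (fderiv_smoothTransition_comp_nonpos ((hc2 (t, z) hz0).differentiableAt one_ne_zero) ?_))
        (mul_nonpos_of_nonneg_of_nonpos (Real.smoothTransition.nonneg _)
        (fderiv_smoothTransition_comp_nonpos ((hc1 (t, z) hz0).differentiableAt one_ne_zero) ?_))
      · intro h3 h4
        have hd := ((htime c t).mul ((hline 1 t z (force Mc U t z.1) hz0).const_add 1)).const_sub Q₂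
        have hd' := fderiv_apply_of_line ((hc2 (t, z) hz0).differentiableAt one_ne_zero)
          (u := (1, z.2, force Mc U t z.1)) hd
        rw [hd']
        have hq : 0 ≤ virialEnergy Mc 1 (z.1, z.2) := by
          by_contra! hq
          have h5 : Q₂ - Real.exp (c * t) * (1 + virialEnergy Mc 1 z) ≤ 1 := h4
          have h6 : Real.exp (c * t) * (1 + virialEnergy Mc 1 z) < Real.exp (c * t) :=
            mul_lt_of_lt_one_right (Real.exp_pos _) (by linarith)
          have h7 : Real.exp (c * t) ≤ Real.exp (c * T) :=
            Real.exp_le_exp.2 (mul_le_mul_of_nonneg_left ht.2.le hc0)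
          have h8 : Real.exp (c * T) + 1 ≤ Q₂ := le_max_left _ _
          linarith
        have h5 := virial_bound hMc (by norm_num) hz0 hg hq
        rw [← hforce, one_mul] at h5
        have h6 := Real.exp_pos (c * t)
        have h7 : 0 ≤ Real.exp (c * t) * (c * (1 + virialEnergy Mc 1 z) +
          fderiv ℝ (virialEnergy Mc 1) z (z.2, force Mc U t z.1)) :=
          mul_nonneg h6.le (by
            have : -(c * (1 + virialEnergy Mc 1 z)) ≤
              fderiv ℝ (virialEnergy Mc 1) z (z.2, force Mc U t z.1) := h5
            linarith)
        simp only [zero_smul, add_zero, zero_mul]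
        linarith
      · intro h3 h4
        have hd := (((hline (-1) t z (force Mc U t z.1) hz0).const_add 1).mul
          (htime (-c) t)).sub_const (Q₀ + 1)
        simp only [neg_mul] at hd
        have hd' := fderiv_apply_of_line ((hc1 (t, z) hz0).differentiableAt one_ne_zero)
          (u := (1, z.2, force Mc U t z.1)) hd
        rw [hd']
        have h3' : 0 ≤ (1 + virialEnergy Mc (-1) z) * Real.exp (-(c * t)) - (Q₀ + 1) := h3
        have h6 := Real.exp_pos (-(c * t))
        have hq : 0 ≤ virialEnergy Mc (-1) (z.1, z.2) := by
          by_contra! hq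
          have h7 : (1 + virialEnergy Mc (-1) z) * Real.exp (-(c * t)) < Real.exp (-(c * t)) :=
            mul_lt_of_lt_one_left h6 (by linarith)
          have h8 : Real.exp (-(c * t)) ≤ 1 := Real.exp_le_one_iff.2 (by
            have := mul_nonneg hc0 ht.1.le
            linarith)
          linarith
        have h5 := virial_bound hMc (by norm_num) hz0 hg hq
        rw [← hforce] at h5
        have h7 : 0 ≤ (c * (1 + virialEnergy Mc (-1) z) -
          fderiv ℝ (virialEnergy Mc (-1)) z (z.2, force Mc U t z.1)) * Real.exp (-(c * t)) :=
          mul_nonneg (by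
            have : -(c * (1 + virialEnergy Mc (-1) z)) ≤
              -1 * fderiv ℝ (virialEnergy Mc (-1)) z (z.2, force Mc U t z.1) := h5
            linarith) h6.le
        simp only [zero_smul, add_zero, zero_mul]
        linarith
    have hQ₂1 : 1 ≤ Q₂ := le_trans (by linarith [Real.exp_pos (c * T)]) (le_max_left _ _)
    have hconf : ∀ t ∈ Icc 0 T, ∀ z, 0 < angMom z → f t z ≠ 0 →
        z ∉ boundedRegion (1 + 8 * (Q₂ + Mc)) (8 * (Q₂ + Mc)) →
        Real.smoothTransition (s₁ (t, z)) * Real.smoothTransition (s₂ (t, z)) = 0 := by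
      intro t ht z hz _ hn
      rw [Real.smoothTransition.zero_of_nonpos (x := s₂ (t, z)), mul_zero]
      by_contra! hs
      refine hn (mem_boundedRegion_of_virialEnergy_le (σ := 1) hMc (by norm_num) (by linarith)
        (fst_ne_zero_of_angMom_pos hz) ?_)
      by_contra! h
      have h1 : 1 ≤ Real.exp (c * t) := Real.one_le_exp (mul_nonneg hc0 ht.1)
      have h2 : 0 < Q₂ - Real.exp (c * t) * (1 + virialEnergy Mc 1 z) := hs
      nlinarith
    have hbar := hf.barrier (R := 1 + 8 * (Q₂ + Mc)) (C := 8 * (Q₂ + Mc)) (Cθ := 1) le_rfl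
      (by positivity) (by positivity) hB
      (θ := fun p => Real.smoothTransition (s₁ p) * Real.smoothTransition (s₂ p))
      (fun p hp => (hcc hc1 p hp).mul (hcc hc2 p hp))
      (fun p => mul_nonneg (Real.smoothTransition.nonneg _) (Real.smoothTransition.nonneg _))
      (fun t _ z _ => mul_le_one₀ (Real.smoothTransition.le_one _)
        (Real.smoothTransition.nonneg _) (Real.smoothTransition.le_one _))
      hconf hD (fun z hz => by
        by_cases h : f 0 z = 0
        · rw [h, zero_mul]
        · have := hq0 z h
          have h1 : s₁ (0, z) ≤ 0 := by simp [hs₁]; linarith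
          simp only [Real.smoothTransition.zero_of_nonpos h1]
          ring) ht₀ hz₀
    have h1 : 0 < s₁ (t₀, z₀) := by
      have h2 : Real.exp (c * t₀) * Real.exp (-(c * t₀)) = 1 := by rw [← Real.exp_add]; simp
      have h3 := Real.exp_pos (-(c * t₀))
      simp only [hs₁]
      nlinarith
    have h2 : 0 < s₂ (t₀, z₀) := by
      have := le_max_right (Real.exp (c * T) + 1)
        (Real.exp (c * t₀) * (1 + virialEnergy Mc 1 z₀) + 1)
      simp only [hs₂]
      linarith
    exact (mul_ne_zero hfz (mul_ne_zero (Real.smoothTransition.pos_of_pos h1).ne'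
      (Real.smoothTransition.pos_of_pos h2).ne')) hbar
  set Q := Real.exp (c * T) * (Q₀ + 1) with hQ
  have hQ0 : 0 ≤ Q := by positivity
  refine ⟨1 + 8 * (Q + Mc), 8 * (Q + Mc), by positivity, by positivity, fun t ht z hz hfz => ?_⟩
  refine mem_boundedRegion_of_virialEnergy_le (σ := -1) hMc (by norm_num) hQ0
    (fst_ne_zero_of_angMom_pos hz) ((key t ht z hz hfz).trans ?_)
  refine mul_le_mul_of_nonneg_right ?_ (by linarith)
  exact Real.exp_le_exp.2 (mul_le_mul_of_nonneg_left ht.2 hc0)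

/-- If angular momentum decreases at most at rate `κ` along characteristics, then the lower bound
on it in the support deteriorates at most at that rate. -/
lemma IsSolution.angMom_lower_bound (hf : IsSolution Mc f U) {a b R C lam κ : ℝ} (ha : 0 ≤ a)
    (hC : 0 ≤ C) (hR : 0 ≤ R)
    (hreg : ∀ t ∈ Icc a b, ∀ z, 0 < angMom z → f t z ≠ 0 → z ∈ boundedRegion R C)
    (hinit : ∀ z, f a z ≠ 0 → lam ≤ angMom z)
    (hκ : ∀ t ∈ Ioo a b, ∀ z, 0 < angMom z → angMom z ≤ lam - κ * (t - a) → f t z ≠ 0 →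
      -κ ≤ fderiv ℝ (fun p : ℝ × Phase => angMom p.2) (t, z) (1, z.2, force Mc U t z.1))
    {t : ℝ} (ht : t ∈ Icc a b) {z : Phase} (hz : 0 < angMom z) (hfz : f t z ≠ 0) :
    lam - κ * (t - a) ≤ angMom z := by
  by_contra! hlt
  -- the barrier is positive where the claimed lower bound fails
  obtain ⟨B, hB⟩ := hf.grad_bounded b
  set s : ℝ × Phase → ℝ := fun p => lam - κ * (p.1 - a) - angMom p.2 with hs
  have hcL : ContDiff ℝ 1 (fun p : ℝ × Phase => angMom p.2) := contDiff_angMom.comp contDiff_snd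
  have hcs : ContDiff ℝ 1 s :=
    (contDiff_const.sub (contDiff_const.mul (contDiff_fst.sub contDiff_const))).sub hcL
  have hbar := hf.barrier (R := R) (C := C) (Cθ := 1) ha hC hR
    (fun t ht x => hB t ⟨ha.trans ht.1, ht.2⟩ x)
    (θ := fun p => Real.smoothTransition (s p))
    (fun p hp => (Real.smoothTransition.contDiff.comp hcs).contDiffAt)
    (fun p => Real.smoothTransition.nonneg _)
    (fun t _ z _ => Real.smoothTransition.le_one _)
    (fun t ht z hz hfz hn => absurd (hreg t ht z hz hfz) hn)
    (fun t ht z hz hfz => fderiv_smoothTransition_comp_nonpos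
      (hcs.differentiable one_ne_zero _) fun h0 _ => by
        have hL := (hcL.differentiable one_ne_zero (t, z)).hasFDerivAt
        have h1 : HasFDerivAt (fun p : ℝ × Phase => lam - κ * (p.1 - a))
            (-(κ • ContinuousLinearMap.fst ℝ ℝ Phase)) (t, z) :=
          ((hasFDerivAt_fst.sub_const a).const_mul κ).const_sub lam
        have h2 : fderiv ℝ s (t, z) = _ := (h1.sub hL).fderiv
        have h3 := hκ t ht z hz (by
          have : 0 ≤ lam - κ * (t - a) - angMom z := h0
          linarith) hfz
        rw [h2]
        simp only [sub_apply, neg_apply, smul_apply, ContinuousLinearMap.coe_fst', smul_eq_mul,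
          mul_one]
        linarith)
    (fun z hz => by
      by_cases h : f a z = 0
      · rw [h, zero_mul]
      · have := hinit z h
        have h1 : s (a, z) ≤ 0 := by simp [hs]; linarith
        simp only [Real.smoothTransition.zero_of_nonpos h1]
        ring) ht hz
  have h1 : 0 < s (t, z) := by simp only [hs]; linarith
  exact mul_ne_zero hfz (Real.smoothTransition.pos_of_pos h1).ne' hbar

/-- A null level set has dense complement; statements on `L > 0` extend by continuity. -/
lemma dense_angMom_pos : Dense {z : Phase | 0 < angMom z} := by
  refine Measure.dense_of_ae (μ := (volume : Measure Phase)) ?_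
  have h : volume {z : Phase | angMom z = 0} = 0 := volume_angMom_eq le_rfl
  have h1 : ∀ᵐ z : Phase, angMom z ≠ 0 := by rw [ae_iff]; simpa using h
  filter_upwards [h1] with z hz
  exact lt_of_le_of_ne (angMom_nonneg z) (Ne.symm hz)

/-- The support of a continuous function is determined by its part where the angular momentum is
positive. -/
lemma support_subset_of_angMom_pos {g : Phase → ℝ} (hg : Continuous g) {S : Set Phase}
    (hS : IsClosed S) (h : ∀ z, 0 < angMom z → g z ≠ 0 → z ∈ S) (z : Phase) (hz : g z ≠ 0) :
    z ∈ S := by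
  have ho : IsOpen {z | g z ≠ 0} := isOpen_ne_fun hg continuous_const
  have h1 : z ∈ closure ({z | g z ≠ 0} ∩ {z | 0 < angMom z}) :=
    (dense_angMom_pos.open_subset_closure_inter ho) hz
  exact hS.closure_subset_iff.2 (fun w hw => h w hw.2 hw.1) h1

end support

/-! ### An elliptic estimate -/

/-- The `i`-th partial derivative. -/
def pd (i : Fin 3) (V : Space → ℝ) (x : Space) : ℝ :=
  fderiv ℝ V x (EuclideanSpace.single i (1 : ℝ))

lemma contDiff_pd {V : Space → ℝ} {n m : WithTop ℕ∞} (hV : ContDiff ℝ n V) (hmn : m + 1 ≤ n)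
    (i : Fin 3) : ContDiff ℝ m (pd i V) :=
  (hV.fderiv_right hmn).clm_apply contDiff_const

lemma laplacian_eq_sum_pd {V : Space → ℝ} (hV : ContDiff ℝ 2 V) (x : Space) :
    Laplacian.laplacian V x = ∑ i, pd i (pd i V) x := by
  rw [InnerProductSpace.laplacian_eq_iteratedFDeriv_orthonormalBasis V
    (EuclideanSpace.basisFun (Fin 3) ℝ)]
  refine Finset.sum_congr rfl fun i _ => ?_
  rw [iteratedFDeriv_two_apply]
  have h1 : DifferentiableAt ℝ (fderiv ℝ V) x :=
    (hV.fderiv_right (m := 1) (by norm_num)).differentiable one_ne_zero x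
  have h2 : HasFDerivAt (pd i V) _ x := h1.hasFDerivAt.clm_apply (hasFDerivAt_const _ x)
  unfold pd at h2 ⊢
  rw [h2.fderiv]
  simp

lemma continuous_laplacian {V : Space → ℝ} (hV : ContDiff ℝ 2 V) :
    Continuous (Laplacian.laplacian V) := by
  rw [show Laplacian.laplacian V = fun x => ∑ i, pd i (pd i V) x from
    funext (laplacian_eq_sum_pd hV)]
  refine continuous_finsetSum _ fun i _ => ?_
  exact (contDiff_pd (m := 0) (contDiff_pd (m := 1) hV (by norm_num) i) (by norm_num) i).continuous

lemma norm_gradient_sq (V : Space → ℝ) (x : Space) :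
    ‖gradient V x‖ ^ 2 = ∑ i, pd i V x ^ 2 := by
  rw [← OrthonormalBasis.sum_sq_norm_inner_right (EuclideanSpace.basisFun (Fin 3) ℝ)]
  refine Finset.sum_congr rfl fun i _ => ?_
  rw [real_inner_comm, inner_gradient, Real.norm_eq_abs, sq_abs]
  simp [pd]

lemma pd_mul {V W : Space → ℝ} {x : Space} (hV : DifferentiableAt ℝ V x)
    (hW : DifferentiableAt ℝ W x) (i : Fin 3) :
    pd i (fun y => V y * W y) x = V x * pd i W x + W x * pd i V x := by
  have h : HasFDerivAt (fun y => V y * W y) _ x := hV.hasFDerivAt.mul hW.hasFDerivAt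
  simp only [pd]
  rw [h.fderiv]; simp

lemma pd_of_line {V : Space → ℝ} {x : Space} {i : Fin 3} {d : ℝ} (hV : DifferentiableAt ℝ V x)
    (h : HasDerivAt (fun s : ℝ => V (x + s • EuclideanSpace.single i (1 : ℝ))) d 0) :
    pd i V x = d := fderiv_apply_of_line hV h

/-- Second derivatives are nonnegative at a minimum. -/
lemma pd_pd_nonneg_of_min {V : Space → ℝ} (hV : ContDiff ℝ 2 V) {x : Space}
    (hmin : ∀ y, V x ≤ V y) (i : Fin 3) : 0 ≤ pd i (pd i V) x := by
  set e : Space := EuclideanSpace.single i (1 : ℝ) with he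
  set φ : ℝ → ℝ := fun s => V (x + s • e) with hφ
  have hl : ∀ s, HasDerivAt (fun s : ℝ => x + s • e) e s := fun s => by
    simpa using ((hasDerivAt_id s).smul_const e).const_add x
  have hd : ∀ s, HasDerivAt φ (pd i V (x + s • e)) s := fun s =>
    ((hV.differentiable two_ne_zero _).hasFDerivAt).comp_hasDerivAt s (hl s)
  have hd' : deriv φ = fun s => pd i V (x + s • e) := funext fun s => (hd s).deriv
  have hp : ContDiff ℝ 1 (pd i V) := contDiff_pd hV (by norm_num) i
  have hdd : HasDerivAt (fun s : ℝ => pd i V (x + s • e)) (pd i (pd i V) (x + (0 : ℝ) • e)) 0 :=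
    ((hp.differentiable one_ne_zero _).hasFDerivAt).comp_hasDerivAt (0 : ℝ) (hl 0)
  have hdd' : deriv (deriv φ) 0 = pd i (pd i V) x := by
    rw [hd', hdd.deriv, zero_smul, add_zero]
  have hm : IsLocalMin φ 0 := Eventually.of_forall fun s => by
    simpa [hφ] using hmin (x + s • e)
  by_contra! hlt
  have hM := isLocalMax_of_deriv_deriv_neg (f := φ) (x₀ := 0) (by rwa [hdd']) hm.deriv_eq_zero
    (hd 0).continuousAt
  have hc : φ =ᶠ[𝓝 0] fun _ => φ 0 := by
    filter_upwards [hm, hM] with s h1 h2 using le_antisymm h2 h1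
  have h3 : deriv (deriv φ) 0 = 0 := by
    rw [hc.deriv.deriv_eq]; simp
  rw [hdd'] at h3
  exact hlt.ne h3

/-- Weak form of the maximum principle on `ℝ³`. -/
lemma nonneg_of_laplacian_neg {V : Space → ℝ} (hV : ContDiff ℝ 2 V)
    (hlim : Tendsto V (cocompact Space) (𝓝 0)) (hΔ : ∀ x, Laplacian.laplacian V x < 0)
    (x : Space) : 0 ≤ V x := by
  by_contra! hx
  obtain ⟨y, hy⟩ := hV.continuous.exists_forall_le' x
    ((hlim.eventually (Ioi_mem_nhds hx)).mono fun z hz => le_of_lt hz)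
  have h1 := hΔ y
  rw [laplacian_eq_sum_pd hV] at h1
  exact absurd h1 (not_lt.2 (Finset.sum_nonneg fun i _ => pd_pd_nonneg_of_min hV hy i))

/-- The Plummer potential `(1 + |x|²) ^ (-1/2)`. -/
def plummer (x : Space) : ℝ := (1 + ‖x‖ ^ 2) ^ (-(1 / 2) : ℝ)

lemma hasDerivAt_line_plummer_pow (x v : Space) (a : ℝ) :
    HasDerivAt (fun s : ℝ => (1 + ‖x + s • v‖ ^ 2) ^ a)
      (2 * inner ℝ x v * a * (1 + ‖x‖ ^ 2) ^ (a - 1)) 0 := by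
  have h := ((hasDerivAt_line_norm_sq x v).const_add 1).rpow_const (p := a) (Or.inl (by positivity))
  simpa using h

lemma contDiff_plummer_pow (a : ℝ) {n : WithTop ℕ∞} :
    ContDiff ℝ n (fun x : Space => (1 + ‖x‖ ^ 2) ^ a) :=
  (contDiff_const.add (contDiff_norm_sq ℝ)).rpow_const_of_ne fun x => by positivity

lemma contDiff_plummer {n : WithTop ℕ∞} : ContDiff ℝ n plummer := contDiff_plummer_pow _

lemma inner_single_right' (x : Space) (i : Fin 3) :
    (inner ℝ x (EuclideanSpace.single i (1 : ℝ)) : ℝ) = x i := by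
  simp [EuclideanSpace.inner_single_right]

lemma hasDerivAt_line_coord (x : Space) (i : Fin 3) :
    HasDerivAt (fun s : ℝ => (x + s • EuclideanSpace.single i (1 : ℝ)) i) 1 0 := by
  have h : (fun s : ℝ => (x + s • EuclideanSpace.single i (1 : ℝ) : Space) i)
      = fun s => x i + s := by ext s; simp
  rw [h]
  simpa using (hasDerivAt_id (0 : ℝ)).const_add (x i)

lemma differentiable_coord (i : Fin 3) : Differentiable ℝ (fun x : Space => x i) :=
  (EuclideanSpace.proj (𝕜 := ℝ) i).differentiable

lemma contDiff_coord (i : Fin 3) {n : WithTop ℕ∞} : ContDiff ℝ n (fun x : Space => x i) :=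
  (EuclideanSpace.proj (𝕜 := ℝ) i).contDiff

lemma sum_coord_sq (x : Space) : ∑ i, x i ^ 2 = ‖x‖ ^ 2 := by
  rw [EuclideanSpace.norm_sq_eq]; simp

/-- The Plummer potential is, up to a constant, generated by the positive density
`(1 + |x|²)^(-5/2)`, which makes it a strict supersolution. -/
lemma laplacian_plummer (x : Space) :
    Laplacian.laplacian plummer x = -3 * (1 + ‖x‖ ^ 2) ^ (-(5 / 2) : ℝ) := by
  have h1 : ∀ i, pd i plummer = fun x => -1 * x i * (1 + ‖x‖ ^ 2) ^ (-(3 / 2) : ℝ) := by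
    intro i
    ext x
    refine pd_of_line (contDiff_plummer.differentiable one_ne_zero x) ?_
    refine (hasDerivAt_line_plummer_pow x _ _).congr_deriv ?_
    rw [inner_single_right']
    norm_num
    left; ring
  rw [laplacian_eq_sum_pd contDiff_plummer]
  have h2 : ∀ i, pd i (pd i plummer) x
      = (-1) * (1 + ‖x‖ ^ 2) ^ (-(3 / 2) : ℝ) + 3 * x i ^ 2 * (1 + ‖x‖ ^ 2) ^ (-(5 / 2) : ℝ) := by
    intro i
    rw [h1]
    refine pd_of_line ?_ ?_
    · exact (((contDiff_const.mul (contDiff_coord i)).mul (contDiff_plummer_pow _)).differentiable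
        one_ne_zero) x
    · have := ((hasDerivAt_line_coord x i).const_mul (-1)).mul
        (hasDerivAt_line_plummer_pow x (EuclideanSpace.single i (1 : ℝ)) (-(3 / 2)))
      refine this.congr_deriv ?_
      rw [inner_single_right']
      simp only [zero_smul, add_zero]
      norm_num
      ring
  simp only [h2]
  have h3 : (1 + ‖x‖ ^ 2) ^ (-(3 / 2) : ℝ) = (1 + ‖x‖ ^ 2) * (1 + ‖x‖ ^ 2) ^ (-(5 / 2) : ℝ) := by
    have hp : 0 < 1 + ‖x‖ ^ 2 := by positivity
    rw [← Real.rpow_one_add' hp.le (by norm_num)]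
    norm_num
  have h4 := sum_coord_sq x
  simp only [Fin.sum_univ_three] at h4 ⊢
  rw [h3]
  linear_combination 3 * (1 + ‖x‖ ^ 2) ^ (-(5 / 2) : ℝ) * h4

lemma plummer_pos (x : Space) : 0 < plummer x := by unfold plummer; positivity

lemma plummer_sq (x : Space) : plummer x ^ 2 = (1 + ‖x‖ ^ 2)⁻¹ := by
  have hp : 0 < 1 + ‖x‖ ^ 2 := by positivity
  unfold plummer
  rw [← Real.rpow_natCast, ← Real.rpow_mul hp.le]
  norm_num [Real.rpow_neg_one]

lemma tendsto_plummer : Tendsto plummer (cocompact Space) (𝓝 0) := by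
  have h1 : Tendsto (fun x : Space => 1 + ‖x‖ ^ 2) (cocompact Space) atTop :=
    tendsto_atTop_add_const_left _ _
      ((tendsto_pow_atTop two_ne_zero).comp (tendsto_norm_cocompact_atTop (E := Space)))
  exact (tendsto_rpow_neg_atTop (by norm_num : (0 : ℝ) < 1 / 2)).comp h1

/-- Potentials generated by compactly supported densities decay like `1 / |x|`. -/
lemma exists_abs_le_plummer {V : Space → ℝ} (hV : ContDiff ℝ 2 V)
    (hlim : Tendsto V (cocompact Space) (𝓝 0)) {R : ℝ}
    (hR : ∀ x, R < ‖x‖ → Laplacian.laplacian V x = 0) :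
    ∃ C, 0 ≤ C ∧ ∀ x, |V x| ≤ C * plummer x := by
  obtain ⟨N, hN⟩ := (isCompact_closedBall (0 : Space) R).exists_bound_of_continuousOn
    (continuous_laplacian hV).continuousOn
  -- `C` is so large that the density of `C * plummer` exceeds that of `V` on `|x| ≤ R`
  set C := (max N 0 + 1) * (1 + R ^ 2) ^ (5 / 2 : ℝ) with hC
  have hC0 : 0 < C := by positivity
  have hp : ∀ x : Space, 0 < (1 + ‖x‖ ^ 2) ^ (-(5 / 2) : ℝ) := fun x => by positivity
  have hb : ∀ x, |Laplacian.laplacian V x| < 3 * C * (1 + ‖x‖ ^ 2) ^ (-(5 / 2) : ℝ) := by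
    intro x
    by_cases hx : ‖x‖ ≤ R
    · have h1 : |Laplacian.laplacian V x| ≤ N := hN x (by simpa using hx)
      have h2 : (1 + R ^ 2) ^ (5 / 2 : ℝ) * (1 + ‖x‖ ^ 2) ^ (-(5 / 2) : ℝ) ≥ 1 := by
        rw [Real.rpow_neg (by positivity), ge_iff_le, ← div_eq_mul_inv, one_le_div (by positivity)]
        refine Real.rpow_le_rpow (by positivity) ?_ (by norm_num)
        have := norm_nonneg x
        gcongr
      have h3 := le_max_left N 0
      have h4 := le_max_right N 0
      have h5 : C * (1 + ‖x‖ ^ 2) ^ (-(5 / 2) : ℝ) ≥ max N 0 + 1 := by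
        rw [hC, mul_assoc]
        nlinarith
      nlinarith
    · rw [hR x (lt_of_not_ge hx), abs_zero]
      have := hp x
      positivity
  have haux : ∀ W : Space → ℝ, ContDiff ℝ 2 W → Tendsto W (cocompact Space) (𝓝 0) →
      (∀ x, |Laplacian.laplacian W x| < 3 * C * (1 + ‖x‖ ^ 2) ^ (-(5 / 2) : ℝ)) →
      ∀ x, W x ≤ C * plummer x := by
    intro W hW hWl hWb x
    have h1 : ContDiff ℝ 2 (C • plummer) := contDiff_plummer.const_smul C
    have h2 := nonneg_of_laplacian_neg (V := C • plummer - W) (h1.sub hW) (by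
      have h3 := (tendsto_plummer.const_mul C).sub hWl
      rw [mul_zero, sub_zero] at h3
      exact h3) (fun y => by
        rw [ContDiffAt.laplacian_sub h1.contDiffAt hW.contDiffAt,
          InnerProductSpace.laplacian_smul C contDiff_plummer.contDiffAt,
          laplacian_plummer, smul_eq_mul]
        have := (abs_lt.1 (hWb y)).1
        linarith) x
    simp only [Pi.sub_apply, Pi.smul_apply, smul_eq_mul] at h2
    linarith
  refine ⟨C, hC0.le, fun x => abs_le.2 ⟨?_, haux V hV hlim hb x⟩⟩
  have hlim' : Tendsto (-V) (cocompact Space) (𝓝 0) := by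
    rw [← neg_zero (G := ℝ)]; exact hlim.neg
  have h1 := haux (-V) hV.neg hlim' (fun x => by
    have : Laplacian.laplacian (-V) x = - Laplacian.laplacian V x := by
      rw [InnerProductSpace.laplacian_neg]; rfl
    rw [this, abs_neg]
    exact hb x) x
  simp only [Pi.neg_apply] at h1
  linarith

/-- Hardy's inequality with a regular weight. -/
lemma hardy {W : Space → ℝ} (hW : ContDiff ℝ 1 W) (hc : HasCompactSupport W) :
    ∫ x, 3 * W x ^ 2 / (1 + ‖x‖ ^ 2) ^ 2 ≤ ∫ x, ∑ i, pd i W x ^ 2 := by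
  -- `b = ∇ψ / ψ` for the positive supersolution `ψ = plummer`; expand `|∇W - W b|² ≥ 0` and
  -- integrate the cross term by parts
  set b : Fin 3 → Space → ℝ := fun i x => -1 * x i / (1 + ‖x‖ ^ 2) with hb
  have hbc : ∀ i, ContDiff ℝ 1 (b i) := fun i =>
    (contDiff_const.mul (contDiff_coord i)).div (contDiff_const.add (contDiff_norm_sq ℝ))
      fun x => by positivity
  have hbd : ∀ i x, pd i (b i) x = -1 / (1 + ‖x‖ ^ 2) + 2 * x i ^ 2 / (1 + ‖x‖ ^ 2) ^ 2 := by
    intro i x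
    have hp : 1 + ‖x‖ ^ 2 ≠ 0 := by positivity
    refine pd_of_line ((hbc i).differentiable one_ne_zero x) ?_
    have := ((hasDerivAt_line_coord x i).const_mul (-1)).div
      ((hasDerivAt_line_norm_sq x (EuclideanSpace.single i (1 : ℝ))).const_add 1) (by simpa using hp)
    refine this.congr_deriv ?_
    rw [inner_single_right']
    simp only [zero_smul, add_zero]
    field_simp
    ring
  have hH : ∀ i, ContDiff ℝ 1 (fun x => W x ^ 2 * b i x) := fun i => (hW.pow 2).mul (hbc i)
  have hHc : ∀ i, HasCompactSupport (fun x => W x ^ 2 * b i x) := fun i =>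
    hc.mono fun x hx => by
      simp only [Function.mem_support, ne_eq, mul_eq_zero, not_or] at hx ⊢
      exact fun h => hx.1 (by simp [h])
  have hHd : ∀ i x, pd i (fun x => W x ^ 2 * b i x) x
      = 2 * W x * pd i W x * b i x + W x ^ 2 * pd i (b i) x := by
    intro i x
    have hWx := hW.differentiable one_ne_zero x
    have h1 : pd i (fun x => W x ^ 2) x = 2 * W x * pd i W x := by
      have : (fun x => W x ^ 2) = fun x => W x * W x := by ext; ring
      rw [this, pd_mul hWx hWx]; ring
    rw [pd_mul ((hW.pow 2).differentiable one_ne_zero x) ((hbc i).differentiable one_ne_zero x), h1]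
    ring
  have hint : ∀ i, Integrable (fun x => pd i (fun x => W x ^ 2 * b i x) x) := fun i =>
    ((contDiff_pd (m := 0) (hH i) (by norm_num) i).continuous).integrable_of_hasCompactSupport
      (((hHc i).fderiv ℝ).comp_left (g := fun L : Space →L[ℝ] ℝ =>
        L (EuclideanSpace.single i (1 : ℝ))) (by simp))
  have h0 : ∫ x, ∑ i, pd i (fun x => W x ^ 2 * b i x) x = 0 := by
    rw [integral_finsetSum _ fun i _ => hint i]
    exact Finset.sum_eq_zero fun i _ => integral_fderiv_apply_eq_zero (hH i) (hHc i) _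
  have hpt : ∀ x, 3 * W x ^ 2 / (1 + ‖x‖ ^ 2) ^ 2 + ∑ i, pd i (fun x => W x ^ 2 * b i x) x
      ≤ ∑ i, pd i W x ^ 2 := by
    intro x
    have hp : 1 + ‖x‖ ^ 2 ≠ 0 := by positivity
    have h1 : ∑ i, (pd i W x - W x * b i x) ^ 2 + ∑ i, pd i (fun x => W x ^ 2 * b i x) x
        = ∑ i, pd i W x ^ 2 - 3 * W x ^ 2 / (1 + ‖x‖ ^ 2) ^ 2 := by
      have h2 : ∀ i, (pd i W x - W x * b i x) ^ 2 + pd i (fun x => W x ^ 2 * b i x) x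
          = pd i W x ^ 2 + (W x ^ 2 * (-1 / (1 + ‖x‖ ^ 2))
            + 3 * W x ^ 2 / (1 + ‖x‖ ^ 2) ^ 2 * x i ^ 2) := by
        intro i
        rw [hHd, hbd]
        simp only [hb]
        field_simp
        ring
      rw [← Finset.sum_add_distrib]
      simp only [h2]
      rw [Finset.sum_add_distrib, Finset.sum_add_distrib, ← Finset.mul_sum _ _ (3 * W x ^ 2 / _),
        sum_coord_sq]
      simp only [Finset.sum_const, Finset.card_univ, Fintype.card_fin, nsmul_eq_mul]
      field_simp
      push_cast
      ring
    have h3 : 0 ≤ ∑ i, (pd i W x - W x * b i x) ^ 2 := Finset.sum_nonneg fun i _ => sq_nonneg _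
    linarith
  have hi1 : Integrable (fun x => 3 * W x ^ 2 / (1 + ‖x‖ ^ 2) ^ 2) := by
    refine Continuous.integrable_of_hasCompactSupport ?_ ?_
    · exact (continuous_const.mul (hW.continuous.pow 2)).div (by fun_prop) fun x => by positivity
    · exact hc.mono fun x hx => fun h => hx (by simp [h])
  have hi2 : Integrable (fun x => ∑ i, pd i W x ^ 2) := by
    refine integrable_finsetSum _ fun i _ => ?_
    refine Continuous.integrable_of_hasCompactSupport
      ((contDiff_pd (m := 0) hW (by norm_num) i).continuous.pow 2) ?_
    exact (hc.fderiv ℝ).comp_left (g := fun L : Space →L[ℝ] ℝ =>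
        L (EuclideanSpace.single i (1 : ℝ)) ^ 2) (by simp)
  have hi3 : Integrable (fun x => ∑ i, pd i (fun x => W x ^ 2 * b i x) x) :=
    integrable_finsetSum _ fun i _ => hint i
  have h4 := integral_mono (hi1.add hi3) hi2 (fun x => by simpa using hpt x)
  rw [integral_add' hi1 hi3] at h4
  rw [h0] at h4
  linarith

/-- A smooth cutoff, equal to `1` for `|x| ≤ n` and to `0` for `|x|² ≥ 2 n²`. -/
def cutoff (n : ℝ) (x : Space) : ℝ := Real.smoothTransition (2 - ‖x‖ ^ 2 / n ^ 2)

lemma contDiff_cutoff (n : ℝ) {m : ℕ∞} : ContDiff ℝ m (cutoff n) :=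
  Real.smoothTransition.contDiff.comp
    (contDiff_const.sub ((contDiff_norm_sq ℝ).div_const _))

lemma cutoff_eq_one {n : ℝ} (hn : 0 < n) {x : Space} (hx : ‖x‖ ≤ n) : cutoff n x = 1 := by
  refine Real.smoothTransition.one_of_one_le ?_
  have : ‖x‖ ^ 2 / n ^ 2 ≤ 1 := by
    rw [div_le_one (by positivity)]
    gcongr
  linarith

lemma cutoff_eq_zero {n : ℝ} (hn : 0 < n) {x : Space} (hx : 2 * n ≤ ‖x‖) : cutoff n x = 0 := by
  refine Real.smoothTransition.zero_of_nonpos ?_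
  have : 2 ≤ ‖x‖ ^ 2 / n ^ 2 := by
    rw [le_div_iff₀ (by positivity)]
    nlinarith
  linarith

lemma hasCompactSupport_cutoff {n : ℝ} (hn : 0 < n) : HasCompactSupport (cutoff n) :=
  HasCompactSupport.of_support_subset_isCompact (isCompact_closedBall (0 : Space) (2 * n))
    fun x hx => by
      by_contra h
      simp only [mem_closedBall_zero_iff, not_le] at h
      exact hx (cutoff_eq_zero hn h.le)

lemma pd_cutoff (n : ℝ) (x : Space) (i : Fin 3) :
    pd i (cutoff n) x = deriv Real.smoothTransition (2 - ‖x‖ ^ 2 / n ^ 2) * (-(2 * x i / n ^ 2)) := by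
  refine pd_of_line ((contDiff_cutoff n (m := 1)).differentiable one_ne_zero x) ?_
  have hd := (Real.smoothTransition.contDiff (n := 1)).differentiable one_ne_zero
    (2 - ‖x‖ ^ 2 / n ^ 2)
  have hl := ((hasDerivAt_line_norm_sq x (EuclideanSpace.single i (1 : ℝ))).div_const
    (n ^ 2)).const_sub 2
  rw [inner_single_right'] at hl
  have hd' : HasDerivAt Real.smoothTransition (deriv Real.smoothTransition (2 - ‖x‖ ^ 2 / n ^ 2))
      (2 - ‖x + (0 : ℝ) • EuclideanSpace.single i (1 : ℝ)‖ ^ 2 / n ^ 2) := by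
    simpa using hd.hasDerivAt
  exact hd'.comp (0 : ℝ) hl

/-- The gradient of the cutoff has size `O(1/n)` and lives in the shell `n ≤ |x| ≤ 2 n`. -/
lemma sum_pd_cutoff_sq_le {Cχ : ℝ} (hCχ : ∀ s, |deriv Real.smoothTransition s| ≤ Cχ) {n : ℝ}
    (hn : 0 < n) (x : Space) :
    ∑ i, pd i (cutoff n) x ^ 2 ≤
      (Metric.closedBall (0 : Space) (2 * n) \ Metric.ball (0 : Space) n).indicator
        (fun _ => 16 * Cχ ^ 2 / n ^ 2) x := by
  have h1 : ∑ i, pd i (cutoff n) x ^ 2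
      = (deriv Real.smoothTransition (2 - ‖x‖ ^ 2 / n ^ 2)) ^ 2 * (4 / n ^ 4 * ‖x‖ ^ 2) := by
    have h2 : ∀ i, pd i (cutoff n) x ^ 2
        = (deriv Real.smoothTransition (2 - ‖x‖ ^ 2 / n ^ 2)) ^ 2 * (4 / n ^ 4) * x i ^ 2 := by
      intro i
      rw [pd_cutoff]; ring
    simp only [h2]
    rw [← Finset.mul_sum, sum_coord_sq, mul_assoc]
  rw [h1]
  by_cases hx : x ∈ Metric.closedBall (0 : Space) (2 * n) \ Metric.ball (0 : Space) n
  · rw [indicator_of_mem hx]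
    have h2 : ‖x‖ ≤ 2 * n := by simpa using hx.1
    have h3 : (deriv Real.smoothTransition (2 - ‖x‖ ^ 2 / n ^ 2)) ^ 2 ≤ Cχ ^ 2 := by
      rw [← sq_abs]
      have := hCχ (2 - ‖x‖ ^ 2 / n ^ 2)
      gcongr
    have h4 : 4 / n ^ 4 * ‖x‖ ^ 2 ≤ 16 / n ^ 2 := by
      calc 4 / n ^ 4 * ‖x‖ ^ 2 ≤ 4 / n ^ 4 * (2 * n) ^ 2 := by gcongr
        _ = 16 / n ^ 2 := by field_simp; ring
    calc _ ≤ Cχ ^ 2 * (16 / n ^ 2) := by gcongr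
      _ = _ := by ring
  · rw [indicator_of_notMem hx]
    refine le_of_eq ?_
    rw [deriv_smoothTransition_eq_zero]
    · ring
    · simp only [Set.mem_sdiff, mem_closedBall_zero_iff, mem_ball_zero_iff, not_and_or, not_le, not_not] at hx
      rcases hx with hx | hx
      · left
        have : 2 < ‖x‖ ^ 2 / n ^ 2 := by
          rw [lt_div_iff₀ (by positivity)]
          nlinarith
        linarith
      · right
        have : ‖x‖ ^ 2 / n ^ 2 < 1 := by
          rw [div_lt_one (by positivity)]
          gcongr
        linarith

/-- Integration by parts in `∫ ζ² V ΔV`, arranged so that only the cutoff and not `V` is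
differentiated in the error term. -/
lemma energy_identity {V ζ : Space → ℝ} (hV : ContDiff ℝ 2 V) (hζ : ContDiff ℝ 1 ζ)
    (hc : HasCompactSupport ζ) :
    ∫ x, ∑ i, pd i (fun y => ζ y * V y) x ^ 2
      = (∫ x, V x ^ 2 * ∑ i, pd i ζ x ^ 2) - ∫ x, ζ x ^ 2 * (V x * Laplacian.laplacian V x) := by
  have hp : ∀ i, ContDiff ℝ 1 (pd i V) := fun i => contDiff_pd hV (by norm_num) i
  have hV1 : ContDiff ℝ 1 V := hV.of_le (by norm_num)
  have hH : ∀ i, ContDiff ℝ 1 (fun x => ζ x ^ 2 * (V x * pd i V x)) := fun i =>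
    (hζ.pow 2).mul (hV1.mul (hp i))
  have hHc : ∀ i, HasCompactSupport (fun x => ζ x ^ 2 * (V x * pd i V x)) := fun i =>
    hc.mono fun x hx => fun h => hx (by simp [h])
  have hHd : ∀ i x, pd i (fun x => ζ x ^ 2 * (V x * pd i V x)) x
      = pd i (fun y => ζ y * V y) x ^ 2 - V x ^ 2 * pd i ζ x ^ 2
        + ζ x ^ 2 * (V x * pd i (pd i V) x) := by
    intro i x
    have hζx := hζ.differentiable one_ne_zero x
    have hVx := hV1.differentiable one_ne_zero x
    have hpx := (hp i).differentiable one_ne_zero x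
    have h1 : pd i (fun x => ζ x ^ 2) x = 2 * ζ x * pd i ζ x := by
      have : (fun x => ζ x ^ 2) = fun x => ζ x * ζ x := by ext; ring
      rw [this, pd_mul hζx hζx]; ring
    rw [pd_mul ((hζ.pow 2).differentiable one_ne_zero x)
      ((hV1.mul (hp i)).differentiable one_ne_zero x), h1, pd_mul hVx hpx, pd_mul hζx hVx]
    ring
  have hcp : ∀ i, Continuous (pd i ζ) := fun i =>
    (contDiff_pd (m := 0) hζ (by norm_num) i).continuous
  have hsupp : ∀ i, HasCompactSupport (pd i ζ) := fun i =>
    (hc.fderiv ℝ).comp_left (g := fun L : Space →L[ℝ] ℝ =>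
        L (EuclideanSpace.single i (1 : ℝ))) (by simp)
  have hi0 : ∀ i, Integrable (fun x => pd i (fun x => ζ x ^ 2 * (V x * pd i V x)) x) := fun i =>
    ((contDiff_pd (m := 0) (hH i) (by norm_num) i).continuous).integrable_of_hasCompactSupport
      (((hHc i).fderiv ℝ).comp_left (g := fun L : Space →L[ℝ] ℝ =>
        L (EuclideanSpace.single i (1 : ℝ))) (by simp))
  have hi1 : Integrable (fun x => V x ^ 2 * ∑ i, pd i ζ x ^ 2) := by
    simp only [Finset.mul_sum]
    refine integrable_finsetSum _ fun i _ => ?_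
    refine ((hV.continuous.pow 2).mul ((hcp i).pow 2)).integrable_of_hasCompactSupport ?_
    exact (hsupp i).mono fun x hx => fun h => hx (by simp [h])
  have hi2 : Integrable (fun x => ζ x ^ 2 * (V x * Laplacian.laplacian V x)) := by
    refine ((hζ.continuous.pow 2).mul
      (hV.continuous.mul (continuous_laplacian hV))).integrable_of_hasCompactSupport ?_
    exact hc.mono fun x hx => fun h => hx (by simp [h])
  have h0 : ∫ x, ∑ i, pd i (fun x => ζ x ^ 2 * (V x * pd i V x)) x = 0 := by
    rw [integral_finsetSum _ fun i _ => hi0 i]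
    exact Finset.sum_eq_zero fun i _ => integral_fderiv_apply_eq_zero (hH i) (hHc i) _
  have hpt : ∀ x, ∑ i, pd i (fun y => ζ y * V y) x ^ 2
      = ∑ i, pd i (fun x => ζ x ^ 2 * (V x * pd i V x)) x + (V x ^ 2 * ∑ i, pd i ζ x ^ 2
        - ζ x ^ 2 * (V x * Laplacian.laplacian V x)) := by
    intro x
    simp only [hHd, laplacian_eq_sum_pd hV, Finset.sum_add_distrib, Finset.sum_sub_distrib,
      Finset.mul_sum]
    ring
  have hi3 : Integrable (fun x => ∑ i, pd i (fun x => ζ x ^ 2 * (V x * pd i V x)) x) :=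
    integrable_finsetSum _ fun i _ => hi0 i
  have hi4 : Integrable (fun x => V x ^ 2 * ∑ i, pd i ζ x ^ 2
      - ζ x ^ 2 * (V x * Laplacian.laplacian V x)) := hi1.sub hi2
  simp only [hpt]
  rw [integral_add hi3 hi4, h0, zero_add, integral_sub hi1 hi2]

/-- The field of a density supported in a fixed ball is controlled in `L²` by the density. -/
lemma elliptic_estimate {V : Space → ℝ} (hV : ContDiff ℝ 2 V)
    (hlim : Tendsto V (cocompact Space) (𝓝 0)) {R : ℝ} (hR0 : 0 < R)
    (hR : ∀ x, R < ‖x‖ → Laplacian.laplacian V x = 0) :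
    ∫ x in Metric.closedBall 0 R, ‖gradient V x‖ ^ 2
      ≤ (1 + R ^ 2) ^ 2 / 3 * ∫ x, Laplacian.laplacian V x ^ 2 := by
  obtain ⟨C, hC0, hC⟩ := exists_abs_le_plummer hV hlim hR
  obtain ⟨Cχ, hCχ0, hCχ⟩ := exists_abs_deriv_smoothTransition_le
  have hV1 : ContDiff ℝ 1 V := hV.of_le (by norm_num)
  have hcl := continuous_laplacian hV
  have hclc : HasCompactSupport (Laplacian.laplacian V) :=
    HasCompactSupport.of_support_subset_isCompact (isCompact_closedBall (0 : Space) R)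
      fun x hx => by
        by_contra h
        simp only [mem_closedBall_zero_iff, not_le] at h
        exact hx (hR x h)
  set c := 3 / (1 + R ^ 2) ^ 2 with hc
  have hcpos : 0 < c := by positivity
  set κ := volume.real (Metric.ball (0 : Space) 1) with hκ
  have hiσ : Integrable (fun x => Laplacian.laplacian V x ^ 2) :=
    (hcl.pow 2).integrable_of_hasCompactSupport (hclc.mono fun x hx => fun h => hx (by simp [h]))
  -- the estimate with an error term from the cutoff at radius `n`
  have key : ∀ n : ℝ, R + 1 ≤ n → ∫ x in Metric.closedBall 0 R, ‖gradient V x‖ ^ 2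
      ≤ 256 * C ^ 2 * Cχ ^ 2 * κ / n + 1 / c * ∫ x, Laplacian.laplacian V x ^ 2 := by
    intro n hn
    have hnR : R ≤ n := by linarith
    have hn0 : 0 < n := by linarith
    have hζ : ContDiff ℝ 1 (cutoff n) := contDiff_cutoff n
    have hζc := hasCompactSupport_cutoff hn0
    have hW : ContDiff ℝ 1 (fun y => cutoff n y * V y) := hζ.mul hV1
    have hWc : HasCompactSupport (fun y => cutoff n y * V y) := hζc.mul_right
    have hE := energy_identity hV hζ hζc
    have hH := hardy hW hWc
    set I := ∫ x, ∑ i, pd i (fun y => cutoff n y * V y) x ^ 2 with hI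
    have hiI : Integrable (fun x => ∑ i, pd i (fun y => cutoff n y * V y) x ^ 2) := by
      refine integrable_finsetSum _ fun i _ => ?_
      refine Continuous.integrable_of_hasCompactSupport
        ((contDiff_pd (m := 0) hW (by norm_num) i).continuous.pow 2) ?_
      exact (hWc.fderiv ℝ).comp_left (g := fun L : Space →L[ℝ] ℝ =>
          L (EuclideanSpace.single i (1 : ℝ)) ^ 2) (by simp)
    have hloc : ∫ x in Metric.closedBall 0 R, ‖gradient V x‖ ^ 2 ≤ I := by
      have h1 : ∫ x in Metric.closedBall 0 R, ‖gradient V x‖ ^ 2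
          = ∫ x in Metric.closedBall 0 R, ∑ i, pd i (fun y => cutoff n y * V y) x ^ 2 := by
        refine setIntegral_congr_fun measurableSet_closedBall fun x hx => ?_
        have hxn : x ∈ Metric.ball (0 : Space) n := by
          rw [mem_ball_zero_iff]
          rw [mem_closedBall_zero_iff] at hx
          linarith
        have h2 : (fun y => cutoff n y * V y) =ᶠ[𝓝 x] V := by
          filter_upwards [Metric.isOpen_ball.mem_nhds hxn] with y hy
          rw [cutoff_eq_one hn0 (mem_ball_zero_iff.1 hy).le, one_mul]
        simp only [norm_gradient_sq, pd]
        rw [h2.fderiv_eq]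
      rw [h1]
      exact setIntegral_le_integral hiI (ae_of_all _ fun x => Finset.sum_nonneg fun i _ => sq_nonneg _)
    -- in the shell `n ≤ |x| ≤ 2 n` one has `V² = O(n⁻²)`, `|∇ζ|² = O(n⁻²)`, and the volume is `O(n³)`
    have herr : ∫ x, V x ^ 2 * ∑ i, pd i (cutoff n) x ^ 2 ≤ 128 * C ^ 2 * Cχ ^ 2 * κ / n := by
      set A := Metric.closedBall (0 : Space) (2 * n) \ Metric.ball (0 : Space) n with hA
      have hmA : MeasurableSet A := measurableSet_closedBall.diff measurableSet_ball
      have hAfin : volume A ≠ ⊤ :=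
        ((measure_mono sdiff_subset).trans_lt measure_closedBall_lt_top).ne
      have hpt : ∀ x, V x ^ 2 * ∑ i, pd i (cutoff n) x ^ 2
          ≤ A.indicator (fun _ => 16 * C ^ 2 * Cχ ^ 2 / n ^ 4) x := by
        intro x
        have h1 := sum_pd_cutoff_sq_le hCχ hn0 x
        by_cases hx : x ∈ A
        · rw [indicator_of_mem hx] at h1 ⊢
          have hxn : n ≤ ‖x‖ := by
            have := hx.2
            simpa using this
          have h2 : V x ^ 2 ≤ C ^ 2 * (1 / n ^ 2) := by
            calc V x ^ 2 = |V x| ^ 2 := (sq_abs _).symm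
              _ ≤ (C * plummer x) ^ 2 := by
                have := hC x
                gcongr
              _ = C ^ 2 * (1 + ‖x‖ ^ 2)⁻¹ := by rw [mul_pow, plummer_sq]
              _ ≤ C ^ 2 * (1 / n ^ 2) := by
                rw [← one_div]
                gcongr
                nlinarith
          calc V x ^ 2 * ∑ i, pd i (cutoff n) x ^ 2 ≤ C ^ 2 * (1 / n ^ 2) * (16 * Cχ ^ 2 / n ^ 2) := by
                gcongr
            _ = _ := by field_simp
        · rw [indicator_of_notMem hx] at h1 ⊢
          exact mul_nonpos_of_nonneg_of_nonpos (sq_nonneg _) h1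
      have hvol : volume.real A ≤ 8 * n ^ 3 * κ := by
        refine (measureReal_mono sdiff_subset measure_closedBall_lt_top.ne).trans (le_of_eq ?_)
        rw [Measure.real, Measure.addHaar_closedBall _ _ (by positivity), ENNReal.toReal_mul,
          ENNReal.toReal_ofReal (by positivity)]
        simp only [finrank_euclideanSpace, Fintype.card_fin]
        rw [hκ, Measure.real]; ring
      have hcont : Continuous (fun x => V x ^ 2 * ∑ i, pd i (cutoff n) x ^ 2) :=
        (hV.continuous.pow 2).mul (continuous_finsetSum _ fun i _ =>
          (contDiff_pd (m := 0) hζ (by norm_num) i).continuous.pow 2)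
      have hiA : Integrable (A.indicator (fun _ : Space => 16 * C ^ 2 * Cχ ^ 2 / n ^ 4)) :=
        (integrable_indicator_iff hmA).2 (integrableOn_const hAfin)
      have h0 : ∀ x, 0 ≤ V x ^ 2 * ∑ i, pd i (cutoff n) x ^ 2 := fun x =>
        mul_nonneg (sq_nonneg _) (Finset.sum_nonneg fun i _ => sq_nonneg _)
      refine (integral_mono_of_nonneg (ae_of_all _ h0) hiA (ae_of_all _ hpt)).trans ?_
      rw [integral_indicator hmA, setIntegral_const, smul_eq_mul]
      calc volume.real A * (16 * C ^ 2 * Cχ ^ 2 / n ^ 4)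
          ≤ (8 * n ^ 3 * κ) * (16 * C ^ 2 * Cχ ^ 2 / n ^ 4) := by gcongr
        _ = _ := by field_simp; ring
    -- Hardy's inequality absorbs `V` into half of the energy `I`; `c` is the minimum of the weight on
    -- `|x| ≤ R`
    have hσ : -∫ x, cutoff n x ^ 2 * (V x * Laplacian.laplacian V x)
        ≤ 1 / 2 * I + 1 / (2 * c) * ∫ x, Laplacian.laplacian V x ^ 2 := by
      have hi2 : Integrable (fun x => cutoff n x ^ 2 * (V x * Laplacian.laplacian V x)) := by
        refine ((hζ.continuous.pow 2).mul
          (hV.continuous.mul hcl)).integrable_of_hasCompactSupport ?_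
        exact hζc.mono fun x hx => fun h => hx (by simp [h])
      have hi3 : Integrable (fun x => 3 * (cutoff n x * V x) ^ 2 / (1 + ‖x‖ ^ 2) ^ 2) := by
        refine Continuous.integrable_of_hasCompactSupport ?_ ?_
        · exact (continuous_const.mul (hW.continuous.pow 2)).div (by fun_prop)
            fun x => by positivity
        · exact hWc.mono fun x hx => fun h => hx (by simp [h])
      have hpt : ∀ x, -(cutoff n x ^ 2 * (V x * Laplacian.laplacian V x))
          ≤ 1 / 2 * (3 * (cutoff n x * V x) ^ 2 / (1 + ‖x‖ ^ 2) ^ 2)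
            + 1 / (2 * c) * Laplacian.laplacian V x ^ 2 := by
        intro x
        by_cases hx : ‖x‖ ≤ R
        · rw [cutoff_eq_one hn0 (hx.trans hnR), one_mul, one_pow, one_mul]
          have h1 : c * V x ^ 2 ≤ 3 * V x ^ 2 / (1 + ‖x‖ ^ 2) ^ 2 := by
            rw [hc, div_mul_eq_mul_div]
            have := norm_nonneg x
            gcongr
          have h2 : 0 ≤ (c * V x + Laplacian.laplacian V x) ^ 2 / (2 * c) := by positivity
          have h3 : (c * V x + Laplacian.laplacian V x) ^ 2 / (2 * c) = 1 / 2 * (c * V x ^ 2)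
            + V x * Laplacian.laplacian V x + 1 / (2 * c) * Laplacian.laplacian V x ^ 2 := by
            field_simp
            ring
          linarith
        · rw [hR x (lt_of_not_ge hx)]
          simp only [mul_zero, neg_zero]
          positivity
      rw [← integral_neg]
      refine (integral_mono hi2.neg ((hi3.const_mul _).add (hiσ.const_mul _)) hpt).trans ?_
      rw [integral_add' (hi3.const_mul _) (hiσ.const_mul _), integral_const_mul, integral_const_mul]
      gcongr
    have h5 : 1 / (2 * c) * ∫ x, Laplacian.laplacian V x ^ 2
        = 1 / 2 * (1 / c * ∫ x, Laplacian.laplacian V x ^ 2) := by field_simp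
    have h6 : 256 * C ^ 2 * Cχ ^ 2 * κ / n = 2 * (128 * C ^ 2 * Cχ ^ 2 * κ / n) := by ring
    rw [h6]
    linarith
  have hlim2 : Tendsto (fun n : ℝ => 256 * C ^ 2 * Cχ ^ 2 * κ / n
      + 1 / c * ∫ x, Laplacian.laplacian V x ^ 2) atTop
      (𝓝 (0 + 1 / c * ∫ x, Laplacian.laplacian V x ^ 2)) :=
    (tendsto_const_nhds.div_atTop tendsto_id).add tendsto_const_nhds
  have h7 := ge_of_tendsto hlim2 ((eventually_ge_atTop (R + 1)).mono key)
  rw [zero_add] at h7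
  refine h7.trans (le_of_eq ?_)
  rw [hc]; field_simp

/-! ### Rotations of potentials and densities -/

lemma laplacian_comp_isometry {V : Space → ℝ} (hV : ContDiff ℝ 2 V) (A : Space ≃ₗᵢ[ℝ] Space)
    (x : Space) : Laplacian.laplacian (fun y => V (A y)) x = Laplacian.laplacian V (A x) := by
  set b := EuclideanSpace.basisFun (Fin 3) ℝ
  rw [InnerProductSpace.laplacian_eq_iteratedFDeriv_orthonormalBasis _ b,
    InnerProductSpace.laplacian_eq_iteratedFDeriv_orthonormalBasis _ (b.map A)]
  refine Finset.sum_congr rfl fun i _ => ?_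
  have h := ContinuousLinearMap.iteratedFDeriv_comp_right
    (A.toContinuousLinearEquiv : Space →L[ℝ] Space) hV x (i := 2) le_rfl
  have h' : iteratedFDeriv ℝ 2 (fun y => V (A y)) x = _ := h
  rw [h', ContinuousMultilinearMap.compContinuousLinearMap_apply]
  congr 1
  ext j
  fin_cases j <;> rfl

lemma gradient_comp_isometry {V : Space → ℝ} (hV : Differentiable ℝ V) (A : Space ≃ₗᵢ[ℝ] Space)
    (x : Space) : gradient (fun y => V (A y)) x = A.symm (gradient V (A x)) := by
  refine ext_inner_right ℝ fun w => ?_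
  have h1 : HasFDerivAt (fun y => V (A y))
      ((fderiv ℝ V (A x)).comp (A.toContinuousLinearEquiv : Space →L[ℝ] Space)) x :=
    (hV (A x)).hasFDerivAt.comp x (A.toContinuousLinearEquiv : Space →L[ℝ] Space).hasFDerivAt
  rw [inner_gradient, h1.fderiv, ← A.inner_map_map, A.apply_symm_apply, inner_gradient]
  rfl

lemma gradient_sub {V W : Space → ℝ} (hV : Differentiable ℝ V) (hW : Differentiable ℝ W)
    (x : Space) : gradient (fun y => V y - W y) x = gradient V x - gradient W x := by
  refine ext_inner_right ℝ fun w => ?_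
  have h1 : HasFDerivAt (fun y => V y - W y) _ x := (hV x).hasFDerivAt.sub (hW x).hasFDerivAt
  rw [inner_gradient, h1.fderiv, inner_sub_left, inner_gradient, inner_gradient]
  rfl

/-- The maximum principle for harmonic functions vanishing at infinity, by comparison with small
multiples of the Plummer potential. -/
lemma le_zero_of_laplacian_eq_zero {V : Space → ℝ} (hV : ContDiff ℝ 2 V)
    (hlim : Tendsto V (cocompact Space) (𝓝 0)) (hΔ : ∀ x, Laplacian.laplacian V x = 0)
    (x : Space) : V x ≤ 0 := by
  have key : ∀ ε : ℝ, 0 < ε → V x ≤ ε * plummer x := by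
    intro ε hε
    have h1 : ContDiff ℝ 2 (ε • plummer) := contDiff_plummer.const_smul ε
    have h2 := nonneg_of_laplacian_neg (V := ε • plummer - V) (h1.sub hV) (by
      have h3 := (tendsto_plummer.const_mul ε).sub hlim
      rw [mul_zero, sub_zero] at h3
      exact h3) (fun y => by
        rw [ContDiffAt.laplacian_sub h1.contDiffAt hV.contDiffAt,
          InnerProductSpace.laplacian_smul ε contDiff_plummer.contDiffAt,
          laplacian_plummer, smul_eq_mul, hΔ]
        have : 0 < (1 + ‖y‖ ^ 2) ^ (-(5 / 2) : ℝ) := by positivity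
        nlinarith) x
    simp only [Pi.sub_apply, Pi.smul_apply, smul_eq_mul] at h2
    linarith
  by_contra! h
  have hp := plummer_pos x
  have := key (V x / (2 * plummer x)) (by positivity)
  have h2 : V x / (2 * plummer x) * plummer x = V x / 2 := by field_simp
  linarith

/-- Liouville: a harmonic function on `ℝ³` that vanishes at infinity is zero. -/
lemma eq_zero_of_laplacian_eq_zero {V : Space → ℝ} (hV : ContDiff ℝ 2 V)
    (hlim : Tendsto V (cocompact Space) (𝓝 0)) (hΔ : ∀ x, Laplacian.laplacian V x = 0)
    (x : Space) : V x = 0 := by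
  refine le_antisymm (le_zero_of_laplacian_eq_zero hV hlim hΔ x) ?_
  have hlim' : Tendsto (-V) (cocompact Space) (𝓝 0) := by
    rw [← neg_zero (G := ℝ)]; exact hlim.neg
  have := le_zero_of_laplacian_eq_zero (V := -V) hV.neg hlim' (fun y => by
    rw [InnerProductSpace.laplacian_neg, Pi.neg_apply, hΔ, neg_zero]) x
  simpa using this

lemma density_comp_isometry (g : Phase → ℝ) (A : Space ≃ₗᵢ[ℝ] Space) (x : Space) :
    density (fun z => g (A z.1, A z.2)) x = density g (A x) :=
  A.measurePreserving.integral_comp A.toHomeomorph.measurableEmbedding fun v => g (A x, v)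

lemma tendsto_comp_isometry {V : Space → ℝ} (hlim : Tendsto V (cocompact Space) (𝓝 0))
    (A : Space ≃ₗᵢ[ℝ] Space) : Tendsto (fun y => V (A y)) (cocompact Space) (𝓝 0) :=
  hlim.comp A.toHomeomorph.isClosedEmbedding.tendsto_cocompact

/-- Pointwise spherical symmetry. -/
def IsRotInvariant (g : Phase → ℝ) : Prop :=
  ∀ (A : Space ≃ₗᵢ[ℝ] Space) (z : Phase), g (A z.1, A z.2) = g z

/-- For continuous functions symmetry almost everywhere is symmetry everywhere. -/
lemma IsRotInvariant.of_ae {g : Phase → ℝ} (hg : Continuous g) (h : IsSphericallySymmetric g) :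
    IsRotInvariant g := by
  intro A
  have h1 : Continuous (fun z : Phase => g (A z.1, A z.2)) :=
    hg.comp ((A.continuous.comp continuous_fst).prodMk (A.continuous.comp continuous_snd))
  exact congrFun (Continuous.ae_eq_iff_eq (volume : Measure Phase) h1 hg |>.1 (h A))

/-- The set of points with `L ≥ λ`, `|x| ≤ R`, `|v| ≤ P`. -/
def confined (lam R P : ℝ) : Set Phase := {z | lam ≤ angMom z ∧ ‖z.1‖ ≤ R ∧ ‖z.2‖ ≤ P}

lemma isCompact_confined (lam R P : ℝ) : IsCompact (confined lam R P) := isCompact_angMom_ge _ _ _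

lemma fst_ne_zero_of_confined {lam R P : ℝ} (hlam : 0 < lam) {z : Phase}
    (hz : z ∈ confined lam R P) : z.1 ≠ 0 := fst_ne_zero_of_angMom_pos (hlam.trans_le hz.1)

lemma confined_map {lam R P : ℝ} (A : Space ≃ₗᵢ[ℝ] Space) {z : Phase} :
    (A z.1, A z.2) ∈ confined lam R P ↔ z ∈ confined lam R P := by
  simp only [confined, mem_ofPred_eq, A.norm_map]
  rw [angMom_map]

/-- The Cauchy–Schwarz inequality for functions supported in a ball of velocities. -/
lemma sq_integral_le {g : Space → ℝ} {P : ℝ} (hP : 0 < P) (hg : Continuous g)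
    (h0 : ∀ v, P < ‖v‖ → g v = 0) :
    (∫ v, g v) ^ 2 ≤ volume.real (Metric.closedBall (0 : Space) P) * ∫ v, g v ^ 2 := by
  set Bv := Metric.closedBall (0 : Space) P with hB
  set β := volume.real Bv with hβ
  have hc : HasCompactSupport g :=
    HasCompactSupport.of_support_subset_isCompact (isCompact_closedBall (0 : Space) P)
      fun x hx => by
        by_contra h
        simp only [mem_closedBall_zero_iff, not_le] at h
        exact hx (h0 x h)
  have hi : Integrable g := hg.integrable_of_hasCompactSupport hc
  have hi2 : Integrable (fun v => g v ^ 2) :=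
    (hg.pow 2).integrable_of_hasCompactSupport (hc.mono fun x hx => fun h => hx (by simp [h]))
  have hβ0 : 0 < β := by
    rw [hβ, Measure.real]
    exact ENNReal.toReal_pos (Metric.measure_closedBall_pos _ _ hP).ne' measure_closedBall_lt_top.ne
  -- expand `(g - a)² ≥ 0` with `a` the mean value of `g` over the ball
  set a := (∫ v, g v) / β with ha
  have hiB : Integrable (Bv.indicator (fun _ : Space => a ^ 2)) :=
    (integrable_indicator_iff measurableSet_closedBall).2
      (integrableOn_const measure_closedBall_lt_top.ne)
  have h1 : ∫ v, 2 * a * g v ≤ ∫ v, (Bv.indicator (fun _ : Space => a ^ 2) v + g v ^ 2) := by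
    refine integral_mono (hi.const_mul _) (hiB.add hi2) fun v => ?_
    by_cases hv : v ∈ Bv
    · simp only [indicator_of_mem hv]
      nlinarith [sq_nonneg (a - g v)]
    · have : g v = 0 := h0 v (by simpa [hB] using hv)
      simp [this, indicator_of_notMem hv]
  rw [integral_const_mul, integral_add hiB hi2, integral_indicator measurableSet_closedBall,
    setIntegral_const, smul_eq_mul] at h1
  have h2 : ∫ v, g v = a * β := by rw [ha]; field_simp
  rw [h2] at h1 ⊢
  have h3 : a ^ 2 * β ≤ ∫ v, g v ^ 2 := by
    rw [← hβ] at h1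
    nlinarith
  nlinarith

/-! ### Propagation of spherical symmetry -/

section symmetry
variable {Mc : ℝ} {f : ℝ → Phase → ℝ} {U : ℝ → Space → ℝ}

/-- Up to time `0` the derivatives of a solution are bounded on compact sets.  At `t = 0` only
one-sided derivatives in time exist, so that time is excluded from the conclusion. -/
lemma IsSolution.exists_fderiv_bound (hf : IsSolution Mc f U) (T : ℝ) {S : Set Phase}
    (hS : IsCompact S) :
    ∃ C, 0 ≤ C ∧ ∀ t ∈ Ioc 0 T, ∀ z ∈ S, ‖fderiv ℝ (joint f) (t, z)‖ ≤ C := by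
  have hu : UniqueDiffOn ℝ (Ici (0 : ℝ) ×ˢ (univ : Set Phase)) :=
    (uniqueDiffOn_Ici 0).prod uniqueDiffOn_univ
  have hc := hf.contDiff.continuousOn_fderivWithin hu le_rfl
  obtain ⟨C, hC⟩ := (isCompact_Icc.prod hS).exists_bound_of_continuousOn
    (hc.mono (prod_mono (fun t ht => ht.1) (subset_univ S) : Icc 0 T ×ˢ S ⊆ _))
  refine ⟨max C 0, le_max_right _ _, fun t ht z hz => ?_⟩
  have h1 := hC (t, z) ⟨⟨ht.1.le, ht.2⟩, hz⟩
  rw [fderivWithin_of_mem_nhds] at h1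
  · exact h1.trans (le_max_left _ _)
  · refine mem_nhds_iff.2 ⟨Ioi 0 ×ˢ univ, prod_mono Ioi_subset_Ici_self subset_rfl,
      isOpen_Ioi.prod isOpen_univ, ht.1, mem_univ _⟩

lemma IsSolution.integrable_of_confined (hf : IsSolution Mc f U) {t lam R P : ℝ} (ht : 0 ≤ t)
    (hsupp : ∀ z, f t z ≠ 0 → z ∈ confined lam R P) : Integrable (f t) :=
  (hf.continuous ht).integrable_of_hasCompactSupport
    (HasCompactSupport.of_support_subset_isCompact (isCompact_confined lam R P) hsupp)

/-- The failure of rotational symmetry of the field is controlled by that of the solution. -/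
lemma IsSolution.field_asymmetry_le (hf : IsSolution Mc f U) {t lam R P : ℝ} (ht : 0 ≤ t)
    (hR : 0 < R) (hP : 0 < P) (hsupp : ∀ z, f t z ≠ 0 → z ∈ confined lam R P)
    (A : Space ≃ₗᵢ[ℝ] Space) :
    ∫ x in Metric.closedBall 0 R, ‖A.symm (gradient (U t) (A x)) - gradient (U t) x‖ ^ 2
      ≤ (1 + R ^ 2) ^ 2 / 3 * ((4 * Real.pi) ^ 2 *
        (volume.real (Metric.closedBall (0 : Space) P) *
          ∫ z : Phase, (f t (A z.1, A z.2) - f t z) ^ 2)) := by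
  have hU := hf.potential_contDiff t ht
  have hUA : ContDiff ℝ 2 (fun y => U t (A y)) :=
    hU.comp A.toContinuousLinearEquiv.contDiff
  have hUd := hU.differentiable two_ne_zero
  have hUAd := hUA.differentiable two_ne_zero
  set V : Space → ℝ := fun y => U t (A y) - U t y with hV
  have hV2 : ContDiff ℝ 2 V := hUA.sub hU
  have hc := hf.continuous ht
  set h : Phase → ℝ := fun z => f t (A z.1, A z.2) - f t z with hh
  have hcA : Continuous (fun z : Phase => f t (A z.1, A z.2)) :=
    hc.comp ((A.continuous.comp continuous_fst).prodMk (A.continuous.comp continuous_snd))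
  have hhc : Continuous h := hcA.sub hc
  have hh0 : ∀ z, z ∉ confined lam R P → h z = 0 := by
    intro z hz
    have h1 : f t z = 0 := by_contra fun hn => hz (hsupp z hn)
    have h2 : f t (A z.1, A z.2) = 0 :=
      by_contra fun hn => hz ((confined_map A).1 (hsupp _ hn))
    simp [hh, h1, h2]
  have hhcs : HasCompactSupport h :=
    HasCompactSupport.of_support_subset_isCompact (isCompact_confined lam R P)
      fun z hz => by_contra fun hn => hz (hh0 z hn)
  have hLap : ∀ x, Laplacian.laplacian V x = 4 * Real.pi * ∫ v, h (x, v) := by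
    intro x
    have h1 : Laplacian.laplacian V x
        = Laplacian.laplacian (fun y => U t (A y)) x - Laplacian.laplacian (U t) x :=
      ContDiffAt.laplacian_sub hUA.contDiffAt hU.contDiffAt
    have hiA : Integrable (fun v => f t (A x, A v)) :=
      (A.measurePreserving.integrable_comp_emb A.toHomeomorph.measurableEmbedding).2
        (hf.density_exists t ht (A x))
    rw [h1, laplacian_comp_isometry hU, hf.poisson t ht, hf.poisson t ht,
      ← density_comp_isometry, ← mul_sub]
    simp only [hh, density]
    rw [integral_sub hiA (hf.density_exists t ht x)]
  have hest := elliptic_estimate hV2 (R := R) (by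
      have h1 := (tendsto_comp_isometry (hf.potential_vanishes t ht) A).sub
        (hf.potential_vanishes t ht)
      rwa [sub_zero] at h1) hR (fun x hx => by
        rw [hLap]
        have : (fun v => h (x, v)) = fun _ => 0 := by
          ext v
          exact hh0 _ fun hz => absurd hz.2.1 (not_le.2 hx)
        rw [this]; simp)
  have hgrad : ∀ x, gradient V x = A.symm (gradient (U t) (A x)) - gradient (U t) x := fun x => by
    rw [hV, gradient_sub hUAd hUd, gradient_comp_isometry hUd]
  simp only [hgrad] at hest
  refine hest.trans (mul_le_mul_of_nonneg_left ?_ (by positivity))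
  have hi2 : Integrable (fun z => h z ^ 2) :=
    (hhc.pow 2).integrable_of_hasCompactSupport (hhcs.mono fun x hx => fun h' => hx (by simp [h']))
  have hprod : ∫ z : Phase, h z ^ 2 = ∫ x, ∫ v, h (x, v) ^ 2 := by
    rw [volume_phase] at hi2 ⊢
    exact integral_prod _ hi2
  have hi3 : Integrable (fun x => ∫ v, h (x, v) ^ 2) := by
    rw [volume_phase] at hi2
    exact hi2.integral_prod_left
  rw [hprod, ← integral_const_mul, ← integral_const_mul]
  refine integral_mono_of_nonneg (ae_of_all _ fun x => sq_nonneg _)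
    ((hi3.const_mul _).const_mul _) (ae_of_all _ fun x => ?_)
  simp only [hLap, mul_pow]
  rw [← mul_pow]
  refine mul_le_mul_of_nonneg_left ?_ (by positivity)
  exact sq_integral_le hP (hhc.comp (by fun_prop)) fun v hv =>
    hh0 _ fun hz => absurd hz.2.2 (not_le.2 hv)

/-- Uniqueness-type argument: rotational symmetry is propagated as long as the support stays away
from vanishing angular momentum. -/
lemma IsSolution.rotInvariant_propagates (hf : IsSolution Mc f U) {a b lam R P : ℝ} (ha : 0 ≤ a)
    (hlam : 0 < lam) (hR : 0 < R) (hP : 0 < P)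
    (hsupp : ∀ t ∈ Icc a b, ∀ z, f t z ≠ 0 → z ∈ confined lam R P)
    (hinit : IsRotInvariant (f a)) {t : ℝ} (ht : t ∈ Icc a b) : IsRotInvariant (f t) := by
  intro A
  set S := confined lam R P with hS
  set Az : Phase → Phase := fun z => (A z.1, A z.2) with hAz
  have hAzc : ContDiff ℝ 1 Az :=
    (A.toContinuousLinearEquiv.contDiff.comp contDiff_fst).prodMk
      (A.toContinuousLinearEquiv.contDiff.comp contDiff_snd)
  set h : ℝ × Phase → ℝ := fun p => joint f (p.1, Az p.2) - joint f p with hh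
  have hh0 : ∀ t ∈ Icc a b, ∀ z, z ∉ S → h (t, z) = 0 := by
    intro t ht z hz
    have h1 : f t z = 0 := by_contra fun hn => hz (hsupp t ht z hn)
    have h2 : f t (A z.1, A z.2) = 0 :=
      by_contra fun hn => hz ((confined_map A).1 (hsupp t ht _ hn))
    simp [hh, joint, hAz, h1, h2]
  have hmap : Continuous (fun p : ℝ × Phase => (p.1, Az p.2)) :=
    continuous_fst.prodMk (hAzc.continuous.comp continuous_snd)
  have hhc : ContinuousOn h (Icc a b ×ˢ univ) := by
    have h1 : ContinuousOn (joint f) (Icc a b ×ˢ univ) :=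
      hf.continuousOn.mono (prod_mono (fun t ht => ha.trans ht.1) subset_rfl)
    exact (h1.comp hmap.continuousOn fun p hp => ⟨hp.1, mem_univ _⟩).sub h1
  have hhd : ∀ p : ℝ × Phase, 0 < p.1 → ContDiffAt ℝ 1 h p := fun p hp =>
    (ContDiffAt.comp (f := fun p : ℝ × Phase => (p.1, Az p.2)) p
      (hf.contDiffAt hp (Az p.2))
      (contDiff_fst.prodMk (hAzc.comp contDiff_snd)).contDiffAt).sub (hf.contDiffAt hp p.2)
  obtain ⟨C, hC0, hC⟩ := hf.exists_fderiv_bound b (isCompact_confined lam R P)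
  -- the derivative of the asymmetry along characteristics
  have hDh : ∀ t ∈ Ioo a b, ∀ z ∈ S, |fderiv ℝ h (t, z) (1, z.2, force Mc U t z.1)|
      ≤ C * ‖A.symm (gradient (U t) (A z.1)) - gradient (U t) z.1‖ := by
    intro t ht z hz
    have ht0 : 0 < t := ha.trans_lt ht.1
    have hz0 : z.1 ≠ 0 := fst_ne_zero_of_confined hlam hz
    have hAz0 : A z.1 ≠ 0 := by simpa using hz0
    have hdf := ((hf.contDiffAt ht0 z).differentiableAt one_ne_zero).hasFDerivAt
    have hdfA := ((hf.contDiffAt ht0 (Az z)).differentiableAt one_ne_zero).hasFDerivAt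
    set Al : Space →L[ℝ] Space := (A.toContinuousLinearEquiv : Space →L[ℝ] Space) with hAl
    have hm : HasFDerivAt (fun p : ℝ × Phase => (p.1, Az p.2))
        ((ContinuousLinearMap.fst ℝ ℝ Phase).prod (((Al.comp (ContinuousLinearMap.fst ℝ Space Space)).prod
          (Al.comp (ContinuousLinearMap.snd ℝ Space Space))).comp
            (ContinuousLinearMap.snd ℝ ℝ Phase))) (t, z) :=
      ContinuousLinearMap.hasFDerivAt ((ContinuousLinearMap.fst ℝ ℝ Phase).prod
        (((Al.comp (ContinuousLinearMap.fst ℝ Space Space)).prod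
          (Al.comp (ContinuousLinearMap.snd ℝ Space Space))).comp
            (ContinuousLinearMap.snd ℝ ℝ Phase)))
    have hcomp : HasFDerivAt h _ (t, z) :=
      (HasFDerivAt.comp (f := fun p : ℝ × Phase => (p.1, Az p.2)) (t, z) hdfA hm).sub hdf
    rw [hcomp.fderiv]
    have hch := hf.characteristic ht0 hz0
    have hchA := hf.characteristic ht0 (z := Az z) hAz0
    set K := force Mc U t z.1 with hK
    set K' := force Mc U t (A z.1) with hK'
    set J := fderiv ℝ (joint f) (t, Az z) with hJ
    -- `f` and its rotated copy are both transported, with forces that differ by `A K - K'`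
    have h1 : J (1, A z.2, A K) = J (0, 0, A K - K') := by
      have : ((1 : ℝ), A z.2, A K) = (1, A z.2, K') + (0, 0, A K - K') := by simp
      rw [this, map_add]
      have : J (1, A z.2, K') = 0 := hchA
      rw [this, zero_add]
    have hforce : ‖A K - K'‖ = ‖A.symm (gradient (U t) (A z.1)) - gradient (U t) z.1‖ := by
      rw [hK, hK', hf.force_eq ht0.le hz0, hf.force_eq ht0.le hAz0, ← A.norm_map (A.symm _ - _)]
      congr 1
      simp only [map_sub, map_neg, map_smul, A.apply_symm_apply, A.norm_map]
      abel
    have hval : (((fderiv ℝ (joint f) (t, Az z)).comp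
        ((ContinuousLinearMap.fst ℝ ℝ Phase).prod (((Al.comp (ContinuousLinearMap.fst ℝ Space Space)).prod
          (Al.comp (ContinuousLinearMap.snd ℝ Space Space))).comp
            (ContinuousLinearMap.snd ℝ ℝ Phase)))) - fderiv ℝ (joint f) (t, z)) (1, z.2, K)
        = J (1, A z.2, A K) := by
      rw [sub_apply, hch, sub_zero]
      rfl
    refine (le_of_eq (congrArg abs hval)).trans ?_
    rw [h1, ← hforce, ← Real.norm_eq_abs]
    refine (J.le_opNorm _).trans (mul_le_mul (hC t ⟨ht0, ht.2.le⟩ _ ((confined_map A).2 hz)) ?_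
      (norm_nonneg _) hC0)
    simp [Prod.norm_def]
  set G : ℝ × Phase → ℝ := fun p => h p ^ 2 with hG
  have hGc : ContinuousOn G (Icc a b ×ˢ univ) := hhc.pow 2
  have hGd : ContDiffOn ℝ 1 G (Ioo a b ×ˢ univ) := fun p hp =>
    ((hhd p (ha.trans_lt hp.1.1)).pow 2).contDiffWithinAt
  have hG0 : ∀ t ∈ Icc a b, ∀ z ∉ S, G (t, z) = 0 := fun t ht z hz => by
    simp [hG, hh0 t ht z hz]
  obtain ⟨hFc, hFd⟩ := transport_identity (K := force Mc U) (isCompact_confined lam R P)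
    (fun z hz => fst_ne_zero_of_confined hlam hz) hGc hGd hG0
    (fun t ht => hf.continuousOn_force (ha.trans ht.1.le))
  set F : ℝ → ℝ := fun t => ∫ z, G (t, z) with hF
  have hF0 : ∀ t, 0 ≤ F t := fun t => integral_nonneg fun z => sq_nonneg _
  set β := volume.real (Metric.closedBall (0 : Space) P) with hβ
  set D := C * (1 + β * ((1 + R ^ 2) ^ 2 / 3 * ((4 * Real.pi) ^ 2 * β))) with hD
  have hGi : ∀ t ∈ Icc a b, Integrable (fun z => G (t, z)) := fun t ht =>
    integrable_of_continuousOn_compact (isCompact_confined lam R P)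
      (hGc.comp (by fun_prop) fun z _ => ⟨ht, mem_univ _⟩) (hG0 t ht)
  have hineq : ∀ t ∈ Ioo a b, ∫ z : Phase, fderiv ℝ G (t, z) (1, z.2, force Mc U t z.1)
      ≤ D * F t := by
    intro t ht
    have ht' := Ioo_subset_Icc_self ht
    have ht0 : 0 < t := ha.trans_lt ht.1
    set g : Space → ℝ := fun x => ‖A.symm (gradient (U t) (A x)) - gradient (U t) x‖ ^ 2 with hg
    have hgc : Continuous g := by
      have := hf.continuous_grad ht0.le
      exact (((A.symm.continuous.comp (this.comp A.continuous)).sub this).norm.pow 2)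
    set Q := Metric.closedBall (0 : Space) R ×ˢ Metric.closedBall (0 : Space) P with hQ
    have hiQ : IntegrableOn (fun z : Phase => g z.1) Q :=
      (hgc.comp continuous_fst).continuousOn.integrableOn_compact
        ((isCompact_closedBall _ _).prod (isCompact_closedBall _ _))
    have hQm : MeasurableSet Q := measurableSet_closedBall.prod measurableSet_closedBall
    have hiQ' : Integrable (Q.indicator (fun z : Phase => g z.1)) :=
      (integrable_indicator_iff hQm).2 hiQ
    have hpt : ∀ z : Phase, fderiv ℝ G (t, z) (1, z.2, force Mc U t z.1)
        ≤ C * (G (t, z) + Q.indicator (fun z : Phase => g z.1) z) := by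
      intro z
      have hdh := ((hhd (t, z) ht0).differentiableAt one_ne_zero).hasFDerivAt
      have hGe : fderiv ℝ G (t, z) = _ := (hdh.pow 2).fderiv
      rw [hGe]
      simp only [smul_apply, smul_eq_mul]
      by_cases hz : z ∈ S
      · have hzQ : z ∈ Q := ⟨by simpa using hz.2.1, by simpa using hz.2.2⟩
        rw [indicator_of_mem hzQ]
        have h1 := hDh t ht z hz
        set y := ‖A.symm (gradient (U t) (A z.1)) - gradient (U t) z.1‖ with hy
        have h2 : h (t, z) * fderiv ℝ h (t, z) (1, z.2, force Mc U t z.1)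
            ≤ |h (t, z)| * (C * y) := by
          refine (le_abs_self _).trans ?_
          rw [abs_mul]
          gcongr
        have h3 : 2 * (|h (t, z)| * y) ≤ G (t, z) + y ^ 2 := by
          simp only [hG]
          rw [← sq_abs (h (t, z))]
          nlinarith [sq_nonneg (|h (t, z)| - y)]
        have h4 : C * (2 * (|h (t, z)| * y)) ≤ C * (G (t, z) + y ^ 2) :=
          mul_le_mul_of_nonneg_left h3 hC0
        simp only [nsmul_eq_mul]
        push_cast
        simp only [pow_one]
        have h5 : g z.1 = y ^ 2 := rfl
        rw [h5]
        nlinarith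
      · rw [hh0 t ht' z hz]
        have : 0 ≤ Q.indicator (fun z : Phase => g z.1) z :=
          indicator_nonneg (fun z _ => sq_nonneg _) z
        have h2 : 0 ≤ G (t, z) := sq_nonneg _
        simp
        positivity
    have hint := (hFd t ht).1
    refine (integral_mono hint (((hGi t ht').add hiQ').const_mul C) hpt).trans ?_
    rw [integral_const_mul, integral_add' (hGi t ht') hiQ', integral_indicator hQm]
    have hQi : ∫ z in Q, g z.1 = β * ∫ x in Metric.closedBall 0 R, g x := by
      have h1 : ∫ z in Q, g z.1 = ∫ z in Q, g z.1 * (1 : ℝ) ∂(volume.prod volume) := by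
        rw [← volume_phase]; simp
      rw [h1, hQ, setIntegral_prod_mul (f := g) (g := fun _ : Space => (1 : ℝ))]
      simp [hβ, mul_comm]
    have hasym : ∫ x in Metric.closedBall 0 R, g x
        ≤ (1 + R ^ 2) ^ 2 / 3 * ((4 * Real.pi) ^ 2 * (β * F t)) :=
      hf.field_asymmetry_le ht0.le hR hP (hsupp t ht') A
    rw [hQi]
    have hβ0 : 0 ≤ β := measureReal_nonneg
    have h6 : C * (F t + β * ∫ x in Metric.closedBall 0 R, g x)
        ≤ C * (F t + β * ((1 + R ^ 2) ^ 2 / 3 * ((4 * Real.pi) ^ 2 * (β * F t)))) := by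
      gcongr
    refine h6.trans (le_of_eq ?_)
    rw [hD]; ring
  -- Gronwall's inequality for the squared `L²` norm of the asymmetry
  have hanti : AntitoneOn (fun t => F t * Real.exp (-(D * t))) (Icc a b) := by
    have hd : ∀ t ∈ Ioo a b, HasDerivAt (fun t => F t * Real.exp (-(D * t)))
        ((∫ z : Phase, fderiv ℝ G (t, z) (1, z.2, force Mc U t z.1)) * Real.exp (-(D * t))
          + F t * (Real.exp (-(D * t)) * -(D * 1))) t := fun t ht =>
      (hFd t ht).2.mul (((hasDerivAt_id t).const_mul D).neg.exp)
    refine antitoneOn_of_deriv_nonpos (convex_Icc a b) (hFc.mul (by fun_prop)) ?_ ?_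
    · rw [interior_Icc]
      exact fun t ht => (hd t ht).differentiableAt.differentiableWithinAt
    · rw [interior_Icc]
      intro t ht
      rw [(hd t ht).deriv]
      have h1 := hineq t ht
      have h2 := Real.exp_pos (-(D * t))
      nlinarith
  have hFa : F a = 0 := by
    refine integral_eq_zero_of_ae (ae_of_all _ fun z => ?_)
    have : h (a, z) = 0 := by
      simp only [hh, joint, hAz]
      rw [hinit A z, sub_self]
    simp [hG, this]
  have hFt : F t = 0 := by
    have h1 := hanti ⟨le_rfl, ht.1.trans ht.2⟩ ht ht.1
    simp only [hFa, zero_mul] at h1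
    have h2 := Real.exp_pos (-(D * t))
    exact le_antisymm (nonpos_of_mul_nonpos_left h1 h2) (hF0 t)
  have hGt : (fun z => G (t, z)) =ᵐ[volume] fun _ => 0 :=
    (integral_eq_zero_iff_of_nonneg (fun z => sq_nonneg _) (hGi t ht)).1 hFt
  have hGtc : Continuous (fun z => G (t, z)) :=
    hGc.comp_continuous (by fun_prop) fun z => ⟨ht, mem_univ _⟩
  have hz := congrFun ((Continuous.ae_eq_iff_eq volume hGtc continuous_const).1 hGt)
  intro z
  have h1 : h (t, z) ^ 2 = 0 := hz z
  have h2 : h (t, z) = 0 := pow_eq_zero_iff two_ne_zero |>.1 h1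
  exact sub_eq_zero.1 h2

end symmetry

/-- The gradient of a spherically symmetric function is radial. -/
lemma inner_gradient_eq_zero_of_rotInvariant {V : Space → ℝ} (hV : Differentiable ℝ V)
    (hsym : ∀ (A : Space ≃ₗᵢ[ℝ] Space) x, V (A x) = V x) {x p : Space}
    (hp : (inner ℝ p x : ℝ) = 0) : (inner ℝ p (gradient V x) : ℝ) = 0 := by
  -- the reflection in the plane orthogonal to `p` fixes `x` and reverses `p`
  set A : Space ≃ₗᵢ[ℝ] Space := Submodule.reflection (ℝ ∙ p)ᗮ with hA
  have hAp : A p = -p := Submodule.reflection_orthogonalComplement_singleton_eq_neg p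
  have hAx : A x = x := by
    refine Submodule.reflection_mem_subspace_eq_self ?_
    rw [Submodule.mem_orthogonal_singleton_iff_inner_right]
    exact hp
  have hinv : (fun y => V (A y)) = V := funext fun y => hsym A y
  have h1 := gradient_comp_isometry hV A x
  rw [hinv, hAx] at h1
  have h2 : (inner ℝ p (gradient V x) : ℝ) = inner ℝ (A p) (A (A.symm (gradient V x))) := by
    rw [A.inner_map_map, ← h1]
  rw [A.apply_symm_apply, hAp, inner_neg_left] at h2
  linarith

section symmetry
variable {Mc : ℝ} {f : ℝ → Phase → ℝ} {U : ℝ → Space → ℝ}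

/-- The potential inherits the symmetry of the density, by uniqueness for the Poisson equation. -/
lemma IsSolution.potential_rotInvariant (hf : IsSolution Mc f U) {t : ℝ} (ht : 0 ≤ t)
    (hsym : IsRotInvariant (f t)) (A : Space ≃ₗᵢ[ℝ] Space) (x : Space) :
    U t (A x) = U t x := by
  have hU := hf.potential_contDiff t ht
  have hUA : ContDiff ℝ 2 (fun y => U t (A y)) := hU.comp A.toContinuousLinearEquiv.contDiff
  have h := eq_zero_of_laplacian_eq_zero (V := fun y => U t (A y) - U t y) (hUA.sub hU) (by
      have h1 := (tendsto_comp_isometry (hf.potential_vanishes t ht) A).sub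
        (hf.potential_vanishes t ht)
      rwa [sub_zero] at h1) (fun y => by
        have h1 : Laplacian.laplacian (fun y => U t (A y) - U t y) y
            = Laplacian.laplacian (fun y => U t (A y)) y - Laplacian.laplacian (U t) y :=
          ContDiffAt.laplacian_sub hUA.contDiffAt hU.contDiffAt
        rw [h1, laplacian_comp_isometry hU, hf.poisson t ht, hf.poisson t ht,
          ← density_comp_isometry]
        have h2 : (fun z : Phase => f t (A z.1, A z.2)) = f t := funext fun z => hsym A z
        rw [h2, sub_self]) x
  linarith

/-- Symmetry of the solution makes angular momentum a constant of motion. -/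
lemma IsSolution.fderiv_angMom_eq_zero (hf : IsSolution Mc f U) {t : ℝ} (ht : 0 ≤ t)
    (hsym : IsRotInvariant (f t)) {z : Phase} (hz : z.1 ≠ 0) :
    fderiv ℝ (fun p : ℝ × Phase => angMom p.2) (t, z) (1, z.2, force Mc U t z.1) = 0 := by
  obtain ⟨x, v⟩ := z
  rw [fderiv_angMom, hf.force_eq ht hz, inner_sub_right, inner_smul_right, inner_perp_self,
    inner_neg_right]
  have h := inner_gradient_eq_zero_of_rotInvariant
    ((hf.potential_contDiff t ht).differentiable two_ne_zero)
    (fun A y => hf.potential_rotInvariant ht hsym A y) (inner_perp_self x v)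
  rw [h]; ring

/-- The solution stays spherically symmetric, with angular momentum bounded below and compact
support. -/
theorem IsSolution.symmetric_confined (hf : IsSolution Mc f U) (hMc : 0 ≤ Mc)
    (hcs : HasCompactSupport (f 0)) {L₀ : ℝ} (hL₀ : 0 < L₀) (hsym : IsRotInvariant (f 0))
    (hvan : ∀ z, f 0 z ≠ 0 → L₀ ≤ angMom z) (T : ℝ) :
    ∃ R P, 0 < R ∧ 0 < P ∧ ∀ t ∈ Icc 0 T, IsRotInvariant (f t) ∧
      ∀ z, f t z ≠ 0 → z ∈ confined L₀ R P := by
  obtain ⟨R, C, hR, hC, hreg⟩ := hf.exists_boundedRegion hMc hcs T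
  obtain ⟨B₀, hB₀⟩ := hf.grad_bounded T
  set B := max B₀ 0 with hBd
  have hB0 : 0 ≤ B := le_max_right _ _
  have hB : ∀ t ∈ Icc 0 T, ∀ x, ‖gradient (U t) x‖ ≤ B := fun t ht x =>
    (hB₀ t ht x).trans (le_max_left _ _)
  -- `κ` bounds the rate of change of `L` where `L ≤ L₀`, uniformly on `[0, T]`; on intervals of
  -- length `τ` the lower bound `L₀` therefore deteriorates at most to `L₀ / 2`
  set κ := 2 * (R * √L₀ * B) with hκ
  have hκ0 : 0 ≤ κ := by positivity
  set τ := L₀ / (2 * (κ + 1)) with hτ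
  have hτ0 : 0 < τ := by positivity
  have hκτ : κ * τ ≤ L₀ / 2 := by
    rw [hτ, mul_div_assoc', div_le_div_iff₀ (by positivity) (by norm_num)]
    nlinarith
  set P := C * (1 + 1 / √(L₀ / 2)) + 1 with hP
  have hP0 : 0 < P := by positivity
  have hR0 : 0 < R + 1 := by linarith
  have hsupp : ∀ t ∈ Icc 0 T, ∀ lam, L₀ / 2 ≤ lam →
      (∀ z, 0 < angMom z → f t z ≠ 0 → lam ≤ angMom z) →
      ∀ z, f t z ≠ 0 → z ∈ confined lam (R + 1) P := by
    intro t ht lam hlam h z hz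
    refine support_subset_of_angMom_pos (hf.continuous ht.1)
      (isCompact_confined lam (R + 1) P).isClosed (fun w hw hfw => ?_) z hz
    have h1 := hreg t ht w hw hfw
    have h2 := h w hw hfw
    exact ⟨h2, by linarith [h1.1], norm_snd_le_of_boundedRegion hC (by positivity) h1
      (hlam.trans h2)⟩
  have step : ∀ a b, 0 ≤ a → a ≤ b → b ≤ T → b ≤ a + τ →
      (IsRotInvariant (f a) ∧ ∀ z, f a z ≠ 0 → L₀ ≤ angMom z) →
      (IsRotInvariant (f b) ∧ ∀ z, f b z ≠ 0 → L₀ ≤ angMom z) := by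
    rintro a b ha hab hbT hbτ ⟨hsa, hva⟩
    have hsub : ∀ t ∈ Icc a b, t ∈ Icc 0 T := fun t ht => ⟨ha.trans ht.1, ht.2.trans hbT⟩
    have hreg' : ∀ t ∈ Icc a b, ∀ z, 0 < angMom z → f t z ≠ 0 → z ∈ boundedRegion R C :=
      fun t ht => hreg t (hsub t ht)
    have h1 : ∀ t ∈ Icc a b, ∀ z, 0 < angMom z → f t z ≠ 0 → L₀ / 2 ≤ angMom z := by
      intro t ht z hz hfz
      have h2 := hf.angMom_lower_bound (κ := κ) ha hC hR hreg' hva (fun t ht z hz hL hfz => by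
        have ht' := hsub t (Ioo_subset_Icc_self ht)
        have h3 := hf.abs_fderiv_angMom_le ht'.1 (fst_ne_zero_of_angMom_pos hz)
        have h4 : ‖z.1‖ ≤ R := (hreg t ht' z hz hfz).1
        have h5 : √(angMom z) ≤ √L₀ := Real.sqrt_le_sqrt (by
          have : 0 ≤ κ * (t - a) := mul_nonneg hκ0 (by linarith [ht.1])
          linarith)
        have h6 := hB t ht' z.1
        have h7 : 2 * (‖z.1‖ * √(angMom z) * ‖gradient (U t) z.1‖) ≤ κ := by
          rw [hκ]; gcongr
        exact (neg_le_neg h7).trans (abs_le.1 h3).1) ht hz hfz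
      have h3 : κ * (t - a) ≤ κ * τ :=
        mul_le_mul_of_nonneg_left (by linarith [ht.2]) hκ0
      linarith
    have h2 : ∀ t ∈ Icc a b, ∀ z, f t z ≠ 0 → z ∈ confined (L₀ / 2) (R + 1) P :=
      fun t ht => hsupp t (hsub t ht) _ le_rfl (h1 t ht)
    have h3 : ∀ t ∈ Icc a b, IsRotInvariant (f t) := fun t ht =>
      hf.rotInvariant_propagates ha (by positivity) hR0 hP0 h2 hsa ht
    have hb : b ∈ Icc a b := ⟨hab, le_rfl⟩
    -- with symmetry known on `[a, b]`, angular momentum is conserved there and the full bound returns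
    refine ⟨h3 b hb, fun z hz => ?_⟩
    refine (hsupp b (hsub b hb) L₀ (by linarith) (fun z hz hfz => ?_) z hz).1
    have h4 := hf.angMom_lower_bound (κ := 0) ha hC hR hreg' hva (fun t ht z hz _ _ => by
      rw [hf.fderiv_angMom_eq_zero (ha.trans ht.1.le) (h3 t (Ioo_subset_Icc_self ht))
        (fst_ne_zero_of_angMom_pos hz), neg_zero]) hb hz hfz
    simpa using h4
  have hind : ∀ n : ℕ, ∀ t ∈ Icc 0 T, t ≤ n * τ →
      (IsRotInvariant (f t) ∧ ∀ z, f t z ≠ 0 → L₀ ≤ angMom z) := by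
    intro n
    induction n with
    | zero =>
      intro t ht h
      have : t = 0 := le_antisymm (by simpa using h) ht.1
      rw [this]
      exact ⟨hsym, hvan⟩
    | succ n ih =>
      intro t ht h
      by_cases hn : t ≤ n * τ
      · exact ih t ht hn
      · push Not at hn
        have h0 : 0 ≤ n * τ := by positivity
        refine step (n * τ) t h0 hn.le ht.2 (by push_cast at h; linarith) ?_
        exact ih _ ⟨h0, hn.le.trans ht.2⟩ le_rfl
  refine ⟨R + 1, P, hR0, hP0, fun t ht => ?_⟩
  obtain ⟨n, hn⟩ := exists_nat_ge (t / τ)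
  have h := hind n t ht (by rwa [div_le_iff₀ hτ0] at hn)
  exact ⟨h.1, hsupp t ht L₀ (by linarith) fun z _ hz => h.2 z hz⟩

end symmetry

/-! ### The radial Poisson equation -/

section radial
variable {V : Space → ℝ}

/-- The radial derivative of `V`, divided by `|x|`. -/
def radialSlope (V : Space → ℝ) (x : Space) : ℝ := fderiv ℝ V x x / ‖x‖ ^ 2

lemma gradient_eq_radialSlope (hV : Differentiable ℝ V)
    (hsym : ∀ (A : Space ≃ₗᵢ[ℝ] Space) x, V (A x) = V x) {x : Space} (hx : x ≠ 0) :
    gradient V x = radialSlope V x • x := by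
  have hx' : ‖x‖ ^ 2 ≠ 0 := pow_ne_zero 2 (norm_ne_zero_iff.2 hx)
  set p := gradient V x - radialSlope V x • x with hp
  have h1 : (inner ℝ p x : ℝ) = 0 := by
    rw [hp, inner_sub_left, inner_smul_left, inner_gradient, real_inner_self_eq_norm_sq,
      radialSlope]
    simp only [RCLike.conj_to_real]
    field_simp
    ring
  have h2 := inner_gradient_eq_zero_of_rotInvariant hV hsym h1
  have h3 : (inner ℝ p p : ℝ) = 0 := by
    nth_rewrite 2 [hp]
    rw [inner_sub_right, inner_smul_right, h1, h2]; ring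
  exact sub_eq_zero.1 (inner_self_eq_zero.1 h3)

lemma contDiffAt_radialSlope (hV : ContDiff ℝ 2 V) {x : Space} (hx : x ≠ 0) :
    ContDiffAt ℝ 1 (radialSlope V) x := by
  have h1 : ContDiff ℝ 1 (fun x => fderiv ℝ V x x) :=
    (hV.fderiv_right (by norm_num)).clm_apply contDiff_id
  exact h1.contDiffAt.div (contDiff_norm_sq ℝ).contDiffAt (pow_ne_zero 2 (norm_ne_zero_iff.2 hx))

/-- The Laplacian of a spherically symmetric function with gradient `s (x) x` is `3 s + x ⬝ ∇s`. -/
lemma laplacian_eq_radialSlope (hV : ContDiff ℝ 2 V)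
    (hsym : ∀ (A : Space ≃ₗᵢ[ℝ] Space) x, V (A x) = V x) {x : Space} (hx : x ≠ 0) :
    Laplacian.laplacian V x = 3 * radialSlope V x + fderiv ℝ (radialSlope V) x x := by
  have hd := (contDiffAt_radialSlope hV hx).differentiableAt one_ne_zero
  have h1 : ∀ i, pd i (pd i V) x = x i * pd i (radialSlope V) x + radialSlope V x := by
    intro i
    have h2 : pd i V =ᶠ[𝓝 x] fun y => y i * radialSlope V y := by
      filter_upwards [isOpen_ne.mem_nhds hx] with y hy
      rw [pd, ← inner_gradient, gradient_eq_radialSlope (hV.differentiable two_ne_zero) hsym hy,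
        inner_smul_left, inner_single_right']
      simp [mul_comm]
    have h3 : pd i (fun y : Space => y i) x = 1 :=
      pd_of_line (differentiable_coord i x) (hasDerivAt_line_coord x i)
    have h4 : pd i (pd i V) x = pd i (fun y => y i * radialSlope V y) x := by
      simp only [pd] at h2 ⊢
      rw [h2.fderiv_eq]
    rw [h4, pd_mul (differentiable_coord i x) hd, h3, mul_one]
  have h5 : x = ∑ i, x i • EuclideanSpace.single i (1 : ℝ) := by
    ext j
    simp [Finset.sum_apply, Pi.single_apply]
  have h6 : fderiv ℝ (radialSlope V) x x = ∑ i, x i * pd i (radialSlope V) x := by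
    nth_rewrite 2 [h5]
    rw [map_sum]
    simp [pd]
  rw [laplacian_eq_sum_pd hV, h6]
  simp only [h1, Finset.sum_add_distrib, Finset.sum_const, Finset.card_univ, Fintype.card_fin,
    nsmul_eq_mul]
  push_cast
  ring

/-- The unit vector along which radial functions are evaluated. -/
def axis : Space := EuclideanSpace.single 0 (1 : ℝ)

lemma norm_axis : ‖axis‖ = 1 := by simp [axis]

lemma norm_smul_axis {r : ℝ} (hr : 0 ≤ r) : ‖r • axis‖ = r := by
  rw [norm_smul, norm_axis, mul_one, Real.norm_of_nonneg hr]

lemma smul_axis_ne_zero {r : ℝ} (hr : 0 < r) : r • axis ≠ 0 := by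
  rw [← norm_ne_zero_iff, norm_smul_axis hr.le]; exact hr.ne'

/-- Integrated form of the Poisson equation for spherically symmetric potentials. -/
lemma sq_mul_fderiv_axis (hV : ContDiff ℝ 2 V)
    (hsym : ∀ (A : Space ≃ₗᵢ[ℝ] Space) x, V (A x) = V x) {r : ℝ} (hr : 0 ≤ r) :
    r ^ 2 * fderiv ℝ V (r • axis) axis
      = ∫ s in (0 : ℝ)..r, s ^ 2 * Laplacian.laplacian V (s • axis) := by
  have hline : Continuous (fun s : ℝ => s • axis) := by fun_prop
  have hcd : Continuous (fun s : ℝ => fderiv ℝ V (s • axis) axis) :=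
    ((hV.continuous_fderiv two_ne_zero).comp hline).clm_apply continuous_const
  have hcl : Continuous (fun s : ℝ => s ^ 2 * Laplacian.laplacian V (s • axis)) :=
    (continuous_pow 2).mul ((continuous_laplacian hV).comp hline)
  have h := intervalIntegral.integral_eq_sub_of_hasDerivAt_of_le hr
    (f := fun s : ℝ => s ^ 2 * fderiv ℝ V (s • axis) axis)
    (f' := fun s : ℝ => s ^ 2 * Laplacian.laplacian V (s • axis))
    ((continuous_pow 2).mul hcd).continuousOn (fun s hs => by
      have hs0 : 0 < s := hs.1
      have hx := smul_axis_ne_zero hs0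
      have hd := (contDiffAt_radialSlope hV hx).differentiableAt one_ne_zero
      have hl : HasDerivAt (fun s : ℝ => s • axis) axis s := by
        simpa using (hasDerivAt_id s).smul_const axis
      have h1 : HasDerivAt (fun s : ℝ => s ^ 3 * radialSlope V (s • axis))
          (3 * s ^ 2 * radialSlope V (s • axis)
            + s ^ 3 * fderiv ℝ (radialSlope V) (s • axis) axis) s := by
        have := (hasDerivAt_pow 3 s).mul (hd.hasFDerivAt.comp_hasDerivAt s hl)
        refine this.congr_deriv ?_
        simp
      have h2 : (fun s : ℝ => s ^ 3 * radialSlope V (s • axis))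
          =ᶠ[𝓝 s] fun s : ℝ => s ^ 2 * fderiv ℝ V (s • axis) axis := by
        filter_upwards [Ioi_mem_nhds hs0] with y hy
        have hy0 : 0 < y := hy
        rw [radialSlope, map_smul, norm_smul_axis hy0.le, smul_eq_mul]
        field_simp
      refine (h1.congr_of_eventuallyEq h2.symm).congr_deriv ?_
      rw [laplacian_eq_radialSlope hV hsym hx, map_smul, smul_eq_mul]
      ring) (hcl.intervalIntegrable _ _)
  rw [h]
  simp

end radial

lemma IsRotInvariant.density_eq {g : Phase → ℝ} (hg : IsRotInvariant g) (x : Space) :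
    density g x = density g (‖x‖ • axis) := by
  obtain ⟨A, hA⟩ := exists_isometry_map x
  have h := density_comp_isometry g A x
  rw [hA] at h
  rw [axis, ← h]
  congr 1
  exact funext fun z => (hg A z).symm

/-- The mass in a ball in terms of the density along the axis. -/
lemma IsRotInvariant.massInBall_eq_integral {g : Phase → ℝ} (hg : IsRotInvariant g) {r : ℝ}
    (hr : 0 ≤ r) : massInBall g r
      = 4 * Real.pi * ∫ s in (0 : ℝ)..r, s ^ 2 * density g (s • axis) := by
  have h1 : massInBall g r
      = ∫ x : Space, (Iic r).indicator (fun s => density g (s • axis)) ‖x‖ := by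
    rw [massInBall, ← integral_indicator measurableSet_closedBall]
    congr 1
    ext x
    by_cases hx : ‖x‖ ≤ r
    · rw [indicator_of_mem (by simpa using hx), indicator_of_mem (show ‖x‖ ∈ Iic r from hx),
        hg.density_eq]
    · rw [indicator_of_notMem (by simpa using hx), indicator_of_notMem (show ‖x‖ ∉ Iic r from hx)]
  rw [h1, integral_radial, intervalIntegral.integral_of_le hr]
  congr 1
  have h2 : ∀ s : ℝ, s ^ 2 * (Iic r).indicator (fun s => density g (s • axis)) s
      = (Iic r).indicator (fun s => s ^ 2 * density g (s • axis)) s := by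
    intro s
    by_cases hs : s ∈ Iic r <;> simp [hs]
  simp only [h2]
  rw [setIntegral_indicator measurableSet_Iic]
  rfl

section solution
variable {Mc : ℝ} {f : ℝ → Phase → ℝ} {U : ℝ → Space → ℝ}

/-- Gauss' law for spherically symmetric solutions. -/
lemma IsSolution.fderiv_axis (hf : IsSolution Mc f U) {t : ℝ} (ht : 0 ≤ t)
    (hsym : IsRotInvariant (f t)) {r : ℝ} (hr : 0 ≤ r) :
    r ^ 2 * fderiv ℝ (U t) (r • axis) axis = massInBall (f t) r := by
  rw [sq_mul_fderiv_axis (hf.potential_contDiff t ht)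
    (fun A x => hf.potential_rotInvariant ht hsym A x) hr, hsym.massInBall_eq_integral hr,
    ← intervalIntegral.integral_const_mul]
  congr 1
  ext s
  rw [hf.poisson t ht]
  ring

/-- For symmetric solutions the field is the one determined by the mass distribution. -/
lemma IsSolution.gradient_eq (hf : IsSolution Mc f U) {t : ℝ} (ht : 0 ≤ t)
    (hsym : IsRotInvariant (f t)) (x : Space) : gradient (U t) x = gradPotential (f t) x := by
  have hU := hf.potential_contDiff t ht
  have hUd := hU.differentiable two_ne_zero
  have hUs : ∀ (A : Space ≃ₗᵢ[ℝ] Space) x, U t (A x) = U t x :=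
    fun A x => hf.potential_rotInvariant ht hsym A x
  by_cases hx : x = 0
  · have h := inner_gradient_eq_zero_of_rotInvariant hUd hUs (x := 0) (p := gradient (U t) 0)
      (inner_zero_right _)
    rw [hx, inner_self_eq_zero.1 h, gradPotential]
    simp
  · have hx' : ‖x‖ ≠ 0 := norm_ne_zero_iff.2 hx
    obtain ⟨A, hA⟩ := exists_isometry_map x
    have hinv : (fun y => U t (A y)) = U t := funext fun y => hUs A y
    have h1 : fderiv ℝ (U t) x x = ‖x‖ * fderiv ℝ (U t) (‖x‖ • axis) axis := by
      rw [← inner_gradient, ← hinv, gradient_comp_isometry hUd, ← A.inner_map_map,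
        A.apply_symm_apply, hA, inner_gradient, hinv, map_smul, smul_eq_mul, axis]
    rw [gradient_eq_radialSlope hUd hUs hx, gradPotential, radialSlope, h1,
      ← hf.fderiv_axis ht hsym (norm_nonneg x), smul_smul]
    congr 1
    field_simp

lemma IsSolution.massInBall_nonneg (hf : IsSolution Mc f U) {t : ℝ} (ht : 0 ≤ t) (r : ℝ) :
    0 ≤ massInBall (f t) r :=
  integral_nonneg fun x => integral_nonneg fun v => hf.nonneg t ht (x, v)

/-- The solution's potential and the one defined by the mass distribution agree, since both vanish
at infinity and have the same radial derivative. -/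
lemma IsSolution.potential_eq (hf : IsSolution Mc f U) {t : ℝ} (ht : 0 ≤ t)
    (hsym : IsRotInvariant (f t)) (x : Space) : potential (f t) x = U t x := by
  have hU := hf.potential_contDiff t ht
  have hUd := hU.differentiable two_ne_zero
  have hl : ∀ s : ℝ, HasDerivAt (fun s : ℝ => s • axis) axis s := fun s => by
    simpa using (hasDerivAt_id s).smul_const axis
  have hd : ∀ s, HasDerivAt (fun s : ℝ => U t (s • axis)) (fderiv ℝ (U t) (s • axis) axis) s :=
    fun s => (hUd _).hasFDerivAt.comp_hasDerivAt s (hl s)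
  have hd' : ∀ s ∈ Ioi ‖x‖, HasDerivAt (fun s : ℝ => U t (s • axis))
      (massInBall (f t) s / s ^ 2) s := fun s hs => by
    have hs0 : 0 < s := (norm_nonneg x).trans_lt hs
    refine (hd s).congr_deriv ?_
    rw [← hf.fderiv_axis ht hsym hs0.le]
    field_simp
  have hlim : Tendsto (fun s : ℝ => U t (s • axis)) atTop (𝓝 0) := by
    refine (hf.potential_vanishes t ht).comp ?_
    rw [← Metric.cobounded_eq_cocompact, ← tendsto_norm_atTop_iff_cobounded]
    refine tendsto_id.congr' ?_
    filter_upwards [eventually_ge_atTop 0] with s hs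
    rw [norm_smul_axis hs]; rfl
  have h := integral_Ioi_of_hasDerivAt_of_nonneg (hd ‖x‖).continuousAt.continuousWithinAt hd'
    (fun s _ => div_nonneg (hf.massInBall_nonneg ht s) (sq_nonneg s)) hlim
  obtain ⟨A, hA⟩ := exists_isometry_map x
  rw [potential, h, zero_sub, neg_neg, ← hf.potential_rotInvariant ht hsym A x, hA, axis]

end solution

/-! ### Conservation laws -/

/-- `f` is spherically symmetric on `[0, T]`, and supported in `L ≥ L₀`, `|x| ≤ R`, `|v| ≤ P`. -/
def IsConfined (f : ℝ → Phase → ℝ) (T L₀ R P : ℝ) : Prop :=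
  ∀ t ∈ Icc 0 T, IsRotInvariant (f t) ∧ ∀ z, f t z ≠ 0 → z ∈ confined L₀ R P

section conservation
variable {Mc : ℝ} {f : ℝ → Phase → ℝ} {U : ℝ → Space → ℝ} {T L₀ R P : ℝ}

lemma IsConfined.eq_zero (hg : IsConfined f T L₀ R P) {t : ℝ} (ht : t ∈ Icc 0 T) {z : Phase}
    (hz : z ∉ confined L₀ R P) : f t z = 0 := by_contra fun h => hz ((hg t ht).2 z h)

/-- Regularity of products of functions of `f` with observables that are singular at the origin. -/
lemma IsSolution.regular_product (hf : IsSolution Mc f U) (hg : IsConfined f T L₀ R P)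
    (hL₀ : 0 < L₀) {Φ : ℝ → ℝ} (hΦ : ContDiff ℝ 1 Φ) (hΦ0 : Φ 0 = 0) {φ : Phase → ℝ}
    (hφ : ∀ z : Phase, z.1 ≠ 0 → ContDiffAt ℝ 1 φ z) {a b : ℝ} (ha : 0 ≤ a) (hb : b ≤ T) :
    ContinuousOn (fun p : ℝ × Phase => Φ (joint f p) * φ p.2) (Icc a b ×ˢ univ) ∧
    ContDiffOn ℝ 1 (fun p : ℝ × Phase => Φ (joint f p) * φ p.2) (Ioo a b ×ˢ univ) ∧
    (∀ t ∈ Icc a b, ∀ z ∉ confined L₀ R P, Φ (joint f (t, z)) * φ z = 0) ∧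
    ∀ t ∈ Ioo a b, ∀ z ∉ confined L₀ R P, ∀ u,
      fderiv ℝ (fun p : ℝ × Phase => Φ (joint f p) * φ p.2) (t, z) u = 0 := by
  set S := confined L₀ R P with hS
  have hScl : IsOpen ((univ : Set ℝ) ×ˢ Sᶜ) :=
    isOpen_univ.prod (isCompact_confined L₀ R P).isClosed.isOpen_compl
  have h0 : ∀ t ∈ Icc a b, ∀ z ∉ S, Φ (joint f (t, z)) * φ z = 0 := fun t ht z hz => by
    have : joint f (t, z) = 0 := hg.eq_zero ⟨ha.trans ht.1, ht.2.trans hb⟩ hz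
    rw [this, hΦ0, zero_mul]
  have hloc : ∀ t ∈ Ioo a b, ∀ z ∉ S,
      (fun p : ℝ × Phase => Φ (joint f p) * φ p.2) =ᶠ[𝓝 (t, z)] fun _ => 0 := by
    intro t ht z hz
    filter_upwards [(isOpen_Ioo.prod (isCompact_confined L₀ R P).isClosed.isOpen_compl).mem_nhds
      (show (t, z) ∈ Ioo a b ×ˢ Sᶜ from ⟨ht, hz⟩)] with p hp
    exact h0 p.1 (Ioo_subset_Icc_self hp.1) p.2 hp.2
  have hne : ∀ z : Phase, z ∈ S → z.1 ≠ 0 := fun z hz => fst_ne_zero_of_confined hL₀ hz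
  refine ⟨fun p hp => ?_, fun p hp => ?_, h0, fun t ht z hz u => ?_⟩
  · by_cases hz : p.2 ∈ S
    · refine ContinuousWithinAt.mul ?_
        ((hφ p.2 (hne _ hz)).continuousAt.comp_continuousWithinAt continuous_snd.continuousWithinAt)
      exact hΦ.continuous.continuousAt.comp_continuousWithinAt
        ((hf.continuousOn p ⟨ha.trans hp.1.1, mem_univ _⟩).mono
          (prod_mono (fun t ht => ha.trans ht.1) subset_rfl))
    · refine (continuousWithinAt_const (b := (0 : ℝ))).congr_of_eventuallyEq ?_
        (h0 p.1 hp.1 p.2 hz)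
      filter_upwards [self_mem_nhdsWithin,
        mem_nhdsWithin_of_mem_nhds (hScl.mem_nhds (show p ∈ _ from ⟨mem_univ _, hz⟩))]
        with q hq1 hq2
      exact h0 q.1 hq1.1 q.2 hq2.2
  · refine ContDiffAt.contDiffWithinAt ?_
    by_cases hz : p.2 ∈ S
    · exact (hΦ.contDiffAt.comp p (hf.contDiffAt (ha.trans_lt hp.1.1) p.2)).mul
        (ContDiffAt.comp p (hφ p.2 (hne _ hz)) contDiffAt_snd)
    · exact contDiffAt_const.congr_of_eventuallyEq (hloc p.1 hp.1 p.2 hz)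
  · rw [(hloc t ht z hz).fderiv_eq]; simp

/-- The transport operator only sees the observable. -/
lemma IsSolution.fderiv_product (hf : IsSolution Mc f U) {Φ : ℝ → ℝ} (hΦ : ContDiff ℝ 1 Φ)
    {φ : Phase → ℝ} {t : ℝ} (ht : 0 < t) {z : Phase} (hz : z.1 ≠ 0)
    (hφ : DifferentiableAt ℝ φ z) :
    fderiv ℝ (fun p : ℝ × Phase => Φ (joint f p) * φ p.2) (t, z) (1, z.2, force Mc U t z.1)
      = Φ (f t z) * fderiv ℝ φ z (z.2, force Mc U t z.1) := by
  have hdf := ((hf.contDiffAt ht z).differentiableAt one_ne_zero).hasFDerivAt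
  have h1 := ((hΦ.differentiable one_ne_zero (joint f (t, z))).hasDerivAt).comp_hasFDerivAt _ hdf
  have h2 : HasFDerivAt (fun p : ℝ × Phase => φ p.2)
      ((fderiv ℝ φ z).comp (ContinuousLinearMap.snd ℝ ℝ Phase)) (t, z) :=
    HasFDerivAt.comp (f := fun p : ℝ × Phase => p.2) (t, z) hφ.hasFDerivAt hasFDerivAt_snd
  have h3 : fderiv ℝ (fun p : ℝ × Phase => Φ (joint f p) * φ p.2) (t, z) = _ := (h1.mul h2).fderiv
  rw [h3]
  simp only [add_apply, smul_apply, smul_eq_mul, hf.characteristic ht hz, mul_zero, add_zero,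
    Function.comp, ContinuousLinearMap.comp_apply, ContinuousLinearMap.coe_snd']
  rfl

/-- Integrals of functions of `f` and `L` are conserved. -/
lemma IsSolution.integral_casimir_eq (hf : IsSolution Mc f U) (hg : IsConfined f T L₀ R P)
    (hL₀ : 0 < L₀) {Φ : ℝ → ℝ} (hΦ : ContDiff ℝ 1 Φ) (hΦ0 : Φ 0 = 0) {w : ℝ → ℝ}
    (hw : ContDiff ℝ 1 w) (hT : 0 ≤ T) :
    ∫ z, Φ (f T z) * w (angMom z) = ∫ z, Φ (f 0 z) * w (angMom z) := by
  have hwL : ContDiff ℝ 1 (fun z : Phase => w (angMom z)) := hw.comp contDiff_angMom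
  obtain ⟨h1, h2, h3, h4⟩ := hf.regular_product hg hL₀ hΦ hΦ0 (φ := fun z => w (angMom z))
    (fun z _ => hwL.contDiffAt) le_rfl le_rfl
  refine transport_eq (G := fun p : ℝ × Phase => Φ (joint f p) * w (angMom p.2))
    (K := force Mc U) hT (isCompact_confined L₀ R P)
    (fun z hz => fst_ne_zero_of_confined hL₀ hz) h1 h2 h3
    (fun t ht => hf.continuousOn_force ht.1.le) fun t ht z => ?_
  by_cases hz : z ∈ confined L₀ R P
  · have hz0 := fst_ne_zero_of_confined hL₀ hz
    rw [hf.fderiv_product hΦ ht.1 hz0 (hwL.differentiable one_ne_zero z)]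
    have h5 := hf.fderiv_angMom_eq_zero ht.1.le (hg t (Ioo_subset_Icc_self ht)).1 hz0
    have hL := (contDiff_angMom.differentiable one_ne_zero z).hasFDerivAt
    have h6 : fderiv ℝ (fun p : ℝ × Phase => angMom p.2) (t, z)
        = (fderiv ℝ angMom z).comp (ContinuousLinearMap.snd ℝ ℝ Phase) :=
      (HasFDerivAt.comp (f := fun p : ℝ × Phase => p.2) (t, z) hL hasFDerivAt_snd).fderiv
    rw [h6] at h5
    have h7 : fderiv ℝ (fun z : Phase => w (angMom z)) z = _ :=
      ((hw.differentiable one_ne_zero (angMom z)).hasDerivAt.comp_hasFDerivAt z hL).fderiv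
    rw [h7]
    have h8 : fderiv ℝ angMom z (z.2, force Mc U t z.1) = 0 := h5
    simp [h8]
  · exact h4 t ht z hz _

lemma IsSolution.integrable (hf : IsSolution Mc f U) (hg : IsConfined f T L₀ R P) {t : ℝ}
    (ht : t ∈ Icc 0 T) : Integrable (f t) :=
  hf.integrable_of_confined ht.1 (hg t ht).2

lemma IsSolution.integral_eq (hf : IsSolution Mc f U) (hg : IsConfined f T L₀ R P)
    (hL₀ : 0 < L₀) {t : ℝ} (ht : t ∈ Icc 0 T) : ∫ z, f t z = ∫ z, f 0 z := by
  have hg' : IsConfined f t L₀ R P := fun s hs => hg s ⟨hs.1, hs.2.trans ht.2⟩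
  have := hf.integral_casimir_eq hg' hL₀ (Φ := fun y => y) contDiff_id rfl (w := fun _ => 1)
    contDiff_const ht.1
  simpa using this

lemma IsSolution.isTame (hf : IsSolution Mc f U) (hg : IsConfined f T L₀ R P) {t : ℝ}
    (ht : t ∈ Icc 0 T) : IsTame L₀ (f t) where
  integrable := hf.integrable hg ht
  kinetic := by
    refine ((continuous_snd.norm.pow 2).mul (hf.continuous ht.1)).integrable_of_hasCompactSupport
      (HasCompactSupport.of_support_subset_isCompact (isCompact_confined L₀ R P) fun z hz => ?_)
    exact (hg t ht).2 z fun h => hz (by simp [h])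
  vanish := ae_of_all _ fun z hz => by_contra fun h => absurd ((hg t ht).2 z h).1 (not_le.2 hz)

/-- Smooth approximations from below of the weight `(L - L₀)₊ ^ (-q)`. -/
def weightApprox (L₀ q : ℝ) (n : ℕ) (y : ℝ) : ℝ :=
  Real.smoothTransition (n * (y - L₀) - 1) * (max (y - L₀) 0) ^ (-q)

lemma contDiff_weightApprox (L₀ q : ℝ) (n : ℕ) : ContDiff ℝ 1 (weightApprox L₀ q n) := by
  rw [contDiff_iff_contDiffAt]
  intro y
  by_cases hy : n * (y - L₀) < 1
  · have hc : Continuous (fun y : ℝ => n * (y - L₀)) := by fun_prop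
    have : weightApprox L₀ q n =ᶠ[𝓝 y] fun _ => 0 := by
      filter_upwards [hc.continuousAt.eventually (Iio_mem_nhds hy)] with s hs
      have hs' : n * (s - L₀) < 1 := hs
      rw [weightApprox, Real.smoothTransition.zero_of_nonpos (by linarith), zero_mul]
    exact contDiffAt_const.congr_of_eventuallyEq this
  · have hy0 : 0 < y - L₀ := by
      by_contra! h
      have : (n : ℝ) * (y - L₀) ≤ 0 := mul_nonpos_of_nonneg_of_nonpos n.cast_nonneg h
      linarith
    have h1 : (fun s : ℝ => (max (s - L₀) 0) ^ (-q)) =ᶠ[𝓝 y] fun s => (s - L₀) ^ (-q) := by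
      filter_upwards [Ioi_mem_nhds (show L₀ < y by linarith)] with s hs
      rw [max_eq_left (sub_nonneg.2 (le_of_lt hs))]
    have h2 : ContDiffAt ℝ 1 (fun s : ℝ => (s - L₀) ^ (-q)) y :=
      (contDiffAt_id.sub contDiffAt_const).rpow_const_of_ne hy0.ne'
    refine ContDiffAt.mul ?_ (h2.congr_of_eventuallyEq h1)
    exact (Real.smoothTransition.contDiff.comp ((contDiff_const.mul
      (contDiff_id.sub contDiff_const)).sub contDiff_const)).contDiffAt

lemma weightApprox_nonneg (L₀ q : ℝ) (n : ℕ) (y : ℝ) : 0 ≤ weightApprox L₀ q n y :=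
  mul_nonneg (Real.smoothTransition.nonneg _) (Real.rpow_nonneg (le_max_right _ _) _)

lemma weightApprox_mono {q : ℝ} (hq : 0 < q) (L₀ y : ℝ) :
    Monotone fun n => weightApprox L₀ q n y := by
  intro m n hmn
  have hmn' : (m : ℝ) ≤ n := Nat.cast_le.2 hmn
  by_cases hy : 0 ≤ y - L₀
  · exact mul_le_mul_of_nonneg_right (smoothTransition_mono (by gcongr))
      (Real.rpow_nonneg (le_max_right _ _) _)
  · have : max (y - L₀) 0 = 0 := max_eq_right (le_of_not_ge hy)
    simp [weightApprox, this, Real.zero_rpow (neg_ne_zero.2 hq.ne')]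

/-- Where `L ≤ L₀` the limit is `0 ^ (-q) = 0`, and so are all approximations. -/
lemma tendsto_weightApprox {q : ℝ} (hq : 0 < q) (L₀ y : ℝ) :
    Tendsto (fun n => weightApprox L₀ q n y) atTop (𝓝 ((max (y - L₀) 0) ^ (-q))) := by
  by_cases hy : 0 < y - L₀
  · refine tendsto_const_nhds.congr' ?_
    obtain ⟨N, hN⟩ := exists_nat_ge (2 / (y - L₀))
    filter_upwards [eventually_ge_atTop N] with n hn
    have h1 : 2 ≤ n * (y - L₀) := by
      rw [div_le_iff₀ hy] at hN
      refine hN.trans ?_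
      have : (N : ℝ) ≤ n := Nat.cast_le.2 hn
      gcongr
    rw [weightApprox, Real.smoothTransition.one_of_one_le (by linarith), one_mul]
  · have : max (y - L₀) 0 = 0 := max_eq_right (not_lt.1 hy)
    simp [weightApprox, this, Real.zero_rpow (neg_ne_zero.2 hq.ne')]

/-- Conservation of the Casimir functional. -/
lemma IsSolution.casimir_conserved (hf : IsSolution Mc f U) (hg : IsConfined f T L₀ R P)
    (hL₀ : 0 < L₀) (hT : 0 ≤ T) {k l : ℝ} (hk : 0 < k) (hl : 0 < l)
    (hi : Integrable (casimirDensity k l L₀ (f 0))) :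
    Integrable (casimirDensity k l L₀ (f T)) ∧ casimir k l L₀ (f T) = casimir k l L₀ (f 0) := by
  set q := l / k with hq
  have hq0 : 0 < q := by positivity
  set p := 1 + 1 / k with hp
  have hp1 : 1 < p := one_lt_exponent hk
  have hΦ : ContDiff ℝ 1 (fun y : ℝ => y ^ p) :=
    Real.contDiff_rpow_const_of_le (n := 1) (by simpa using hp1.le)
  have hΦ0 : (0 : ℝ) ^ p = 0 := Real.zero_rpow (by linarith)
  -- the weight is singular at `L = L₀`: pass from regular weights to the limit by monotone convergence
  have hlim : ∀ t ∈ Icc 0 T, Tendsto (fun n : ℕ => ∫⁻ z : Phase,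
      ENNReal.ofReal (f t z ^ p * weightApprox L₀ q n (angMom z))) atTop
      (𝓝 (∫⁻ z : Phase, ENNReal.ofReal (casimirDensity k l L₀ (f t) z))) := by
    intro t ht
    have hpow : ∀ z, 0 ≤ f t z ^ p := fun z => Real.rpow_nonneg (hf.nonneg t ht.1 z) _
    refine lintegral_tendsto_of_tendsto_of_monotone (fun n => ?_) (ae_of_all _ fun z m n hmn => ?_)
      (ae_of_all _ fun z => ?_)
    · have h1 : Continuous (fun z => f t z ^ p * weightApprox L₀ q n (angMom z)) :=
        (hΦ.continuous.comp (hf.continuous ht.1)).mul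
          ((contDiff_weightApprox L₀ q n).continuous.comp continuous_angMom)
      exact h1.measurable.ennreal_ofReal.aemeasurable
    · exact ENNReal.ofReal_le_ofReal (mul_le_mul_of_nonneg_left
        (weightApprox_mono hq0 L₀ (angMom z) hmn) (hpow z))
    · exact ENNReal.tendsto_ofReal ((tendsto_weightApprox hq0 L₀ (angMom z)).const_mul _)
  have hcont : ∀ t ∈ Icc 0 T, ∀ n : ℕ,
      Integrable (fun z => f t z ^ p * weightApprox L₀ q n (angMom z)) := fun t ht n => by
    have h1 : Continuous (fun z => f t z ^ p * weightApprox L₀ q n (angMom z)) :=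
      (hΦ.continuous.comp (hf.continuous ht.1)).mul
        ((contDiff_weightApprox L₀ q n).continuous.comp continuous_angMom)
    refine h1.integrable_of_hasCompactSupport
      (HasCompactSupport.of_support_subset_isCompact (isCompact_confined L₀ R P) fun z hz => ?_)
    refine (hg t ht).2 z fun h => hz ?_
    simp only [h, hΦ0, zero_mul]
  have heq : ∀ n : ℕ, ∫⁻ z : Phase, ENNReal.ofReal (f T z ^ p * weightApprox L₀ q n (angMom z))
      = ∫⁻ z : Phase, ENNReal.ofReal (f 0 z ^ p * weightApprox L₀ q n (angMom z)) := by
    intro n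
    have h0 : ∀ t ∈ Icc 0 T, ∀ z, 0 ≤ f t z ^ p * weightApprox L₀ q n (angMom z) := fun t ht z =>
      mul_nonneg (Real.rpow_nonneg (hf.nonneg t ht.1 z) _) (weightApprox_nonneg _ _ _ _)
    have hTm : T ∈ Icc 0 T := ⟨hT, le_rfl⟩
    have h0m : (0 : ℝ) ∈ Icc 0 T := ⟨le_rfl, hT⟩
    rw [← ofReal_integral_eq_lintegral_ofReal (hcont T hTm n) (ae_of_all _ (h0 T hTm)),
      ← ofReal_integral_eq_lintegral_ofReal (hcont 0 h0m n) (ae_of_all _ (h0 0 h0m))]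
    congr 1
    exact hf.integral_casimir_eq hg hL₀ hΦ hΦ0 (contDiff_weightApprox L₀ q n) hT
  have hlT := hlim T ⟨hT, le_rfl⟩
  simp only [heq] at hlT
  have hE := tendsto_nhds_unique hlT (hlim 0 ⟨le_rfl, hT⟩)
  have hnn : ∀ t ∈ Icc 0 T, 0 ≤ᵐ[volume] casimirDensity k l L₀ (f t) := fun t ht =>
    ae_of_all _ fun z => casimirDensity_nonneg (hf.nonneg t ht.1 z)
  have hm : ∀ t ∈ Icc 0 T, AEStronglyMeasurable (casimirDensity k l L₀ (f t)) := fun t ht =>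
    aestronglyMeasurable_casimirDensity (hf.continuous ht.1).aestronglyMeasurable
  have hTm : T ∈ Icc 0 T := ⟨hT, le_rfl⟩
  have h0m : (0 : ℝ) ∈ Icc 0 T := ⟨le_rfl, hT⟩
  constructor
  · refine (lintegral_ofReal_ne_top_iff_integrable (hm T hTm) (hnn T hTm)).1 ?_
    rw [hE]
    exact (lintegral_ofReal_ne_top_iff_integrable (hm 0 h0m) (hnn 0 h0m)).2 hi
  · rw [casimir, casimir, integral_eq_lintegral_of_nonneg_ae (hnn T hTm) (hm T hTm),
      integral_eq_lintegral_of_nonneg_ae (hnn 0 h0m) (hm 0 h0m), hE]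

/-- Lipschitz continuity in time of the solution and of its field. -/
lemma IsSolution.exists_lipschitz (hf : IsSolution Mc f U) (hg : IsConfined f T L₀ R P)
    (hL₀ : 0 < L₀) (hP : 0 < P) :
    ∃ C, 0 ≤ C ∧ ∀ s ∈ Icc 0 T, ∀ t ∈ Icc 0 T, s ≤ t → ∀ x,
      ‖gradPotential (f t) x - gradPotential (f s) x‖ ≤ C * (t - s) * (1 + ‖x‖) ^ (-2 : ℝ) := by
  obtain ⟨C, hC0, hC⟩ := hf.exists_fderiv_bound T (isCompact_confined L₀ R P)
  set S := confined L₀ R P with hS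
  have hScomp : IsCompact S := isCompact_confined L₀ R P
  have hlip : ∀ s ∈ Icc 0 T, ∀ t ∈ Icc 0 T, s ≤ t → ∀ z ∈ S, |f t z - f s z| ≤ C * (t - s) := by
    intro s hs t ht hst z hz
    rcases hst.eq_or_lt with rfl | hlt
    · simp
    have hmap : Continuous (fun r : ℝ => ((r, z) : ℝ × Phase)) := by fun_prop
    have hd : ∀ r ∈ Ioo s t, HasDerivAt (fun r => f r z)
        (fderiv ℝ (joint f) (r, z) (1, 0)) r := by
      intro r hr
      have h1 := ((hf.contDiffAt (hs.1.trans_lt hr.1) z).differentiableAt one_ne_zero).hasFDerivAt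
      exact h1.comp_hasDerivAt r ((hasDerivAt_id r).prodMk (hasDerivAt_const r z))
    obtain ⟨r, hr, hslope⟩ := exists_deriv_eq_slope (fun r => f r z) hlt
      (hf.continuousOn.comp hmap.continuousOn fun r hr => ⟨hs.1.trans hr.1, mem_univ _⟩)
      (fun r hr => (hd r hr).differentiableAt.differentiableWithinAt)
    rw [(hd r hr).deriv] at hslope
    have h2 : ‖fderiv ℝ (joint f) (r, z) (1, 0)‖ ≤ C := by
      refine ((fderiv ℝ (joint f) (r, z)).le_opNorm _).trans ?_
      have h3 := hC r ⟨hs.1.trans_lt hr.1, hr.2.le.trans ht.2⟩ z hz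
      have h4 : ‖((1 : ℝ), (0 : Phase))‖ = 1 := by simp [Prod.norm_def]
      rw [h4, mul_one]; exact h3
    have h5 : f t z - f s z = fderiv ℝ (joint f) (r, z) (1, 0) * (t - s) := by
      rw [hslope]; field_simp [sub_ne_zero.2 hlt.ne']
    rw [h5, abs_mul, abs_of_pos (sub_pos.2 hlt)]
    exact mul_le_mul_of_nonneg_right h2 (sub_pos.2 hlt).le
  set β := volume.real S with hβ
  -- on the support `L₀ ≤ L ≤ |x|² P²`, so the field vanishes for `|x| < r₀`
  set r₀ := √L₀ / P with hr₀
  have hr₀0 : 0 < r₀ := by positivity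
  have hSr : ∀ z ∈ S, r₀ ≤ ‖z.1‖ := by
    intro z hz
    rw [hr₀, div_le_iff₀ hP]
    refine Real.sqrt_le_iff.2 ⟨by positivity, hz.1.trans ((angMom_le z).trans ?_)⟩
    rw [mul_pow]
    have := hz.2.2
    gcongr
  set D := C * β * (1 + 1 / r₀) ^ 2 with hD
  have hβ0 : 0 ≤ β := measureReal_nonneg
  refine ⟨D, by positivity, fun s hs t ht hst x => ?_⟩
  have hit := hf.integrable hg ht
  have his := hf.integrable hg hs
  have hst0 : 0 ≤ t - s := sub_nonneg.2 hst
  rw [← gradPotential_sub hit his]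
  set g : Phase → ℝ := fun z => f t z - f s z with hgd
  have hg0 : ∀ z ∉ S, g z = 0 := fun z hz => by
    simp [hgd, hg.eq_zero ht hz, hg.eq_zero hs hz]
  have hnorm : ‖gradPotential g x‖ = |massInBall g ‖x‖| / ‖x‖ ^ 2 := by
    rw [← Real.sqrt_sq (norm_nonneg (gradPotential g x)), norm_gradPotential_sq,
      Real.sqrt_sq_eq_abs, abs_div, abs_of_nonneg (sq_nonneg ‖x‖)]
  have hRHS : 0 ≤ D * (t - s) * (1 + ‖x‖) ^ (-2 : ℝ) := by positivity
  rw [hnorm]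
  by_cases hx : ‖x‖ < r₀
  · have h1 : massInBall g ‖x‖ = 0 := by
      refine setIntegral_eq_zero_of_forall_eq_zero fun y hy => ?_
      have h2 : (fun v => g (y, v)) = fun _ => 0 := by
        ext v
        refine hg0 _ fun hz => ?_
        have h3 := hSr _ hz
        have h4 : ‖y‖ ≤ ‖x‖ := by simpa using hy
        simp only at h3
        linarith
      rw [density, h2]; simp
    rw [h1, abs_zero, zero_div]
    exact hRHS
  · push Not at hx
    have hx0 : 0 < ‖x‖ := hr₀0.trans_le hx
    have h1 : |massInBall g ‖x‖| ≤ C * (t - s) * β := by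
      refine (abs_massInBall_le (hit.sub his) _).trans ?_
      have hiS : Integrable (S.indicator (fun _ : Phase => C * (t - s))) :=
        (integrable_indicator_iff hScomp.measurableSet).2 (integrableOn_const hScomp.measure_lt_top.ne)
      have h2 : ∫ z, ‖g z‖ ≤ ∫ z, S.indicator (fun _ : Phase => C * (t - s)) z := by
        refine integral_mono (hit.sub his).norm hiS fun z => ?_
        by_cases hz : z ∈ S
        · rw [indicator_of_mem hz]
          exact hlip s hs t ht hst z hz
        · rw [indicator_of_notMem hz]
          exact le_of_eq (by rw [hg0 z hz, norm_zero])
      refine h2.trans (le_of_eq ?_)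
      rw [integral_indicator hScomp.measurableSet, setIntegral_const, smul_eq_mul, mul_comm]
    have h3 : 1 / ‖x‖ ^ 2 ≤ (1 + 1 / r₀) ^ 2 * (1 + ‖x‖) ^ (-2 : ℝ) := by
      have h4 : (1 + ‖x‖) ^ (-2 : ℝ) = 1 / (1 + ‖x‖) ^ 2 := by
        rw [Real.rpow_neg (by positivity), one_div]
        norm_cast
      rw [h4, mul_one_div, div_le_div_iff₀ (by positivity) (by positivity), one_mul, ← mul_pow]
      have h5 : 1 ≤ ‖x‖ / r₀ := (one_le_div hr₀0).2 hx
      have h6 : (1 + 1 / r₀) * ‖x‖ = ‖x‖ + ‖x‖ / r₀ := by ring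
      rw [h6]
      gcongr ?_ ^ 2
      linarith
    calc |massInBall g ‖x‖| / ‖x‖ ^ 2 = |massInBall g ‖x‖| * (1 / ‖x‖ ^ 2) := by ring
      _ ≤ (C * (t - s) * β) * ((1 + 1 / r₀) ^ 2 * (1 + ‖x‖) ^ (-2 : ℝ)) := by gcongr
      _ = _ := by rw [hD]; ring

lemma contDiffAt_particleEnergy {g : Phase → ℝ} {u : Space → ℝ} (hu : ContDiff ℝ 2 u)
    (hgu : ∀ x, potential g x = u x) (Mc : ℝ) {z : Phase} (hz : z.1 ≠ 0) :
    ContDiffAt ℝ 1 (particleEnergy Mc g) z := by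
  have h0 : particleEnergy Mc g = fun z => (1 / 2) * ‖z.2‖ ^ 2 + u z.1 - Mc / ‖z.1‖ := by
    ext z; rw [particleEnergy, hgu]
  rw [h0]
  have h1 : ContDiffAt ℝ 1 (fun z : Phase => Mc / ‖z.1‖) z :=
    ContDiffAt.comp (f := Prod.fst) (g := fun y : Space => Mc / ‖y‖) z
      (contDiffAt_const_div_norm Mc hz) contDiffAt_fst
  refine ContDiffAt.sub (ContDiff.contDiffAt ?_) h1
  exact (contDiff_const.mul (contDiff_snd.norm_sq ℝ)).add
    ((hu.of_le (by norm_num)).comp contDiff_fst)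

/-- Along the free motion with acceleration `K` the particle energy changes only by the work of
`K` minus the force belonging to the energy. -/
lemma fderiv_particleEnergy {g : Phase → ℝ} {u : Space → ℝ} (hu : ContDiff ℝ 2 u)
    (hgu : ∀ x, potential g x = u x) (Mc : ℝ) {x : Space} (hx : x ≠ 0) (v K : Space) :
    fderiv ℝ (particleEnergy Mc g) (x, v) (v, K)
      = inner ℝ v (K + gradient u x + (Mc / ‖x‖ ^ 3) • x) := by
  refine fderiv_apply_of_line
    ((contDiffAt_particleEnergy hu hgu Mc (z := (x, v)) hx).differentiableAt one_ne_zero) ?_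
  have hul : HasDerivAt (fun s : ℝ => u (x + s • v)) (fderiv ℝ u x v) 0 :=
    (hu.differentiable two_ne_zero x).hasFDerivAt.hasLineDerivAt v
  have h := (((hasDerivAt_line_norm_sq v K).const_mul (1 / 2)).add hul).sub
    (hasDerivAt_line_inv_norm x v Mc hx)
  have h0 : (fun s : ℝ => particleEnergy Mc g ((x, v) + s • (v, K)))
      = fun s => 1 / 2 * ‖v + s • K‖ ^ 2 + u (x + s • v) - Mc / ‖x + s • v‖ := by
    ext s
    simp only [particleEnergy, hgu, Prod.smul_mk, Prod.mk_add_mk]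
  rw [h0]
  refine h.congr_deriv ?_
  rw [inner_add_right, inner_add_right, inner_smul_right, real_inner_comm (gradient u x) v,
    inner_gradient, real_inner_comm x v]
  ring

/-- The energy varies at most quadratically on short time intervals. -/
lemma IsSolution.exists_energy_quadratic (hf : IsSolution Mc f U) (hg : IsConfined f T L₀ R P)
    (hL₀ : 0 < L₀) (hP : 0 < P) :
    ∃ C, 0 ≤ C ∧ ∀ s ∈ Icc 0 T, ∀ t ∈ Icc 0 T, s ≤ t →
      |(kineticEnergy (f t) + potentialEnergy Mc (f t))
        - (kineticEnergy (f s) + potentialEnergy Mc (f s))| ≤ C * (t - s) ^ 2 := by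
  obtain ⟨C, hC0, hC⟩ := hf.exists_lipschitz hg hL₀ hP
  set M := ∫ z, f 0 z with hM
  set J := ∫ x : Space, (1 + ‖x‖) ^ (-4 : ℝ) with hJ
  have hJ0 : 0 ≤ J := integral_nonneg fun x => by positivity
  have hM0 : 0 ≤ M := integral_nonneg fun z => hf.nonneg 0 le_rfl z
  refine ⟨P * C * M + 1 / (8 * Real.pi) * (C ^ 2 * J), by positivity, fun s hs t ht hst => ?_⟩
  have hst0 : 0 ≤ t - s := sub_nonneg.2 hst
  have htt := hf.isTame hg ht
  have hts := hf.isTame hg hs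
  -- expand about the state at time `s`: the first order term is transported by the frozen energy,
  -- the second order term is quadratic in the change of the field
  have hexp := htt.energy_expansion hL₀ hts Mc
  have hsymm : ∀ r ∈ Icc 0 T, IsRotInvariant (f r) := fun r hr => (hg r hr).1
  have hpot : ∀ x, potential (f s) x = U s x := hf.potential_eq hs.1 (hsymm s hs)
  have hfield : ∫ x, fieldDiffSq (f t) (f s) x ≤ C ^ 2 * J * (t - s) ^ 2 := by
    have h1 : ∀ x, fieldDiffSq (f t) (f s) x ≤ (C * (t - s)) ^ 2 * (1 + ‖x‖) ^ (-4 : ℝ) := by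
      intro x
      have h2 := hC s hs t ht hst x
      have h3 : (1 + ‖x‖) ^ (-4 : ℝ) = ((1 + ‖x‖) ^ (-2 : ℝ)) ^ 2 := by
        rw [← Real.rpow_natCast, ← Real.rpow_mul (by positivity)]; norm_num
      rw [fieldDiffSq, h3, ← mul_pow]
      gcongr
    have h4 := integral_mono (htt.integrable_fieldDiffSq hL₀ hts)
      (integrable_japanese.const_mul ((C * (t - s)) ^ 2)) h1
    rw [integral_const_mul] at h4
    refine h4.trans (le_of_eq ?_)
    ring
  have hfield0 : 0 ≤ ∫ x, fieldDiffSq (f t) (f s) x := integral_nonneg fun x => sq_nonneg _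
  set φ := particleEnergy Mc (f s) with hφ
  have hφc : ∀ z : Phase, z.1 ≠ 0 → ContDiffAt ℝ 1 φ z := fun z hz =>
    contDiffAt_particleEnergy (hf.potential_contDiff s hs.1) hpot Mc hz
  -- along characteristics the frozen energy changes only because the field changes
  have hDφ : ∀ r ∈ Ioo s t, ∀ z ∈ confined L₀ R P,
      |fderiv ℝ φ z (z.2, force Mc U r z.1)| ≤ P * (C * (t - s)) := by
    intro r hr z hz
    have hr' : r ∈ Icc 0 T := ⟨hs.1.trans hr.1.le, hr.2.le.trans ht.2⟩
    have hz0 := fst_ne_zero_of_confined hL₀ hz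
    obtain ⟨x, v⟩ := z
    rw [fderiv_particleEnergy (hf.potential_contDiff s hs.1) hpot Mc hz0, hf.force_eq hr'.1 hz0,
      hf.gradient_eq hr'.1 (hsymm r hr'), hf.gradient_eq hs.1 (hsymm s hs)]
    have h1 : -gradPotential (f r) x - (Mc / ‖x‖ ^ 3) • x + gradPotential (f s) x
        + (Mc / ‖x‖ ^ 3) • x = -(gradPotential (f r) x - gradPotential (f s) x) := by abel
    rw [h1, inner_neg_right, abs_neg]
    refine (abs_real_inner_le_norm _ _).trans (mul_le_mul hz.2.2 ?_ (norm_nonneg _) hP.le)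
    refine (hC s hs r hr' hr.1.le x).trans ?_
    have h2 : (1 + ‖x‖) ^ (-2 : ℝ) ≤ 1 :=
      Real.rpow_le_one_of_one_le_of_nonpos (by linarith [norm_nonneg x]) (by norm_num)
    have h3 : 0 ≤ C * (r - s) := mul_nonneg hC0 (by linarith [hr.1])
    calc C * (r - s) * (1 + ‖x‖) ^ (-2 : ℝ) ≤ C * (r - s) := mul_le_of_le_one_right h3 h2
      _ ≤ C * (t - s) := by
        have := hr.2
        gcongr
  -- the sign `σ` gives upper and lower bounds from the one-sided transport inequality
  have htrans : ∀ σ : ℝ, |σ| = 1 → (∫ z, (σ * f t z) * φ z)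
      ≤ (∫ z, (σ * f s z) * φ z) + P * (C * (t - s)) * M * (t - s) := by
    intro σ hσ
    have hΦ : ContDiff ℝ 1 (fun y : ℝ => σ * y) := contDiff_const.mul contDiff_id
    obtain ⟨h1, h2, h3, h4⟩ := hf.regular_product hg hL₀ hΦ (mul_zero σ) hφc hs.1 ht.2
    refine transport_le (G := fun p : ℝ × Phase => (σ * joint f p) * φ p.2)
      (K := force Mc U) hst (isCompact_confined L₀ R P)
      (fun z hz => fst_ne_zero_of_confined hL₀ hz) h1 h2 h3
      (fun r hr => hf.continuousOn_force (hs.1.trans hr.1.le)) fun r hr hi => ?_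
    have hr' : r ∈ Icc 0 T := ⟨hs.1.trans hr.1.le, hr.2.le.trans ht.2⟩
    have h5 : ∫ z, P * (C * (t - s)) * f r z = P * (C * (t - s)) * M := by
      rw [integral_const_mul, hf.integral_eq hg hL₀ hr']
    rw [← h5]
    refine integral_mono hi ((hf.integrable hg hr').const_mul _) fun z => ?_
    by_cases hz : z ∈ confined L₀ R P
    · have hz0 := fst_ne_zero_of_confined hL₀ hz
      have h6 := hf.fderiv_product hΦ (hs.1.trans_lt hr.1) hz0
        ((hφc z hz0).differentiableAt one_ne_zero)
      refine h6.trans_le ((le_abs_self _).trans ?_)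
      rw [abs_mul, abs_mul, hσ, one_mul, abs_of_nonneg (hf.nonneg r hr'.1 z), mul_comm]
      exact mul_le_mul_of_nonneg_right (hDφ r hr z hz) (hf.nonneg r hr'.1 z)
    · refine (h4 r hr z hz _).trans_le ?_
      rw [hg.eq_zero hr' hz, mul_zero]
  have hi1 : ∀ r ∈ Icc 0 T, Integrable (fun z => φ z * f r z) := fun r hr =>
    (hts.integrable_particleEnergy hL₀ (hf.isTame hg hr) Mc).1
  have hI : ∫ z, φ z * (f t z - f s z) = (∫ z, φ z * f t z) - ∫ z, φ z * f s z := by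
    simp only [mul_sub]
    exact integral_sub (hi1 t ht) (hi1 s hs)
  have hp := htrans 1 (by norm_num)
  have hm := htrans (-1) (by norm_num)
  have hc : ∀ r, ∫ z, (1 * f r z) * φ z = ∫ z, φ z * f r z := fun r => by
    congr 1; ext z; ring
  have hc' : ∀ r, ∫ z, (-1 * f r z) * φ z = -∫ z, φ z * f r z := fun r => by
    rw [← integral_neg]; congr 1; ext z; ring
  rw [hc, hc] at hp
  rw [hc', hc'] at hm
  rw [hexp, hI]
  have hpi : 0 < 1 / (8 * Real.pi) := by positivity
  have h7 := mul_le_mul_of_nonneg_left hfield hpi.le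
  have h8 := mul_nonneg hpi.le hfield0
  have h9 : P * (C * (t - s)) * M * (t - s) = P * C * M * (t - s) ^ 2 := by ring
  rw [h9] at hp hm
  have h10 : 0 ≤ P * C * M * (t - s) ^ 2 := by positivity
  have h11 : (P * C * M + 1 / (8 * Real.pi) * (C ^ 2 * J)) * (t - s) ^ 2
      = P * C * M * (t - s) ^ 2 + 1 / (8 * Real.pi) * (C ^ 2 * J * (t - s) ^ 2) := by ring
  rw [h11, abs_le]
  constructor <;> linarith

/-- A function whose increments are quadratically small is constant. -/
lemma eq_of_quadratic {E : ℝ → ℝ} {T C : ℝ} (hT : 0 ≤ T)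
    (h : ∀ s ∈ Icc 0 T, ∀ t ∈ Icc 0 T, s ≤ t → |E t - E s| ≤ C * (t - s) ^ 2) : E T = E 0 := by
  -- subdivide `[0, T]` into `n` equal intervals
  have key : ∀ n : ℕ, 0 < n → |E T - E 0| ≤ C * T ^ 2 / n := by
    intro n hn
    have hn' : (0 : ℝ) < n := Nat.cast_pos.2 hn
    have hstep : ∀ i : ℕ, i ≤ n → |E (i * (T / n)) - E 0| ≤ i * (C * (T / n) ^ 2) := by
      intro i
      induction i with
      | zero => intro _; simp
      | succ i ih =>
        intro hi
        have h1 := ih (by omega)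
        have hmem : ∀ j : ℕ, j ≤ n → (j : ℝ) * (T / n) ∈ Icc 0 T := fun j hj => by
          have : (j : ℝ) ≤ n := Nat.cast_le.2 hj
          refine ⟨by positivity, ?_⟩
          rw [mul_div_assoc', div_le_iff₀ hn']
          nlinarith
        have h2 := h _ (hmem i (by omega)) _ (hmem (i + 1) hi) (by
          push_cast
          have : 0 ≤ T / n := by positivity
          nlinarith)
        have h3 : ((i + 1 : ℕ) : ℝ) * (T / n) - i * (T / n) = T / n := by push_cast; ring
        rw [h3] at h2
        have h4 := abs_sub_le (E (((i + 1 : ℕ) : ℝ) * (T / n))) (E (i * (T / n))) (E 0)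
        push_cast at h2 h4 ⊢
        linarith
    have h5 := hstep n le_rfl
    have h6 : (n : ℝ) * (T / n) = T := by field_simp
    rw [h6] at h5
    refine h5.trans (le_of_eq ?_)
    field_simp
  have hlim : Tendsto (fun n : ℕ => C * T ^ 2 / (n : ℝ)) atTop (𝓝 0) :=
    tendsto_const_div_atTop_nhds_zero_nat _
  have h0 : |E T - E 0| ≤ 0 :=
    ge_of_tendsto hlim ((eventually_gt_atTop 0).mono key)
  exact sub_eq_zero.1 (abs_nonpos_iff.1 h0)

/-- Conservation of energy. -/
lemma IsSolution.energy_conserved (hf : IsSolution Mc f U) (hg : IsConfined f T L₀ R P)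
    (hL₀ : 0 < L₀) (hP : 0 < P) (hT : 0 ≤ T) :
    kineticEnergy (f T) + potentialEnergy Mc (f T)
      = kineticEnergy (f 0) + potentialEnergy Mc (f 0) := by
  obtain ⟨C, -, hC⟩ := hf.exists_energy_quadratic hg hL₀ hP
  exact eq_of_quadratic (E := fun t => kineticEnergy (f t) + potentialEnergy Mc (f t)) hT hC

end conservation

/-! ### Invariance of the admissible class -/

/-- Solutions starting in the class of admissible perturbations stay there and conserve the
energy-Casimir functional. -/
theorem IsSolution.admissible_conserved {k l L₀ Mc M : ℝ} (hk : 0 < k) (hl : 0 < l) (hL₀ : 0 < L₀)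
    (hMc : 0 < Mc) {f : ℝ → Phase → ℝ} {U : ℝ → Space → ℝ} (hf : IsSolution Mc f U)
    (hcs : HasCompactSupport (f 0)) (hadm : IsAdmissible k l L₀ M (f 0)) {t : ℝ} (ht : 0 ≤ t) :
    IsAdmissible k l L₀ M (f t) ∧
      energyCasimir k l L₀ Mc (f t) = energyCasimir k l L₀ Mc (f 0) := by
  have hc0 := hf.continuous le_rfl
  -- by continuity `f 0` vanishes on the open set `L < L₀`
  have hvan : ∀ z, f 0 z ≠ 0 → L₀ ≤ angMom z := by
    intro z hz
    by_contra! hlt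
    have ho : IsOpen ({z : Phase | f 0 z ≠ 0} ∩ {z | angMom z < L₀}) :=
      (isOpen_ne_fun hc0 continuous_const).inter (isOpen_lt continuous_angMom continuous_const)
    have hpos := ho.measure_pos (volume : Measure Phase) ⟨z, hz, hlt⟩
    have hnull : volume ({z : Phase | f 0 z ≠ 0} ∩ {z | angMom z < L₀}) = 0 := by
      refine measure_mono_null ?_ (ae_iff.1 hadm.vanish)
      rintro w ⟨h1, h2⟩ h3
      exact h1 (h3 h2)
    exact hpos.ne' hnull
  obtain ⟨R, P, -, hP, hg⟩ := hf.symmetric_confined hMc.le hcs hL₀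
    (IsRotInvariant.of_ae hc0 hadm.symmetric) hvan t
  have htm : t ∈ Icc 0 t := ⟨ht, le_rfl⟩
  have htame := hf.isTame hg htm
  obtain ⟨hci, hce⟩ := hf.casimir_conserved hg hL₀ ht hk hl hadm.casimir_finite
  refine ⟨⟨htame.integrable, ae_of_all _ (hf.nonneg t ht),
    fun A => ae_of_all _ fun z => (hg t htm).1 A z, ?_, htame.kinetic, hci, htame.vanish⟩, ?_⟩
  · rw [hf.integral_eq hg hL₀ htm, hadm.mass]
  · rw [energyCasimir, energyCasimir, hce, hf.energy_conserved hg hL₀ hP ht]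

end VlasovPoisson

end

open VlasovPoisson in
theorem theorem6p1
    (k l L₀ Mc M : ℝ) (hk : 0 < k) (hkl : k ≤ l) (hL₀ : 0 < L₀) (hMc : 0 < Mc) (hM : 0 < M)
    (f₀ : Phase → ℝ) (hmin : IsMinimizer k l L₀ Mc M f₀)
    (huniq : ∀ g : Phase → ℝ, IsMinimizer k l L₀ Mc M g → g =ᵐ[MeasureTheory.volume] f₀)
    (E₀ : ℝ) :
    ∀ ε : ℝ, 0 < ε → ∃ δ : ℝ, 0 < δ ∧
      ∀ (f : ℝ → Phase → ℝ) (U : ℝ → Space → ℝ), IsSolution Mc f U →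
        ContDiff ℝ 1 (f 0) → HasCompactSupport (f 0) → IsAdmissible k l L₀ M (f 0) →
        stabilityDist k l L₀ Mc E₀ (f 0) f₀ < δ →
        ∀ t : ℝ, 0 ≤ t →
          IsAdmissible k l L₀ M (f t) ∧
          MeasureTheory.Integrable (distDensity k l L₀ Mc E₀ (f t) f₀) ∧
          MeasureTheory.Integrable (fieldDiffSq (f t) f₀) ∧
          stabilityDist k l L₀ Mc E₀ (f t) f₀ < ε := by
  intro ε hε
  have hpi := Real.pi_pos
  obtain ⟨δ₁, hδ₁, hfield⟩ := exists_fieldDiff_lt hk hkl hL₀ hMc hM hmin huniq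
    (ε := 2 * Real.pi * ε) (by positivity)
  refine ⟨min δ₁ (ε / 2), by positivity, fun f U hf _ hcs hadm hd t ht => ?_⟩
  obtain ⟨hadm', hcons⟩ :=
    hf.admissible_conserved hk (hk.trans_le hkl) hL₀ hMc hcs hadm ht
  obtain ⟨-, hexp₀⟩ := hadm.expansion (Mc := Mc) hL₀ hmin.1 E₀
  obtain ⟨hint, hexp⟩ := hadm'.expansion (Mc := Mc) hL₀ hmin.1 E₀
  have hN₀ : 0 ≤ 1 / (8 * Real.pi) * ∫ x, fieldDiffSq (f 0) f₀ x :=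
    mul_nonneg (by positivity) (MeasureTheory.integral_nonneg fun x => sq_nonneg _)
  -- the excess of the conserved functional is at most the initial distance
  have hH : energyCasimir k l L₀ Mc (f t) - energyCasimir k l L₀ Mc f₀ < min δ₁ (ε / 2) := by
    rw [hcons, hexp₀]
    rw [stabilityDist] at hd
    linarith
  have hN : 1 / (8 * Real.pi) * ∫ x, fieldDiffSq (f t) f₀ x < ε / 4 := by
    have h1 := hfield (f t) hadm' (by linarith [min_le_left δ₁ (ε / 2)])
    calc 1 / (8 * Real.pi) * ∫ x, fieldDiffSq (f t) f₀ x
        < 1 / (8 * Real.pi) * (2 * Real.pi * ε) := by gcongr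
      _ = ε / 4 := by field_simp; norm_num
  refine ⟨hadm', hint, hadm'.tame.integrable_fieldDiffSq hL₀ hmin.1.tame, ?_⟩
  rw [stabilityDist]
  linarith [min_le_right δ₁ (ε / 2)]
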